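/- Let $\alpha\subseteq\widehat{\mathbb C}=\mathbb C\cup\{\infty\}$ be a set of six points and let $\mathcal A_\alpha$ be the group of linear fractional transformations $f$ with $f(\alpha)=\alpha$. Below $\psi,\varphi$ denote linear fractional transformations and $\langle\cdots\rangle$ the group generated. **Multiplicity vectors.** Let $K_6$ be the set of $\lambda=(\lambda^1,\lambda^2,\lambda^3)\in\mathbb C^3$ with $\lambda^i\ne0,1$ and $\lambda^i\neq\lambda^j$ for $i\ne j$; put $(z_1^\lambda,\dots,z_6^\lambda)=(0,1,\infty,\lambda^1,\lambda^2,\lambda^3)$ and $[\lambda]=\{z^\lambda_1,\dots,z^\lambda_6\}$. For $\sigma\in S_6$ let $f_\sigma^\lambda$ be the linear fractional transformation sending $z^\lambda_{\sigma^{-1}(1)},z^\lambda_{\sigma^{-1}(2)},z^\lambda_{\sigma^{-1}(3)}$ to $0,1,\infty$, and let $g_\sigma:K_6\to K_6$, $g_\sigma(\lambda)=(f^\lambda_\sigma(z^\lambda_{\sigma^{-1}(i+3)}))_{i=1,2,3}$. These maps form a group $G$. The stabilizer $G_\lambda$ is identified with $\mathcal A_{[\lambda]}$ by $g_\sigma\mapsto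 f^\lambda_\sigma$, and it acts linearly on the tangent space $\mathbb C^3$ of $K_6$ at $\lambda$ by the Jacobian matrices of the $g_\sigma$ at $\lambda$. The multiplicity vector of $\alpha$ is $(p_1,\dots,p_k)$ if, for all $\varphi$ and $\lambda\in K_6$ with $\varphi(\alpha)=[\lambda]$, this representation is $p_1X^{(1)}\oplus\dots\oplus p_kX^{(k)}$, where the $X^{(i)}$ are the irreducible representations of $G_\lambda\simeq\mathcal A_{[\lambda]}=\varphi\mathcal A_\alpha\varphi^{-1}\simeq\mathcal A_\alpha$ with the characters listed below (the classes are given as classes of $\mathcal A_\alpha$): * $D_6$ (case 1; classes: rotations by $\pm\frac{\pi}{3}$, by $\pm\frac{2\pi}{3}$, by $\pi$ in the cyclic group $\psi^{-1}\langle z\mapsto e^{\pi i/3}z\rangle\psi$; the identity; the other elements with two fixed points in $\alpha$; the other elements without fixed point in $\alpha$): $(1,-1,-2,2,0,0)$, $(-1,-1,2,2,0,0)$, $(1,1,1,1,1,1)$, $(1,1,1,1,-1,-1)$, $(-1,1,-1,1,1,-1)$, $(-1,1,-1,1,-1,1)$. * $\mathbb Z_p$ (cases 2 and 5(d)iii,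 $p=5,2$; $\rho=\psi^{-1}\circ(z\mapsto e^{2\pi i/p}z)\circ\psi$): $X^{(l)}(\rho)=e^{2\pi i l/p}$, $l=1,\dots,p$. * $S_4$ (case 3; classes of $1,(1234),(123),(12)(34),(12)$ under any isomorphism $\mathcal A_\alpha\simeq S_4$): $(1,1,1,1,1)$, $(1,-1,1,1,-1)$, $(3,-1,0,-1,1)$, $(3,1,0,-1,-1)$, $(2,0,-1,2,0)$. * $D_3$ (case 4(c); classes: elements conjugate to the rotation by $\frac{2\pi}3$, the identity, elements of order two): $(-1,2,0)$, $(1,1,1)$, $(1,1,-1)$. * $K_4$ (case 5(d)i), viewed as type $2+mC$ (with $m=1$): there is $\kappa$ with $\kappa(\alpha)=\{0,\infty,\pm c,\pm c^{-1}\}$, $c\ne0$, $c^4\ne1$, and for every such $\kappa$ the classes are $\kappa^{-1}\circ(z\mapsto-z)\circ\kappa$, the identity, and the two remaining elements of $\mathcal A_\alpha$ in either order: $(1,1,1,1)$, $(1,1,-1,-1)$, $(-1,1,1,-1)$, $(-1,1,-1,1)$. **Theorem.** 1. If $\psi(\alpha)=\{1,w,w^2,w^3,w^4,w^5\}$ with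 $w=e^{\pi i/3}$, then $\mathcal A_\alpha=\psi^{-1}\langle z\mapsto e^{\pi i/3}z,\ z\mapsto \frac1z\rangle\psi\simeq D_6$ (order 12), with multiplicity vector $(0,1,0,0,0,1)$. 2. If $\psi(\alpha)=\{0,1,w,w^2,w^3,w^4\}$ with $w=e^{2\pi i/5}$, then $\mathcal A_\alpha=\psi^{-1}\langle z\mapsto e^{2\pi i/5}z\rangle\psi\simeq\mathbb Z_5$, with multiplicity vector $(1,1,1,0,0)$. 3. If $\psi(\alpha)=\{0,\infty,1,i,-1,-i\}$, then $\mathcal A_\alpha=\psi^{-1}\langle z\mapsto iz,\ z\mapsto\frac{iz+1}{z+i}\rangle\psi\simeq S_4$, with multiplicity vector $(0,0,1,0,0)$. 4. Let $w=e^{2\pi i/3}$, $\sqrt w=e^{\pi i/3}$, and suppose $\psi(\alpha)=\{1,w,w^2,a,aw,aw^2\}$ with $|a|\ge1$, $a\ne1,w,w^2$. (a) If $a\in\{\sqrt w,w\sqrt w,w^2\sqrt w\}$, then $\psi(\alpha)$ is the set of sixth roots of unity (case 1). (b) If $a\in\{-(2+\sqrt3),-(2+\sqrt3)w,-(2+\sqrt3)w^2\}$,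 then $\varphi(\alpha)=\{0,\infty,\pm1,\pm i\}$ for some $\varphi$ (case 3). (c) Otherwise $\mathcal A_\alpha=\psi^{-1}\langle z\mapsto wz,\ z\mapsto\frac az\rangle\psi\simeq D_3$ (order 6), with multiplicity vector $(1,1,0)$. 5. Suppose $\psi(\alpha)=\{\pm1,\pm a,\pm b\}$ with $a\ne\pm b$ and $a,b\in\mathbb C\setminus\{0,\pm1\}$. (a) If $\{\pm1,\pm a,\pm b\}$ is the set of sixth roots of unity or one of $\{\pm(7-4\sqrt3),\pm(2-\sqrt3),\pm1\}$, $\{\pm(2-\sqrt3),\pm1,\pm(2+\sqrt3)\}$, $\{\pm1,\pm(2+\sqrt3),\pm(7+4\sqrt3)\}$, then $\varphi(\alpha)$ is the set of sixth roots of unity for some $\varphi$ (case 1). (b) If $\{\pm1,\pm a,\pm b\}$ is one of $\{\pm(\sqrt2-1)i,\pm(\sqrt2+1)i,\pm1\}$, $\{\pm(3-2\sqrt2),\pm1,\pm(\sqrt2-1)i\}$, $\{\pm1,\pm(3+2\sqrt2),\pm(\sqrt2+1)i\}$, then $\varphi(\alpha)=\{0,\infty,\pm1,\pm i\}$ for some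 $\varphi$ (case 3). (c) If $a^2b+ab^2+a^2-6ab+b^2+a+b=0$, possibly after changing the sign of $a$, of $b$ or of both, then there are $\varphi$ and $c$ with $|c|\ge1$, $c\ne1,w,w^2$ and $\varphi(\alpha)=\{1,w,w^2,c,cw,cw^2\}$, $w=e^{2\pi i/3}$; if moreover neither (a) nor (b) applies, then $c$ is not one of the exceptional values of 4(a), 4(b) (so this is case 4(c)). (d) If none of (a), (b), (c) applies, then: i. if $ab=\pm1$, then $\mathcal A_\alpha=\psi^{-1}\langle z\mapsto-z,\ z\mapsto\frac1z\rangle\psi\simeq K_4$, with multiplicity vector $(1,0,1,1)$ (viewed as type $2+mC$); ii. if $b=\pm a^2$ or $a=\pm b^2$, then $\varphi(\alpha)=\{\pm1,\pm a',\pm b'\}$ for some $\varphi$ and some admissible $a',b'$, to which none of (a), (b), (c) applies, with $a'b'=\pm1$ (this is case i with other parameters); iii. in all other cases $\mathcal A_\alpha=\psi^{-1}\langle z\mapsto-z\rangle\psi\simeq\mathbb Z_2$, with multiplicity vector $(1,2)$. 6. If no $\psi$ as in 1–5 exists, then $\mathcal A_\alpha=\{\mathrm{Id}\}$. In particular $\mathcal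 A_\alpha$ is isomorphic to $D_6$, $\mathbb Z_5$, $S_4$, $D_3$, $K_4$, $\mathbb Z_2$ or the trivial group. -/

import Mathlib

noncomputable section

namespace SixPoints

open scoped OnePoint Pointwise

/-! ### Linear fractional transformations of the Riemann sphere -/

/-- The Riemann sphere. -/
abbrev Sphere : Type := OnePoint ℂ

/-- The group of linear fractional transformations, as permutations of the Riemann sphere. -/
def LFT : Subgroup (Equiv.Perm Sphere) :=
  (MulAction.toPermHom (Matrix.GeneralLinearGroup (Fin 2) ℂ) Sphere).range

/-- The transformation `z ↦ (a z + b) / (c z + d)` (the identity if `a d - b c = 0`). -/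
def mob (a b c d : ℂ) : Equiv.Perm Sphere :=
  if h : (!![a, b; c, d] : Matrix (Fin 2) (Fin 2) ℂ).det ≠ 0 then
    MulAction.toPermHom (Matrix.GeneralLinearGroup (Fin 2) ℂ) Sphere
      (Matrix.GeneralLinearGroup.mkOfDetNeZero _ h)
  else 1

/-- `z ↦ c z`. -/
def rot (c : ℂ) : Equiv.Perm Sphere := mob c 0 0 1

/-- `z ↦ c / z`. -/
def inv (c : ℂ) : Equiv.Perm Sphere := mob 0 c 1 0

/-- The group `𝒜_α` of the linear fractional transformations `f` with `f(α) = α`. -/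
def A (α : Set Sphere) : Subgroup (Equiv.Perm Sphere) :=
  LFT ⊓ MulAction.stabilizer (Equiv.Perm Sphere) α

theorem mem_A {α : Set Sphere} {f : Equiv.Perm Sphere} : f ∈ A α ↔ f ∈ LFT ∧ f '' α = α :=
  Iff.rfl

/-- The group `ψ⁻¹ ⟨S⟩ ψ`. -/
def conjGen (ψ : Equiv.Perm Sphere) (S : Set (Equiv.Perm Sphere)) :
    Subgroup (Equiv.Perm Sphere) :=
  (Subgroup.closure S).map (MulAut.conj ψ⁻¹).toMonoidHom

/-! ### The transformation sending three given points to `0, 1, ∞` -/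

/-- Homogeneous coordinates of a point of the sphere. -/
def hc (p : Sphere) : ℂ × ℂ := p.elim (1, 0) (fun z => (z, 1))

/-- The determinant of the homogeneous coordinates of two points. -/
def br (p q : Sphere) : ℂ := (hc p).1 * (hc q).2 - (hc p).2 * (hc q).1

/-- The linear fractional transformation with `p ↦ 0`, `q ↦ 1`, `r ↦ ∞` (for distinct `p, q, r`),
that is `z ↦ (z - p) (q - r) / ((z - r) (q - p))`. -/
def toZeroOneInf (p q r : Sphere) : Equiv.Perm Sphere :=
  mob (br q r * (hc p).2) (-(br q r * (hc p).1)) (br q p * (hc r).2) (-(br q p * (hc r).1))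

theorem mob_mem (a b c d : ℂ) : mob a b c d ∈ LFT := by
  unfold mob
  split_ifs
  · exact ⟨_, rfl⟩
  · exact one_mem _

theorem mob_apply {a b c d : ℂ} (h : a * d - b * c ≠ 0) (z : Sphere) :
    mob a b c d z = if c * (hc z).1 + d * (hc z).2 = 0 then ∞ else
      (((a * (hc z).1 + b * (hc z).2) / (c * (hc z).1 + d * (hc z).2) : ℂ) : Sphere) := by
  have h' : (!![a, b; c, d] : Matrix (Fin 2) (Fin 2) ℂ).det ≠ 0 := by
    rwa [Matrix.det_fin_two_of]
  rw [mob, dif_pos h', MulAction.toPermHom_apply, MulAction.toPerm_apply]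
  cases z using OnePoint.rec with
  | infty =>
    rw [OnePoint.smul_infty_eq_ite]
    simp [hc, Matrix.GeneralLinearGroup.mkOfDetNeZero]
  | coe z =>
    rw [OnePoint.smul_some_eq_ite]
    simp [hc, Matrix.GeneralLinearGroup.mkOfDetNeZero]

theorem br_ne_zero {p q : Sphere} (h : p ≠ q) : br p q ≠ 0 := by
  cases p using OnePoint.rec with
  | infty =>
    cases q using OnePoint.rec with
    | infty => exact absurd rfl h
    | coe q => simp [br, hc]
  | coe p =>
    cases q using OnePoint.rec with
    | infty => simp [br, hc]
    | coe q =>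
      have : p ≠ q := fun e => h (by rw [e])
      simpa [br, hc, sub_eq_zero] using this

theorem toZeroOneInf_det {p q r : Sphere} (hpq : p ≠ q) (hpr : p ≠ r) (hqr : q ≠ r) :
    (br q r * (hc p).2) * (-(br q p * (hc r).1)) - (-(br q r * (hc p).1)) * (br q p * (hc r).2)
      ≠ 0 := by
  have h : (br q r * (hc p).2) * (-(br q p * (hc r).1)) -
      (-(br q r * (hc p).1)) * (br q p * (hc r).2) = br q r * br q p * br p r := by
    simp only [br]; ring
  rw [h]
  exact mul_ne_zero (mul_ne_zero (br_ne_zero hqr) (br_ne_zero hpq.symm)) (br_ne_zero hpr)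

theorem toZeroOneInf_spec {p q r : Sphere} (hpq : p ≠ q) (hpr : p ≠ r) (hqr : q ≠ r) :
    toZeroOneInf p q r p = ((0 : ℂ) : Sphere) ∧ toZeroOneInf p q r q = ((1 : ℂ) : Sphere) ∧
      toZeroOneInf p q r r = ∞ := by
  have hdet := toZeroOneInf_det hpq hpr hqr
  have hn : ∀ z, br q r * (hc p).2 * (hc z).1 + -(br q r * (hc p).1) * (hc z).2 =
      br q r * br z p := fun z => by simp only [br]; ring
  have hd : ∀ z, br q p * (hc r).2 * (hc z).1 + -(br q p * (hc r).1) * (hc z).2 =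
      br q p * br z r := fun z => by simp only [br]; ring
  have hs : ∀ z, br z z = 0 := fun z => by simp only [br]; ring
  have h1 := br_ne_zero hpr
  have h2 := br_ne_zero hqr
  have h3 := br_ne_zero hpq.symm
  refine ⟨?_, ?_, ?_⟩ <;> rw [toZeroOneInf, mob_apply hdet, hn, hd]
  · simp [hs, h1, h3]
  · rw [if_neg (mul_ne_zero h3 h2), mul_comm (br q r), div_self (mul_ne_zero h3 h2)]
  · simp [hs]

theorem eq_one_of_fix {f : Equiv.Perm Sphere} (hf : f ∈ LFT) (h0 : f ((0 : ℂ) : Sphere) = (0 : ℂ))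
    (h1 : f ((1 : ℂ) : Sphere) = (1 : ℂ)) (hi : f ∞ = ∞) : f = 1 := by
  obtain ⟨g, rfl⟩ := hf
  simp only [MulAction.toPermHom_apply, MulAction.toPerm_apply] at h0 h1 hi
  have c0 : g 1 0 = 0 := OnePoint.smul_infty_eq_self_iff.1 hi
  rw [OnePoint.smul_some_eq_ite] at h0 h1
  have d0 : g 1 1 ≠ 0 := by
    intro h; simp [h] at h0
  have b0 : g 0 1 = 0 := by
    simpa [c0, d0] using h0
  have a0 : g 0 0 = g 1 1 := by
    simpa [c0, d0, b0, div_eq_one_iff_eq] using h1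
  ext z
  simp only [MulAction.toPermHom_apply, MulAction.toPerm_apply, Equiv.Perm.coe_one, id]
  cases z using OnePoint.rec with
  | infty => exact hi
  | coe z =>
    rw [OnePoint.smul_some_eq_ite]
    simp [c0, d0, b0, a0]

theorem eq_of_three {f g : Equiv.Perm Sphere} (hf : f ∈ LFT) (hg : g ∈ LFT) {p q r : Sphere}
    (hpq : p ≠ q) (hpr : p ≠ r) (hqr : q ≠ r) (hp : f p = g p) (hq : f q = g q)
    (hr : f r = g r) : f = g := by
  obtain ⟨n0, n1, n2⟩ := toZeroOneInf_spec hpq hpr hqr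
  have key : toZeroOneInf p q r * (g⁻¹ * f) * (toZeroOneInf p q r)⁻¹ = 1 := by
    have hN : toZeroOneInf p q r ∈ LFT := mob_mem _ _ _ _
    refine eq_one_of_fix (mul_mem (mul_mem hN (mul_mem (inv_mem hg) hf)) (inv_mem hN)) ?_ ?_ ?_
    · rw [← n0]; simp [hp]
    · rw [← n1]; simp [hq]
    · rw [← n2]; simp [hr]
  have := conj_eq_one_iff.1 key
  exact (inv_mul_eq_one.1 this).symm

/-! ### The action of the symmetric group on `K_n`, `n = m + 3` -/

variable {m : ℕ}

/-- `K_n ⊆ ℂ^{n-3}`, with `n = m + 3`. -/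
def K (m : ℕ) : Set (Fin m → ℂ) :=
  {l | Function.Injective l ∧ ∀ i, l i ≠ 0 ∧ l i ≠ 1}

/-- The `n` points `0, 1, ∞, l 0, …, l (m - 1)`. They are indexed by `Fin 3 ⊕ Fin m`, whose
permutation group is the symmetric group on `n` letters. -/
def pts (l : Fin m → ℂ) : Fin 3 ⊕ Fin m → Sphere :=
  Sum.elim ![((0 : ℂ) : Sphere), ((1 : ℂ) : Sphere), ∞] (fun i => ((l i : ℂ) : Sphere))

/-- The linear fractional transformation sending the points number `σ⁻¹(1)`, `σ⁻¹(2)`, `σ⁻¹(3)`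
to `0, 1, ∞`. -/
def f (l : Fin m → ℂ) (σ : Equiv.Perm (Fin 3 ⊕ Fin m)) : Equiv.Perm Sphere :=
  toZeroOneInf (pts l (σ⁻¹ (Sum.inl 0))) (pts l (σ⁻¹ (Sum.inl 1))) (pts l (σ⁻¹ (Sum.inl 2)))

/-- The map `g_σ` in coordinates. It is only meaningful on `K m`, where no value below is `∞`. -/
def gFun (σ : Equiv.Perm (Fin 3 ⊕ Fin m)) (l : Fin m → ℂ) : Fin m → ℂ :=
  fun i => (f l σ (pts l (σ⁻¹ (Sum.inr i)))).elim 0 id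

theorem pts_injective {l : Fin m → ℂ} (hl : l ∈ K m) : Function.Injective (pts l) := by
  rintro (i | i) (j | j) h
  · fin_cases i <;> fin_cases j <;> simp [pts] at h ⊢
  · have := hl.2 j
    fin_cases i <;> simp [pts] at h <;> simp_all
  · have := hl.2 i
    fin_cases j <;> simp [pts] at h <;> simp_all
  · simp only [pts, Sum.elim_inr, OnePoint.coe_eq_coe] at h
    rw [hl.1 h]

theorem mem_K_of_injective {l : Fin m → ℂ} (h : Function.Injective (pts l)) : l ∈ K m := by
  refine ⟨fun i j e => ?_, fun i => ⟨fun e => ?_, fun e => ?_⟩⟩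
  · have : (Sum.inr i : Fin 3 ⊕ Fin m) = Sum.inr j := h (by simp [pts, e])
    exact Sum.inr.inj this
  · exact Sum.inr_ne_inl (h (by simp [pts, e] : pts l (Sum.inr i) = pts l (Sum.inl 0)))
  · exact Sum.inr_ne_inl (h (by simp [pts, e] : pts l (Sum.inr i) = pts l (Sum.inl 1)))

theorem f_mem (l : Fin m → ℂ) (σ : Equiv.Perm (Fin 3 ⊕ Fin m)) : f l σ ∈ LFT :=
  mob_mem _ _ _ _

theorem f_spec {l : Fin m → ℂ} (hl : l ∈ K m) (σ : Equiv.Perm (Fin 3 ⊕ Fin m)) :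
    f l σ (pts l (σ⁻¹ (Sum.inl 0))) = ((0 : ℂ) : Sphere) ∧
      f l σ (pts l (σ⁻¹ (Sum.inl 1))) = ((1 : ℂ) : Sphere) ∧
      f l σ (pts l (σ⁻¹ (Sum.inl 2))) = ∞ := by
  have hi : Function.Injective fun k => pts l (σ⁻¹ k) :=
    (pts_injective hl).comp σ⁻¹.injective
  exact toZeroOneInf_spec (hi.ne (by simp)) (hi.ne (by simp)) (hi.ne (by simp))

theorem pts_gFun {l : Fin m → ℂ} (hl : l ∈ K m) (σ : Equiv.Perm (Fin 3 ⊕ Fin m))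
    (k : Fin 3 ⊕ Fin m) : pts (gFun σ l) k = f l σ (pts l (σ⁻¹ k)) := by
  obtain ⟨h0, h1, h2⟩ := f_spec hl σ
  rcases k with k | i
  · fin_cases k
    · exact h0.symm
    · exact h1.symm
    · exact h2.symm
  · have hne : f l σ (pts l (σ⁻¹ (Sum.inr i))) ≠ ∞ := by
      rw [← h2]
      exact (f l σ).injective.ne ((pts_injective hl).ne (σ⁻¹.injective.ne (by simp)))
    obtain ⟨z, hz⟩ := OnePoint.ne_infty_iff_exists.1 hne
    simp [pts, gFun] at hz ⊢
    rw [← hz]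
    simp

theorem gFun_mem {l : Fin m → ℂ} (hl : l ∈ K m) (σ : Equiv.Perm (Fin 3 ⊕ Fin m)) :
    gFun σ l ∈ K m := by
  apply mem_K_of_injective
  have : pts (gFun σ l) = fun k => f l σ (pts l (σ⁻¹ k)) := funext (pts_gFun hl σ)
  rw [this]
  exact (f l σ).injective.comp ((pts_injective hl).comp σ⁻¹.injective)

theorem pts_inj {l l' : Fin m → ℂ} (h : ∀ i, pts l (Sum.inr i) = pts l' (Sum.inr i)) : l = l' := by
  funext i
  simpa [pts] using h i

theorem gFun_one {l : Fin m → ℂ} (hl : l ∈ K m) : gFun 1 l = l := by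
  obtain ⟨h0, h1, h2⟩ := f_spec hl 1
  have : f l 1 = 1 := eq_one_of_fix (f_mem _ _) h0 h1 h2
  apply pts_inj
  intro i
  rw [pts_gFun hl, this]
  rfl

theorem gFun_mul {l : Fin m → ℂ} (hl : l ∈ K m) (π σ : Equiv.Perm (Fin 3 ⊕ Fin m)) :
    gFun (π * σ) l = gFun π (gFun σ l) := by
  have hl' := gFun_mem hl σ
  have hi : Function.Injective fun k => pts l ((π * σ)⁻¹ k) :=
    (pts_injective hl).comp (π * σ)⁻¹.injective
  have hc : ∀ k, (f (gFun σ l) π * f l σ) (pts l ((π * σ)⁻¹ k)) = pts (gFun π (gFun σ l)) k := by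
    intro k
    rw [pts_gFun hl', pts_gFun hl, mul_inv_rev]
    rfl
  obtain ⟨h0, h1, h2⟩ := f_spec hl (π * σ)
  have key : f l (π * σ) = f (gFun σ l) π * f l σ := by
    refine eq_of_three (f_mem _ _) (mul_mem (f_mem _ _) (f_mem _ _))
      (hi.ne (show (Sum.inl 0 : Fin 3 ⊕ Fin m) ≠ Sum.inl 1 by simp))
      (hi.ne (show (Sum.inl 0 : Fin 3 ⊕ Fin m) ≠ Sum.inl 2 by simp))
      (hi.ne (show (Sum.inl 1 : Fin 3 ⊕ Fin m) ≠ Sum.inl 2 by simp)) ?_ ?_ ?_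
    · exact h0.trans (hc (Sum.inl 0)).symm
    · exact h1.trans (hc (Sum.inl 1)).symm
    · exact h2.trans (hc (Sum.inl 2)).symm
  apply pts_inj
  intro i
  rw [← hc, ← key, pts_gFun hl]

/-- `σ ↦ g_σ`, as a homomorphism into the permutations of `K_n`. -/
def gHom (m : ℕ) : Equiv.Perm (Fin 3 ⊕ Fin m) →* Equiv.Perm (K m) :=
  MonoidHom.toHomPerm
    { toFun := fun σ l => (⟨gFun σ l, gFun_mem l.2 σ⟩ : K m)
      map_one' := funext fun l => Subtype.ext (gFun_one l.2)
      map_mul' := fun π σ => funext fun l => Subtype.ext (gFun_mul l.2 π σ) }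

theorem gHom_apply (σ : Equiv.Perm (Fin 3 ⊕ Fin m)) (l : K m) :
    ((gHom m σ l : K m) : Fin m → ℂ) = gFun σ l := rfl

/-- The group `G = {g_σ}` of transformations of `K_n`. -/
def G (m : ℕ) : Subgroup (Equiv.Perm (K m)) := (gHom m).range

/-- `g_σ` as an element of `G`. -/
def g (σ : Equiv.Perm (Fin 3 ⊕ Fin m)) : G m := (gHom m).rangeRestrict σ

/-- The stabilizer `G_l` of a point `l` of `K_n`. -/
abbrev Stab (l : K m) : Subgroup (G m) := MulAction.stabilizer (G m) l

/-! ### The tangent representation and multiplicity vectors -/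

/-- `X` is the representation `g_σ ↦ J_σ|_l` of `G_l` on the tangent space `ℂ^{n-3}` of `K_n`
at `l`, where `J_σ|_l` is the derivative (Jacobian) of `g_σ` at `l`. -/
def IsTangentRep (l : K m) (X : Representation ℂ (Stab l) (Fin m → ℂ)) : Prop :=
  ∀ (σ : Equiv.Perm (Fin 3 ⊕ Fin m)) (hσ : g σ ∈ Stab l),
    HasFDerivAt (𝕜 := ℂ) (gFun σ) (LinearMap.toContinuousLinearMap (X ⟨g σ, hσ⟩))
      (l : Fin m → ℂ)

/-- Given classes `C 0, …, C (k-1)` of linear fractional transformations into which the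
transformations `f l σ` (`g_σ ∈ G_l`) are partitioned, and a table `T`: there are irreducible
representations `X 0, …, X (k-1)` of `G_l`, the character of `X i` being equal to `T i j` at the
`g_σ` with `f l σ ∈ C j`, such that the tangent representation of `G_l` is
`p 0 • X 0 ⊕ ⋯ ⊕ p (k-1) • X (k-1)`. -/
def HasMultiplicities (l : K m) {k : ℕ} (C : Fin k → Set (Equiv.Perm Sphere))
    (T : Matrix (Fin k) (Fin k) ℂ) (p : Fin k → ℕ) : Prop :=
  (∀ σ : Equiv.Perm (Fin 3 ⊕ Fin m), g σ ∈ Stab l → ∃! j, f (l : Fin m → ℂ) σ ∈ C j) ∧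
  ∃ R : Representation ℂ (Stab l) (Fin m → ℂ), IsTangentRep l R ∧
  ∃ (d : Fin k → ℕ) (X : ∀ i, Representation ℂ (Stab l) (Fin (d i) → ℂ)),
    (∀ i, (X i).IsIrreducible) ∧
    (∀ (i j : Fin k) (σ : Equiv.Perm (Fin 3 ⊕ Fin m)) (hσ : g σ ∈ Stab l),
      f (l : Fin m → ℂ) σ ∈ C j → (X i).character ⟨g σ, hσ⟩ = T i j) ∧
    Nonempty (R.Equiv (Representation.directSum
      (fun s : (Σ i : Fin k, Fin (p i)) => X s.1)))

/-- For a set `α` of six points, classes `C j` of elements of `𝒜_α` and a table `T` of characters: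
the multiplicity vector of `α` is `p`. Here `α` is moved by a linear fractional transformation
`φ` to a set `{0, 1, ∞, l 0, l 1, l 2}` with `l ∈ K_6`, and the classes are moved along; every
choice of `φ` and `l` is considered. -/
def HasMultiplicityVector (α : Set Sphere) {k : ℕ} (C : Fin k → Set (Equiv.Perm Sphere))
    (T : Matrix (Fin k) (Fin k) ℂ) (p : Fin k → ℕ) : Prop :=
  ∀ (l : K 3), ∀ φ ∈ LFT, φ '' α = Set.range (pts (l : Fin 3 → ℂ)) →
    HasMultiplicities l (fun j => {h | φ⁻¹ * h * φ ∈ C j}) T p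

/-! ### Classes and character tables -/

/-- `e^{2πi/n}`. -/
def ζ (n : ℕ) : ℂ := Complex.exp (2 * Real.pi * Complex.I / n)

/-- `𝒜_α ≃ D₆`, in a coordinate `ψ` with `ψ(α)` the sixth roots of unity: the rotations by
`±2πl/6` for `l = 1, 2, 3`; the identity; the remaining elements with two fixed points in `α`;
the remaining elements with no fixed point in `α`. -/
def classesD6 (α : Set Sphere) (ψ : Equiv.Perm Sphere) : Fin 6 → Set (Equiv.Perm Sphere) :=
  ![{h | ψ * h * ψ⁻¹ = rot (ζ 6) ∨ ψ * h * ψ⁻¹ = rot (ζ 6 ^ 5)},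
    {h | ψ * h * ψ⁻¹ = rot (ζ 6 ^ 2) ∨ ψ * h * ψ⁻¹ = rot (ζ 6 ^ 4)},
    {h | ψ * h * ψ⁻¹ = rot (ζ 6 ^ 3)},
    {1},
    {h | (∀ j : ℕ, ψ * h * ψ⁻¹ ≠ rot (ζ 6 ^ j)) ∧ {z ∈ α | h z = z}.ncard = 2},
    {h | (∀ j : ℕ, ψ * h * ψ⁻¹ ≠ rot (ζ 6 ^ j)) ∧ {z ∈ α | h z = z} = ∅}]

/-- Character table of `D₆` (rows: irreducible characters, columns: classes). -/
def tableD6 : Matrix (Fin 6) (Fin 6) ℂ :=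
  !![ 1, -1, -2, 2,  0,  0;
     -1, -1,  2, 2,  0,  0;
      1,  1,  1, 1,  1,  1;
      1,  1,  1, 1, -1, -1;
     -1,  1, -1, 1,  1, -1;
     -1,  1, -1, 1, -1,  1]

/-- `𝒜_α ≃ ℤ_p`, in a coordinate `ψ` with `ψ 𝒜_α ψ⁻¹ = ⟨z ↦ e^{2πi/p} z⟩`: the classes `{ρ^j}`,
`j = 1, …, p`, where `ρ` is the rotation by `2π/p`. -/
def classesZ (p : ℕ) (ψ : Equiv.Perm Sphere) : Fin p → Set (Equiv.Perm Sphere) :=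
  fun j => {h | ψ * h * ψ⁻¹ = rot (ζ p ^ (j.val + 1))}

/-- Character table of `ℤ_p`. -/
def tableZ (p : ℕ) : Matrix (Fin p) (Fin p) ℂ :=
  Matrix.of fun i j => ζ p ^ ((i.val + 1) * (j.val + 1))

/-- `𝒜_α ≃ S₄` by `Ψ`: the identity, and the classes of `(1234)`, `(123)`, `(12)(34)`, `(12)`. -/
def classesS4 (α : Set Sphere) (Ψ : A α ≃* Equiv.Perm (Fin 4)) :
    Fin 5 → Set (Equiv.Perm Sphere) :=
  fun j => {h | ∃ hh : h ∈ A α,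
    (Ψ ⟨h, hh⟩).cycleType = (![0, {4}, {3}, {2, 2}, {2}] : Fin 5 → Multiset ℕ) j}

/-- Character table of `S₄`. -/
def tableS4 : Matrix (Fin 5) (Fin 5) ℂ :=
  !![1,  1,  1,  1,  1;
     1, -1,  1,  1, -1;
     3, -1,  0, -1,  1;
     3,  1,  0, -1, -1;
     2,  0, -1,  2,  0]

/-- `𝒜_α ≃ D₃`: the elements conjugate to a rotation by `2π/3`; the identity; the elements of
order two. -/
def classesD3 : Fin 3 → Set (Equiv.Perm Sphere) :=
  ![{h | ∃ κ ∈ LFT, κ * h * κ⁻¹ = rot (ζ 3)}, {1}, {h | orderOf h = 2}]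

/-- Character table of `D₃`. -/
def tableD3 : Matrix (Fin 3) (Fin 3) ℂ :=
  !![-1, 2,  0;
      1, 1,  1;
      1, 1, -1]

/-- `α` is of the dihedral type `2 + mC` for `p = 2`, `m = 1`, in the coordinate `κ`: `κ(α)` is the
union of the orbits `{0, ∞}` and `{±c, ±1/c}` of `⟨z ↦ -z, z ↦ 1/z⟩`, the second one having four
elements. -/
def IsTypeTwoC (α : Set Sphere) (κ : Equiv.Perm Sphere) (c : ℂ) : Prop :=
  κ ∈ LFT ∧ c ≠ 0 ∧ c ^ 4 ≠ 1 ∧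
    κ '' α = {((0 : ℂ) : Sphere), ∞, (c : Sphere), ((-c : ℂ) : Sphere), ((c⁻¹ : ℂ) : Sphere),
      ((-c⁻¹ : ℂ) : Sphere)}

/-- `𝒜_α ≃ K₄ = D₂`, in a coordinate `κ` with `κ 𝒜_α κ⁻¹ = ⟨z ↦ -z, z ↦ 1/z⟩`: the rotation by
`π`; the identity; `z ↦ s/z`; `z ↦ -s/z`. For `s = 1, -1` these are the two possible orders of the
two remaining classes. -/
def classesK4 (κ : Equiv.Perm Sphere) (s : ℂ) : Fin 4 → Set (Equiv.Perm Sphere) :=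
  ![{h | κ * h * κ⁻¹ = rot (-1)}, {1}, {h | κ * h * κ⁻¹ = inv s}, {h | κ * h * κ⁻¹ = inv (-s)}]

/-- Character table of `D₂`. -/
def tableK4 : Matrix (Fin 4) (Fin 4) ℂ :=
  !![ 1, 1,  1,  1;
      1, 1, -1, -1;
     -1, 1,  1, -1;
     -1, 1, -1,  1]

/-! ### Normal forms of six points -/

/-- A set of complex numbers as a subset of the sphere. -/
def onSphere (S : Set ℂ) : Set Sphere := (fun z : ℂ => (z : Sphere)) '' S

/-- The sixth roots of unity. -/
def roots6 : Set ℂ := {1, ζ 6, ζ 6 ^ 2, ζ 6 ^ 3, ζ 6 ^ 4, ζ 6 ^ 5}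

/-- `0` and the fifth roots of unity. -/
def zeroRoots5 : Set ℂ := {0, 1, ζ 5, ζ 5 ^ 2, ζ 5 ^ 3, ζ 5 ^ 4}

/-- The octahedron `{0, ∞, 1, i, -1, -i}`. -/
def octahedron : Set Sphere := insert ∞ (onSphere {0, 1, Complex.I, -1, -Complex.I})

/-- `{1, w, w², a, aw, aw²}` with `w = e^{2πi/3}`. -/
def hex (a : ℂ) : Set ℂ := {1, ζ 3, ζ 3 ^ 2, a, a * ζ 3, a * ζ 3 ^ 2}

/-- Admissible parameters of `hex`. -/
def HexParam (a : ℂ) : Prop := 1 ≤ ‖a‖ ∧ a ≠ 1 ∧ a ≠ ζ 3 ∧ a ≠ ζ 3 ^ 2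

/-- `a = √w, w√w, w²√w` with `√w = e^{πi/3}`. -/
def HexRoots6 (a : ℂ) : Prop := a = ζ 6 ∨ a = ζ 3 * ζ 6 ∨ a = ζ 3 ^ 2 * ζ 6

/-- `a = -(2+√3), -(2+√3)w, -(2+√3)w²`. -/
def HexOcta (a : ℂ) : Prop :=
  a = -(2 + (√3 : ℝ)) ∨ a = -(2 + (√3 : ℝ)) * ζ 3 ∨ a = -(2 + (√3 : ℝ)) * ζ 3 ^ 2

/-- `{±1, ±a, ±b}`. -/
def pm (a b : ℂ) : Set ℂ := {1, -1, a, -a, b, -b}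

/-- Admissible parameters of `pm`. -/
def PmParam (a b : ℂ) : Prop :=
  a ≠ b ∧ a ≠ -b ∧ a ≠ 0 ∧ a ≠ 1 ∧ a ≠ -1 ∧ b ≠ 0 ∧ b ≠ 1 ∧ b ≠ -1

/-- The sets `{±1, ±a, ±b}` that are equivalent to the sixth roots of unity. -/
def PmRoots6 (a b : ℂ) : Prop :=
  pm a b = roots6 ∨
  pm a b = pm (7 - 4 * (√3 : ℝ)) (2 - (√3 : ℝ)) ∨
  pm a b = pm (2 - (√3 : ℝ)) (2 + (√3 : ℝ)) ∨
  pm a b = pm (2 + (√3 : ℝ)) (7 + 4 * (√3 : ℝ))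

/-- The sets `{±1, ±a, ±b}` that are equivalent to the octahedron. -/
def PmOcta (a b : ℂ) : Prop :=
  pm a b = pm (((√2 : ℝ) - 1) * Complex.I) (((√2 : ℝ) + 1) * Complex.I) ∨
  pm a b = pm (3 - 2 * (√2 : ℝ)) (((√2 : ℝ) - 1) * Complex.I) ∨
  pm a b = pm (3 + 2 * (√2 : ℝ)) (((√2 : ℝ) + 1) * Complex.I)

/-- `a²b + ab² + a² - 6ab + b² + a + b`. -/
def cubic (a b : ℂ) : ℂ := a ^ 2 * b + a * b ^ 2 + a ^ 2 - 6 * a * b + b ^ 2 + a + b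

/-- The cubic vanishes at `(±a, ±b)` for some choice of the signs. -/
def PmCubic (a b : ℂ) : Prop :=
  cubic a b = 0 ∨ cubic (-a) b = 0 ∨ cubic a (-b) = 0 ∨ cubic (-a) (-b) = 0

/-- None of the three exceptional cases. -/
def PmGeneral (a b : ℂ) : Prop := ¬ PmRoots6 a b ∧ ¬ PmOcta a b ∧ ¬ PmCubic a b

end SixPoints

end

open SixPoints

/-! The group. An element of `A α` permutes six points and is determined by three values, so `A α`
is finite. A nontrivial element therefore has finite order and is conjugate to a rotation `z ↦ k z`,
since a parabolic transformation has infinite order (`exists_conj_rot`). Away from 0 and ∞ every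
orbit of the rotation has `n` elements, `n` being the order of `k`. Distributing six points over
such orbits and the two fixed points leaves `n = 2, …, 6` and a short list of normal forms
(`exists_normal_form`); the form {0, ∞, ±1, ±a} reduces to {±1, ±a', ±b'} (`image_zero_infty_pm`).

For the sixth roots of unity and for 0 with the fifth roots, the group is found by comparing
coefficients of polynomials; for the octahedron this is done for the stabilizer of ∞, and the rest
follows by transitivity. For `hex a` with `a` not exceptional, the evident dihedral group is simply
transitive on the six points, and `eq_one_of_fix_hex` shows that nothing else fixes a point. For `pm
a b` outside the exceptional sets, the other normal forms are ruled out, so every element has square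
1. Hence everything commutes with `z ↦ -z` and is a rotation or an inversion; `param_of_inv_mem`
decides which inversions occur.

The exceptional parameters. A transformation between two normal forms carries the known symmetry of
the first to a symmetry of the second, and the candidates there are known up to conjugation. After
one explicit transformation it remains to compare transformations conjugating rotations to
rotations, and these are `c z` or `c / z` (`eq_rot_or_inv_of_conj`). The cubic is `e₁ e₂ - 9 e₃` in
the elementary symmetric functions of `1, a, b`. It expresses that some transformation takes `1, a,
b` to the cube roots of unity and turns `z ↦ -z` into `z ↦ t² / z` (`exists_cube_map`,
`cubicForm_eq_zero`).

The multiplicities. The tangent space of `K 3` at `l` is dual to the quadratic differentials with at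
most simple poles at the six points; these are the binary quadratic forms divided by the product of
the six linear forms. The derivative of `g_σ` is transport by `f_σ` corrected by an infinitesimal
linear fractional transformation (`extv_deriv`), and the correction pairs to zero by the residue
theorem (`sum_residues`). So the tangent representation is the action `sym2` on quadratic monomials
times the scalar `kap` (`pairing_deriv`), in any coordinate `ψ` (`exists_coordinates`). In the
normal forms rotations are diagonal and inversions exchange the outer monomials, so the
decompositions can be written down; for the octahedron the representation is irreducible. The same
model shows that the tangent representation is faithful, which identifies `A α` with the stabilizer
(`toStab_bijective`). -/

noncomputable section
namespace SixPoints
open scoped OnePoint Pointwise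
open Matrix

/-! ### Linear fractional transformations and matrices -/

/-- The linear fractional transformation of an invertible matrix. -/
def lf : GL (Fin 2) ℂ →* Equiv.Perm Sphere := MulAction.toPermHom (GL (Fin 2) ℂ) Sphere

theorem exists_lf {f : Equiv.Perm Sphere} (h : f ∈ LFT) : ∃ g, lf g = f := h

theorem hc_coe (z : ℂ) : hc (z : Sphere) = (z, 1) := rfl

theorem hc_infty : hc ∞ = (1, 0) := rfl

/-- First homogeneous coordinate of the image of a point. -/
def num (g : GL (Fin 2) ℂ) (z : Sphere) : ℂ := g 0 0 * (hc z).1 + g 0 1 * (hc z).2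

/-- Second homogeneous coordinate of the image of a point. -/
def den (g : GL (Fin 2) ℂ) (z : Sphere) : ℂ := g 1 0 * (hc z).1 + g 1 1 * (hc z).2

/-- The scaling factor between the image of the homogeneous coordinates of a point and
the homogeneous coordinates of its image. -/
def tf (g : GL (Fin 2) ℂ) (z : Sphere) : ℂ := if den g z = 0 then num g z else den g z

theorem det_eq (g : GL (Fin 2) ℂ) : g 0 0 * g 1 1 - g 0 1 * g 1 0 = (g : Matrix (Fin 2) (Fin 2) ℂ).det :=
  (Matrix.det_fin_two _).symm

theorem det_ne (g : GL (Fin 2) ℂ) : (g : Matrix (Fin 2) (Fin 2) ℂ).det ≠ 0 :=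
  ((Matrix.isUnit_iff_isUnit_det _).1 g.isUnit).ne_zero

theorem lf_apply (g : GL (Fin 2) ℂ) (z : Sphere) :
    lf g z = if den g z = 0 then ∞ else ((num g z / den g z : ℂ) : Sphere) := by
  change g • z = _
  cases z using OnePoint.rec with
  | infty => rw [OnePoint.smul_infty_eq_ite]; simp [hc, num, den]
  | coe z => rw [OnePoint.smul_some_eq_ite]; simp [hc, num, den]

theorem hc_ne (z : Sphere) : (hc z).1 ≠ 0 ∨ (hc z).2 ≠ 0 := by
  cases z using OnePoint.rec <;> simp [hc]

theorem num_ne_of_den {g : GL (Fin 2) ℂ} {z : Sphere} (h : den g z = 0) : num g z ≠ 0 := by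
  intro h'
  have hd := det_ne g
  rw [← det_eq] at hd
  simp only [den, num] at h h'
  rcases hc_ne z with h0 | h0
  · apply hd
    apply mul_right_cancel₀ h0
    linear_combination g 1 1 * h' - g 0 1 * h
  · apply hd
    apply mul_right_cancel₀ h0
    linear_combination g 0 0 * h - g 1 0 * h'

theorem tf_ne (g : GL (Fin 2) ℂ) (z : Sphere) : tf g z ≠ 0 := by
  unfold tf
  split_ifs with h
  · exact num_ne_of_den h
  · exact h

theorem num_eq (g : GL (Fin 2) ℂ) (z : Sphere) : num g z = tf g z * (hc (lf g z)).1 := by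
  rw [lf_apply, tf]
  split_ifs with h
  · simp [hc_infty]
  · rw [hc_coe]; field_simp

theorem den_eq (g : GL (Fin 2) ℂ) (z : Sphere) : den g z = tf g z * (hc (lf g z)).2 := by
  rw [lf_apply, tf]
  split_ifs with h
  · simp [hc_infty, h]
  · rw [hc_coe]; simp

/-- Homogeneous coordinates are normalised to `(z, 1)` or `(1, 0)`. Proportional pairs are thus
equal pairs, and the factor is recovered along with the point; both conclusions are used below. -/
theorem hc_inj {z w : Sphere} {s t : ℂ} (hs : s ≠ 0) (h1 : s * (hc z).1 = t * (hc w).1)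
    (h2 : s * (hc z).2 = t * (hc w).2) : z = w ∧ s = t := by
  cases z using OnePoint.rec <;> cases w using OnePoint.rec <;> simp [hc] at * <;> grind

/-- The cocycle rule of an automorphy factor: apply the two matrices in turn to the normalised
vector and compare the total scaling. -/
theorem tf_mul (g h : GL (Fin 2) ℂ) (z : Sphere) : tf (g * h) z = tf g (lf h z) * tf h z := by
  have e1 : num (g * h) z = tf h z * num g (lf h z) := by
    have a := num_eq h z
    have b := den_eq h z
    simp only [num, den, Units.val_mul, Matrix.mul_apply, Fin.sum_univ_two] at a b ⊢
    linear_combination g 0 0 * a + g 0 1 * b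
  have e2 : den (g * h) z = tf h z * den g (lf h z) := by
    have a := num_eq h z
    have b := den_eq h z
    simp only [num, den, Units.val_mul, Matrix.mul_apply, Fin.sum_univ_two] at a b ⊢
    linear_combination g 1 0 * a + g 1 1 * b
  rw [num_eq, num_eq g] at e1
  rw [den_eq, den_eq g] at e2
  exact (hc_inj (tf_ne _ _) (e1.trans (by ring)) (e2.trans (by ring))).2

/-- The kernel consists of the scalar matrices. Fixing 0 and ∞ kills the off-diagonal entries, and
fixing 1 equates the diagonal ones. -/
theorem lf_eq_one {g : GL (Fin 2) ℂ} :
    lf g = 1 ↔ g 0 1 = 0 ∧ g 1 0 = 0 ∧ g 0 0 = g 1 1 := by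
  constructor
  · intro h
    have h0 : lf g ((0 : ℂ) : Sphere) = (0 : ℂ) := by rw [h]; rfl
    have h1 : lf g ((1 : ℂ) : Sphere) = (1 : ℂ) := by rw [h]; rfl
    have hi : lf g ∞ = ∞ := by rw [h]; rfl
    have n0 := num_eq g ((0 : ℂ) : Sphere)
    have n1 := num_eq g ((1 : ℂ) : Sphere)
    have d1 := den_eq g ((1 : ℂ) : Sphere)
    have di := den_eq g ∞
    rw [h0] at n0
    rw [h1] at n1 d1
    rw [hi] at di
    simp only [num, den, hc_coe, hc_infty, mul_zero, mul_one, zero_add, add_zero] at n0 n1 d1 di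
    refine ⟨n0, di, ?_⟩
    linear_combination n1 - d1 - n0 + di
  · rintro ⟨h1, h2, h3⟩
    have hd := det_ne g
    rw [← det_eq, h1, h3] at hd
    ext z
    have e : ∀ z, num g z = g 1 1 * (hc z).1 := fun z => by simp [num, h1, h3]
    have e' : ∀ z, den g z = g 1 1 * (hc z).2 := fun z => by simp [den, h2]
    have a := num_eq g z
    have b := den_eq g z
    rw [e] at a
    rw [e'] at b
    have h11 : g 1 1 ≠ 0 := by rintro h; simp [h] at hd
    exact (hc_inj h11 a b).1.symm

/-- Two matrices of the same transformation are proportional. -/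
theorem lf_eq_lf {g h : GL (Fin 2) ℂ} (e : lf g = lf h) :
    ∃ k : ℂ, k ≠ 0 ∧ ∀ i j, g i j = k * h i j := by
  have h1 : lf (g * h⁻¹) = 1 := by rw [map_mul, e, map_inv, mul_inv_cancel]
  obtain ⟨a, b, c⟩ := lf_eq_one.1 h1
  have hd := det_ne (g * h⁻¹)
  rw [← det_eq, a, c] at hd
  have hg : g = (g * h⁻¹) * h := by group
  refine ⟨(g * h⁻¹) 1 1, by rintro h; simp [h] at hd, ?_⟩
  intro i j
  conv_lhs => rw [hg]
  rw [Units.val_mul (g * h⁻¹) h, Matrix.mul_apply, Fin.sum_univ_two]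
  fin_cases i <;> simp [a, b, c]

theorem mul_eq_of_scalar {g h : GL (Fin 2) ℂ} {k : ℂ} (e : ∀ i j, g i j = k * h i j)
    (z : Sphere) : num g z = k * num h z ∧ den g z = k * den h z := by
  simp only [num, den, e]
  constructor <;> ring

theorem lf_eq_of_scalar {g h : GL (Fin 2) ℂ} {k : ℂ}
    (e : ∀ i j, g i j = k * h i j) : lf g = lf h := by
  ext z
  obtain ⟨a, b⟩ := mul_eq_of_scalar e z
  rw [num_eq, num_eq h] at a
  rw [den_eq, den_eq h] at b
  exact (hc_inj (tf_ne _ _) (a.trans (by ring)) (b.trans (by ring)) :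
    _ ∧ tf g z = k * tf h z).1

theorem tf_of_scalar {g h : GL (Fin 2) ℂ} {k : ℂ} (e : ∀ i j, g i j = k * h i j)
    (z : Sphere) : tf g z = k * tf h z := by
  obtain ⟨a, b⟩ := mul_eq_of_scalar e z
  rw [num_eq, num_eq h] at a
  rw [den_eq, den_eq h] at b
  exact (hc_inj (tf_ne _ _) (a.trans (by ring)) (b.trans (by ring)) :
    _ ∧ tf g z = k * tf h z).2

/-- The invertible matrix with given entries. -/
def gl (a b c d : ℂ) (h : a * d - b * c ≠ 0) : GL (Fin 2) ℂ :=
  Matrix.GeneralLinearGroup.mkOfDetNeZero !![a, b; c, d] (by rwa [Matrix.det_fin_two_of])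

@[simp] theorem gl_val (a b c d : ℂ) (h : a * d - b * c ≠ 0) :
    (gl a b c d h : Matrix (Fin 2) (Fin 2) ℂ) = !![a, b; c, d] := rfl

theorem mob_eq_lf {a b c d : ℂ} (h : a * d - b * c ≠ 0) : mob a b c d = lf (gl a b c d h) := by
  rw [mob, dif_pos (by rwa [Matrix.det_fin_two_of])]
  rfl

/-- The action of a matrix on binary quadratic forms. -/
def sym2 (g : Matrix (Fin 2) (Fin 2) ℂ) : Matrix (Fin 3) (Fin 3) ℂ :=
  !![g 0 0 ^ 2, 2 * g 0 0 * g 0 1, g 0 1 ^ 2;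
     g 0 0 * g 1 0, g 0 0 * g 1 1 + g 0 1 * g 1 0, g 0 1 * g 1 1;
     g 1 0 ^ 2, 2 * g 1 0 * g 1 1, g 1 1 ^ 2]

theorem sym2_mul (g h : Matrix (Fin 2) (Fin 2) ℂ) : sym2 (g * h) = sym2 g * sym2 h := by
  ext i j
  fin_cases i <;> fin_cases j <;>
    simp [sym2, Matrix.mul_apply, Fin.sum_univ_two, Fin.sum_univ_three] <;> ring

theorem sym2_one : sym2 1 = 1 := by
  ext i j
  fin_cases i <;> fin_cases j <;> simp [sym2]

/-- The quadratic monomials in the homogeneous coordinates of a point. -/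
def mon (z : Sphere) : Fin 3 → ℂ := ![(hc z).1 ^ 2, (hc z).1 * (hc z).2, (hc z).2 ^ 2]

/-- `mon z` is quadratic in the normalised vector of `z`, so the scaling factor of that vector
enters squared. -/
theorem sym2_mon (g : GL (Fin 2) ℂ) (z : Sphere) :
    sym2 g *ᵥ mon z = tf g z ^ 2 • mon (lf g z) := by
  have a := num_eq g z
  have b := den_eq g z
  simp only [num, den] at a b
  ext i
  fin_cases i
  · simp [sym2, mon, Matrix.mulVec, dotProduct, Fin.sum_univ_three]
    linear_combination (g 0 0 * (hc z).1 + g 0 1 * (hc z).2 + tf g z * (hc (lf g z)).1) * a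
  · simp [sym2, mon, Matrix.mulVec, dotProduct, Fin.sum_univ_three]
    linear_combination (g 1 0 * (hc z).1 + g 1 1 * (hc z).2) * a + tf g z * (hc (lf g z)).1 * b
  · simp [sym2, mon, Matrix.mulVec, dotProduct, Fin.sum_univ_three]
    linear_combination (g 1 0 * (hc z).1 + g 1 1 * (hc z).2 + tf g z * (hc (lf g z)).2) * b

/-- `br` is the determinant of two column vectors, so it is multiplied by `det g`; renormalising
both columns costs one factor `tf` each. -/
theorem br_lf (g : GL (Fin 2) ℂ) (z w : Sphere) :
    tf g z * tf g w * br (lf g z) (lf g w) = (g : Matrix (Fin 2) (Fin 2) ℂ).det * br z w := by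
  have a := num_eq g z
  have b := den_eq g z
  have a' := num_eq g w
  have b' := den_eq g w
  have e : tf g z * tf g w * br (lf g z) (lf g w) = num g z * den g w - den g z * num g w := by
    rw [a, b, a', b']; simp only [br]; ring
  rw [e, ← det_eq]
  simp only [num, den, br]
  ring

theorem det_of_scalar {g h : Matrix (Fin 2) (Fin 2) ℂ} {k : ℂ} (e : ∀ i j, g i j = k * h i j) :
    g.det = k ^ 2 * h.det := by
  simp only [Matrix.det_fin_two, e]; ring

/-- The factor by which the tangent action differs from the action on quadratic forms. -/
def kap {ι : Type*} [Fintype ι] (b : ι → Sphere) (g : GL (Fin 2) ℂ) : ℂ :=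
  (∏ i, tf g (b i)) / (g : Matrix (Fin 2) (Fin 2) ℂ).det ^ 4

end SixPoints

end

noncomputable section
namespace SixPoints
open scoped OnePoint Pointwise
open Matrix

/-! ### The derivative of `g_σ` and quadratic differentials -/

theorem isOpen_K (m : ℕ) : IsOpen (K m) := by
  have : K m = (⋂ i, ⋂ j, {l : Fin m → ℂ | i ≠ j → l i ≠ l j}) ∩
      ⋂ i, ({l | l i ≠ 0} ∩ {l | l i ≠ 1}) := by
    ext l
    simp only [K, Function.Injective, Set.mem_ofPred_eq, Set.mem_inter_iff, Set.mem_iInter]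
    refine and_congr ⟨fun h i j hij e => hij (h e), fun h i j e => ?_⟩ Iff.rfl
    by_contra hij
    exact h i j hij e
  rw [this]
  refine IsOpen.inter ?_ ?_
  · refine isOpen_iInter_of_finite fun i => isOpen_iInter_of_finite fun j => ?_
    by_cases h : i = j
    · simp [h]
    · simpa [h] using isOpen_ne_fun (continuous_apply i) (continuous_apply j)
  · refine isOpen_iInter_of_finite fun i => IsOpen.inter ?_ ?_
    · exact isOpen_ne_fun (continuous_apply i) continuous_const
    · exact isOpen_ne_fun (continuous_apply i) continuous_const

/-- A tangent vector as a family of displacements of all points. -/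
def extv {m : ℕ} (v : Fin m → ℂ) : Fin 3 ⊕ Fin m → ℂ := Sum.elim 0 v

/-- The points `0, 1, ∞` stay put and the second homogeneous coordinates are constant, so the first
coordinates carry the whole motion. -/
theorem hc_pts_fst_hasDerivAt {m : ℕ} {L : ℂ → Fin m → ℂ} {v : Fin m → ℂ} {s : ℂ}
    (h : HasDerivAt L v s) (k : Fin 3 ⊕ Fin m) :
    HasDerivAt (fun s => (hc (pts (L s) k)).1) (extv v k) s := by
  rcases k with k | i
  · exact hasDerivAt_const s (hc (pts (L s) (Sum.inl k))).1
  · exact (hasDerivAt_pi.1 h) i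

theorem hc_pts_snd {m : ℕ} (l l' : Fin m → ℂ) (k : Fin 3 ⊕ Fin m) :
    (hc (pts l k)).2 = (hc (pts l' k)).2 := by
  rcases k with k | i <;> rfl

/-- The second coordinate is 1 except at ∞, and ∞ has displacement zero. -/
theorem extv_mul_snd {m : ℕ} (v l : Fin m → ℂ) (k : Fin 3 ⊕ Fin m) :
    extv v k * (hc (pts l k)).2 = extv v k := by
  rcases k with k | i
  · simp [extv]
  · simp [extv, pts, hc]

/-- Near a point of `K m` each coordinate of `g_σ` is a cross ratio, a quotient of brackets of
distinct points, hence rational with nonvanishing denominator. -/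
theorem gFun_differentiableAt {m : ℕ} {l : Fin m → ℂ} (hl : l ∈ K m)
    (σ : Equiv.Perm (Fin 3 ⊕ Fin m)) : DifferentiableAt ℂ (gFun σ) l := by
  have hx : ∀ k, DifferentiableAt ℂ (fun l : Fin m → ℂ => (hc (pts l k)).1) l := by
    rintro (k | i)
    · exact differentiableAt_const (hc (pts l (Sum.inl k))).1
    · exact differentiableAt_apply i l
  have hy : ∀ k, DifferentiableAt ℂ (fun l : Fin m → ℂ => (hc (pts l k)).2) l := by
    rintro (k | i)
    · exact differentiableAt_const (hc (pts l (Sum.inl k))).2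
    · exact differentiableAt_const (1 : ℂ)
  rw [differentiableAt_pi]
  intro i
  set p := fun l => pts l (σ⁻¹ (Sum.inl 0))
  set q := fun l => pts l (σ⁻¹ (Sum.inl 1))
  set r := fun l => pts l (σ⁻¹ (Sum.inl 2))
  set z := fun l => pts l (σ⁻¹ (Sum.inr i))
  have inj : ∀ l ∈ K m, Function.Injective fun k => pts l (σ⁻¹ k) := fun l hl =>
    (pts_injective hl).comp σ⁻¹.injective
  have h1 : ∀ l ∈ K m, br (q l) (p l) * br (z l) (r l) ≠ 0 := fun l hl =>
    mul_ne_zero (br_ne_zero ((inj l hl).ne (by simp))) (br_ne_zero ((inj l hl).ne (by simp)))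
  have e : (fun l => gFun σ l i) =ᶠ[nhds l] fun l =>
      (br (q l) (r l) * br (z l) (p l)) / (br (q l) (p l) * br (z l) (r l)) := by
    filter_upwards [(isOpen_K m).mem_nhds hl] with l hl
    have hpq : p l ≠ q l := (inj l hl).ne (by simp)
    have hpr : p l ≠ r l := (inj l hl).ne (by simp)
    have hqr : q l ≠ r l := (inj l hl).ne (by simp)
    have hn : br (q l) (r l) * (hc (p l)).2 * (hc (z l)).1 +
      -(br (q l) (r l) * (hc (p l)).1) * (hc (z l)).2 = br (q l) (r l) * br (z l) (p l) := by
      simp only [br]; ring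
    have hd : br (q l) (p l) * (hc (r l)).2 * (hc (z l)).1 +
      -(br (q l) (p l) * (hc (r l)).1) * (hc (z l)).2 = br (q l) (p l) * br (z l) (r l) := by
      simp only [br]; ring
    change (toZeroOneInf (p l) (q l) (r l) (z l)).elim 0 id = _
    rw [toZeroOneInf, mob_apply (toZeroOneInf_det hpq hpr hqr), hn, hd, if_neg (h1 l hl)]
    rfl
  refine DifferentiableAt.congr_of_eventuallyEq ?_ e
  have hp : ∀ k k', DifferentiableAt ℂ (fun l : Fin m → ℂ => br (pts l k) (pts l k')) l := by
    intro k k'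
    exact ((hx k).mul (hy k')).sub ((hy k).mul (hx k'))
  simp_rw [div_eq_mul_inv]
  exact ((hp _ _).mul (hp _ _)).mul (((hp _ _).mul (hp _ _)).inv (h1 l hl))

/-- The displacement under `g_σ` is the displacement moved by `f_σ`, up to a vector field of
degree two. -/
theorem extv_deriv {m : ℕ} {l : Fin m → ℂ} (hl : l ∈ K m) {σ : Equiv.Perm (Fin 3 ⊕ Fin m)}
    (hσ : gFun σ l = l) {J : (Fin m → ℂ) →L[ℂ] (Fin m → ℂ)} (hJ : HasFDerivAt (gFun σ) J l)
    (v : Fin m → ℂ) :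
    ∃ g : GL (Fin 2) ℂ, lf g = f l σ ∧ ∃ A B C : ℂ, ∀ k,
      extv (J v) k = A * (hc (pts l k)).1 ^ 2 + B * (hc (pts l k)).1 * (hc (pts l k)).2 +
        C * (hc (pts l k)).2 ^ 2 +
        (g : Matrix (Fin 2) (Fin 2) ℂ).det / tf g (pts l (σ⁻¹ k)) ^ 2 * extv v (σ⁻¹ k) := by
  -- The derivative is computed along the line through `l` in direction `v`, with explicit matrix
  -- entries `a, b, c, d` depending on the parameter.
  let L : ℂ → Fin m → ℂ := fun s => l + s • v
  have hL0 : L 0 = l := by simp [L]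
  have hL : HasDerivAt L v 0 := by
    have := ((hasDerivAt_id (0 : ℂ)).smul_const v).const_add l
    rwa [one_smul] at this
  have hLK : ∀ᶠ s in nhds (0 : ℂ), L s ∈ K m :=
    hL.continuousAt.eventually (by rw [hL0]; exact (isOpen_K m).mem_nhds hl)
  have hG : HasDerivAt (fun s => gFun σ (L s)) (J v) 0 :=
    HasFDerivAt.comp_hasDerivAt (0 : ℂ) (l := gFun σ) (f := L) (by rwa [hL0]) hL
  have hx := hc_pts_fst_hasDerivAt hL
  have hX := hc_pts_fst_hasDerivAt hG
  have hy : ∀ k, HasDerivAt (fun s => (hc (pts (L s) k)).2) 0 0 := by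
    intro k
    simp_rw [fun s => hc_pts_snd (L s) l k]
    exact hasDerivAt_const _ _
  have hb : ∀ k k', DifferentiableAt ℂ (fun s => br (pts (L s) k) (pts (L s) k')) 0 := by
    intro k k'
    exact ((hx k).differentiableAt.mul (hy k').differentiableAt).sub
      ((hy k).differentiableAt.mul (hx k').differentiableAt)
  set p := fun s => pts (L s) (σ⁻¹ (Sum.inl 0)) with hp
  set q := fun s => pts (L s) (σ⁻¹ (Sum.inl 1)) with hq
  set r := fun s => pts (L s) (σ⁻¹ (Sum.inl 2)) with hr
  obtain ⟨a, ha⟩ : ∃ a : ℂ → ℂ, ∀ s, a s = br (q s) (r s) * (hc (p s)).2 := ⟨_, fun _ => rfl⟩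
  obtain ⟨b, hb'⟩ : ∃ a : ℂ → ℂ, ∀ s, a s = -(br (q s) (r s) * (hc (p s)).1) :=
    ⟨_, fun _ => rfl⟩
  obtain ⟨c, hc'⟩ : ∃ a : ℂ → ℂ, ∀ s, a s = br (q s) (p s) * (hc (r s)).2 := ⟨_, fun _ => rfl⟩
  obtain ⟨d, hd⟩ : ∃ a : ℂ → ℂ, ∀ s, a s = -(br (q s) (p s) * (hc (r s)).1) :=
    ⟨_, fun _ => rfl⟩
  have da : DifferentiableAt ℂ a 0 := by
    rw [funext ha]; exact (hb _ _).mul (hy _).differentiableAt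
  have db : DifferentiableAt ℂ b 0 := by
    rw [funext hb']; exact ((hb _ _).mul (hx _).differentiableAt).neg
  have dc : DifferentiableAt ℂ c 0 := by
    rw [funext hc']; exact (hb _ _).mul (hy _).differentiableAt
  have dd : DifferentiableAt ℂ d 0 := by
    rw [funext hd]; exact ((hb _ _).mul (hx _).differentiableAt).neg
  have inj : ∀ l ∈ K m, Function.Injective fun k => pts l (σ⁻¹ k) := fun l hl =>
    (pts_injective hl).comp σ⁻¹.injective
  have hdet : ∀ s, L s ∈ K m → a s * d s - b s * c s ≠ 0 := by
    intro s hs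
    rw [ha, hb', hc', hd]
    exact toZeroOneInf_det ((inj _ hs).ne (by simp)) ((inj _ hs).ne (by simp))
      ((inj _ hs).ne (by simp))
  have hf : ∀ s (hs : L s ∈ K m), f (L s) σ = lf (gl _ _ _ _ (hdet s hs)) := by
    intro s hs
    rw [← mob_eq_lf, ha, hb', hc', hd]
    rfl
  have hl0 : L 0 ∈ K m := by rwa [hL0]
  -- With `M` the matrix at parameter 0 and `M'` its derivative, the three coefficients are those of
  -- the quadratic vector field generated by `M' M⁻¹`.
  refine ⟨gl _ _ _ _ (hdet 0 hl0), by rw [← hf 0 hl0, hL0],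
    (-(deriv c 0) * d 0 + deriv d 0 * c 0) / (a 0 * d 0 - b 0 * c 0),
    (deriv a 0 * d 0 - deriv b 0 * c 0 + deriv c 0 * b 0 - deriv d 0 * a 0) /
      (a 0 * d 0 - b 0 * c 0),
    (-(deriv a 0) * b 0 + deriv b 0 * a 0) / (a 0 * d 0 - b 0 * c 0), fun k => ?_⟩
  set j := σ⁻¹ k with hj
  -- Cross-multiplied form of the statement that the transformation takes the moving point `j` to
  -- the moving point `k`. It holds identically near 0, so its derivative vanishes; this avoids
  -- dividing and treats ∞ like the other points.
  have hE : (fun s => (a s * (hc (pts (L s) j)).1 + b s * (hc (pts (L s) j)).2) *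
      (hc (pts l k)).2 - (c s * (hc (pts (L s) j)).1 + d s * (hc (pts (L s) j)).2) *
      (hc (pts (gFun σ (L s)) k)).1) =ᶠ[nhds 0] fun _ => (0 : ℂ) := by
    filter_upwards [hLK] with s hs
    have h1 := num_eq (gl _ _ _ _ (hdet s hs)) (pts (L s) j)
    have h2 := den_eq (gl _ _ _ _ (hdet s hs)) (pts (L s) j)
    rw [← hf s hs, ← pts_gFun hs] at h1 h2
    rw [hc_pts_snd _ l] at h2
    simp only [num, den, gl_val, Matrix.of_apply, Matrix.cons_val', Matrix.cons_val_zero,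
      Matrix.cons_val_one, Matrix.cons_val_fin_one] at h1 h2
    rw [h1, h2]
    ring
  have hD := (((da.hasDerivAt.mul (hx j)).add (db.hasDerivAt.mul (hy j))).mul_const
    ((hc (pts l k)).2)).sub (((dc.hasDerivAt.mul (hx j)).add (dd.hasDerivAt.mul (hy j))).mul
      (hX k))
  have h0 := hD.unique ((hasDerivAt_const (0 : ℂ) (0 : ℂ)).congr_of_eventuallyEq hE)
  have h1 := num_eq (gl _ _ _ _ (hdet 0 hl0)) (pts (L 0) j)
  have h2 := den_eq (gl _ _ _ _ (hdet 0 hl0)) (pts (L 0) j)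
  rw [← hf 0 hl0, ← pts_gFun hl0] at h1 h2
  have hne := hdet 0 hl0
  have ht := tf_ne (gl _ _ _ _ (hdet 0 hl0)) (pts (L 0) j)
  have hy1 := extv_mul_snd (J v) l k
  have hy2 := extv_mul_snd v l j
  simp only [num, den, gl_val, Matrix.of_apply, Matrix.cons_val', Matrix.cons_val_zero,
      Matrix.cons_val_one, Matrix.cons_val_fin_one, hL0, hσ, Pi.add_apply, Pi.mul_apply,
      Matrix.det_fin_two_of] at h0 h1 h2 ht ⊢
  generalize tf (gl _ _ _ _ (hdet 0 hl0)) (pts l j) = t at *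
  generalize (hc (pts l j)).1 = x at *
  generalize (hc (pts l j)).2 = y at *
  generalize (hc (pts l k)).1 = X at *
  generalize (hc (pts l k)).2 = Y at *
  generalize extv (J v) k = u at *
  generalize extv v j = w at *
  generalize deriv a 0 = a' at *
  generalize deriv b 0 = b' at *
  generalize deriv c 0 = c' at *
  generalize deriv d 0 = d' at *
  generalize a 0 = a at *
  generalize b 0 = b at *
  generalize c 0 = c at *
  generalize d 0 = d at *
  -- Cramer's rule expresses the old point by the new one, so that the vector field can be read in
  -- the coordinates of the new point.
  have ex : (a * d - b * c) * x = t * (d * X - b * Y) := by linear_combination d * h1 - b * h2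
  have ey : (a * d - b * c) * y = t * (a * Y - c * X) := by linear_combination a * h2 - c * h1
  have e1 : t * u = (a' * x + b' * y) * Y - (c' * x + d' * y) * X + (a * Y - c * X) * w := by
    linear_combination -h0 - u * h2 - t * hy1
  have e2 : t ^ 2 * (a * d - b * c) * u = t ^ 2 * ((a' * (d * X - b * Y) +
      b' * (a * Y - c * X)) * Y - (c' * (d * X - b * Y) + d' * (a * Y - c * X)) * X) +
      (a * d - b * c) ^ 2 * w := by
    linear_combination t * (a * d - b * c) * e1 + t * (a' * Y - c' * X) * ex +
      t * (b' * Y - d' * X) * ey - (a * d - b * c) * w * ey + (a * d - b * c) ^ 2 * hy2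
  generalize hDD : a * d - b * c = D at *
  rw [show u = (t ^ 2 * D * u) / (t ^ 2 * D) by field_simp, e2]
  field_simp
  ring

/-! ### The pairing with quadratic differentials -/

/-- The product of the differences to the other points. -/
def wt (l : Fin 3 → ℂ) (k : Fin 3 ⊕ Fin 3) : ℂ :=
  ∏ j, if j = k then 1 else br (pts l k) (pts l j)

theorem wt_ne {l : Fin 3 → ℂ} (hl : l ∈ K 3) (k : Fin 3 ⊕ Fin 3) : wt l k ≠ 0 := by
  refine Finset.prod_ne_zero_iff.2 fun j _ => ?_
  split_ifs with h
  · exact one_ne_zero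
  · exact br_ne_zero ((pts_injective hl).ne (Ne.symm h))

/-- The sum of the residues of a quartic form over the product of the six linear forms. -/
theorem sum_residues {l : Fin 3 → ℂ} (hl : l ∈ K 3) (c : Fin 5 → ℂ) :
    ∑ k, (c 0 * (hc (pts l k)).1 ^ 4 + c 1 * (hc (pts l k)).1 ^ 3 * (hc (pts l k)).2 +
      c 2 * (hc (pts l k)).1 ^ 2 * (hc (pts l k)).2 ^ 2 +
      c 3 * (hc (pts l k)).1 * (hc (pts l k)).2 ^ 3 + c 4 * (hc (pts l k)).2 ^ 4) / wt l k = 0 := by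
  have h0 := (hl.2 0).1
  have h0' := sub_ne_zero.2 (hl.2 0).2
  have h1 := (hl.2 1).1
  have h1' := sub_ne_zero.2 (hl.2 1).2
  have h2 := (hl.2 2).1
  have h2' := sub_ne_zero.2 (hl.2 2).2
  have h01 := sub_ne_zero.2 (hl.1.ne (show (0 : Fin 3) ≠ 1 by decide))
  have h02 := sub_ne_zero.2 (hl.1.ne (show (0 : Fin 3) ≠ 2 by decide))
  have h12 := sub_ne_zero.2 (hl.1.ne (show (1 : Fin 3) ≠ 2 by decide))
  -- One orientation is fixed for each difference, so that the common denominator of the six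
  -- residues is recognised; what remains is a polynomial identity.
  have n0' : 1 - l 0 = -(l 0 - 1) := by ring
  have n1' : 1 - l 1 = -(l 1 - 1) := by ring
  have n2' : 1 - l 2 = -(l 2 - 1) := by ring
  have n01 : l 1 - l 0 = -(l 0 - l 1) := by ring
  have n02 : l 2 - l 0 = -(l 0 - l 2) := by ring
  have n12 : l 2 - l 1 = -(l 1 - l 2) := by ring
  simp [Fintype.sum_sum_type, Fin.sum_univ_three, wt, Fintype.prod_sum_type, Fin.prod_univ_three,
    pts, br, hc_coe, hc_infty]
  rw [n0', n1', n2', n01, n02, n12]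
  field_simp
  ring

/-- The pairing of tangent vectors with the quadratic differentials with simple poles at the six
points, in the basis given by the quadratic monomials. -/
def pairing (l : Fin 3 → ℂ) : (Fin 3 → ℂ) →ₗ[ℂ] (Fin 3 → ℂ) where
  toFun v := ∑ k, (extv v k / wt l k) • mon (pts l k)
  map_add' v w := by
    rw [← Finset.sum_add_distrib]
    refine Finset.sum_congr rfl fun k _ => ?_
    rw [← add_smul]
    rcases k with k | k <;> simp [extv, add_div]
  map_smul' c v := by
    rw [Finset.smul_sum]
    refine Finset.sum_congr rfl fun k _ => ?_
    rw [smul_smul]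
    rcases k with k | k <;> simp [extv, mul_div_assoc]

theorem pairing_apply (l v : Fin 3 → ℂ) :
    pairing l v = ∑ k, (extv v k / wt l k) • mon (pts l k) := rfl

/-- The points `0, 1, ∞` have displacement zero, so only `l 0, l 1, l 2` contribute and the system
is a Vandermonde system. The combinations used evaluate the quadratic polynomial vanishing at two of
the three points. -/
theorem pairing_injective {l : Fin 3 → ℂ} (hl : l ∈ K 3) : Function.Injective (pairing l) := by
  rw [injective_iff_map_eq_zero]
  intro v hv
  rw [pairing_apply] at hv
  have e : ∀ i, ∑ j, v j / wt l (Sum.inr j) * mon (pts l (Sum.inr j)) i = 0 := by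
    intro i
    have := congrFun hv i
    simpa [Fintype.sum_sum_type, extv] using this
  have w : ∀ j, v j / wt l (Sum.inr j) = 0 → v j = 0 := fun j h =>
    (div_eq_zero_iff.1 h).resolve_right (wt_ne hl _)
  have e0 := e 0
  have e1 := e 1
  have e2 := e 2
  simp only [Fin.sum_univ_three, mon, pts, hc_coe, Sum.elim_inr, Matrix.cons_val] at e0 e1 e2
  have h01 := sub_ne_zero.2 (hl.1.ne (show (0 : Fin 3) ≠ 1 by decide))
  have h02 := sub_ne_zero.2 (hl.1.ne (show (0 : Fin 3) ≠ 2 by decide))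
  have h12 := sub_ne_zero.2 (hl.1.ne (show (1 : Fin 3) ≠ 2 by decide))
  ext j
  apply w
  fin_cases j
  · change v 0 / wt l (Sum.inr 0) = 0
    apply mul_right_cancel₀ (mul_ne_zero h01 h02)
    linear_combination e0 - (l 1 + l 2) * e1 + l 1 * l 2 * e2
  · change v 1 / wt l (Sum.inr 1) = 0
    apply mul_right_cancel₀ (mul_ne_zero h01 h12)
    linear_combination -e0 + (l 0 + l 2) * e1 - l 0 * l 2 * e2
  · change v 2 / wt l (Sum.inr 2) = 0
    apply mul_right_cancel₀ (mul_ne_zero h02 h12)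
    linear_combination e0 - (l 0 + l 1) * e1 + l 0 * l 1 * e2

/-- How the products of differences change under a transformation preserving the six points. -/
theorem wt_lf {l : Fin 3 → ℂ} {σ : Equiv.Perm (Fin 3 ⊕ Fin 3)} {g : GL (Fin 2) ℂ}
    (h : ∀ k, lf g (pts l k) = pts l (σ k)) (k : Fin 3 ⊕ Fin 3) :
    tf g (pts l k) ^ 4 * (∏ j, tf g (pts l j)) * wt l (σ k) =
      (g : Matrix (Fin 2) (Fin 2) ℂ).det ^ 5 * wt l k := by
  have e : wt l (σ k) = ∏ j, if j = k then 1 else br (pts l (σ k)) (pts l (σ j)) := by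
    rw [wt, ← Equiv.prod_comp σ]
    -- After reindexing, each of the five nontrivial factors obeys `br_lf`. The fixed point `k`
    -- occurs in all five, which gives `tf ^ 4` beyond the full product and `det ^ 5` on the other
    -- side.
    simp only [EmbeddingLike.apply_eq_iff_eq]
  have hs : ∀ F : Fin 3 ⊕ Fin 3 → ℂ, ∏ j, (if j = k then 1 else F j) =
      ∏ j ∈ Finset.univ.erase k, F j := by
    intro F
    rw [← Finset.mul_prod_erase _ _ (Finset.mem_univ k), if_pos rfl, one_mul]
    exact Finset.prod_congr rfl fun j hj => if_neg (Finset.ne_of_mem_erase hj)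
  have hcard : (Finset.univ.erase k : Finset (Fin 3 ⊕ Fin 3)).card = 5 := by
    rw [Finset.card_erase_of_mem (Finset.mem_univ k)]; rfl
  rw [e, wt, hs, hs, ← Finset.mul_prod_erase _ _ (Finset.mem_univ k)]
  have h5 : ∀ c : ℂ, c ^ 5 = ∏ j ∈ (Finset.univ.erase k : Finset (Fin 3 ⊕ Fin 3)), c := by
    intro c; rw [Finset.prod_const, hcard]
  rw [h5, ← Finset.prod_mul_distrib, ← mul_assoc, ← pow_succ, h5, ← Finset.prod_mul_distrib,
    ← Finset.prod_mul_distrib]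
  refine Finset.prod_congr rfl fun j _ => ?_
  rw [← br_lf, h, h]

/-- The tangent action is dual to the action on quadratic differentials. Transport of a displacement
contributes `det / tf²`, the residue weight `tf⁴ (∏ tf) / det⁵` by `wt_lf`, and the monomials absorb
`tf²`. The dependence on the point cancels and `kap` remains. -/
theorem pairing_deriv {l : Fin 3 → ℂ} (hl : l ∈ K 3) {σ : Equiv.Perm (Fin 3 ⊕ Fin 3)}
    (hσ : gFun σ l = l) {J : (Fin 3 → ℂ) →L[ℂ] (Fin 3 → ℂ)} (hJ : HasFDerivAt (gFun σ) J l)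
    {g : GL (Fin 2) ℂ} (hg : lf g = f l σ) (v : Fin 3 → ℂ) :
    pairing l (J v) = kap (pts l) g • sym2 g *ᵥ pairing l v := by
  have hdet := det_ne g
  have hp : ∀ k, lf g (pts l k) = pts l (σ k) := by
    intro k
    have := pts_gFun hl σ (σ k)
    rw [hσ] at this
    rw [this, hg, show σ⁻¹ (σ k) = k from σ.symm_apply_apply k]
  obtain ⟨g', hg', A, B, C, h⟩ := extv_deriv hl hσ hJ v
  -- `extv_deriv` supplies its own matrix of the transformation. The ratio `det / tf²` does not
  -- change under scaling, so the given matrix may replace it.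
  obtain ⟨t, ht, hgt⟩ := lf_eq_lf (hg'.trans hg.symm)
  have hk : ∀ k, extv (J v) k = A * (hc (pts l k)).1 ^ 2 + B * (hc (pts l k)).1 *
      (hc (pts l k)).2 + C * (hc (pts l k)).2 ^ 2 +
        (g : Matrix (Fin 2) (Fin 2) ℂ).det / tf g (pts l (σ⁻¹ k)) ^ 2 * extv v (σ⁻¹ k) := by
    intro k
    have := tf_ne g (pts l (σ⁻¹ k))
    rw [h, tf_of_scalar hgt, det_of_scalar hgt]
    field_simp
  -- The quadratic vector field times a quadratic monomial is a quartic form, to which the vanishing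
  -- of the sum of residues applies.
  have hres : ∀ i, ∑ k, (A * (hc (pts l k)).1 ^ 2 + B * (hc (pts l k)).1 *
      (hc (pts l k)).2 + C * (hc (pts l k)).2 ^ 2) / wt l k * mon (pts l k) i = 0 := by
    intro i
    fin_cases i
    · refine Eq.trans (Finset.sum_congr rfl fun k _ => ?_) (sum_residues hl ![A, B, C, 0, 0])
      simp [mon]; ring
    · refine Eq.trans (Finset.sum_congr rfl fun k _ => ?_) (sum_residues hl ![0, A, B, C, 0])
      simp [mon]; ring
    · refine Eq.trans (Finset.sum_congr rfl fun k _ => ?_) (sum_residues hl ![0, 0, A, B, C])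
      simp [mon]; ring
  have hsum : pairing l (J v) = ∑ k, ((g : Matrix (Fin 2) (Fin 2) ℂ).det /
      tf g (pts l (σ⁻¹ k)) ^ 2 * extv v (σ⁻¹ k) / wt l k) • mon (pts l k) := by
    ext i
    rw [pairing_apply, Finset.sum_apply, Finset.sum_apply, ← sub_eq_zero,
      ← Finset.sum_sub_distrib, ← hres i]
    refine Finset.sum_congr rfl fun k _ => ?_
    rw [hk]
    simp only [Pi.smul_apply, smul_eq_mul]
    ring
  rw [hsum, pairing_apply, ← Equiv.sum_comp σ, ← Matrix.mulVecLin_apply, map_sum,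
    Finset.smul_sum]
  refine Finset.sum_congr rfl fun k _ => ?_
  rw [show σ⁻¹ (σ k) = k from σ.symm_apply_apply k, map_smul, Matrix.mulVecLin_apply, sym2_mon, hp, smul_smul,
    smul_smul]
  congr 1
  have hw := wt_lf hp k
  have h1 := wt_ne hl k
  have h2 := wt_ne hl (σ k)
  have h3 := tf_ne g (pts l k)
  rw [kap]
  generalize (∏ j, tf g (pts l j)) = T at *
  generalize (g : Matrix (Fin 2) (Fin 2) ℂ).det = D at *
  field_simp
  linear_combination (-extv v k) * hw

end SixPoints

end

noncomputable section
namespace SixPoints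
open scoped OnePoint Pointwise
open Matrix

/-! ### The tangent representation -/

theorem g_surjective {m : ℕ} (γ : G m) : ∃ σ, g σ = γ := by
  obtain ⟨_, σ, rfl⟩ := γ
  exact ⟨σ, rfl⟩

theorem g_mul {m : ℕ} (σ τ : Equiv.Perm (Fin 3 ⊕ Fin m)) : g (σ * τ) = g σ * g τ :=
  map_mul _ _ _

theorem mem_stab_iff {m : ℕ} {l : K m} {σ : Equiv.Perm (Fin 3 ⊕ Fin m)} :
    g σ ∈ Stab l ↔ gFun σ l = l := by
  rw [MulAction.mem_stabilizer_iff, Subtype.ext_iff]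
  rfl

/-- An element of `G` as a map of `ℂ^m`, extended by zero outside of `K_n`. -/
def extG {m : ℕ} (γ : G m) (l : Fin m → ℂ) : Fin m → ℂ :=
  open Classical in if h : l ∈ K m then ((γ : Equiv.Perm (K m)) ⟨l, h⟩ : K m) else 0

theorem extG_of_mem {m : ℕ} (γ : G m) (l : K m) :
    extG γ l = ((γ : Equiv.Perm (K m)) l : K m) := by
  simp [extG]

theorem extG_g {m : ℕ} (σ : Equiv.Perm (Fin 3 ⊕ Fin m)) {l : Fin m → ℂ} (hl : l ∈ K m) :
    extG (g σ) l = gFun σ l := extG_of_mem (g σ) ⟨l, hl⟩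

/-- A derivative sees only a germ, and `K m` is open. Derivatives can therefore be attached to
elements of `G`, independently of the permutation representing them. -/
theorem extG_eventuallyEq {m : ℕ} (σ : Equiv.Perm (Fin 3 ⊕ Fin m)) {l : Fin m → ℂ}
    (hl : l ∈ K m) : gFun σ =ᶠ[nhds l] extG (g σ) := by
  filter_upwards [(isOpen_K m).mem_nhds hl] with l hl
  rw [extG_g σ hl]

theorem extG_differentiableAt {m : ℕ} (γ : G m) (l : K m) :
    DifferentiableAt ℂ (extG γ) (l : Fin m → ℂ) := by
  obtain ⟨σ, rfl⟩ := g_surjective γ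
  exact (gFun_differentiableAt l.2 σ).congr_of_eventuallyEq (extG_eventuallyEq σ l.2).symm

/-- The tangent representation. -/
def tangentRep {m : ℕ} (l : K m) : Representation ℂ (Stab l) (Fin m → ℂ) where
  toFun γ := (fderiv ℂ (extG (γ : G m)) (l : Fin m → ℂ)).toLinearMap
  map_one' := by
    have h : extG (1 : G m) =ᶠ[nhds (l : Fin m → ℂ)] id := by
      filter_upwards [(isOpen_K m).mem_nhds l.2] with l' hl'
      exact extG_of_mem 1 ⟨l', hl'⟩
    rw [OneMemClass.coe_one, h.fderiv_eq, fderiv_id]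
    rfl
  -- Multiplicativity is the chain rule at a common fixed point.
  map_mul' γ δ := by
    have hδ : extG (δ : G m) (l : Fin m → ℂ) = l := by
      rw [extG_of_mem]
      exact congrArg Subtype.val δ.2
    have h : extG ((γ * δ : Stab l) : G m) =ᶠ[nhds (l : Fin m → ℂ)]
        extG (γ : G m) ∘ extG (δ : G m) := by
      filter_upwards [(isOpen_K m).mem_nhds l.2] with l' hl'
      rw [Function.comp_apply, extG_of_mem _ ⟨l', hl'⟩, extG_of_mem _ ⟨l', hl'⟩, extG_of_mem]
      rfl
    have hd : DifferentiableAt ℂ (extG (γ : G m)) (extG (δ : G m) (l : Fin m → ℂ)) := by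
      rw [hδ]; exact extG_differentiableAt _ l
    rw [h.fderiv_eq, fderiv_comp _ hd (extG_differentiableAt _ l), hδ]
    rfl

theorem isTangentRep_tangentRep {m : ℕ} (l : K m) : IsTangentRep l (tangentRep l) := by
  intro σ hσ
  have h := (extG_differentiableAt (g σ) l).hasFDerivAt.congr_of_eventuallyEq
    (extG_eventuallyEq σ l.2)
  convert h
  ext v i
  rfl

/-! ### The stabilizer and the group of the six points -/

theorem f_eq_of_perm {m : ℕ} {l : Fin m → ℂ} (hl : l ∈ K m) {F : Equiv.Perm Sphere}
    (hF : F ∈ LFT) {σ : Equiv.Perm (Fin 3 ⊕ Fin m)} (h : ∀ k, F (pts l k) = pts l (σ k)) :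
    f l σ = F := by
  have h' : ∀ k, F (pts l (σ⁻¹ k)) = pts l k := fun k => by
    rw [h, show σ (σ⁻¹ k) = k from σ.apply_symm_apply k]
  obtain ⟨h0, h1, h2⟩ := f_spec hl σ
  have inj : Function.Injective fun k => pts l (σ⁻¹ k) :=
    (pts_injective hl).comp σ⁻¹.injective
  refine eq_of_three (f_mem _ _) hF
    (inj.ne (show (Sum.inl 0 : Fin 3 ⊕ Fin m) ≠ Sum.inl 1 by simp))
    (inj.ne (show (Sum.inl 0 : Fin 3 ⊕ Fin m) ≠ Sum.inl 2 by simp))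
    (inj.ne (show (Sum.inl 1 : Fin 3 ⊕ Fin m) ≠ Sum.inl 2 by simp)) ?_ ?_ ?_
  · exact h0.trans (h' (Sum.inl 0)).symm
  · exact h1.trans (h' (Sum.inl 1)).symm
  · exact h2.trans (h' (Sum.inl 2)).symm

theorem gFun_eq_of_perm {m : ℕ} {l : Fin m → ℂ} (hl : l ∈ K m) {F : Equiv.Perm Sphere}
    (hF : F ∈ LFT) {σ : Equiv.Perm (Fin 3 ⊕ Fin m)} (h : ∀ k, F (pts l k) = pts l (σ k)) :
    gFun σ l = l := by
  apply pts_inj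
  intro i
  rw [pts_gFun hl, f_eq_of_perm hl hF h, h, show ∀ k, σ (σ⁻¹ k) = k from σ.apply_symm_apply]

theorem f_pts_of_stab {m : ℕ} {l : Fin m → ℂ} (hl : l ∈ K m)
    {σ : Equiv.Perm (Fin 3 ⊕ Fin m)} (h : gFun σ l = l) (k : Fin 3 ⊕ Fin m) :
    f l σ (pts l k) = pts l (σ k) := by
  have := pts_gFun hl σ (σ k)
  rw [h] at this
  rw [this, show σ⁻¹ (σ k) = k from σ.symm_apply_apply k]

theorem image_eq_of_mem_A {α : Set Sphere} {h : Equiv.Perm Sphere} (hh : h ∈ A α) :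
    h '' α = α := (mem_A.1 hh).2

theorem apply_mem_of_mem_A {α : Set Sphere} {h : Equiv.Perm Sphere} (hh : h ∈ A α) {z : Sphere}
    (hz : z ∈ α) : h z ∈ α := by
  rw [← image_eq_of_mem_A hh]; exact ⟨z, hz, rfl⟩

section
variable {m : ℕ} {α : Set Sphere} {φ : Equiv.Perm Sphere} {l : K m}

theorem exists_perm (hl : φ '' α = Set.range (pts (l : Fin m → ℂ))) (h : A α) :
    ∃ σ : Equiv.Perm (Fin 3 ⊕ Fin m), ∀ k, (φ * h * φ⁻¹ : Equiv.Perm Sphere)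
      (pts (l : Fin m → ℂ) k) = pts (l : Fin m → ℂ) (σ k) := by
  have hs : ∀ k, ∃ j, pts (l : Fin m → ℂ) j =
      (φ * h * φ⁻¹ : Equiv.Perm Sphere) (pts (l : Fin m → ℂ) k) := by
    intro k
    have hk : pts (l : Fin m → ℂ) k ∈ φ '' α := by rw [hl]; exact ⟨k, rfl⟩
    obtain ⟨z, hz, e⟩ := hk
    have : (φ * h * φ⁻¹ : Equiv.Perm Sphere) (pts (l : Fin m → ℂ) k) ∈ φ '' α := by
      rw [← e]
      refine ⟨h.1 z, apply_mem_of_mem_A h.2 hz, ?_⟩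
      simp
    rw [hl] at this
    exact this
  choose s hs using hs
  have inj : Function.Injective s := by
    intro i j e
    have := (hs i).symm.trans ((congrArg _ e).trans (hs j))
    exact pts_injective l.2 ((φ * h * φ⁻¹ : Equiv.Perm Sphere).injective this)
  exact ⟨Equiv.ofBijective s (Finite.injective_iff_bijective.1 inj), fun k => (hs k).symm⟩

theorem perm_unique (l : K m) {F : Equiv.Perm Sphere} {σ τ : Equiv.Perm (Fin 3 ⊕ Fin m)}
    (h : ∀ k, F (pts (l : Fin m → ℂ) k) = pts (l : Fin m → ℂ) (σ k))
    (h' : ∀ k, F (pts (l : Fin m → ℂ) k) = pts (l : Fin m → ℂ) (τ k)) : σ = τ := by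
  ext1 k
  exact pts_injective l.2 ((h k).symm.trans (h' k))

theorem conj_mem_LFT (hφ : φ ∈ LFT) (h : A α) : (φ * h * φ⁻¹ : Equiv.Perm Sphere) ∈ LFT :=
  mul_mem (mul_mem hφ h.2.1) (inv_mem hφ)

/-- The homomorphism from `𝒜_α` to `G_l` determined by a coordinate in which `α` consists of
the points `0, 1, ∞, l`. -/
def toStab (hφ : φ ∈ LFT) (hl : φ '' α = Set.range (pts (l : Fin m → ℂ))) : A α →* Stab l :=
  MonoidHom.mk' (fun h => ⟨g (exists_perm hl h).choose,
      mem_stab_iff.2 (gFun_eq_of_perm l.2 (conj_mem_LFT hφ h) (exists_perm hl h).choose_spec)⟩)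
    (by
      intro h h'
      refine Subtype.ext ?_
      change g _ = g _ * g _
      rw [← g_mul]
      congr 1
      refine perm_unique l (exists_perm hl (h * h')).choose_spec fun k => ?_
      refine Eq.trans ?_ ((exists_perm hl h).choose_spec ((exists_perm hl h').choose k))
      rw [← (exists_perm hl h').choose_spec k]
      simp)

theorem toStab_spec (hφ : φ ∈ LFT) (hl : φ '' α = Set.range (pts (l : Fin m → ℂ))) (h : A α) :
    ∃ σ, (toStab hφ hl h : G m) = g σ ∧ f (l : Fin m → ℂ) σ = φ * h * φ⁻¹ ∧ gFun σ l = l :=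
  ⟨(exists_perm hl h).choose, rfl,
    f_eq_of_perm l.2 (conj_mem_LFT hφ h) (exists_perm hl h).choose_spec,
    gFun_eq_of_perm l.2 (conj_mem_LFT hφ h) (exists_perm hl h).choose_spec⟩

theorem toStab_surj (hφ : φ ∈ LFT) (hl : φ '' α = Set.range (pts (l : Fin m → ℂ)))
    {σ : Equiv.Perm (Fin 3 ⊕ Fin m)} (hσ : g σ ∈ Stab l) :
    ∃ h : A α, toStab hφ hl h = ⟨g σ, hσ⟩ ∧ f (l : Fin m → ℂ) σ = φ * h * φ⁻¹ := by
  have hf := f_pts_of_stab l.2 (mem_stab_iff.1 hσ)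
  have himg : f (l : Fin m → ℂ) σ '' Set.range (pts (l : Fin m → ℂ)) =
      Set.range (pts (l : Fin m → ℂ)) := by
    rw [← Set.range_comp]
    have : (f (l : Fin m → ℂ) σ) ∘ pts (l : Fin m → ℂ) = pts (l : Fin m → ℂ) ∘ σ := funext hf
    rw [this, Set.range_comp, σ.surjective.range_eq, Set.image_univ]
  have hmem : φ⁻¹ * f (l : Fin m → ℂ) σ * φ ∈ A α := by
    refine mem_A.2 ⟨mul_mem (mul_mem (inv_mem hφ) (f_mem _ _)) hφ, ?_⟩
    rw [Equiv.Perm.coe_mul, Equiv.Perm.coe_mul, Set.image_comp, Set.image_comp, hl, himg, ← hl,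
      ← Set.image_comp, ← Equiv.Perm.coe_mul, inv_mul_cancel]
    simp
  have e : φ * (φ⁻¹ * f (l : Fin m → ℂ) σ * φ) * φ⁻¹ = f (l : Fin m → ℂ) σ := by group
  refine ⟨⟨_, hmem⟩, Subtype.ext ?_, e.symm⟩
  change g _ = g _
  congr 1
  refine perm_unique l (exists_perm hl ⟨_, hmem⟩).choose_spec fun k => ?_
  rw [← hf]
  exact congrFun (congrArg _ e) _

end

section
variable {α : Set Sphere} {φ : Equiv.Perm Sphere} {l : K 3}

/-- The corner entries of `sym2 g` are squares of the off-diagonal entries of `g` and force these to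
vanish. Comparing the first two diagonal entries then makes `g` scalar. -/
theorem sym2_scalar {g : GL (Fin 2) ℂ} {k : ℂ} (h : ∀ v, k • sym2 g *ᵥ v = v) :
    lf g = 1 := by
  have h0 := h ![1, 0, 0]
  have h1 := h ![0, 1, 0]
  have h2 := h ![0, 0, 1]
  have e00 := congrFun h0 0
  have e10 := congrFun h0 2
  have e11 := congrFun h1 1
  have e22 := congrFun h2 2
  have e02 := congrFun h2 0
  simp [sym2] at e00 e10 e11 e22 e02
  have hk : k ≠ 0 := by rintro rfl; simp at e00
  have h10 : g 1 0 = 0 := e10.resolve_left hk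
  have h01 : g 0 1 = 0 := e02.resolve_left hk
  rw [h01, h10] at e11
  refine lf_eq_one.2 ⟨h01, h10, ?_⟩
  have : g 0 0 ≠ 0 := by rintro h; simp [h] at e00
  apply mul_left_cancel₀ (mul_ne_zero hk this)
  linear_combination e00 - e11

/-- Injectivity is the substantial half: different transformations must induce different maps `g_σ`.
If the induced map is the identity, so is its derivative; then `sym2` of the matrix is a scalar and
the transformation is the identity. -/
theorem toStab_bijective (hφ : φ ∈ LFT) (hl : φ '' α = Set.range (pts (l : Fin 3 → ℂ))) :
    Function.Bijective (toStab hφ hl) := by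
  constructor
  · rw [injective_iff_map_eq_one]
    intro h hh
    obtain ⟨σ, h1, h2, h3⟩ := toStab_spec hφ hl h
    obtain ⟨M, hM⟩ := exists_lf (f_mem (l : Fin 3 → ℂ) σ)
    have hσ := mem_stab_iff.2 h3
    have hd := isTangentRep_tangentRep l σ hσ
    have e : (⟨g σ, hσ⟩ : Stab l) = 1 := by
      rw [← hh]; exact Subtype.ext h1.symm
    rw [e, map_one] at hd
    have hp := pairing_deriv l.2 h3 hd hM
    have hs : Function.Surjective (pairing (l : Fin 3 → ℂ)) :=
      LinearMap.injective_iff_surjective.1 (pairing_injective l.2)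
    have h1' : lf M = 1 := by
      apply sym2_scalar (k := kap (pts (l : Fin 3 → ℂ)) M)
      intro v
      obtain ⟨u, rfl⟩ := hs v
      exact (hp u).symm
    rw [hM, h2] at h1'
    exact Subtype.ext (conj_eq_one_iff.1 h1')
  · rintro ⟨γ, hγ⟩
    obtain ⟨σ, rfl⟩ := g_surjective γ
    obtain ⟨h, hh, -⟩ := toStab_surj hφ hl hγ
    exact ⟨h, hh⟩

/-- `𝒜_α` is isomorphic to the stabilizer. -/
def stabEquiv (hφ : φ ∈ LFT) (hl : φ '' α = Set.range (pts (l : Fin 3 → ℂ))) : A α ≃* Stab l :=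
  MulEquiv.ofBijective _ (toStab_bijective hφ hl)

theorem f_eq_stabEquiv (hφ : φ ∈ LFT) (hl : φ '' α = Set.range (pts (l : Fin 3 → ℂ)))
    {σ : Equiv.Perm (Fin 3 ⊕ Fin 3)} (hσ : g σ ∈ Stab l) :
    f (l : Fin 3 → ℂ) σ = φ * (stabEquiv hφ hl).symm ⟨g σ, hσ⟩ * φ⁻¹ := by
  obtain ⟨h, hh, e⟩ := toStab_surj hφ hl hσ
  rw [e, ← hh]
  congr 2
  exact congrArg Subtype.val ((stabEquiv hφ hl).symm_apply_apply h).symm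

/-- The matrix `N` contributes the factors `tf N` at `b (σ i)` and the inverse factors at `b i`;
their products cancel because `σ` is a permutation. -/
theorem kap_conj {ι : Type*} [Fintype ι] (b : ι → Sphere) (N M : GL (Fin 2) ℂ)
    (σ : Equiv.Perm ι) (h : ∀ i, lf M (b i) = b (σ i)) :
    kap (fun i => lf N (b i)) (N * M * N⁻¹) = kap b M := by
  have hi : ∀ i, tf (N * M * N⁻¹) (lf N (b i)) * tf N (b i) = tf N (b (σ i)) * tf M (b i) := by
    intro i
    rw [← tf_mul, inv_mul_cancel_right, tf_mul, h]
  have hprod : (∏ i, tf (N * M * N⁻¹) (lf N (b i))) = ∏ i, tf M (b i) := by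
    have hN : (∏ i, tf N (b i)) ≠ 0 := Finset.prod_ne_zero_iff.2 fun i _ => tf_ne _ _
    apply mul_right_cancel₀ hN
    rw [← Finset.prod_mul_distrib, Finset.prod_congr rfl fun i _ => hi i,
      Finset.prod_mul_distrib, Equiv.prod_comp σ fun i => tf N (b i), mul_comm]
  have hdet : (N * M * N⁻¹ : GL (Fin 2) ℂ).val.det = M.val.det := by
    rw [Units.val_mul, Units.val_mul, Matrix.det_mul, Matrix.det_mul, mul_right_comm,
      ← Matrix.det_mul, ← Units.val_mul, mul_inv_cancel]
    simp
  rw [kap, kap, hprod, hdet]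

theorem kap_range {ι κ : Type*} [Fintype ι] [Fintype κ] {b : ι → Sphere} {c : κ → Sphere}
    (hb : Function.Injective b) (hc : Function.Injective c) (h : Set.range b = Set.range c)
    (M : GL (Fin 2) ℂ) : kap b M = kap c M := by
  let e : ι ≃ κ := (Equiv.ofInjective b hb).trans
    ((Equiv.setCongr h).trans (Equiv.ofInjective c hc).symm)
  have he : ∀ i, c (e i) = b i := fun i =>
    congrArg Subtype.val ((Equiv.ofInjective c hc).apply_symm_apply _)
  rw [kap, kap, ← Equiv.prod_comp e]
  simp only [he]

theorem ncard_of_normalized (hl : φ '' α = Set.range (pts (l : Fin 3 → ℂ))) : α.ncard = 6 := by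
  have h := Set.ncard_image_of_injective α φ.injective
  rw [hl, ← Set.image_univ, Set.ncard_image_of_injective _ (pts_injective l.2), Set.ncard_univ,
    Nat.card_eq_fintype_card] at h
  exact h.symm

theorem injective_of_range_ncard {S : Set Sphere} {b : Fin 6 → Sphere} (hb : Set.range b = S)
    (hS : S.ncard = 6) : Function.Injective b := by
  have h : Set.InjOn b Set.univ := by
    refine Set.injOn_of_ncard_image_eq ?_ Set.finite_univ
    rw [Set.image_univ, hb, hS, Set.ncard_univ, Nat.card_fin]
  exact Set.injOn_univ.1 h

theorem pairing_tangentRep (hφ : φ ∈ LFT) (hl : φ '' α = Set.range (pts (l : Fin 3 → ℂ)))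
    (h : A α) {M : GL (Fin 2) ℂ} (hM : lf M = φ * h * φ⁻¹) (v : Fin 3 → ℂ) :
    pairing l (tangentRep l (stabEquiv hφ hl h) v) =
      kap (pts (l : Fin 3 → ℂ)) M • sym2 M *ᵥ pairing l v := by
  obtain ⟨σ, h1, h2, h3⟩ := toStab_spec hφ hl h
  have hσ := mem_stab_iff.2 h3
  have hd := isTangentRep_tangentRep l σ hσ
  have e : (⟨g σ, hσ⟩ : Stab l) = stabEquiv hφ hl h := Subtype.ext h1.symm
  rw [e] at hd
  exact pairing_deriv l.2 h3 hd (hM.trans h2.symm) v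

/-- The tangent representation in a coordinate `ψ` is the action on binary quadratic forms
twisted by a scalar. -/
theorem exists_coordinates (hφ : φ ∈ LFT) (hl : φ '' α = Set.range (pts (l : Fin 3 → ℂ)))
    {ψ : Equiv.Perm Sphere} (hψ : ψ ∈ LFT) {b : Fin 6 → Sphere} (hb : Set.range b = ψ '' α) :
    ∃ L : (Fin 3 → ℂ) ≃ₗ[ℂ] (Fin 3 → ℂ), ∀ (h : A α) (M : GL (Fin 2) ℂ),
      lf M = ψ * h * ψ⁻¹ → ∀ v, L (tangentRep l (stabEquiv hφ hl h) v) =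
        kap b M • sym2 M *ᵥ L v := by
  obtain ⟨N, hN⟩ := exists_lf (mul_mem hψ (inv_mem hφ))
  have hinj : Function.Injective (sym2 N).mulVecLin := by
    refine Function.LeftInverse.injective (g := (sym2 (N⁻¹ : GL (Fin 2) ℂ)).mulVecLin) fun v => ?_
    rw [Matrix.mulVecLin_apply, Matrix.mulVecLin_apply, Matrix.mulVec_mulVec, ← sym2_mul,
      ← Units.val_mul, inv_mul_cancel, Units.val_one, sym2_one, Matrix.one_mulVec]
  have hinj' : Function.Injective ((sym2 N).mulVecLin ∘ₗ pairing l) := by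
    rw [LinearMap.coe_comp]
    exact hinj.comp (pairing_injective l.2)
  -- The coordinates are the pairing followed by the change of monomials from the coordinate `φ` to
  -- `ψ`, with `N` a matrix of `ψ φ⁻¹`. Invariance of `kap` under conjugation and reindexing
  -- finishes the comparison.
  refine ⟨LinearEquiv.ofInjectiveEndo _ hinj', fun h M hM v => ?_⟩
  have hM' : lf (N⁻¹ * M * N) = φ * h * φ⁻¹ := by
    rw [map_mul, map_mul, map_inv, hN, hM]; group
  have hp := pairing_tangentRep hφ hl h hM' v
  have hconj : N * (N⁻¹ * M * N) = M * N := by group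
  have hk : kap b M = kap (pts (l : Fin 3 → ℂ)) (N⁻¹ * M * N) := by
    obtain ⟨σ, hσ⟩ := exists_perm hl h
    rw [← kap_conj _ N _ σ (fun k => by rw [hM', hσ]), hconj, mul_inv_cancel_right]
    have hS : (ψ '' α).ncard = 6 := by
      rw [Set.ncard_image_of_injective _ ψ.injective, ncard_of_normalized hl]
    refine kap_range (injective_of_range_ncard hb hS) ((lf N).injective.comp
      (pts_injective l.2)) ?_ M
    rw [hb, Set.range_comp, ← hl, hN, ← Set.image_comp]
    congr 1
    ext z
    simp
  rw [LinearEquiv.coe_ofInjectiveEndo, LinearMap.comp_apply, LinearMap.comp_apply, hp, hk,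
    Matrix.mulVecLin_apply, Matrix.mulVecLin_apply, Matrix.mulVec_smul, Matrix.mulVec_mulVec,
    Matrix.mulVec_mulVec, ← sym2_mul, ← sym2_mul, ← Units.val_mul, ← Units.val_mul, hconj]

end

end SixPoints

end

noncomputable section
namespace SixPoints
open scoped OnePoint Pointwise
open Matrix

/-! ### Decomposing the tangent representation -/

/-- The representation of a homomorphism into matrices. -/
def matRep {Γ : Type*} [Group Γ] {d : ℕ} (ρ : Γ →* Matrix (Fin d) (Fin d) ℂ) :
    Representation ℂ Γ (Fin d → ℂ) :=
  (Matrix.toLinAlgEquiv' (R := ℂ) (n := Fin d) : _ →* _).comp ρ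

theorem matRep_apply {Γ : Type*} [Group Γ] {d : ℕ} (ρ : Γ →* Matrix (Fin d) (Fin d) ℂ) (x : Γ)
    (v : Fin d → ℂ) : matRep ρ x v = ρ x *ᵥ v := rfl

theorem matRep_character {Γ : Type*} [Group Γ] {d : ℕ} (ρ : Γ →* Matrix (Fin d) (Fin d) ℂ)
    (x : Γ) : (matRep ρ).character x = (ρ x).trace := by
  change LinearMap.trace ℂ _ (Matrix.toLin' (ρ x)) = _
  rw [Matrix.trace_toLin'_eq]

theorem isIrreducible_of_forall {Γ : Type*} [Group Γ] {d : ℕ} [NeZero d]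
    (X : Representation ℂ Γ (Fin d → ℂ))
    (h : ∀ S : Subrepresentation X, S.toSubmodule ≠ ⊥ → S.toSubmodule = ⊤) :
    X.IsIrreducible := by
  have : Nontrivial (Subrepresentation X) := by
    refine ⟨⊥, ⊤, fun e => ?_⟩
    have e' : (⊥ : Submodule ℂ (Fin d → ℂ)) = ⊤ := congrArg Subrepresentation.toSubmodule e
    exact bot_ne_top e'
  constructor
  intro S
  by_cases hS : S.toSubmodule = ⊥
  · exact Or.inl (Subrepresentation.toSubmodule_injective hS)
  · exact Or.inr (Subrepresentation.toSubmodule_injective (h S hS))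

theorem isIrreducible_one {Γ : Type*} [Group Γ] (X : Representation ℂ Γ (Fin 1 → ℂ)) :
    X.IsIrreducible := by
  refine isIrreducible_of_forall X fun S hS => ?_
  have h := Submodule.one_le_finrank_iff.2 hS
  refine Submodule.eq_top_of_finrank_eq (le_antisymm (Submodule.finrank_le _) ?_)
  rw [Module.finrank_fin_fun]
  exact h

/-- A proper nonzero invariant subspace would be a line of common eigenvectors. The commutator kills
that line, so its determinant would vanish. -/
theorem isIrreducible_two {Γ : Type*} [Group Γ] (ρ : Γ →* Matrix (Fin 2) (Fin 2) ℂ) {x y : Γ}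
    (h : (ρ x * ρ y - ρ y * ρ x).det ≠ 0) : (matRep ρ).IsIrreducible := by
  refine isIrreducible_of_forall _ fun S hS => ?_
  have h1 := Submodule.one_le_finrank_iff.2 hS
  have h2 := Submodule.finrank_le S.toSubmodule
  rw [Module.finrank_fin_fun] at h2
  by_cases hr : Module.finrank ℂ S.toSubmodule = 1
  · exfalso
    obtain ⟨v, hv0, hv⟩ := finrank_eq_one_iff'.1 hr
    have ex : ∀ x, ∃ c : ℂ, ρ x *ᵥ (v : Fin 2 → ℂ) = c • (v : Fin 2 → ℂ) := by
      intro x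
      obtain ⟨c, hc⟩ := hv ⟨_, S.apply_mem_toSubmodule x v.2⟩
      exact ⟨c, (congrArg Subtype.val hc).symm⟩
    obtain ⟨a, ha⟩ := ex x
    obtain ⟨b, hb⟩ := ex y
    apply h
    rw [← Matrix.exists_mulVec_eq_zero_iff]
    refine ⟨v, fun e => hv0 (Subtype.ext e), ?_⟩
    rw [Matrix.sub_mulVec, ← Matrix.mulVec_mulVec, ← Matrix.mulVec_mulVec, ha, hb,
      Matrix.mulVec_smul, Matrix.mulVec_smul, ha, hb, smul_smul, smul_smul, mul_comm, sub_self]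
  · refine Submodule.eq_top_of_finrank_eq ?_
    rw [Module.finrank_fin_fun]
    omega

theorem isIrreducible_comp {Γ Δ : Type*} [Group Γ] [Group Δ] {d : ℕ}
    {X : Representation ℂ Γ (Fin d → ℂ)} (hX : X.IsIrreducible) (e : Δ ≃* Γ) :
    Representation.IsIrreducible (X.comp e.toMonoidHom) := by
  have : NeZero d := by
    refine ⟨fun h0 => ?_⟩
    obtain ⟨S, S', hne⟩ := hX.toNontrivial
    apply hne
    apply Subrepresentation.toSubmodule_injective
    have : Subsingleton (Fin d → ℂ) := by rw [h0]; infer_instance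
    exact Subsingleton.elim _ _
  refine isIrreducible_of_forall _ fun S hS => ?_
  let S' : Subrepresentation X := ⟨S.toSubmodule, fun h v hv => by
    have := S.apply_mem_toSubmodule (e.symm h) hv
    simpa using this⟩
  rcases hX.eq_bot_or_eq_top S' with h | h
  · exact absurd (congrArg Subrepresentation.toSubmodule h) hS
  · exact congrArg Subrepresentation.toSubmodule h

/-- Intertwining maps with spanning ranges give a surjection from the direct sum, and equality of
dimensions makes it bijective. Directness of the sum need not be checked separately. -/
theorem nonempty_equiv_directSum {Γ ι : Type*} [Group Γ] [Fintype ι] [DecidableEq ι] {n : ℕ}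
    (R : Representation ℂ Γ (Fin n → ℂ)) {d : ι → ℕ}
    (X : ∀ i, Representation ℂ Γ (Fin (d i) → ℂ))
    (J : ∀ i, (Fin (d i) → ℂ) →ₗ[ℂ] (Fin n → ℂ)) (hJ : ∀ i x v, J i (X i x v) = R x (J i v))
    (hspan : ⨆ i, LinearMap.range (J i) = ⊤) (hdim : ∑ i, d i = n) :
    Nonempty (R.Equiv (Representation.directSum X)) := by
  let F : (DirectSum ι fun i => Fin (d i) → ℂ) →ₗ[ℂ] (Fin n → ℂ) := DirectSum.toModule ℂ _ _ J
  have h2 : ∀ i w, F (DirectSum.lof ℂ ι (fun i => Fin (d i) → ℂ) i w) = J i w :=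
    fun i w => by exact DirectSum.toModule_lof ℂ (M := fun i => Fin (d i) → ℂ) (φ := J) i w
  have hF : ∀ x v, F (Representation.directSum X x v) = R x (F v) := by
    intro x
    have : F ∘ₗ Representation.directSum X x = R x ∘ₗ F := by
      refine DirectSum.linearMap_ext ℂ fun i => LinearMap.ext fun v => ?_
      have h1 : Representation.directSum X x (DirectSum.lof ℂ ι (fun i => Fin (d i) → ℂ) i v) =
          DirectSum.lof ℂ ι (fun i => Fin (d i) → ℂ) i (X i x v) := DirectSum.lmap_lof _ _ _
      change F (Representation.directSum X x (DirectSum.lof ℂ ι _ i v)) =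
        R x (F (DirectSum.lof ℂ ι _ i v))
      rw [h1, h2, h2, hJ]
    exact fun v => LinearMap.congr_fun this v
  have hsurj : Function.Surjective F := by
    rw [← LinearMap.range_eq_top, eq_top_iff, ← hspan, iSup_le_iff]
    rintro i _ ⟨v, rfl⟩
    exact ⟨_, h2 i v⟩
  have hfr : Module.finrank ℂ (DirectSum ι fun i => Fin (d i) → ℂ) =
      Module.finrank ℂ (Fin n → ℂ) := by
    rw [Module.finrank_directSum, Module.finrank_fin_fun, ← hdim]
    simp
  have hbij : Function.Bijective F :=
    ⟨(LinearMap.injective_iff_surjective_of_finrank_eq_finrank hfr).2 hsurj, hsurj⟩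
  let F' : Representation.IntertwiningMap (Representation.directSum X) R :=
    LinearMap.intertwiningMap_of_isIntertwiningMap _ _ F hF
  exact ⟨(F'.ofBijective hbij).symm⟩

section
variable {α : Set Sphere} {φ : Equiv.Perm Sphere} {l : K 3}

/-- Moves the data from `A α`, where the classes live, to the stabilizer along `stabEquiv`. -/
theorem hasMultiplicities_of (hφ : φ ∈ LFT) (hl : φ '' α = Set.range (pts (l : Fin 3 → ℂ)))
    {k : ℕ} {C : Fin k → Set (Equiv.Perm Sphere)} {T : Matrix (Fin k) (Fin k) ℂ} {p : Fin k → ℕ}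
    (hC : ∀ h : A α, ∃! j, (h : Equiv.Perm Sphere) ∈ C j) (d : Fin k → ℕ)
    (X : ∀ i, Representation ℂ (A α) (Fin (d i) → ℂ)) (hX : ∀ i, (X i).IsIrreducible)
    (hT : ∀ i j (h : A α), (h : Equiv.Perm Sphere) ∈ C j → (X i).character h = T i j)
    (J : ∀ s : (Σ i, Fin (p i)), (Fin (d s.1) → ℂ) →ₗ[ℂ] (Fin 3 → ℂ))
    (hJ : ∀ s (h : A α) v, J s (X s.1 h v) = tangentRep l (stabEquiv hφ hl h) (J s v))
    (hspan : ⨆ s, LinearMap.range (J s) = ⊤) (hdim : ∑ i, p i * d i = 3) :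
    HasMultiplicities l (fun j => {h | φ⁻¹ * h * φ ∈ C j}) T p := by
  set e := stabEquiv hφ hl with he
  have hf : ∀ σ (hσ : g σ ∈ Stab l), φ⁻¹ * f (l : Fin 3 → ℂ) σ * φ = e.symm ⟨g σ, hσ⟩ := by
    intro σ hσ
    rw [f_eq_stabEquiv hφ hl hσ]
    group
    rfl
  refine ⟨fun σ hσ => ?_, tangentRep l, isTangentRep_tangentRep l, d,
    fun i => (X i).comp e.symm.toMonoidHom, fun i => ?_, fun i j σ hσ hm => ?_, ?_⟩
  · simp only [Set.mem_ofPred_eq]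
    rw [hf σ hσ]
    exact hC _
  · exact isIrreducible_comp (hX i) e.symm
  · have hm' : φ⁻¹ * f (l : Fin 3 → ℂ) σ * φ ∈ C j := hm
    rw [hf σ hσ] at hm'
    exact hT i j _ hm'
  · refine nonempty_equiv_directSum (tangentRep l)
      (fun s : (Σ i, Fin (p i)) => (X s.1).comp e.symm.toMonoidHom) J (fun s γ v => ?_) hspan ?_
    · have := hJ s (e.symm γ) v
      rwa [e.apply_symm_apply] at this
    · rw [← hdim, Fintype.sum_sigma]
      simp

/-- The multiplicity vector from explicit matrices, in a coordinate `ψ`. -/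
theorem hasMultiplicityVector_of {Γ : Type*} [Group Γ] (E : Γ ≃* A α)
    {ψ : Equiv.Perm Sphere} (hψ : ψ ∈ LFT) {b : Fin 6 → Sphere} (hb : Set.range b = ψ '' α)
    (M : Γ → GL (Fin 2) ℂ) (hM : ∀ x, lf (M x) = ψ * E x * ψ⁻¹)
    {k : ℕ} {C : Fin k → Set (Equiv.Perm Sphere)} {T : Matrix (Fin k) (Fin k) ℂ} {p : Fin k → ℕ}
    (hC : ∀ x, ∃! j, (E x : Equiv.Perm Sphere) ∈ C j) (d : Fin k → ℕ)
    (ρ : ∀ i, Γ →* Matrix (Fin (d i)) (Fin (d i)) ℂ) (hρ : ∀ i, (matRep (ρ i)).IsIrreducible)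
    (hT : ∀ i j x, (E x : Equiv.Perm Sphere) ∈ C j → (ρ i x).trace = T i j)
    (P : ∀ i, Fin (p i) → Matrix (Fin 3) (Fin (d i)) ℂ)
    (hP : ∀ i s x, P i s * ρ i x = kap b (M x) • sym2 (M x) * P i s)
    (hspan : ∀ j : Fin 3, (Pi.single j 1 : Fin 3 → ℂ) ∈
      ⨆ s : (Σ i, Fin (p i)), LinearMap.range (P s.1 s.2).mulVecLin)
    (hdim : ∑ i, p i * d i = 3) : HasMultiplicityVector α C T p := by
  intro l φ hφ hl
  obtain ⟨L, hL⟩ := exists_coordinates hφ hl hψ hb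
  have hirr : ∀ i, (matRep ((ρ i).comp E.symm.toMonoidHom)).IsIrreducible :=
    fun i => isIrreducible_comp (hρ i) E.symm
  refine hasMultiplicities_of hφ hl (fun h => ?_) d
    (fun i => matRep ((ρ i).comp E.symm.toMonoidHom)) hirr (fun i j h hh => ?_)
    -- The columns `P` describe the summands in the basis of quadratic monomials; `L.symm` brings
    -- them back to the tangent space.
    (fun s => L.symm.toLinearMap ∘ₗ (P s.1 s.2).mulVecLin) (fun s h v => ?_) ?_ hdim
  · have := hC (E.symm h)
    rwa [E.apply_symm_apply] at this
  · rw [matRep_character]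
    exact hT i j (E.symm h) (by rwa [E.apply_symm_apply])
  · have h1 := hL h (M (E.symm h)) (by rw [hM, E.apply_symm_apply])
    apply L.injective
    rw [h1]
    simp only [LinearMap.comp_apply, LinearEquiv.coe_coe, LinearEquiv.apply_symm_apply,
      Matrix.mulVecLin_apply, matRep_apply, Matrix.mulVec_mulVec]
    have h2 := hP s.1 s.2 (E.symm h)
    rw [Matrix.smul_mul] at h2
    rw [← Matrix.smul_mulVec, ← h2]
    rfl
  · have h1 : (⨆ s : (Σ i, Fin (p i)), LinearMap.range (P s.1 s.2).mulVecLin) = ⊤ := by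
      rw [eq_top_iff]
      intro v _
      rw [pi_eq_sum_univ' v]
      refine Submodule.sum_mem _ fun i _ => Submodule.smul_mem _ _ ?_
      exact hspan i
    simp only [LinearMap.range_comp]
    rw [← Submodule.map_iSup, h1, Submodule.map_top, LinearEquiv.range]

end

end SixPoints

end

noncomputable section
namespace SixPoints
open scoped OnePoint Pointwise
open Matrix

/-! ### Rotations and inversions -/

theorem rot_eq_lf {c : ℂ} (hc : c ≠ 0) : rot c = lf (gl c 0 0 1 (by simpa)) := mob_eq_lf _

theorem inv_eq_lf {c : ℂ} (hc : c ≠ 0) : inv c = lf (gl 0 c 1 0 (by simpa)) := mob_eq_lf _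

theorem rot_mem (c : ℂ) : rot c ∈ LFT := mob_mem _ _ _ _

theorem inv_mem_LFT (c : ℂ) : inv c ∈ LFT := mob_mem _ _ _ _

@[simp] theorem rot_coe {c : ℂ} (hc : c ≠ 0) (z : ℂ) : rot c (z : Sphere) = ((c * z : ℂ) : Sphere) := by
  rw [rot, mob_apply (by simpa)]
  simp [hc_coe]

@[simp] theorem rot_infty {c : ℂ} (hc : c ≠ 0) : rot c ∞ = ∞ := by
  rw [rot, mob_apply (by simpa)]
  simp [hc_infty]

theorem inv_coe {c z : ℂ} (hc : c ≠ 0) (hz : z ≠ 0) : inv c (z : Sphere) = ((c / z : ℂ) : Sphere) := by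
  rw [inv, mob_apply (by simpa)]
  simp [hc_coe, hz]

theorem inv_zero {c : ℂ} (hc : c ≠ 0) : inv c ((0 : ℂ) : Sphere) = ∞ := by
  rw [inv, mob_apply (by simpa)]
  simp [hc_coe]

theorem inv_infty {c : ℂ} (hc : c ≠ 0) : inv c ∞ = ((0 : ℂ) : Sphere) := by
  rw [inv, mob_apply (by simpa)]
  simp [hc_infty]

theorem sphere_cases (z : Sphere) : z = ((0 : ℂ) : Sphere) ∨ z = ∞ ∨ ∃ w : ℂ, w ≠ 0 ∧ z = w := by
  cases z using OnePoint.rec with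
  | infty => exact Or.inr (Or.inl rfl)
  | coe z =>
    by_cases h : z = 0
    · exact Or.inl (by rw [h])
    · exact Or.inr (Or.inr ⟨z, h, rfl⟩)

theorem rot_mul_rot {a b : ℂ} (ha : a ≠ 0) (hb : b ≠ 0) : rot a * rot b = rot (a * b) := by
  have hab := mul_ne_zero ha hb
  ext z
  rw [Equiv.Perm.mul_apply]
  cases z using OnePoint.rec with
  | infty => rw [rot_infty hb, rot_infty ha, rot_infty hab]
  | coe z => rw [rot_coe hb, rot_coe ha, rot_coe hab, mul_assoc]

theorem rot_one : rot 1 = 1 := by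
  ext z
  cases z using OnePoint.rec with
  | infty => rw [rot_infty one_ne_zero]; rfl
  | coe z => rw [rot_coe one_ne_zero, one_mul]; rfl

theorem rot_inv {a : ℂ} (ha : a ≠ 0) : (rot a)⁻¹ = rot a⁻¹ := by
  rw [inv_eq_iff_mul_eq_one, rot_mul_rot ha (inv_ne_zero ha), mul_inv_cancel₀ ha, rot_one]

theorem rot_pow {a : ℂ} (ha : a ≠ 0) (n : ℕ) : rot a ^ n = rot (a ^ n) := by
  induction n with
  | zero => rw [pow_zero, pow_zero, rot_one]
  | succ n ih => rw [pow_succ, ih, rot_mul_rot (pow_ne_zero _ ha) ha, pow_succ]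

theorem rot_mul_inv {a b : ℂ} (ha : a ≠ 0) (hb : b ≠ 0) : rot a * inv b = inv (a * b) := by
  have hab := mul_ne_zero ha hb
  ext z
  rw [Equiv.Perm.mul_apply]
  obtain rfl | rfl | ⟨z, hz, rfl⟩ := sphere_cases z
  · rw [inv_zero hb, inv_zero hab, rot_infty ha]
  · rw [inv_infty hb, inv_infty hab, rot_coe ha, mul_zero]
  · rw [inv_coe hb hz, inv_coe hab hz, rot_coe ha, mul_div_assoc]

theorem inv_mul_rot {a b : ℂ} (ha : a ≠ 0) (hb : b ≠ 0) : inv a * rot b = inv (a / b) := by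
  have hab := div_ne_zero ha hb
  ext z
  rw [Equiv.Perm.mul_apply]
  obtain rfl | rfl | ⟨z, hz, rfl⟩ := sphere_cases z
  · rw [rot_coe hb, mul_zero, inv_zero ha, inv_zero hab]
  · rw [rot_infty hb, inv_infty ha, inv_infty hab]
  · rw [rot_coe hb, inv_coe ha (mul_ne_zero hb hz), inv_coe hab hz, div_div]

theorem inv_mul_inv {a b : ℂ} (ha : a ≠ 0) (hb : b ≠ 0) : inv a * inv b = rot (a / b) := by
  have hab := div_ne_zero ha hb
  ext z
  rw [Equiv.Perm.mul_apply]
  obtain rfl | rfl | ⟨z, hz, rfl⟩ := sphere_cases z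
  · rw [inv_zero hb, inv_infty ha, rot_coe hab, mul_zero]
  · rw [inv_infty hb, inv_zero ha, rot_infty hab]
  · rw [inv_coe hb hz, inv_coe ha (div_ne_zero hb hz), rot_coe hab]
    congr 1
    field_simp

theorem inv_inv_LFT {a : ℂ} (ha : a ≠ 0) : (inv a)⁻¹ = inv a := by
  rw [inv_eq_iff_mul_eq_one, inv_mul_inv ha ha, div_self ha, rot_one]

theorem rot_injective {a b : ℂ} (ha : a ≠ 0) (hb : b ≠ 0) (h : rot a = rot b) : a = b := by
  have := congrFun (congrArg DFunLike.coe h) ((1 : ℂ) : Sphere)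
  simpa [rot_coe ha, rot_coe hb] using this

theorem inv_injective_LFT {a b : ℂ} (ha : a ≠ 0) (hb : b ≠ 0) (h : inv a = inv b) : a = b := by
  have := congrFun (congrArg DFunLike.coe h) ((1 : ℂ) : Sphere)
  simpa [inv_coe ha, inv_coe hb] using this

theorem rot_ne_inv {a b : ℂ} (ha : a ≠ 0) (hb : b ≠ 0) : rot a ≠ inv b := by
  intro h
  have := congrFun (congrArg DFunLike.coe h) ∞
  simp [rot_infty ha, inv_infty hb] at this

theorem rot_fixed {k : ℂ} (hk0 : k ≠ 0) (hk : k ≠ 1) {z : Sphere} (h : rot k z = z) :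
    z = ((0 : ℂ) : Sphere) ∨ z = ∞ := by
  obtain rfl | rfl | ⟨z, hz, rfl⟩ := sphere_cases z
  · exact Or.inl rfl
  · exact Or.inr rfl
  · rw [rot_coe hk0, OnePoint.coe_eq_coe] at h
    exact absurd (mul_right_cancel₀ hz (h.trans (one_mul z).symm)) hk

theorem eq_rot_of_fix {F : Equiv.Perm Sphere} (hF : F ∈ LFT) (h0 : F ((0 : ℂ) : Sphere) = (0 : ℂ))
    (hi : F ∞ = ∞) : ∃ k : ℂ, k ≠ 0 ∧ F = rot k := by
  obtain h | h | ⟨k, hk, h⟩ := sphere_cases (F ((1 : ℂ) : Sphere))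
  · exact absurd (F.injective (h.trans h0.symm)) (by simp)
  · exact absurd (F.injective (h.trans hi.symm)) (by simp)
  · refine ⟨k, hk, eq_of_three hF (rot_mem k) (p := ((0 : ℂ) : Sphere)) (q := ((1 : ℂ) : Sphere))
      (r := ∞) (by simp) (by simp) (by simp) ?_ ?_ ?_⟩
    · rw [h0, rot_coe hk, mul_zero]
    · rw [h, rot_coe hk, mul_one]
    · rw [hi, rot_infty hk]

theorem eq_inv_of_swap {F : Equiv.Perm Sphere} (hF : F ∈ LFT) (h0 : F ((0 : ℂ) : Sphere) = ∞)
    (hi : F ∞ = ((0 : ℂ) : Sphere)) : ∃ k : ℂ, k ≠ 0 ∧ F = inv k := by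
  have hI := inv_mem_LFT 1
  obtain ⟨k, hk, h⟩ := eq_rot_of_fix (mul_mem hF hI)
    (by rw [Equiv.Perm.mul_apply, inv_zero one_ne_zero, hi])
    (by rw [Equiv.Perm.mul_apply, inv_infty one_ne_zero, h0])
  refine ⟨k, hk, ?_⟩
  rw [eq_comm, ← mul_inv_eq_iff_eq_mul.2 h.symm, inv_inv_LFT one_ne_zero,
    rot_mul_inv hk one_ne_zero, mul_one]

/-- A transformation conjugating one rotation into another is a rotation or an inversion. -/
theorem eq_rot_or_inv_of_conj {χ : Equiv.Perm Sphere} (hχ : χ ∈ LFT) {k k' : ℂ} (hk : k ≠ 0)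
    (hk' : k' ≠ 0) (h1 : k' ≠ 1) (h : χ * rot k = rot k' * χ) :
    ∃ c : ℂ, c ≠ 0 ∧ (χ = rot c ∨ χ = inv c) := by
  have h' : ∀ z, χ (rot k z) = rot k' (χ z) := fun z => congrFun (congrArg DFunLike.coe h) z
  have a := h' ((0 : ℂ) : Sphere)
  have b := h' ∞
  rw [rot_coe hk, mul_zero] at a
  rw [rot_infty hk] at b
  -- The transformation carries the fixed points 0 and ∞ of the first rotation to fixed points of
  -- the second, so it preserves the pair {0, ∞}, fixing or exchanging its members.
  rcases rot_fixed hk' h1 a.symm with a | a <;> rcases rot_fixed hk' h1 b.symm with b | b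
  · exact absurd (χ.injective (a.trans b.symm)) (by simp)
  · obtain ⟨c, hc, e⟩ := eq_rot_of_fix hχ a b
    exact ⟨c, hc, Or.inl e⟩
  · obtain ⟨c, hc, e⟩ := eq_inv_of_swap hχ a b
    exact ⟨c, hc, Or.inr e⟩
  · exact absurd (χ.injective (a.trans b.symm)) (by simp)

theorem exists_third (p q : Sphere) : ∃ r, p ≠ r ∧ q ≠ r := by
  have : Infinite Sphere := inferInstanceAs (Infinite (Option ℂ))
  obtain ⟨r, hr⟩ := Set.Infinite.nonempty (Set.Finite.infinite_compl (Set.toFinite {p, q}))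
  exact ⟨r, fun e => hr (by simp [e]), fun e => hr (by simp [e])⟩

theorem exists_to_zero_infty {p q : Sphere} (h : p ≠ q) :
    ∃ ψ ∈ LFT, ψ p = ((0 : ℂ) : Sphere) ∧ ψ q = ∞ := by
  obtain ⟨r, h1, h2⟩ := exists_third p q
  obtain ⟨a, -, c⟩ := toZeroOneInf_spec h1 h h2.symm
  exact ⟨_, mob_mem _ _ _ _, a, c⟩

/-! ### Changing coordinates -/

theorem conj_mem_A {α : Set Sphere} {ψ h : Equiv.Perm Sphere} (hψ : ψ ∈ LFT) :
    ψ * h * ψ⁻¹ ∈ A (ψ '' α) ↔ h ∈ A α := by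
  rw [mem_A, mem_A]
  refine and_congr ⟨fun H => ?_, fun H => mul_mem (mul_mem hψ H) (inv_mem hψ)⟩ ?_
  · have := mul_mem (mul_mem (inv_mem hψ) H) hψ
    rwa [show ψ⁻¹ * (ψ * h * ψ⁻¹) * ψ = h by group] at this
  · rw [← Set.image_comp, ← Equiv.Perm.coe_mul, inv_mul_cancel_right, Equiv.Perm.coe_mul,
      Set.image_comp]
    exact ψ.injective.image_injective.eq_iff

theorem A_eq_conjGen {α : Set Sphere} {ψ : Equiv.Perm Sphere} (hψ : ψ ∈ LFT)
    {S : Set (Equiv.Perm Sphere)} (h : A (ψ '' α) = Subgroup.closure S) :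
    A α = conjGen ψ S := by
  ext x
  rw [conjGen, Subgroup.mem_map, ← conj_mem_A hψ, h]
  constructor
  · intro hx
    refine ⟨_, hx, ?_⟩
    simp only [MulEquiv.toMonoidHom_eq_coe, MonoidHom.coe_coe, MulAut.conj_apply]
    group
  · rintro ⟨y, hy, rfl⟩
    simp only [MulEquiv.toMonoidHom_eq_coe, MonoidHom.coe_coe, MulAut.conj_apply]
    rwa [show ψ * (ψ⁻¹ * y * ψ⁻¹⁻¹) * ψ⁻¹ = y by group]

/-- The isomorphism of the groups of two equivalent sets. -/
def conjA {α : Set Sphere} {ψ : Equiv.Perm Sphere} (hψ : ψ ∈ LFT) : A α ≃* A (ψ '' α) where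
  toFun h := ⟨ψ * h * ψ⁻¹, (conj_mem_A hψ).2 h.2⟩
  invFun h := ⟨ψ⁻¹ * h * ψ, by
    rw [← conj_mem_A hψ, show ψ * (ψ⁻¹ * (h : Equiv.Perm Sphere) * ψ) * ψ⁻¹ = h by group]
    exact h.2⟩
  left_inv h := Subtype.ext (by group)
  right_inv h := Subtype.ext (by group)
  map_mul' h h' := Subtype.ext (by simp [mul_assoc])

theorem conjA_symm_spec {α : Set Sphere} {ψ : Equiv.Perm Sphere} (hψ : ψ ∈ LFT)
    (h : A (ψ '' α)) : ψ * ((conjA hψ).symm h : Equiv.Perm Sphere) * ψ⁻¹ = h :=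
  congrArg Subtype.val ((conjA hψ).apply_symm_apply h)

theorem ncard_image_perm {α : Set Sphere} (ψ : Equiv.Perm Sphere) (hα : α.ncard = 6) :
    (ψ '' α).ncard = 6 := by
  rw [Set.ncard_image_of_injective _ ψ.injective, hα]

theorem image_mul (φ ψ : Equiv.Perm Sphere) (α : Set Sphere) :
    (φ * ψ : Equiv.Perm Sphere) '' α = φ '' (ψ '' α) := by
  rw [Equiv.Perm.coe_mul, Set.image_comp]

theorem image_inv_image (ψ : Equiv.Perm Sphere) (α : Set Sphere) :
    (ψ⁻¹ : Equiv.Perm Sphere) '' (ψ '' α) = α := by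
  rw [← image_mul, inv_mul_cancel]; simp

theorem exists_three_mem {α : Set Sphere} (hα : α.ncard = 6) :
    ∃ p ∈ α, ∃ q ∈ α, ∃ r ∈ α, p ≠ q ∧ p ≠ r ∧ q ≠ r := by
  obtain ⟨p, q, r, hp, hq, hr, h1, h2, h3⟩ :=
    (Set.two_lt_ncard_iff (Set.finite_of_ncard_ne_zero (by omega))).1 (by omega : 2 < α.ncard)
  exact ⟨p, hp, q, hq, r, hr, h1, h2, h3⟩

/-- The action on the six points is faithful, because three values determine a transformation. -/
theorem finite_A {α : Set Sphere} (hα : α.ncard = 6) : Finite (A α) := by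
  have hfin : Finite α := Set.finite_of_ncard_ne_zero (by omega)
  obtain ⟨p, hp, q, hq, r, hr, h1, h2, h3⟩ := exists_three_mem hα
  refine Finite.of_injective (fun (h : A α) (z : α) =>
    (⟨h.1 z, apply_mem_of_mem_A h.2 z.2⟩ : α)) fun h h' e => Subtype.ext ?_
  have e' : ∀ z ∈ α, h.1 z = h'.1 z := fun z hz => congrArg Subtype.val (congrFun e ⟨z, hz⟩)
  exact eq_of_three h.2.1 h'.2.1 h1 h2 h3 (e' p hp) (e' q hq) (e' r hr)

theorem exists_pow_eq_one {α : Set Sphere} (hα : α.ncard = 6) {h : Equiv.Perm Sphere}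
    (hh : h ∈ A α) : ∃ n, 0 < n ∧ h ^ n = 1 := by
  have := finite_A hα
  obtain ⟨n, hn, e⟩ := (isOfFinOrder_of_finite (⟨h, hh⟩ : A α)).exists_pow_eq_one
  exact ⟨n, hn, congrArg Subtype.val e⟩

theorem exists_fixed {h : Equiv.Perm Sphere} (hh : h ∈ LFT) : ∃ p, h p = p := by
  obtain ⟨M, rfl⟩ := exists_lf hh
  by_cases hc : M 1 0 = 0
  · refine ⟨∞, ?_⟩
    rw [lf_apply]
    simp [den, hc_infty, hc]
  -- `z` is a square root of the discriminant of the fixed point equation.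
  · obtain ⟨z, hz⟩ := IsAlgClosed.exists_eq_mul_self ((M 1 1 - M 0 0) ^ 2 + 4 * M 1 0 * M 0 1)
    refine ⟨(((M 0 0 - M 1 1 + z) / (2 * M 1 0) : ℂ) : Sphere), ?_⟩
    set w := (M 0 0 - M 1 1 + z) / (2 * M 1 0) with hw
    have hw' : M 0 0 * w + M 0 1 = w * (M 1 0 * w + M 1 1) := by
      rw [hw]; field_simp; linear_combination hz
    have hd : den M w ≠ 0 := by
      intro hd
      refine num_ne_of_den hd ?_
      simp only [den, num, hc_coe, mul_one] at hd ⊢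
      rw [hw', hd, mul_zero]
    rw [lf_apply, if_neg hd]
    congr 1
    rw [div_eq_iff hd]
    simpa [den, num, hc_coe] using hw'

/-- The point is the existence of a second fixed point. With the first one at ∞ the transformation
is affine, and an affine map without finite fixed point is a nontrivial translation, which has
infinite order. -/
theorem exists_conj_rot {h : Equiv.Perm Sphere} (hh : h ∈ LFT) (h1 : h ≠ 1) {n : ℕ} (hn : 0 < n)
    (hpow : h ^ n = 1) : ∃ ψ ∈ LFT, ∃ k : ℂ, k ≠ 0 ∧ k ≠ 1 ∧ ψ * h * ψ⁻¹ = rot k := by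
  obtain ⟨p, hp⟩ := exists_fixed hh
  suffices ∃ q, q ≠ p ∧ h q = q by
    obtain ⟨q, hqp, hq⟩ := this
    obtain ⟨ψ, hψ, h0, hi⟩ := exists_to_zero_infty hqp
    obtain ⟨k, hk, e⟩ := eq_rot_of_fix (F := ψ * h * ψ⁻¹)
      (mul_mem (mul_mem hψ hh) (inv_mem hψ)) (by rw [← h0]; simp [hq]) (by rw [← hi]; simp [hp])
    refine ⟨ψ, hψ, k, hk, ?_, e⟩
    rintro rfl
    rw [rot_one] at e
    exact h1 (conj_eq_one_iff.1 e)
  obtain ⟨r, hr, -⟩ := exists_third p p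
  obtain ⟨ψ, hψ, -, hi⟩ := exists_to_zero_infty hr.symm
  obtain ⟨M, hM⟩ := exists_lf (mul_mem (mul_mem hψ hh) (inv_mem hψ))
  have hMi : lf M ∞ = ∞ := by rw [hM, ← hi]; simp [hp]
  have hc : M 1 0 = 0 := by
    have := den_eq M ∞
    rw [hMi] at this
    simpa [den, hc_infty] using this
  have hdet := det_ne M
  rw [← det_eq, hc, mul_zero, sub_zero] at hdet
  have hd := right_ne_zero_of_mul hdet
  have hz : ∀ z : ℂ, lf M z = (((M 0 0 * z + M 0 1) / M 1 1 : ℂ) : Sphere) := by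
    intro z
    rw [lf_apply]
    simp [den, num, hc_coe, hc, hd]
  suffices ∃ z : ℂ, lf M z = z by
    obtain ⟨z, hz⟩ := this
    refine ⟨ψ⁻¹ z, fun e => ?_, ?_⟩
    · have : ψ p = z := by rw [← e]; simp
      rw [hi] at this
      simp at this
    · rw [hM] at hz
      apply ψ.injective
      simpa using hz
  -- Equal diagonal entries mean a translation by `M 0 1 / M 1 1`, whose iterates are computed at 0;
  -- otherwise the finite fixed point is explicit.
  by_cases had : M 0 0 = M 1 1
  · exfalso
    have hz' : ∀ (m : ℕ) , ((lf M) ^ m) ((0 : ℂ) : Sphere) = ((m * (M 0 1 / M 1 1) : ℂ) : Sphere) := by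
      intro m
      induction m with
      | zero => simp
      | succ m ih =>
        rw [pow_succ', Equiv.Perm.mul_apply, ih, hz, had]
        congr 1
        push_cast
        field_simp
    have hpow' : lf M ^ n = 1 := by rw [hM, conj_pow, hpow]; simp
    have h0 := hz' n
    rw [hpow', Equiv.Perm.one_apply, OnePoint.coe_eq_coe, eq_comm, mul_eq_zero] at h0
    have hb : M 0 1 = 0 := by
      rcases h0 with h0 | h0
      · exact absurd (Nat.cast_eq_zero.1 h0) hn.ne'
      · exact (div_eq_zero_iff.1 h0).resolve_right hd
    have := lf_eq_one.2 ⟨hb, hc, had⟩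
    rw [hM] at this
    exact h1 (conj_eq_one_iff.1 this)
  · refine ⟨M 0 1 / (M 1 1 - M 0 0), ?_⟩
    have := sub_ne_zero.2 (Ne.symm had)
    rw [hz]
    congr 1
    field_simp
    ring

end SixPoints

end

noncomputable section
namespace SixPoints
open scoped OnePoint Pointwise

/-! ### The normal forms as sets of roots -/

theorem isPrimitiveRoot_ζ (n : ℕ) [NeZero n] : IsPrimitiveRoot (ζ n) n :=
  Complex.isPrimitiveRoot_exp n (NeZero.ne n)

theorem ζ_pow (n : ℕ) [NeZero n] : ζ n ^ n = 1 := (isPrimitiveRoot_ζ n).pow_eq_one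

theorem ζ_ne_zero (n : ℕ) [NeZero n] : ζ n ≠ 0 := (isPrimitiveRoot_ζ n).ne_zero (NeZero.ne n)

theorem ζ2 : ζ 2 = -1 := (isPrimitiveRoot_ζ 2).eq_neg_one_of_two_right

theorem ζ3_sq : ζ 3 ^ 2 + ζ 3 + 1 = 0 := by
  have h := (isPrimitiveRoot_ζ 3).geom_sum_eq_zero (by norm_num)
  simp only [Finset.sum_range_succ, Finset.sum_range_zero] at h
  linear_combination h

theorem ζ6_cube : ζ 6 ^ 3 = -1 := by
  have h : IsPrimitiveRoot (ζ 6 ^ 3) 2 := (isPrimitiveRoot_ζ 6).pow (by norm_num) (by norm_num)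
  exact h.eq_neg_one_of_two_right

theorem ζ6_sq : ζ 6 ^ 2 - ζ 6 + 1 = 0 := by
  have h : ζ 6 + 1 ≠ 0 := by
    intro h
    have h1 := eq_neg_of_add_eq_zero_left h
    have h2 := (isPrimitiveRoot_ζ 6).pow_ne_one_of_pos_of_lt (l := 2) (by norm_num) (by norm_num)
    rw [h1] at h2
    norm_num at h2
  apply mul_left_cancel₀ h
  linear_combination ζ6_cube

theorem mem_onSphere {S : Set ℂ} {z : ℂ} : (z : Sphere) ∈ onSphere S ↔ z ∈ S := by
  simp [onSphere]

theorem infty_notMem_onSphere (S : Set ℂ) : ∞ ∉ onSphere S := by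
  simp [onSphere]

theorem exists_of_mem_onSphere {S : Set ℂ} {z : Sphere} (h : z ∈ onSphere S) :
    ∃ w ∈ S, z = w := by
  obtain ⟨w, hw, rfl⟩ := h
  exact ⟨w, hw, rfl⟩

/-- The normal forms are used through equations between powers. Invariance under rotations and
inversions then reduces to computing with powers. -/
theorem mem_roots6 {z : ℂ} : z ∈ roots6 ↔ z ^ 6 = 1 := by
  constructor
  · simp only [roots6, Set.mem_insert_iff, Set.mem_singleton_iff]
    have h := ζ_pow 6
    rintro (rfl | rfl | rfl | rfl | rfl | rfl) <;> first | norm_num; done | skip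
    · exact h
    all_goals rw [← pow_mul, mul_comm, pow_mul, h, one_pow]
  · intro h
    obtain ⟨i, hi, rfl⟩ := (isPrimitiveRoot_ζ 6).eq_pow_of_pow_eq_one h
    interval_cases i <;> simp [roots6]

theorem mem_zeroRoots5 {z : ℂ} : z ∈ zeroRoots5 ↔ z = 0 ∨ z ^ 5 = 1 := by
  constructor
  · simp only [zeroRoots5, Set.mem_insert_iff, Set.mem_singleton_iff]
    have h := ζ_pow 5
    rintro (rfl | rfl | rfl | rfl | rfl | rfl)
    · exact Or.inl rfl
    · simp
    · exact Or.inr h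
    all_goals right; rw [← pow_mul, mul_comm, pow_mul, h, one_pow]
  · rintro (rfl | h)
    · simp [zeroRoots5]
    · obtain ⟨i, hi, rfl⟩ := (isPrimitiveRoot_ζ 5).eq_pow_of_pow_eq_one h
      interval_cases i <;> simp [zeroRoots5]

theorem pow_four_eq_one {z : ℂ} :
    z ^ 4 = 1 ↔ z = 1 ∨ z = Complex.I ∨ z = -1 ∨ z = -Complex.I := by
  constructor
  · intro h
    have h' : (z - 1) * ((z - Complex.I) * ((z + 1) * (z + Complex.I))) = 0 := by
      linear_combination h + (1 - z ^ 2) * Complex.I_sq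
    rcases mul_eq_zero.1 h' with h | h
    · exact Or.inl (sub_eq_zero.1 h)
    rcases mul_eq_zero.1 h with h | h
    · exact Or.inr (Or.inl (sub_eq_zero.1 h))
    rcases mul_eq_zero.1 h with h | h
    · exact Or.inr (Or.inr (Or.inl (eq_neg_of_add_eq_zero_left h)))
    · exact Or.inr (Or.inr (Or.inr (eq_neg_of_add_eq_zero_left h)))
  · rintro (rfl | rfl | rfl | rfl) <;> norm_num

theorem mem_octahedron {z : ℂ} : (z : Sphere) ∈ octahedron ↔ z = 0 ∨ z ^ 4 = 1 := by
  rw [pow_four_eq_one, octahedron, Set.mem_insert_iff, mem_onSphere]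
  simp

theorem infty_mem_octahedron : ∞ ∈ octahedron := by simp [octahedron]

theorem mem_hex {a z : ℂ} : z ∈ hex a ↔ z ^ 3 = 1 ∨ z ^ 3 = a ^ 3 := by
  have h := ζ_pow 3
  constructor
  · simp only [hex, Set.mem_insert_iff, Set.mem_singleton_iff]
    rintro (rfl | rfl | rfl | rfl | rfl | rfl)
    · simp
    · exact Or.inl h
    · left; rw [← pow_mul, mul_comm, pow_mul, h, one_pow]
    · exact Or.inr rfl
    · right; rw [mul_pow, h, mul_one]
    · right; rw [mul_pow, ← pow_mul, mul_comm 2, pow_mul, h, one_pow, mul_one]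
  · rintro (hz | hz)
    · obtain ⟨i, hi, rfl⟩ := (isPrimitiveRoot_ζ 3).eq_pow_of_pow_eq_one hz
      interval_cases i <;> simp [hex]
    · by_cases ha : a = 0
      · rw [ha, zero_pow (by norm_num)] at hz
        simp [hex, ha, eq_zero_of_pow_eq_zero hz]
      · have : (z / a) ^ 3 = 1 := by rw [div_pow, hz, div_self (pow_ne_zero _ ha)]
        obtain ⟨i, hi, e⟩ := (isPrimitiveRoot_ζ 3).eq_pow_of_pow_eq_one this
        have hz' : z = a * ζ 3 ^ i := by rw [e]; field_simp
        rw [hz']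
        interval_cases i <;> simp [hex]

theorem mem_pm {a b z : ℂ} : z ∈ pm a b ↔ z ^ 2 = 1 ∨ z ^ 2 = a ^ 2 ∨ z ^ 2 = b ^ 2 := by
  rw [sq_eq_one_iff, sq_eq_sq_iff_eq_or_eq_neg, sq_eq_sq_iff_eq_or_eq_neg]
  simp [pm]
  tauto

theorem image_onSphere_rot {c : ℂ} (hc : c ≠ 0) (S : Set ℂ) :
    rot c '' onSphere S = onSphere ((fun z => c * z) '' S) := by
  rw [onSphere, onSphere, ← Set.image_comp, ← Set.image_comp]
  exact Set.image_congr fun z _ => rot_coe hc z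

theorem mem_image_perm {χ : Equiv.Perm Sphere} {β : Set Sphere} {z : Sphere} :
    z ∈ χ '' β ↔ χ⁻¹ z ∈ β := by
  constructor
  · rintro ⟨w, hw, rfl⟩
    simpa using hw
  · intro h
    exact ⟨_, h, by simp⟩

theorem ncard_rootsOfUnity (n : ℕ) [NeZero n] : {z : ℂ | z ^ n = 1}.ncard = n := by
  have h : {z : ℂ | z ^ n = 1} = ↑(Polynomial.nthRootsFinset n (1 : ℂ)) := by
    ext z
    simp [Polynomial.mem_nthRootsFinset (NeZero.pos n)]
  rw [h, Set.ncard_coe_finset, (isPrimitiveRoot_ζ n).card_nthRootsFinset]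

theorem ncard_rootsOf (n : ℕ) [NeZero n] {e : ℂ} (he0 : e ≠ 0) :
    {z : ℂ | z ^ n = e ^ n}.ncard = n := by
  have h2 : {z : ℂ | z ^ n = e ^ n} = (fun z => e * z) '' {z : ℂ | z ^ n = 1} := by
    ext z
    constructor
    · intro hz
      exact ⟨z / e, by
        change (z / e) ^ n = 1
        rw [div_pow, (hz : z ^ n = e ^ n), div_self (pow_ne_zero _ he0)], by
        change e * (z / e) = z
        field_simp⟩
    · rintro ⟨w, hw, rfl⟩
      change (e * w) ^ n = e ^ n
      rw [mul_pow, (hw : w ^ n = 1), mul_one]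
  rw [h2, Set.ncard_image_of_injective _ (mul_right_injective₀ he0), ncard_rootsOfUnity]

theorem finite_rootsOf (n : ℕ) [NeZero n] {e : ℂ} (he0 : e ≠ 0) :
    {z : ℂ | z ^ n = e ^ n}.Finite :=
  Set.finite_of_ncard_ne_zero (by rw [ncard_rootsOf n he0]; exact NeZero.ne n)

theorem finite_rootsOfUnity (n : ℕ) [NeZero n] : {z : ℂ | z ^ n = 1}.Finite :=
  Set.finite_of_ncard_ne_zero (by rw [ncard_rootsOfUnity]; exact NeZero.ne n)

theorem disjoint_rootsOf {n : ℕ} {c d : ℂ} (h : c ≠ d) :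
    Disjoint {z : ℂ | z ^ n = c} {z : ℂ | z ^ n = d} := by
  rw [Set.disjoint_left]
  intro z hz hz'
  exact h (hz.symm.trans hz')

theorem range_six {X : Type*} (x₀ x₁ x₂ x₃ x₄ x₅ : X) :
    Set.range ![x₀, x₁, x₂, x₃, x₄, x₅] = {x₀, x₁, x₂, x₃, x₄, x₅} := by
  simp only [Matrix.range_cons, Matrix.range_empty, Set.union_empty]
  rfl

theorem ncard_range_fin_le {X : Type*} {n : ℕ} (b : Fin n → X) : (Set.range b).ncard ≤ n := by
  rw [← Set.image_univ]
  refine (Set.ncard_image_le Set.finite_univ).trans ?_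
  rw [Set.ncard_univ, Nat.card_fin]

theorem ncard_onSphere (S : Set ℂ) : (onSphere S).ncard = S.ncard :=
  Set.ncard_image_of_injective _ OnePoint.coe_injective

theorem hexParam_of {a : ℂ} (h : 1 ≤ ‖a‖) (h3 : a ^ 3 ≠ 1) : HexParam a := by
  refine ⟨h, ?_, ?_, ?_⟩ <;> rintro rfl <;> apply h3
  · norm_num
  · exact ζ_pow 3
  · rw [← pow_mul, mul_comm, pow_mul, ζ_pow 3, one_pow]

/-- The inversion exchanges the parameters `a` and `1 / a`, so the normalisation `1 ≤ ‖a‖` loses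
nothing. -/
theorem inv_image_hex {a : ℂ} (ha : a ≠ 0) : inv 1 '' onSphere (hex a) = onSphere (hex a⁻¹) := by
  ext z
  rw [mem_image_perm, inv_inv_LFT one_ne_zero]
  obtain rfl | rfl | ⟨z, hz, rfl⟩ := sphere_cases z
  · rw [inv_zero one_ne_zero, mem_onSphere, mem_hex]
    simp [infty_notMem_onSphere, (pow_ne_zero 3 ha).symm]
  · rw [inv_infty one_ne_zero, mem_onSphere, mem_hex]
    simp [infty_notMem_onSphere, (pow_ne_zero 3 ha).symm]
  · rw [inv_coe one_ne_zero hz, mem_onSphere, mem_onSphere, mem_hex, mem_hex, one_div, inv_pow,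
      inv_pow, inv_eq_one, inv_eq_iff_eq_inv]

theorem inv_conj_rot {k : ℂ} (hk : k ≠ 0) : inv 1 * rot k * (inv 1)⁻¹ = rot k⁻¹ := by
  rw [inv_inv_LFT one_ne_zero, inv_mul_rot one_ne_zero hk,
    inv_mul_inv (div_ne_zero one_ne_zero hk) one_ne_zero, div_one, one_div]

/-- The normal forms of a nontrivial element of the group of six points. -/
theorem exists_normal_form {α : Set Sphere} (hα : α.ncard = 6) {h : Equiv.Perm Sphere}
    (hh : h ∈ A α) (h1 : h ≠ 1) : ∃ ψ ∈ LFT, ∃ k : ℂ, k ≠ 0 ∧ k ≠ 1 ∧ ψ * h * ψ⁻¹ = rot k ∧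
      ((IsPrimitiveRoot k 6 ∧ ψ '' α = onSphere roots6) ∨
      (IsPrimitiveRoot k 5 ∧ ψ '' α = onSphere zeroRoots5) ∨
      (IsPrimitiveRoot k 4 ∧ ψ '' α = octahedron) ∨
      (IsPrimitiveRoot k 3 ∧ ∃ a, HexParam a ∧ ψ '' α = onSphere (hex a)) ∨
      (k = -1 ∧ ∃ a b, ψ '' α = onSphere (pm a b)) ∨
      (k = -1 ∧ ∃ a : ℂ, ψ '' α = {((0 : ℂ) : Sphere), ∞, ((1 : ℂ) : Sphere), ((-1 : ℂ) : Sphere),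
        (a : Sphere), ((-a : ℂ) : Sphere)})) := by
  obtain ⟨N, hN, hpow⟩ := exists_pow_eq_one hα hh
  obtain ⟨ψ₀, hψ₀, k, hk0, hk1, hk⟩ := exists_conj_rot hh.1 h1 hN hpow
  -- Six points cannot all lie in {0, ∞}. Scaling one of the others to 1 commutes with the rotation
  -- and leaves `k` unchanged.
  obtain ⟨ψ, hψ, hψk, h1β⟩ : ∃ ψ ∈ LFT, ψ * h * ψ⁻¹ = rot k ∧ ((1 : ℂ) : Sphere) ∈ ψ '' α := by
    have : ∃ z ∈ ψ₀ '' α, z ∉ ({((0 : ℂ) : Sphere), ∞} : Set Sphere) := by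
      by_contra! hc
      have := Set.ncard_le_ncard (s := ψ₀ '' α) (t := {((0 : ℂ) : Sphere), ∞}) hc
      rw [ncard_image_perm _ hα] at this
      have h2 := Set.ncard_insert_le ((0 : ℂ) : Sphere) {∞}
      rw [Set.ncard_singleton] at h2
      omega
    obtain ⟨z, hz, hz'⟩ := this
    obtain rfl | rfl | ⟨z, hz0, rfl⟩ := sphere_cases z
    · simp at hz'
    · simp at hz'
    · have hi := inv_ne_zero hz0
      refine ⟨rot z⁻¹ * ψ₀, mul_mem (rot_mem _) hψ₀, ?_, ?_⟩
      · rw [mul_inv_rev, show rot z⁻¹ * ψ₀ * h * (ψ₀⁻¹ * (rot z⁻¹)⁻¹) =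
          rot z⁻¹ * (ψ₀ * h * ψ₀⁻¹) * (rot z⁻¹)⁻¹ by group, hk, rot_inv hi, inv_inv,
          rot_mul_rot hi hk0, rot_mul_rot (mul_ne_zero hi hk0) hz0]
        congr 1
        field_simp
      · rw [image_mul]
        exact ⟨_, hz, by rw [rot_coe hi, inv_mul_cancel₀ hz0]⟩
  set β := ψ '' α with hβ
  have hβ6 : β.ncard = 6 := ncard_image_perm _ hα
  have hβf : β.Finite := Set.finite_of_ncard_ne_zero (by omega)
  have hkN : k ^ N = 1 := by
    have : rot k ^ N = 1 := by rw [← hψk, conj_pow, hpow]; simp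
    rw [rot_pow hk0, ← rot_one] at this
    exact rot_injective (pow_ne_zero _ hk0) one_ne_zero this
  have hrot : rot k ∈ A β := by rw [← hψk]; exact (conj_mem_A hψ).2 hh
  have hT1 : ∀ (z : ℂ) (j : ℕ), (z : Sphere) ∈ β → ((k ^ j * z : ℂ) : Sphere) ∈ β := by
    intro z j hz
    induction j with
    | zero => simpa using hz
    | succ j ih =>
      have := apply_mem_of_mem_A hrot ih
      rwa [rot_coe hk0, ← mul_assoc, ← pow_succ'] at this
  have hn : 0 < orderOf k := orderOf_pos_iff.2 (isOfFinOrder_iff_pow_eq_one.2 ⟨N, hN, hkN⟩)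
  obtain ⟨n, hnk⟩ : ∃ n, n = orderOf k := ⟨_, rfl⟩
  have hprim : IsPrimitiveRoot k n := hnk ▸ IsPrimitiveRoot.orderOf k
  rw [← hnk] at hn
  have : NeZero n := ⟨hn.ne'⟩
  have hT : ∀ w z : ℂ, w ^ n = 1 → (z : Sphere) ∈ β → ((w * z : ℂ) : Sphere) ∈ β := by
    intro w z hw hz
    obtain ⟨j, -, rfl⟩ := hprim.eq_pow_of_pow_eq_one hw
    exact hT1 z j hz
  -- The orbit of 1 consists of all the `n`-th roots of unity, which already gives `n ≤ 6`.
  have hμ : onSphere {z : ℂ | z ^ n = 1} ⊆ β := by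
    rintro _ ⟨w, hw, rfl⟩
    simpa using hT w 1 hw h1β
  have hn6 : n ≤ 6 := by
    have := Set.ncard_le_ncard hμ hβf
    rwa [ncard_onSphere, ncard_rootsOfUnity, hβ6] at this
  have hμe : ∀ e : ℂ, e ≠ 0 → (e : Sphere) ∈ β → onSphere {z : ℂ | z ^ n = e ^ n} ⊆ β := by
    rintro e he0 he _ ⟨w, hw, rfl⟩
    have := hT (w / e) e (by rw [div_pow, hw, div_self (pow_ne_zero _ he0)]) he
    rwa [div_mul_cancel₀ _ he0] at this
  -- A further point off {0, ∞} brings a second orbit of `n` elements. For `n ≥ 4` there is no room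
  -- for it.
  have hcount : ∀ e : ℂ, e ≠ 0 → (e : Sphere) ∈ β → e ^ n ≠ 1 → 2 * n ≤ 6 := by
    intro e he0 he hen
    have h3 := ncard_rootsOf n he0
    have h4 := Set.ncard_union_eq (disjoint_rootsOf (Ne.symm hen)) (finite_rootsOfUnity n)
      (finite_rootsOf n he0)
    rw [ncard_rootsOfUnity, h3] at h4
    have h5 : onSphere ({z : ℂ | z ^ n = 1} ∪ {z : ℂ | z ^ n = e ^ n}) ⊆ β := by
      rw [onSphere, Set.image_union]
      exact Set.union_subset hμ (hμe e he0 he)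
    have := Set.ncard_le_ncard h5 hβf
    rw [ncard_onSphere, h4, hβ6] at this
    omega
  have hn1 : n ≠ 1 := by
    rintro rfl
    exact hk1 (by simpa using hprim.pow_eq_one)
  clear_value β
  interval_cases n
  · exact absurd rfl hn1
  · -- order two
    have hkm : k = -1 := hprim.eq_neg_one_of_two_right
    obtain ⟨e, he0, he, he1⟩ : ∃ e : ℂ, e ≠ 0 ∧ (e : Sphere) ∈ β ∧ e ^ 2 ≠ 1 := by
      by_contra! hc
      have hsub : β ⊆ Set.range ![((0 : ℂ) : Sphere), ∞, ((1 : ℂ) : Sphere),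
          ((-1 : ℂ) : Sphere)] := by
        intro z hz
        obtain rfl | rfl | ⟨z, hz0, rfl⟩ := sphere_cases z
        · exact ⟨0, rfl⟩
        · exact ⟨1, rfl⟩
        · rcases sq_eq_one_iff.1 (hc z hz0 hz) with rfl | rfl
          · exact ⟨2, rfl⟩
          · exact ⟨3, rfl⟩
      have := (Set.ncard_le_ncard hsub (Set.finite_range _)).trans (ncard_range_fin_le _)
      omega
    -- Either there are three orbits of length two, or two such orbits together with both fixed
    -- points.
    by_cases hc : ∃ e' : ℂ, e' ≠ 0 ∧ (e' : Sphere) ∈ β ∧ e' ^ 2 ≠ 1 ∧ e' ^ 2 ≠ e ^ 2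
    · obtain ⟨e', he0', he', h1', h2'⟩ := hc
      refine ⟨ψ, hψ, k, hk0, hk1, hψk, Or.inr (Or.inr (Or.inr (Or.inr (Or.inl
        ⟨hkm, e, e', ?_⟩))))⟩
      rw [← hβ]
      have hpm : pm e e' = ({z : ℂ | z ^ 2 = 1} ∪ {z : ℂ | z ^ 2 = e ^ 2}) ∪
          {z : ℂ | z ^ 2 = e' ^ 2} := by
        ext z; rw [mem_pm]; exact or_assoc.symm
      have hsub : onSphere (pm e e') ⊆ β := by
        rw [hpm, onSphere, Set.image_union, Set.image_union]
        exact Set.union_subset (Set.union_subset hμ (hμe e he0 he)) (hμe e' he0' he')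
      refine (Set.eq_of_subset_of_ncard_le hsub ?_ hβf).symm
      rw [hβ6, ncard_onSphere, hpm, Set.ncard_union_eq (Set.disjoint_union_left.2
        ⟨disjoint_rootsOf (Ne.symm h1'), disjoint_rootsOf (Ne.symm h2')⟩)
        ((finite_rootsOfUnity 2).union (finite_rootsOf 2 he0)) (finite_rootsOf 2 he0'),
        Set.ncard_union_eq (disjoint_rootsOf (Ne.symm he1)) (finite_rootsOfUnity 2)
        (finite_rootsOf 2 he0), ncard_rootsOfUnity, ncard_rootsOf 2 he0, ncard_rootsOf 2 he0']
    · refine ⟨ψ, hψ, k, hk0, hk1, hψk, Or.inr (Or.inr (Or.inr (Or.inr (Or.inr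
        ⟨hkm, e, ?_⟩))))⟩
      rw [← hβ]
      have hS : ({((0 : ℂ) : Sphere), ∞, ((1 : ℂ) : Sphere), ((-1 : ℂ) : Sphere),
        (e : Sphere), ((-e : ℂ) : Sphere)} : Set Sphere) = Set.range ![((0 : ℂ) : Sphere), ∞,
          ((1 : ℂ) : Sphere), ((-1 : ℂ) : Sphere), (e : Sphere), ((-e : ℂ) : Sphere)] := by
        exact (range_six _ _ _ _ _ _).symm
      have hsub : β ⊆ {((0 : ℂ) : Sphere), ∞, ((1 : ℂ) : Sphere), ((-1 : ℂ) : Sphere),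
          (e : Sphere), ((-e : ℂ) : Sphere)} := by
        intro z hz
        obtain rfl | rfl | ⟨z, hz0, rfl⟩ := sphere_cases z
        · simp
        · simp
        · by_cases hz1 : z ^ 2 = 1
          · rcases sq_eq_one_iff.1 hz1 with rfl | rfl <;> simp
          · have : z ^ 2 = e ^ 2 := by
              by_contra hne
              exact hc ⟨z, hz0, hz, hz1, hne⟩
            rcases sq_eq_sq_iff_eq_or_eq_neg.1 this with rfl | rfl <;> simp
      refine Set.eq_of_subset_of_ncard_le hsub ?_ (Set.toFinite _)
      rw [hS, hβ6]
      exact ncard_range_fin_le _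
  · -- order three
    obtain ⟨e, he0, he, he1⟩ : ∃ e : ℂ, e ≠ 0 ∧ (e : Sphere) ∈ β ∧ e ^ 3 ≠ 1 := by
      by_contra! hc
      have hsub : β ⊆ Set.range ![((0 : ℂ) : Sphere), ∞, ((1 : ℂ) : Sphere),
          ((ζ 3 : ℂ) : Sphere), ((ζ 3 ^ 2 : ℂ) : Sphere)] := by
        intro z hz
        obtain rfl | rfl | ⟨z, hz0, rfl⟩ := sphere_cases z
        · exact ⟨0, rfl⟩
        · exact ⟨1, rfl⟩
        · obtain ⟨i, hi, rfl⟩ := (isPrimitiveRoot_ζ 3).eq_pow_of_pow_eq_one (hc z hz0 hz)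
          interval_cases i
          · exact ⟨2, by simp⟩
          · exact ⟨3, by simp⟩
          · exact ⟨4, rfl⟩
      have := (Set.ncard_le_ncard hsub (Set.finite_range _)).trans (ncard_range_fin_le _)
      omega
    have hhex : hex e = {z : ℂ | z ^ 3 = 1} ∪ {z : ℂ | z ^ 3 = e ^ 3} := by
      ext z; rw [mem_hex]; rfl
    have hβhex : β = onSphere (hex e) := by
      have hsub : onSphere (hex e) ⊆ β := by
        rw [hhex, onSphere, Set.image_union]
        exact Set.union_subset hμ (hμe e he0 he)
      refine (Set.eq_of_subset_of_ncard_le hsub ?_ hβf).symm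
      rw [hβ6, ncard_onSphere, hhex, Set.ncard_union_eq (disjoint_rootsOf (Ne.symm he1))
        (finite_rootsOfUnity 3) (finite_rootsOf 3 he0), ncard_rootsOfUnity, ncard_rootsOf 3 he0]
    -- If the second orbit lies inside the unit circle, the coordinate is followed by `z ↦ 1 / z`;
    -- the multiplier becomes `k⁻¹`, of the same order.
    rcases le_or_gt 1 ‖e‖ with hle | hlt
    · refine ⟨ψ, hψ, k, hk0, hk1, hψk, Or.inr (Or.inr (Or.inr (Or.inl ⟨hprim, e, ?_, ?_⟩)))⟩
      · exact hexParam_of hle he1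
      · rw [← hβ, hβhex]
    · refine ⟨inv 1 * ψ, mul_mem (inv_mem_LFT 1) hψ, k⁻¹, inv_ne_zero hk0, ?_, ?_,
        Or.inr (Or.inr (Or.inr (Or.inl ⟨hprim.inv, e⁻¹, hexParam_of ?_ ?_, ?_⟩)))⟩
      · simpa using hk1
      · rw [← inv_conj_rot hk0, ← hψk]; group
      · rw [norm_inv]
        exact (one_le_inv₀ (norm_pos_iff.2 he0)).2 hlt.le
      · rw [inv_pow]; simpa using he1
      · rw [image_mul, ← hβ, hβhex, inv_image_hex he0]
  · -- order four
    have hT4 : ∀ e : ℂ, e ≠ 0 → (e : Sphere) ∈ β → e ^ 4 = 1 := by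
      intro e he0 he
      by_contra hne
      have := hcount e he0 he hne
      omega
    refine ⟨ψ, hψ, k, hk0, hk1, hψk, Or.inr (Or.inr (Or.inl ⟨hprim, ?_⟩))⟩
    rw [← hβ]
    have hS : octahedron = Set.range ![∞, ((0 : ℂ) : Sphere), ((1 : ℂ) : Sphere),
        ((Complex.I : ℂ) : Sphere), ((-1 : ℂ) : Sphere), ((-Complex.I : ℂ) : Sphere)] := by
      rw [range_six, octahedron, onSphere]
      simp only [Set.image_insert_eq, Set.image_singleton]
    have hsub : β ⊆ octahedron := by
      intro z hz
      obtain rfl | rfl | ⟨z, hz0, rfl⟩ := sphere_cases z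
      · exact mem_octahedron.2 (Or.inl rfl)
      · exact infty_mem_octahedron
      · exact mem_octahedron.2 (Or.inr (hT4 z hz0 hz))
    refine Set.eq_of_subset_of_ncard_le hsub ?_ (by rw [hS]; exact Set.finite_range _)
    rw [hS, hβ6]
    exact ncard_range_fin_le _
  · -- order five
    have hT5 : ∀ e : ℂ, e ≠ 0 → (e : Sphere) ∈ β → e ^ 5 = 1 := by
      intro e he0 he
      by_contra hne
      have := hcount e he0 he hne
      omega
    have hμ' : ∀ z : ℂ, z ^ 5 = 1 → (z : Sphere) ∈ β := fun z hz => hμ ⟨z, hz, rfl⟩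
    by_cases h0 : ((0 : ℂ) : Sphere) ∈ β
    · refine ⟨ψ, hψ, k, hk0, hk1, hψk, Or.inr (Or.inl ⟨hprim, ?_⟩)⟩
      rw [← hβ]
      have hz : onSphere zeroRoots5 = insert ((0 : ℂ) : Sphere) (onSphere {z : ℂ | z ^ 5 = 1}) := by
        ext z
        obtain rfl | rfl | ⟨z, hz0, rfl⟩ := sphere_cases z
        · simp [mem_onSphere, mem_zeroRoots5]
        · simp [infty_notMem_onSphere]
        · simp [mem_onSphere, mem_zeroRoots5]
      rw [hz]
      refine (Set.eq_of_subset_of_ncard_le (Set.insert_subset h0 hμ) ?_ hβf).symm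
      rw [hβ6, Set.ncard_insert_of_notMem (by simp [mem_onSphere])
        (show (onSphere _).Finite from Set.Finite.image _ (finite_rootsOfUnity 5)),
        ncard_onSphere, ncard_rootsOfUnity]
    -- Five points form the orbit of 1, so the sixth is a fixed point. When it is ∞, the inversion
    -- moves it to 0.
    · have hi : ∞ ∈ β := by
        by_contra hi
        have hsub : β ⊆ onSphere {z : ℂ | z ^ 5 = 1} := by
          intro z hz
          obtain rfl | rfl | ⟨z, hz0, rfl⟩ := sphere_cases z
          · exact absurd hz h0
          · exact absurd hz hi
          · exact mem_onSphere.2 (hT5 z hz0 hz)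
        have := Set.ncard_le_ncard hsub (Set.Finite.image _ (finite_rootsOfUnity 5))
        rw [ncard_onSphere, ncard_rootsOfUnity, hβ6] at this
        omega
      refine ⟨inv 1 * ψ, mul_mem (inv_mem_LFT 1) hψ, k⁻¹, inv_ne_zero hk0, by simpa using hk1, ?_,
        Or.inr (Or.inl ⟨hprim.inv, ?_⟩)⟩
      · rw [← inv_conj_rot hk0, ← hψk]; group
      · rw [image_mul, ← hβ]
        ext z
        rw [mem_image_perm, inv_inv_LFT one_ne_zero]
        obtain rfl | rfl | ⟨z, hz0, rfl⟩ := sphere_cases z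
        · rw [inv_zero one_ne_zero, mem_onSphere, mem_zeroRoots5]
          simp [hi]
        · rw [inv_infty one_ne_zero]
          simp [infty_notMem_onSphere, h0]
        · rw [inv_coe one_ne_zero hz0, mem_onSphere, mem_zeroRoots5]
          constructor
          · intro hz
            have := hT5 _ (div_ne_zero one_ne_zero hz0) hz
            rw [div_pow, one_pow, div_eq_one_iff_eq (pow_ne_zero _ hz0)] at this
            exact Or.inr this.symm
          · rintro (hz | hz)
            · exact absurd hz hz0
            · exact hμ' _ (by rw [div_pow, hz, one_pow, div_one])
  · -- order six
    refine ⟨ψ, hψ, k, hk0, hk1, hψk, Or.inl ⟨hprim, ?_⟩⟩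
    rw [← hβ]
    have hz : roots6 = {z : ℂ | z ^ 6 = 1} := by
      ext z; exact mem_roots6
    rw [hz]
    refine (Set.eq_of_subset_of_ncard_le hμ ?_ hβf).symm
    rw [hβ6, ncard_onSphere, ncard_rootsOfUnity]

end SixPoints

end

noncomputable section
namespace SixPoints
open scoped OnePoint Pointwise

/-! ### The groups of the normal forms -/

theorem image_eq_of_forall_mem {χ : Equiv.Perm Sphere} {S T : Set Sphere} (hS : S.ncard = 6)
    (hT : T.ncard = 6) (h : ∀ z ∈ S, χ z ∈ T) : χ '' S = T := by
  refine Set.eq_of_subset_of_ncard_le (Set.image_subset_iff.2 h) ?_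
    (Set.finite_of_ncard_ne_zero (by omega))
  rw [hT, ncard_image_perm _ hS]

theorem mem_A_of_forall_mem {χ : Equiv.Perm Sphere} {S : Set Sphere} (hS : S.ncard = 6)
    (hχ : χ ∈ LFT) (h : ∀ z ∈ S, χ z ∈ S) : χ ∈ A S :=
  mem_A.2 ⟨hχ, image_eq_of_forall_mem hS hS h⟩

theorem onSphere_pm (a b : ℂ) : onSphere (pm a b) = Set.range ![((1 : ℂ) : Sphere),
    ((-1 : ℂ) : Sphere), (a : Sphere), ((-a : ℂ) : Sphere), (b : Sphere), ((-b : ℂ) : Sphere)] := by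
  rw [range_six, onSphere, pm]
  simp only [Set.image_insert_eq, Set.image_singleton]

theorem onSphere_hex (a : ℂ) : onSphere (hex a) = Set.range ![((1 : ℂ) : Sphere),
    ((ζ 3 : ℂ) : Sphere), ((ζ 3 ^ 2 : ℂ) : Sphere), (a : Sphere), ((a * ζ 3 : ℂ) : Sphere),
    ((a * ζ 3 ^ 2 : ℂ) : Sphere)] := by
  rw [range_six, onSphere, hex]
  simp only [Set.image_insert_eq, Set.image_singleton]

theorem onSphere_roots6 : onSphere roots6 = Set.range ![((1 : ℂ) : Sphere),
    ((ζ 6 : ℂ) : Sphere), ((ζ 6 ^ 2 : ℂ) : Sphere), ((ζ 6 ^ 3 : ℂ) : Sphere),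
    ((ζ 6 ^ 4 : ℂ) : Sphere), ((ζ 6 ^ 5 : ℂ) : Sphere)] := by
  rw [range_six, onSphere, roots6]
  simp only [Set.image_insert_eq, Set.image_singleton]

theorem onSphere_zeroRoots5 : onSphere zeroRoots5 = Set.range ![((0 : ℂ) : Sphere),
    ((1 : ℂ) : Sphere), ((ζ 5 : ℂ) : Sphere), ((ζ 5 ^ 2 : ℂ) : Sphere), ((ζ 5 ^ 3 : ℂ) : Sphere),
    ((ζ 5 ^ 4 : ℂ) : Sphere)] := by
  rw [range_six, onSphere, zeroRoots5]
  simp only [Set.image_insert_eq, Set.image_singleton]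

theorem octahedron_eq : octahedron = Set.range ![∞, ((0 : ℂ) : Sphere),
    ((1 : ℂ) : Sphere), ((Complex.I : ℂ) : Sphere), ((-1 : ℂ) : Sphere),
    ((-Complex.I : ℂ) : Sphere)] := by
  rw [range_six, octahedron, onSphere]
  simp only [Set.image_insert_eq, Set.image_singleton]

theorem ncard_roots6 : (onSphere roots6).ncard = 6 := by
  have : roots6 = {z : ℂ | z ^ 6 = 1} := by
    ext z; exact mem_roots6
  rw [ncard_onSphere, this, ncard_rootsOfUnity]

theorem ncard_zeroRoots5 : (onSphere zeroRoots5).ncard = 6 := by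
  have : zeroRoots5 = insert 0 {z : ℂ | z ^ 5 = 1} := by
    ext z; exact mem_zeroRoots5
  rw [ncard_onSphere, this, Set.ncard_insert_of_notMem (by simp) (finite_rootsOfUnity 5),
    ncard_rootsOfUnity]

theorem ncard_octahedron : octahedron.ncard = 6 := by
  have : octahedron = insert ∞ (onSphere (insert 0 {z : ℂ | z ^ 4 = 1})) := by
    ext z
    obtain rfl | rfl | ⟨z, hz0, rfl⟩ := sphere_cases z
    · simp [mem_octahedron, mem_onSphere]
    · simp [infty_mem_octahedron]
    · simp [mem_octahedron, mem_onSphere]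
  have hf := (finite_rootsOfUnity 4).insert 0
  rw [this, Set.ncard_insert_of_notMem (infty_notMem_onSphere _)
    (show (onSphere _).Finite from Set.Finite.image _ hf), ncard_onSphere,
    Set.ncard_insert_of_notMem (by simp) (finite_rootsOfUnity 4), ncard_rootsOfUnity]

theorem cube_ne_one {a : ℂ} (ha : HexParam a) : a ^ 3 ≠ 1 := by
  intro h
  obtain ⟨i, hi, rfl⟩ := (isPrimitiveRoot_ζ 3).eq_pow_of_pow_eq_one h
  obtain ⟨-, h1, h2, h3⟩ := ha
  interval_cases i <;> simp_all

theorem HexParam.ne_zero {a : ℂ} (ha : HexParam a) : a ≠ 0 := by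
  rintro rfl
  have := ha.1
  norm_num at this

theorem ncard_hex {a : ℂ} (ha : HexParam a) : (onSphere (hex a)).ncard = 6 := by
  have : hex a = {z : ℂ | z ^ 3 = 1} ∪ {z : ℂ | z ^ 3 = a ^ 3} := by
    ext z; exact mem_hex
  rw [ncard_onSphere, this, Set.ncard_union_eq (disjoint_rootsOf (cube_ne_one ha).symm)
    (finite_rootsOfUnity 3) (finite_rootsOf 3 ha.ne_zero), ncard_rootsOfUnity,
    ncard_rootsOf 3 ha.ne_zero]

theorem ncard_pm {a b : ℂ} (h : PmParam a b) : (onSphere (pm a b)).ncard = 6 := by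
  have hpm : pm a b = ({z : ℂ | z ^ 2 = 1} ∪ {z : ℂ | z ^ 2 = a ^ 2}) ∪ {z : ℂ | z ^ 2 = b ^ 2} := by
    ext z; rw [mem_pm]; exact or_assoc.symm
  obtain ⟨h1, h2, h3, h4, h5, h6, h7, h8⟩ := h
  have ha1 : (1 : ℂ) ≠ a ^ 2 := fun h => (sq_eq_one_iff.1 h.symm).elim h4 h5
  have hb1 : (1 : ℂ) ≠ b ^ 2 := fun h => (sq_eq_one_iff.1 h.symm).elim h7 h8
  have hab : a ^ 2 ≠ b ^ 2 := fun h => (sq_eq_sq_iff_eq_or_eq_neg.1 h).elim h1 h2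
  rw [ncard_onSphere, hpm, Set.ncard_union_eq (Set.disjoint_union_left.2
    ⟨disjoint_rootsOf hb1, disjoint_rootsOf hab⟩)
    ((finite_rootsOfUnity 2).union (finite_rootsOf 2 h3)) (finite_rootsOf 2 h6),
    Set.ncard_union_eq (disjoint_rootsOf ha1) (finite_rootsOfUnity 2)
    (finite_rootsOf 2 h3), ncard_rootsOfUnity, ncard_rootsOf 2 h3, ncard_rootsOf 2 h6]

/-- Together with `ncard_pm` this makes admissibility a condition on the set alone, so it passes to
any image under a transformation. -/
theorem pmParam_of_ncard {a b : ℂ} (h : (onSphere (pm a b)).ncard = 6) : PmParam a b := by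
  have hi := injective_of_range_ncard (onSphere_pm a b).symm h
  have key : ∀ i j : Fin 6, i ≠ j → (![1, -1, a, -a, b, -b] : Fin 6 → ℂ) i ≠
      (![1, -1, a, -a, b, -b] : Fin 6 → ℂ) j := by
    intro i j hij e
    apply hij
    apply hi
    fin_cases i <;> fin_cases j <;> simp at e hij ⊢ <;> exact e
  refine ⟨key 2 4 (by decide), key 2 5 (by decide), fun h => key 2 3 (by decide) ?_,
    key 2 0 (by decide), key 2 1 (by decide), fun h => key 4 5 (by decide) ?_,
    key 4 0 (by decide), key 4 1 (by decide)⟩ <;> simp [h]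

theorem mob_coe {a b c d z : ℂ} (h : a * d - b * c ≠ 0) (hz : c * z + d ≠ 0) :
    mob a b c d (z : Sphere) = (((a * z + b) / (c * z + d) : ℂ) : Sphere) := by
  rw [mob_apply h]
  simp [hc_coe, hz]

theorem mob_pole {a b c d z : ℂ} (h : a * d - b * c ≠ 0) (hz : c * z + d = 0) :
    mob a b c d (z : Sphere) = ∞ := by
  rw [mob_apply h]
  simp [hc_coe, hz]

theorem mob_infty {a b c d : ℂ} (h : a * d - b * c ≠ 0) (hc : c ≠ 0) :
    mob a b c d ∞ = ((a / c : ℂ) : Sphere) := by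
  rw [mob_apply h]
  simp [hc_infty, hc]

/-- The involution `z ↦ s² / z` exchanges 0 with ∞, 1 with s² and -1 with -s². The map `z ↦ (z - s)
/ (z + s)` turns it into `z ↦ -z`, so the six points become three opposite pairs. -/
theorem image_zero_infty_pm {s : ℂ} (h0 : s ≠ 0) (h1 : s ≠ 1) (h2 : s ≠ -1) :
    mob 1 (-s) 1 s '' {((0 : ℂ) : Sphere), ∞, ((1 : ℂ) : Sphere), ((-1 : ℂ) : Sphere),
      ((s ^ 2 : ℂ) : Sphere), ((-s ^ 2 : ℂ) : Sphere)} =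
      onSphere (pm ((1 - s) / (1 + s)) ((1 + s) / (1 - s))) := by
  have h1' : 1 - s ≠ 0 := sub_ne_zero.2 h1.symm
  have h1'' : s - 1 ≠ 0 := sub_ne_zero.2 h1
  have h2' : 1 + s ≠ 0 := fun h => h2 (eq_neg_of_add_eq_zero_right h)
  have h2'' : s + 1 ≠ 0 := by rwa [add_comm]
  have hd : 1 * s - -s * 1 ≠ 0 := by
    ring_nf
    exact mul_ne_zero h0 two_ne_zero
  have e0 : mob 1 (-s) 1 s ((0 : ℂ) : Sphere) = ((-1 : ℂ) : Sphere) := by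
    rw [mob_coe hd (by simpa)]
    simp [h0]
  have e1 : mob 1 (-s) 1 s ((1 : ℂ) : Sphere) = (((1 - s) / (1 + s) : ℂ) : Sphere) := by
    rw [mob_coe hd (by simpa)]
    congr 2 <;> ring
  have e2 : mob 1 (-s) 1 s ((-1 : ℂ) : Sphere) = (((1 + s) / (1 - s) : ℂ) : Sphere) := by
    have : 1 * (-1) + s ≠ 0 := by
      rw [show 1 * (-1) + s = s - 1 by ring]
      exact h1''
    rw [mob_coe hd this]
    congr 1
    rw [div_eq_div_iff this h1']
    ring
  have e3 : mob 1 (-s) 1 s ((s ^ 2 : ℂ) : Sphere) = ((-((1 - s) / (1 + s)) : ℂ) : Sphere) := by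
    have : 1 * s ^ 2 + s ≠ 0 := by
      rw [show 1 * s ^ 2 + s = s * (1 + s) by ring]
      exact mul_ne_zero h0 h2'
    rw [mob_coe hd this]
    congr 1
    field_simp
    ring
  have e4 : mob 1 (-s) 1 s ((-s ^ 2 : ℂ) : Sphere) = ((-((1 + s) / (1 - s)) : ℂ) : Sphere) := by
    have : 1 * (-s ^ 2) + s ≠ 0 := by
      rw [show 1 * (-s ^ 2) + s = s * (1 - s) by ring]
      exact mul_ne_zero h0 h1'
    rw [mob_coe hd this]
    congr 1
    rw [neg_div', div_eq_div_iff this h1']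
    ring
  have ei : mob 1 (-s) 1 s ∞ = ((1 : ℂ) : Sphere) := by
    rw [mob_infty hd one_ne_zero, div_one]
  simp only [Set.image_insert_eq, Set.image_singleton, e0, e1, e2, e3, e4, ei]
  rw [onSphere_pm, range_six]
  ext z
  simp only [Set.mem_insert_iff, Set.mem_singleton_iff]
  tauto

/-- The normal forms of sets of six points with a nontrivial group. -/
theorem exists_normal_form_pm {α : Set Sphere} (hα : α.ncard = 6) {h : Equiv.Perm Sphere}
    (hh : h ∈ A α) (h1 : h ≠ 1) : ∃ ψ ∈ LFT, ψ '' α = onSphere roots6 ∨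
      ψ '' α = onSphere zeroRoots5 ∨ ψ '' α = octahedron ∨
      (∃ a, HexParam a ∧ ψ '' α = onSphere (hex a)) ∨
      (h ^ 2 = 1 ∧ ∃ a b, PmParam a b ∧ ψ '' α = onSphere (pm a b)) := by
  obtain ⟨ψ, hψ, k, -, -, hk, hc⟩ := exists_normal_form hα hh h1
  have key : ∀ χ ∈ LFT, ∀ a b, χ '' α = onSphere (pm a b) → PmParam a b := by
    intro χ hχ a b e
    apply pmParam_of_ncard
    rw [← e, ncard_image_perm _ hα]
  have hsq : k = -1 → h ^ 2 = 1 := by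
    rintro rfl
    have : (ψ * h * ψ⁻¹) ^ 2 = 1 := by
      rw [hk, rot_pow (by norm_num)]
      norm_num [rot_one]
    rwa [conj_pow, conj_eq_one_iff] at this
  rcases hc with ⟨-, h⟩ | ⟨-, h⟩ | ⟨-, h⟩ | ⟨-, h⟩ | ⟨hk1, a, b, h⟩ | ⟨hk1, a, h⟩
  · exact ⟨ψ, hψ, Or.inl h⟩
  · exact ⟨ψ, hψ, Or.inr (Or.inl h)⟩
  · exact ⟨ψ, hψ, Or.inr (Or.inr (Or.inl h))⟩
  · exact ⟨ψ, hψ, Or.inr (Or.inr (Or.inr (Or.inl h)))⟩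
  · exact ⟨ψ, hψ, Or.inr (Or.inr (Or.inr (Or.inr ⟨hsq hk1, a, b, key ψ hψ a b h, h⟩)))⟩
  · obtain ⟨s, hs⟩ := IsAlgClosed.exists_pow_nat_eq a (n := 2) two_pos
    have h6 : (ψ '' α).ncard = 6 := ncard_image_perm _ hα
    rw [h] at h6
    have hi := injective_of_range_ncard (range_six _ _ _ _ _ _) h6
    have h0' : s ≠ 0 := by
      rintro rfl
      exact absurd (hi (a₁ := 0) (a₂ := 4) (by simp [← hs])) (by decide)
    have h1' : s ≠ 1 := by
      rintro rfl
      exact absurd (hi (a₁ := 2) (a₂ := 4) (by simp [← hs])) (by decide)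
    have h2' : s ≠ -1 := by
      rintro rfl
      exact absurd (hi (a₁ := 2) (a₂ := 4) (by simp [← hs])) (by decide)
    rw [← hs] at h
    have e := image_zero_infty_pm h0' h1' h2'
    rw [← h, ← image_mul] at e
    have hm := mul_mem (mob_mem 1 (-s) 1 s) hψ
    exact ⟨_, hm, Or.inr (Or.inr (Or.inr (Or.inr ⟨hsq hk1, _, _, key _ hm _ _ e, e⟩)))⟩

/-- A polynomial of degree less than `n` that vanishes at all `n`-th roots of unity is zero, by the
Vandermonde determinant. -/
theorem coeff_eq_zero {n : ℕ} [NeZero n] (c : Fin n → ℂ)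
    (h : ∀ x : ℂ, x ^ n = 1 → ∑ i : Fin n, x ^ (i : ℕ) * c i = 0) : c = 0 := by
  have hi : Function.Injective fun j : Fin n => ζ n ^ (j : ℕ) := fun i j e =>
    Fin.ext ((isPrimitiveRoot_ζ n).pow_inj i.2 j.2 e)
  refine Matrix.eq_zero_of_forall_index_sum_pow_mul_eq_zero hi fun j => h _ ?_
  rw [← pow_mul, mul_comm, pow_mul, ζ_pow, one_pow]

theorem lf_coe_eq {g : GL (Fin 2) ℂ} {z w : ℂ} (h : lf g (z : Sphere) = (w : Sphere)) :
    g 1 0 * z + g 1 1 ≠ 0 ∧ g 0 0 * z + g 0 1 = w * (g 1 0 * z + g 1 1) := by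
  have hn := num_eq g z
  have hd := den_eq g z
  have ht := tf_ne g z
  rw [h] at hn hd
  simp only [num, den, hc_coe, mul_one] at hn hd
  refine ⟨by rwa [hd], ?_⟩
  rw [hn, hd, mul_comm]

theorem lf_eq_rot {g : GL (Fin 2) ℂ} (h1 : g 0 1 = 0) (h2 : g 1 0 = 0) :
    ∃ k, k ≠ 0 ∧ lf g = rot k := by
  have hdet := det_ne g
  rw [← det_eq, h1, h2, zero_mul, sub_zero] at hdet
  have h00 := left_ne_zero_of_mul hdet
  have h11 := right_ne_zero_of_mul hdet
  refine ⟨g 0 0 / g 1 1, div_ne_zero h00 h11, ?_⟩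
  rw [rot_eq_lf (div_ne_zero h00 h11)]
  refine lf_eq_of_scalar (k := g 1 1) fun i j => ?_
  fin_cases i <;> fin_cases j <;> simp [gl_val, h1, h2]
  field_simp

theorem lf_eq_inv {g : GL (Fin 2) ℂ} (h1 : g 0 0 = 0) (h2 : g 1 1 = 0) :
    ∃ k, k ≠ 0 ∧ lf g = inv k := by
  have hdet := det_ne g
  rw [← det_eq, h1, h2, zero_mul, zero_sub, neg_ne_zero] at hdet
  have h01 := left_ne_zero_of_mul hdet
  have h10 := right_ne_zero_of_mul hdet
  refine ⟨g 0 1 / g 1 0, div_ne_zero h01 h10, ?_⟩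
  rw [inv_eq_lf (div_ne_zero h01 h10)]
  refine lf_eq_of_scalar (k := g 1 0) fun i j => ?_
  fin_cases i <;> fin_cases j <;> simp [gl_val, h1, h2]
  field_simp

/-- With matrix entries `p, q, r, s`, invariance says that `(p x + q) ^ 6 - (r x + s) ^ 6` vanishes
on the sixth roots of unity. All coefficients of its reduction modulo `x ^ 6 - 1` are then zero, and
this leaves only diagonal and antidiagonal matrices. -/
theorem mem_A_roots6 {f : Equiv.Perm Sphere} :
    f ∈ A (onSphere roots6) ↔ ∃ k : ℂ, k ^ 6 = 1 ∧ (f = rot k ∨ f = inv k) := by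
  constructor
  · intro hf
    obtain ⟨g, rfl⟩ := exists_lf hf.1
    have hx : ∀ x : ℂ, x ^ 6 = 1 →
        (g 0 0 * x + g 0 1) ^ 6 = (g 1 0 * x + g 1 1) ^ 6 := by
      intro x hx
      obtain ⟨w, hw, e⟩ := exists_of_mem_onSphere
        (apply_mem_of_mem_A hf (mem_onSphere.2 (mem_roots6.2 hx)))
      obtain ⟨-, h⟩ := lf_coe_eq e
      rw [h, mul_pow, mem_roots6.1 hw, one_mul]
    set p := g 0 0 with hp
    set q := g 0 1 with hq
    set r := g 1 0 with hr
    set s := g 1 1 with hs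
    have hdet : p * s - q * r ≠ 0 := by rw [det_eq]; exact det_ne g
    -- Coefficients after reduction modulo `x ^ 6 - 1`; the terms of degree six have moved into the
    -- constant one.
    have hc := coeff_eq_zero (n := 6) ![q ^ 6 + p ^ 6 - s ^ 6 - r ^ 6, 6 * (p * q ^ 5 - r * s ^ 5),
      15 * (p ^ 2 * q ^ 4 - r ^ 2 * s ^ 4), 20 * (p ^ 3 * q ^ 3 - r ^ 3 * s ^ 3),
      15 * (p ^ 4 * q ^ 2 - r ^ 4 * s ^ 2), 6 * (p ^ 5 * q - r ^ 5 * s)] (by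
        intro x h6
        simp only [Fin.sum_univ_succ]
        simp
        linear_combination hx x h6 + (r ^ 6 - p ^ 6) * h6)
    have h1 := congrFun hc 1
    have h2 := congrFun hc 2
    have h5 := congrFun hc 5
    simp [sub_eq_zero] at h1 h2 h5
    have hfin : ∀ k : ℂ, k ≠ 0 → lf g = rot k ∨ lf g = inv k → k ^ 6 = 1 := by
      intro k hk h
      have hz : lf g ((1 : ℂ) : Sphere) = (k : Sphere) := by
        rcases h with h | h <;> rw [h]
        · rw [rot_coe hk, mul_one]
        · rw [inv_coe hk one_ne_zero, div_one]
      have := apply_mem_of_mem_A hf (mem_onSphere.2 (mem_roots6.2 (one_pow 6)))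
      rw [hz] at this
      exact mem_roots6.1 (mem_onSphere.1 this)
    by_cases hq0 : q = 0
    · rw [hq0] at h1 hdet
      have hs0 : s ≠ 0 := by rintro h; simp [h] at hdet
      have hr0 : r = 0 := by simpa [hs0] using h1.symm
      obtain ⟨k, hk, e⟩ := lf_eq_rot hq0 hr0
      exact ⟨k, hfin k hk (Or.inl e), Or.inl e⟩
    by_cases hp0 : p = 0
    · rw [hp0] at h1 hdet
      have hr0 : r ≠ 0 := by rintro h; simp [h] at hdet
      have hs0 : s = 0 := by simpa [hr0] using h1.symm
      obtain ⟨k, hk, e⟩ := lf_eq_inv hp0 hs0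
      exact ⟨k, hfin k hk (Or.inr e), Or.inr e⟩
    exfalso
    have hrs : r * s ^ 5 ≠ 0 := h1 ▸ mul_ne_zero hp0 (pow_ne_zero _ hq0)
    -- From `p q⁵ = r s⁵` and `p² q⁴ = r² s⁴` with nonzero entries, division would give `p s = q r`,
    -- against invertibility.
    have : p * q ^ 4 * (r * s ^ 4) * (p * s - q * r) = 0 := by
      linear_combination (r * s ^ 5) * h2 - r ^ 2 * s ^ 4 * h1
    have hr0 := left_ne_zero_of_mul hrs
    have hs0 : s ≠ 0 := by rintro h; simp [h] at hrs
    simp [hdet, hp0, hq0, hr0, hs0] at this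
  · rintro ⟨k, hk, h⟩
    have hk0 : k ≠ 0 := by rintro rfl; norm_num at hk
    refine mem_A_of_forall_mem ncard_roots6
      (by rcases h with rfl | rfl; exacts [rot_mem _, inv_mem_LFT _]) fun z hz => ?_
    obtain ⟨w, hw, rfl⟩ := exists_of_mem_onSphere hz
    rw [mem_roots6] at hw
    have hw0 : w ≠ 0 := by rintro rfl; norm_num at hw
    rcases h with rfl | rfl
    · rw [rot_coe hk0, mem_onSphere, mem_roots6, mul_pow, hk, hw, one_mul]
    · rw [inv_coe hk0 hw0, mem_onSphere, mem_roots6, div_pow, hk, hw, one_div_one]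

/-- The five roots and 0 are the zeros of `y (y ^ 5 - 1)`. Homogenising, substituting and reducing
modulo `x ^ 5 - 1` gives the coefficient equations; the point 0 contributes one more equation. -/
theorem mem_A_zeroRoots5 {f : Equiv.Perm Sphere} :
    f ∈ A (onSphere zeroRoots5) ↔ ∃ k : ℂ, k ^ 5 = 1 ∧ f = rot k := by
  constructor
  · intro hf
    obtain ⟨g, rfl⟩ := exists_lf hf.1
    have hx : ∀ x : ℂ, x = 0 ∨ x ^ 5 = 1 → (g 0 0 * x + g 0 1) *
        ((g 0 0 * x + g 0 1) ^ 5 - (g 1 0 * x + g 1 1) ^ 5) = 0 := by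
      intro x hx
      obtain ⟨w, hw, e⟩ := exists_of_mem_onSphere
        (apply_mem_of_mem_A hf (mem_onSphere.2 (mem_zeroRoots5.2 hx)))
      obtain ⟨-, h⟩ := lf_coe_eq e
      rw [h]
      rcases mem_zeroRoots5.1 hw with rfl | hw
      · simp
      · rw [mul_pow, hw]; ring
    set p := g 0 0 with hp
    set q := g 0 1 with hq
    set r := g 1 0 with hr
    set s := g 1 1 with hs
    have hdet : p * s - q * r ≠ 0 := by rw [det_eq]; exact det_ne g
    have h0 : q * (q ^ 5 - s ^ 5) = 0 := by simpa using hx 0 (Or.inl rfl)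
    have hc := coeff_eq_zero (n := 5)
      ![q * (q ^ 5 - s ^ 5) + 6 * p ^ 5 * q - 5 * p * r ^ 4 * s - q * r ^ 5,
        6 * p * q ^ 5 - p * s ^ 5 - 5 * q * r * s ^ 4 + p ^ 6 - p * r ^ 5,
        5 * (3 * p ^ 2 * q ^ 4 - p * r * s ^ 4 - 2 * q * r ^ 2 * s ^ 3),
        10 * (2 * p ^ 3 * q ^ 3 - p * r ^ 2 * s ^ 3 - q * r ^ 3 * s ^ 2),
        5 * (3 * p ^ 4 * q ^ 2 - 2 * p * r ^ 3 * s ^ 2 - q * r ^ 4 * s)] (by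
        intro x h5
        simp only [Fin.sum_univ_succ]
        simp
        linear_combination hx x (Or.inr h5) - (p ^ 6 * x + 6 * p ^ 5 * q - p * r ^ 5 * x -
          5 * p * r ^ 4 * s - q * r ^ 5) * h5)
    have h2 := congrFun hc 2
    have h3 := congrFun hc 3
    simp at h2 h3
    by_cases hq0 : q = 0
    · rw [hq0] at h2 hdet
      have hps : p * s ≠ 0 := by simpa using hdet
      have hp0 := left_ne_zero_of_mul hps
      have hs0 := right_ne_zero_of_mul hps
      have hr0 : r = 0 := by simpa [hp0, hs0] using h2
      obtain ⟨k, hk, e⟩ := lf_eq_rot hq0 hr0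
      refine ⟨k, ?_, e⟩
      have := apply_mem_of_mem_A hf (mem_onSphere.2 (mem_zeroRoots5.2 (Or.inr (one_pow 5))))
      rw [e, rot_coe hk, mul_one] at this
      exact (mem_zeroRoots5.1 (mem_onSphere.1 this)).resolve_left hk
    · exfalso
      have h5 : q ^ 5 = s ^ 5 := by simpa [hq0, sub_eq_zero] using h0
      have hs0 : s ≠ 0 := by
        rintro h
        rw [h, zero_pow (by norm_num)] at h5
        exact hq0 (eq_zero_of_pow_eq_zero h5)
      -- If `q ≠ 0`, the equation at 0 gives `q ^ 5 = s ^ 5`. With it the coefficient of `x ^ 2`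
      -- factors and that of `x ^ 3` becomes a relation between `p s` and `q r`; together they force
      -- `q r = 0` and hence a singular matrix.
      have e2 : (3 * p * s + 2 * q * r) * (p * s - q * r) = 0 := by
        apply mul_left_cancel₀ (pow_ne_zero 4 hq0)
        linear_combination s ^ 2 * h2 - (s * p * r + 2 * q * r ^ 2) * h5
      have e2' : 3 * p * s + 2 * q * r = 0 := by simpa [hdet] using e2
      have e3 : 2 * (p * s) ^ 3 = p * s * (q * r) ^ 2 + (q * r) ^ 3 := by
        apply mul_left_cancel₀ (pow_ne_zero 3 hq0)
        linear_combination s ^ 3 * h3 - (s * p * r ^ 2 + q * r ^ 3) * h5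
      have hps : p * s = -2 / 3 * (q * r) := by linear_combination e2' / 3
      rw [hps] at e3 hdet
      have hqr : (q * r) ^ 3 = 0 := by linear_combination (-27 / 25) * e3
      rw [eq_zero_of_pow_eq_zero hqr] at hdet
      norm_num at hdet
  · rintro ⟨k, hk, rfl⟩
    have hk0 : k ≠ 0 := by rintro rfl; norm_num at hk
    refine mem_A_of_forall_mem ncard_zeroRoots5 (rot_mem _) fun z hz => ?_
    obtain ⟨w, hw, rfl⟩ := exists_of_mem_onSphere hz
    rw [mem_zeroRoots5] at hw
    rw [rot_coe hk0, mem_onSphere, mem_zeroRoots5, mul_pow, hk, one_mul]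
    rcases hw with rfl | hw
    · simp
    · exact Or.inr hw

end SixPoints

end

noncomputable section
namespace SixPoints
open scoped OnePoint Pointwise

/-! ### Cyclic and dihedral groups of linear fractional transformations -/

/-- The character `j ↦ e^{2πij/n}` of `ℤ/n`. -/
def chi (n : ℕ) [NeZero n] : AddChar (ZMod n) ℂ := ZMod.stdAddChar

theorem chi_one (n : ℕ) [NeZero n] : chi n 1 = ζ n := by
  have := ZMod.stdAddChar_coe (N := n) 1
  rw [Int.cast_one] at this
  rw [chi, this, ζ]
  norm_num

theorem chi_natCast (n : ℕ) [NeZero n] (j : ℕ) : chi n j = ζ n ^ j := by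
  rw [← chi_one, ← AddChar.map_nsmul_eq_pow, nsmul_one]

theorem chi_val (n : ℕ) [NeZero n] (i : ZMod n) : chi n i = ζ n ^ i.val := by
  rw [← chi_natCast, ZMod.natCast_zmod_val]

theorem chi_injective (n : ℕ) [NeZero n] : Function.Injective (chi n) :=
  ZMod.injective_stdAddChar

theorem chi_ne_zero {n : ℕ} [NeZero n] (χ : AddChar (ZMod n) ℂ) (i : ZMod n) : χ i ≠ 0 := by
  intro h
  have := AddChar.map_add_eq_mul χ i (-i)
  rw [add_neg_cancel, AddChar.map_zero_eq_one, h, zero_mul] at this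
  exact one_ne_zero this

theorem chi_neg {n : ℕ} [NeZero n] (χ : AddChar (ZMod n) ℂ) (i : ZMod n) : χ (-i) = (χ i)⁻¹ :=
  AddChar.map_neg_eq_inv χ i

theorem chi_pow {n : ℕ} [NeZero n] (χ : AddChar (ZMod n) ℂ) (i : ZMod n) : χ i ^ n = 1 := by
  rw [← AddChar.map_nsmul_eq_pow]
  simp

theorem exists_chi {n : ℕ} [NeZero n] {k : ℂ} (h : k ^ n = 1) : ∃ i, k = chi n i := by
  obtain ⟨j, -, rfl⟩ := (isPrimitiveRoot_ζ n).eq_pow_of_pow_eq_one h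
  exact ⟨j, (chi_natCast n j).symm⟩

/-- The rotations `z ↦ χ(j) z`. -/
def cycLF (n : ℕ) [NeZero n] : Multiplicative (ZMod n) →* Equiv.Perm Sphere where
  toFun x := rot (chi n x.toAdd)
  map_one' := by simp [rot_one]
  map_mul' _ _ := by
    rw [rot_mul_rot (chi_ne_zero _ _) (chi_ne_zero _ _), toAdd_mul, AddChar.map_add_eq_mul]

theorem cycLF_injective (n : ℕ) [NeZero n] : Function.Injective (cycLF n) := fun _ _ h =>
  Multiplicative.toAdd.injective (chi_injective n (rot_injective (chi_ne_zero _ _)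
    (chi_ne_zero _ _) h))

theorem mem_range_cycLF {n : ℕ} [NeZero n] {f : Equiv.Perm Sphere} :
    f ∈ (cycLF n).range ↔ ∃ k : ℂ, k ^ n = 1 ∧ f = rot k := by
  constructor
  · rintro ⟨x, rfl⟩
    exact ⟨_, chi_pow _ _, rfl⟩
  · rintro ⟨k, hk, rfl⟩
    obtain ⟨i, rfl⟩ := exists_chi hk
    exact ⟨Multiplicative.ofAdd i, rfl⟩

theorem range_cycLF (n : ℕ) [NeZero n] : (cycLF n).range = Subgroup.closure {rot (ζ n)} := by
  apply le_antisymm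
  · intro f hf
    obtain ⟨k, hk, rfl⟩ := mem_range_cycLF.1 hf
    obtain ⟨j, -, rfl⟩ := (isPrimitiveRoot_ζ n).eq_pow_of_pow_eq_one hk
    rw [← rot_pow (ζ_ne_zero n)]
    exact pow_mem (Subgroup.subset_closure (Set.mem_singleton _)) j
  · rw [Subgroup.closure_le, Set.singleton_subset_iff]
    exact mem_range_cycLF.2 ⟨_, ζ_pow n, rfl⟩

/-- The transformations `z ↦ χ(j) z` and `z ↦ c χ(-j) / z`. -/
def dihLF (n : ℕ) [NeZero n] {c : ℂ} (hc : c ≠ 0) : DihedralGroup n →* Equiv.Perm Sphere where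
  toFun
    | .r i => rot (chi n i)
    | .sr i => inv (c * chi n (-i))
  map_one' := by
    change rot (chi n 0) = 1
    simp [rot_one]
  map_mul' := by
    have h := chi_ne_zero (chi n)
    rintro (i | i) (j | j)
    · change rot (chi n (i + j)) = rot (chi n i) * rot (chi n j)
      rw [rot_mul_rot (h _) (h _), AddChar.map_add_eq_mul]
    · change inv (c * chi n (-(j - i))) = rot (chi n i) * inv (c * chi n (-j))
      rw [rot_mul_inv (h _) (mul_ne_zero hc (h _)), neg_sub, sub_eq_add_neg,
        AddChar.map_add_eq_mul, mul_left_comm]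
    · change inv (c * chi n (-(i + j))) = inv (c * chi n (-i)) * rot (chi n j)
      rw [inv_mul_rot (mul_ne_zero hc (h _)) (h _), neg_add, AddChar.map_add_eq_mul,
        chi_neg _ j, mul_div_assoc, div_eq_mul_inv]
    · change rot (chi n (j - i)) = inv (c * chi n (-i)) * inv (c * chi n (-j))
      rw [inv_mul_inv (mul_ne_zero hc (h _)) (mul_ne_zero hc (h _)), mul_div_mul_left _ _ hc,
        sub_eq_add_neg, AddChar.map_add_eq_mul, chi_neg _ j, div_inv_eq_mul, mul_comm]

theorem dihLF_r (n : ℕ) [NeZero n] {c : ℂ} (hc : c ≠ 0) (i : ZMod n) :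
    dihLF n hc (.r i) = rot (chi n i) := rfl

theorem dihLF_sr (n : ℕ) [NeZero n] {c : ℂ} (hc : c ≠ 0) (i : ZMod n) :
    dihLF n hc (.sr i) = inv (c * chi n (-i)) := rfl

theorem dihLF_injective (n : ℕ) [NeZero n] {c : ℂ} (hc : c ≠ 0) :
    Function.Injective (dihLF n hc) := by
  have h := chi_ne_zero (chi n)
  rintro (i | i) (j | j) e <;> simp only [dihLF_r, dihLF_sr] at e
  · rw [chi_injective n (rot_injective (h _) (h _) e)]
  · exact absurd e (rot_ne_inv (h _) (mul_ne_zero hc (h _)))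
  · exact absurd e.symm (rot_ne_inv (h _) (mul_ne_zero hc (h _)))
  · have := inv_injective_LFT (mul_ne_zero hc (h _)) (mul_ne_zero hc (h _)) e
    rw [neg_injective (chi_injective n (mul_left_cancel₀ hc this))]

theorem mem_range_dihLF {n : ℕ} [NeZero n] {c : ℂ} (hc : c ≠ 0) {f : Equiv.Perm Sphere} :
    f ∈ (dihLF n hc).range ↔ ∃ k : ℂ, k ^ n = 1 ∧ (f = rot k ∨ f = inv (c * k)) := by
  constructor
  · rintro ⟨i | i, rfl⟩
    · exact ⟨_, chi_pow _ _, Or.inl rfl⟩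
    · exact ⟨_, chi_pow _ _, Or.inr rfl⟩
  · rintro ⟨k, hk, rfl | rfl⟩ <;> obtain ⟨i, rfl⟩ := exists_chi hk
    · exact ⟨.r i, rfl⟩
    · exact ⟨.sr (-i), by rw [dihLF_sr, neg_neg]⟩

theorem range_dihLF (n : ℕ) [NeZero n] {c : ℂ} (hc : c ≠ 0) :
    (dihLF n hc).range = Subgroup.closure {rot (ζ n), inv c} := by
  apply le_antisymm
  · intro f hf
    obtain ⟨k, hk, h⟩ := (mem_range_dihLF hc).1 hf
    obtain ⟨j, -, rfl⟩ := (isPrimitiveRoot_ζ n).eq_pow_of_pow_eq_one hk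
    have hr : rot (ζ n ^ j) ∈ Subgroup.closure {rot (ζ n), inv c} := by
      rw [← rot_pow (ζ_ne_zero n)]
      exact pow_mem (Subgroup.subset_closure (by simp)) j
    rcases h with rfl | rfl
    · exact hr
    · rw [mul_comm, ← rot_mul_inv (pow_ne_zero _ (ζ_ne_zero n)) hc]
      exact mul_mem hr (Subgroup.subset_closure (by simp))
  · rw [Subgroup.closure_le]
    rintro _ (rfl | rfl)
    · exact (mem_range_dihLF hc).2 ⟨_, ζ_pow n, Or.inl rfl⟩
    · exact (mem_range_dihLF hc).2 ⟨1, one_pow _, Or.inr (by rw [mul_one])⟩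

/-- Puts the explicit model of the group in the form needed for `hasMultiplicityVector_of`: an
isomorphism with prescribed transformations in the coordinate `ψ`. -/
theorem exists_equiv_of_range {Γ : Type*} [Group Γ] {Θ : Γ →* Equiv.Perm Sphere}
    (hΘ : Function.Injective Θ) {α : Set Sphere} {ψ : Equiv.Perm Sphere} (hψ : ψ ∈ LFT)
    (h : A (ψ '' α) = Θ.range) : ∃ E : Γ ≃* A α, ∀ x, ψ * E x * ψ⁻¹ = Θ x := by
  refine ⟨((MonoidHom.ofInjective hΘ).trans (MulEquiv.subgroupCongr h.symm)).trans
    (conjA hψ).symm, fun x => ?_⟩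
  exact conjA_symm_spec hψ _

/-! ### Representations of dihedral and cyclic groups by matrices -/

/-- The one-dimensional representation given by a character. -/
def rep1 {Γ : Type*} [Group Γ] (χ : Γ →* ℂ) : Γ →* Matrix (Fin 1) (Fin 1) ℂ where
  toFun x := !![χ x]
  map_one' := by ext i j; fin_cases i; fin_cases j; simp
  map_mul' x y := by ext i j; fin_cases i; fin_cases j; simp

theorem rep1_apply {Γ : Type*} [Group Γ] (χ : Γ →* ℂ) (x : Γ) : rep1 χ x = !![χ x] := rfl

/-- The character of the dihedral group with the given values `χ(i)` and `ε χ(i)`. -/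
def dihChar {n : ℕ} [NeZero n] (χ : AddChar (ZMod n) ℂ) (hχ : ∀ i, χ i * χ i = 1) {ε : ℂ}
    (hε : ε * ε = 1) : DihedralGroup n →* ℂ where
  toFun
    | .r i => χ i
    | .sr i => ε * χ i
  map_one' := by
    change χ 0 = 1
    simp
  map_mul' := by
    have hn : ∀ i, χ (-i) = χ i := fun i => by
      rw [chi_neg, inv_eq_of_mul_eq_one_right (hχ i)]
    rintro (i | i) (j | j)
    · exact AddChar.map_add_eq_mul _ _ _
    · change ε * χ (j - i) = χ i * (ε * χ j)
      rw [sub_eq_add_neg, AddChar.map_add_eq_mul, hn]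
      ring
    · change ε * χ (i + j) = ε * χ i * χ j
      rw [AddChar.map_add_eq_mul]
      ring
    · change χ (j - i) = ε * χ i * (ε * χ j)
      rw [sub_eq_add_neg, AddChar.map_add_eq_mul, hn]
      linear_combination -χ i * χ j * hε

theorem dihChar_r {n : ℕ} [NeZero n] (χ : AddChar (ZMod n) ℂ) (hχ : ∀ i, χ i * χ i = 1) {ε : ℂ}
    (hε : ε * ε = 1) (i : ZMod n) : dihChar χ hχ hε (.r i) = χ i := rfl

theorem dihChar_sr {n : ℕ} [NeZero n] (χ : AddChar (ZMod n) ℂ) (hχ : ∀ i, χ i * χ i = 1) {ε : ℂ}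
    (hε : ε * ε = 1) (i : ZMod n) : dihChar χ hχ hε (.sr i) = ε * χ i := rfl

/-- The two-dimensional representation of the dihedral group given by a character of the
rotations. -/
def dihRep {n : ℕ} [NeZero n] (χ : AddChar (ZMod n) ℂ) :
    DihedralGroup n →* Matrix (Fin 2) (Fin 2) ℂ where
  toFun
    | .r i => !![χ i, 0; 0, χ (-i)]
    | .sr i => !![0, χ (-i); χ i, 0]
  map_one' := by
    change !![χ 0, 0; 0, χ (-0)] = 1
    simp [Matrix.one_fin_two]
  map_mul' := by
    rintro (i | i) (j | j)
    · change !![χ (i + j), 0; 0, χ (-(i + j))] = _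
      simp [AddChar.map_add_eq_mul, mul_comm]
    · change !![0, χ (-(j - i)); χ (j - i), 0] = _
      simp [AddChar.map_add_eq_mul, sub_eq_add_neg, mul_comm]
    · change !![0, χ (-(i + j)); χ (i + j), 0] = _
      simp [AddChar.map_add_eq_mul, mul_comm]
    · change !![χ (j - i), 0; 0, χ (-(j - i))] = _
      simp [AddChar.map_add_eq_mul, sub_eq_add_neg, mul_comm]

theorem dihRep_r {n : ℕ} [NeZero n] (χ : AddChar (ZMod n) ℂ) (i : ZMod n) :
    dihRep χ (.r i) = !![χ i, 0; 0, χ (-i)] := rfl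

theorem dihRep_sr {n : ℕ} [NeZero n] (χ : AddChar (ZMod n) ℂ) (i : ZMod n) :
    dihRep χ (.sr i) = !![0, χ (-i); χ i, 0] := rfl

/-- The commutator of a rotation and a reflection is antidiagonal with entries `±(χ 1 - χ (-1))`,
nonzero as soon as `χ 1 ≠ ±1`. -/
theorem isIrreducible_dihRep {n : ℕ} [NeZero n] (χ : AddChar (ZMod n) ℂ) (h : χ 1 ^ 2 ≠ 1) :
    (matRep (dihRep χ)).IsIrreducible := by
  apply isIrreducible_two (x := .r 1) (y := .sr 0)
  have h0 := chi_ne_zero χ 1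
  rw [dihRep_r, dihRep_sr, Matrix.mul_fin_two, Matrix.mul_fin_two]
  simp [Matrix.det_fin_two, sub_eq_zero]
  have : χ 1 ≠ χ (-1) := by
    rw [chi_neg]
    intro e
    apply h
    rw [sq]
    nth_rewrite 2 [e]
    exact mul_inv_cancel₀ h0
  exact ⟨this, this.symm⟩

/-! ### The scaling factors of rotations and inversions -/

theorem tf_rot_coe {k : ℂ} (h : k * 1 - 0 * 0 ≠ 0) (z : ℂ) : tf (gl k 0 0 1 h) (z : Sphere) = 1 := by
  simp [tf, den, gl_val, hc_coe]

theorem tf_rot_infty {k : ℂ} (h : k * 1 - 0 * 0 ≠ 0) : tf (gl k 0 0 1 h) ∞ = k := by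
  simp [tf, den, num, gl_val, hc_infty]

theorem tf_inv_coe {k : ℂ} (h : 0 * 0 - k * 1 ≠ 0) {z : ℂ} (hz : z ≠ 0) :
    tf (gl 0 k 1 0 h) (z : Sphere) = z := by
  simp [tf, den, gl_val, hc_coe, hz]

theorem tf_inv_zero {k : ℂ} (h : 0 * 0 - k * 1 ≠ 0) : tf (gl 0 k 1 0 h) ((0 : ℂ) : Sphere) = k := by
  simp [tf, den, num, gl_val, hc_coe]

theorem tf_inv_infty {k : ℂ} (h : 0 * 0 - k * 1 ≠ 0) : tf (gl 0 k 1 0 h) ∞ = 1 := by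
  simp [tf, den, gl_val, hc_infty]

/-- None of the six points is ∞ here, so all scaling factors of the rotation equal 1 and only the
determinant counts. Point sets containing ∞ need a separate computation. -/
theorem kap_rot {k : ℂ} (h : k * 1 - 0 * 0 ≠ 0) (z : Fin 6 → ℂ) :
    kap (fun i => (z i : Sphere)) (gl k 0 0 1 h) = (k ^ 4)⁻¹ := by
  simp [kap, tf_rot_coe, gl_val, Matrix.det_fin_two]

theorem kap_inv {k : ℂ} (h : 0 * 0 - k * 1 ≠ 0) {z : Fin 6 → ℂ} (hz : ∀ i, z i ≠ 0) :
    kap (fun i => (z i : Sphere)) (gl 0 k 1 0 h) = (∏ i, z i) * (k ^ 4)⁻¹ := by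
  simp [kap, tf_inv_coe, hz, gl_val, Matrix.det_fin_two, div_eq_mul_inv, show (-k) ^ 4 = k ^ 4 by ring]

theorem sym2_rot {k : ℂ} (h : k * 1 - 0 * 0 ≠ 0) :
    sym2 (gl k 0 0 1 h) = !![k ^ 2, 0, 0; 0, k, 0; 0, 0, 1] := by
  simp [sym2, gl_val]

theorem sym2_inv {k : ℂ} (h : 0 * 0 - k * 1 ≠ 0) :
    sym2 (gl 0 k 1 0 h) = !![0, 0, k ^ 2; 0, k, 0; 1, 0, 0] := by
  simp [sym2, gl_val]

end SixPoints

end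

noncomputable section
namespace SixPoints
open scoped OnePoint Pointwise Matrix

/-! ### The sixth roots of unity -/

theorem chi6 (i : ZMod 6) : chi 6 i = (![1, ζ 6, ζ 6 - 1, -1, -ζ 6, 1 - ζ 6] : Fin 6 → ℂ) i := by
  rw [chi_val]
  have h2 : ζ 6 ^ 2 = ζ 6 - 1 := by linear_combination ζ6_sq
  have h3 := ζ6_cube
  have h4 : ζ 6 ^ 4 = -ζ 6 := by linear_combination ζ 6 * h3
  have h5 : ζ 6 ^ 5 = 1 - ζ 6 := by linear_combination ζ 6 ^ 2 * h3 - h2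
  fin_cases i
  · exact pow_zero _
  · exact pow_one _
  · exact h2
  · exact h3
  · exact h4
  · exact h5

theorem fixed_image {α : Set Sphere} {ψ h F : Equiv.Perm Sphere} (e : ψ * h * ψ⁻¹ = F) :
    ψ '' {z ∈ α | h z = z} = {w ∈ ψ '' α | F w = w} := by
  subst e
  ext w
  constructor
  · rintro ⟨z, ⟨hz, hz'⟩, rfl⟩
    exact ⟨⟨z, hz, rfl⟩, by simp [hz']⟩
  · rintro ⟨⟨z, hz, rfl⟩, h2⟩
    exact ⟨z, ⟨hz, by simpa using h2⟩, rfl⟩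

theorem fixed_inv_roots6 {c : ℂ} (hc : c ≠ 0) :
    {w ∈ onSphere roots6 | inv c w = w} = onSphere {w | w ^ 6 = 1 ∧ w ^ 2 = c} := by
  ext w
  obtain rfl | rfl | ⟨w, hw, rfl⟩ := sphere_cases w
  · simp [mem_onSphere, mem_roots6]
  · simp [infty_notMem_onSphere]
  · simp only [Set.mem_ofPred_eq, mem_onSphere, mem_roots6, inv_coe hc hw, OnePoint.coe_eq_coe,
      div_eq_iff hw, ← sq, eq_comm (a := c)]

/-- The class of an element of the dihedral group of order twelve. -/
def classD6 : DihedralGroup 6 → Fin 6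
  | .r i => (![3, 0, 1, 2, 1, 0] : Fin 6 → Fin 6) i
  | .sr i => (![4, 5, 4, 5, 4, 5] : Fin 6 → Fin 6) i

/-- The two classes of reflections are told apart by fixed points: `z ↦ c / z` fixes the square
roots of `c`, and these are sixth roots of unity exactly when `c` is an even power of `ζ 6`. -/
theorem mem_classesD6 {α : Set Sphere} {ψ : Equiv.Perm Sphere}
    (h : ψ '' α = onSphere roots6) {E : DihedralGroup 6 ≃* A α}
    (hE : ∀ x, ψ * E x * ψ⁻¹ = dihLF 6 one_ne_zero x) (x : DihedralGroup 6) (j : Fin 6) :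
    (E x : Equiv.Perm Sphere) ∈ classesD6 α ψ j ↔ classD6 x = j := by
  have h0 := chi_ne_zero (chi 6)
  have hz := fun j : ℕ => pow_ne_zero j (ζ_ne_zero 6)
  have h1 : (E x : Equiv.Perm Sphere) = 1 ↔ x = 1 := by
    rw [OneMemClass.coe_eq_one, EmbeddingLike.map_eq_one_iff]
  have hi : ∀ a b, chi 6 a = chi 6 b ↔ a = b := fun _ _ => (chi_injective 6).eq_iff
  rcases x with i | i
  · have hr : ∀ k : ℂ, k ≠ 0 → (rot (chi 6 i) = rot k ↔ chi 6 i = k) := fun k hk =>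
      ⟨rot_injective (h0 _) hk, fun e => by rw [e]⟩
    have hn : ¬ ∀ j : ℕ, rot (chi 6 i) ≠ rot (ζ 6 ^ j) := fun hc => hc _ (by rw [chi_val])
    have e1 : ζ 6 = chi 6 1 := (chi_one 6).symm
    have e2 : ζ 6 ^ 2 = chi 6 2 := (chi_natCast 6 2).symm
    have e3 : ζ 6 ^ 3 = chi 6 3 := (chi_natCast 6 3).symm
    have e4 : ζ 6 ^ 4 = chi 6 4 := (chi_natCast 6 4).symm
    have e5 : ζ 6 ^ 5 = chi 6 5 := (chi_natCast 6 5).symm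
    have hx : (DihedralGroup.r i : DihedralGroup 6) = 1 ↔ i = 0 := by
      rw [DihedralGroup.one_def, DihedralGroup.r.injEq]
    rw [hx] at h1
    fin_cases j
    · change (_ = rot (ζ 6) ∨ _ = rot (ζ 6 ^ 5)) ↔ _
      rw [hE, dihLF_r, hr _ (ζ_ne_zero 6), hr _ (hz 5), e5, e1, hi, hi]
      clear * -
      revert i; decide
    · change (_ = rot (ζ 6 ^ 2) ∨ _ = rot (ζ 6 ^ 4)) ↔ _
      rw [hE, dihLF_r, hr _ (hz 2), hr _ (hz 4), e2, e4, hi, hi]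
      clear * -
      revert i; decide
    · change _ = rot (ζ 6 ^ 3) ↔ _
      rw [hE, dihLF_r, hr _ (hz 3), e3, hi]
      clear * -
      revert i; decide
    · change (E _ : Equiv.Perm Sphere) = 1 ↔ _
      rw [h1]
      clear * -
      revert i; decide
    · change (_ ∧ _) ↔ _
      rw [hE, dihLF_r]
      simp only [hn, false_and, false_iff]
      clear * -
      revert i; decide
    · change (_ ∧ _) ↔ _
      rw [hE, dihLF_r]
      simp only [hn, false_and, false_iff]
      clear * -
      revert i; decide
  · have hr : ∀ k : ℂ, k ≠ 0 → inv (1 * chi 6 (-i)) ≠ rot k := fun k hk =>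
      (rot_ne_inv hk (by rw [one_mul]; exact h0 _)).symm
    have hx : ¬ (DihedralGroup.sr i : DihedralGroup 6) = 1 := by
      rw [DihedralGroup.one_def]; exact nofun
    have hF := fixed_image (α := α) (hE (.sr i))
    rw [h, dihLF_sr, one_mul, fixed_inv_roots6 (h0 _)] at hF
    -- A fixed point `chi 6 m` would satisfy `m + m = -i` in `ZMod 6`, which is impossible for odd
    -- `i`.
    have hodd : classD6 (.sr i) ≠ 4 → {z ∈ α | (E (.sr i) : Equiv.Perm Sphere) z = z} = ∅ := by
      intro hcl
      rw [← Set.image_eq_empty (f := ψ), hF]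
      rw [onSphere, Set.image_eq_empty, Set.eq_empty_iff_forall_notMem]
      rintro w ⟨hw, hw'⟩
      obtain ⟨m, rfl⟩ := exists_chi hw
      rw [sq, ← AddChar.map_add_eq_mul, hi] at hw'
      clear * - hcl hw'
      revert i m; decide
    have heven : classD6 (.sr i) = 4 →
        {z ∈ α | (E (.sr i) : Equiv.Perm Sphere) z = z}.ncard = 2 := by
      intro hcl
      obtain ⟨m, hm⟩ : ∃ m : ZMod 6, m + m = -i := by
        clear * - hcl
        revert i; decide
      rw [← Set.ncard_image_of_injective _ ψ.injective, hF, ncard_onSphere]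
      have : {w : ℂ | w ^ 6 = 1 ∧ w ^ 2 = chi 6 (-i)} = {w : ℂ | w ^ 2 = chi 6 m ^ 2} := by
        ext w
        simp only [Set.mem_ofPred_eq]
        rw [← hm, AddChar.map_add_eq_mul, ← sq, and_iff_right_iff_imp]
        intro hw
        rw [show w ^ 6 = (w ^ 2) ^ 3 by ring, hw, ← pow_mul, chi_pow]
      rw [this, ncard_rootsOf 2 (h0 _)]
    fin_cases j
    · change (_ = rot (ζ 6) ∨ _ = rot (ζ 6 ^ 5)) ↔ _
      rw [hE, dihLF_sr]
      simp only [hr _ (ζ_ne_zero 6), hr _ (hz 5), false_or, false_iff]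
      clear * -
      revert i; decide
    · change (_ = rot (ζ 6 ^ 2) ∨ _ = rot (ζ 6 ^ 4)) ↔ _
      rw [hE, dihLF_sr]
      simp only [hr _ (hz 2), hr _ (hz 4), false_or, false_iff]
      clear * -
      revert i; decide
    · change _ = rot (ζ 6 ^ 3) ↔ _
      rw [hE, dihLF_sr]
      simp only [hr _ (hz 3), false_iff]
      clear * -
      revert i; decide
    · change (E _ : Equiv.Perm Sphere) = 1 ↔ _
      rw [h1]
      simp only [hx, false_iff]
      clear * -
      revert i; decide
    · change (_ ∧ _) ↔ _
      rw [hE, dihLF_sr]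
      refine ⟨fun hc => ?_, fun hcl => ⟨fun j => hr _ (hz j), heven hcl⟩⟩
      by_contra hcl
      rw [hodd hcl, Set.ncard_empty] at hc
      exact absurd hc.2 (by norm_num)
    · change (_ ∧ _) ↔ _
      rw [hE, dihLF_sr]
      have h45 : ¬ classD6 (.sr i) = 4 ↔ classD6 (.sr i) = 5 := by
        clear * -
        revert i; decide
      change _ ↔ classD6 (.sr i) = 5
      rw [← h45]
      refine ⟨fun hc hcl => ?_, fun hcl => ⟨fun j => hr _ (hz j), hodd hcl⟩⟩
      have := heven hcl
      rw [hc.2, Set.ncard_empty] at this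
      exact absurd this (by norm_num)

theorem chi6_three_sq (i : ZMod 6) : (chi 6 ^ 3) i * (chi 6 ^ 3) i = 1 := by
  rw [AddChar.pow_apply, ← sq, ← pow_mul, chi_pow]

theorem chi6_cube (i : ZMod 6) : chi 6 i ^ 3 = (![1, -1, 1, -1, 1, -1] : Fin 6 → ℂ) i := by
  rw [chi_val, ← pow_mul, mul_comm, pow_mul, ζ6_cube]
  fin_cases i
  · exact pow_zero _
  · exact pow_one _
  · change (-1 : ℂ) ^ 2 = 1
    norm_num
  · change (-1 : ℂ) ^ 3 = -1
    norm_num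
  · change (-1 : ℂ) ^ 4 = 1
    norm_num
  · change (-1 : ℂ) ^ 5 = -1
    norm_num

/-- The dimensions of the irreducible representations of the dihedral group of order twelve. -/
def dimD6 : Fin 6 → ℕ := ![2, 2, 1, 1, 1, 1]

/-- The irreducible representations of the dihedral group of order twelve. -/
def repD6 : ∀ i : Fin 6, DihedralGroup 6 →* Matrix (Fin (dimD6 i)) (Fin (dimD6 i)) ℂ
  | 0 => dihRep (chi 6)
  | 1 => dihRep (chi 6 ^ 2)
  | 2 => rep1 1
  | 3 => rep1 (dihChar (n := 6) 1 (by simp) (ε := -1) (by norm_num))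
  | 4 => rep1 (dihChar (chi 6 ^ 3) chi6_three_sq (one_mul 1))
  | 5 => rep1 (dihChar (chi 6 ^ 3) chi6_three_sq (ε := -1) (by norm_num))

theorem repD6_irreducible (i : Fin 6) : (matRep (repD6 i)).IsIrreducible := by
  have hp := isPrimitiveRoot_ζ 6
  fin_cases i
  · refine isIrreducible_dihRep _ ?_
    rw [chi_one]
    exact hp.pow_ne_one_of_pos_of_lt (by norm_num) (by norm_num)
  · refine isIrreducible_dihRep _ ?_
    rw [AddChar.pow_apply, chi_one, ← pow_mul]
    exact hp.pow_ne_one_of_pos_of_lt (by norm_num) (by norm_num)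
  all_goals exact isIrreducible_one _

theorem repD6_trace (i : Fin 6) (x : DihedralGroup 6) :
    (repD6 i x).trace = tableD6 i (classD6 x) := by
  have h2 : ζ 6 ^ 2 = ζ 6 - 1 := by linear_combination ζ6_sq
  have h3 := ζ6_cube
  have hr2 : ∀ (χ : AddChar (ZMod 6) ℂ) (j : ZMod 6), (dihRep χ (.r j)).trace = χ j + χ (-j) := by
    intro χ j
    rw [dihRep_r, Matrix.trace_fin_two_of]
  have hs2 : ∀ (χ : AddChar (ZMod 6) ℂ) (j : ZMod 6), (dihRep χ (.sr j)).trace = 0 := by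
    intro χ j
    rw [dihRep_sr, Matrix.trace_fin_two_of, add_zero]
  have h1 : ∀ χ : DihedralGroup 6 →* ℂ, (rep1 χ x).trace = χ x := fun χ => by
    rw [rep1_apply, Matrix.trace_fin_one_of]
  fin_cases i
  · change (dihRep (chi 6) x).trace = _
    rcases x with j | j
    · rw [hr2]
      simp only [chi6]
      fin_cases j
      · change (1 : ℂ) + 1 = 2
        norm_num
      · change ζ 6 + (1 - ζ 6) = 1
        ring
      · change (ζ 6 - 1) + (-ζ 6) = -1
        ring
      · change (-1 : ℂ) + (-1) = -2
        ring
      · change (-ζ 6) + (ζ 6 - 1) = -1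
        ring
      · change (1 - ζ 6) + ζ 6 = 1
        ring
    · rw [hs2]
      fin_cases j <;> rfl
  · change (dihRep (chi 6 ^ 2) x).trace = _
    rcases x with j | j
    · rw [hr2]
      simp only [AddChar.pow_apply, chi6]
      fin_cases j
      · change (1 : ℂ) ^ 2 + 1 ^ 2 = 2
        norm_num
      · change ζ 6 ^ 2 + (1 - ζ 6) ^ 2 = -1
        linear_combination 2 * h2
      · change (ζ 6 - 1) ^ 2 + (-ζ 6) ^ 2 = -1
        linear_combination 2 * h2
      · change (-1 : ℂ) ^ 2 + (-1) ^ 2 = 2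
        norm_num
      · change (-ζ 6) ^ 2 + (ζ 6 - 1) ^ 2 = -1
        linear_combination 2 * h2
      · change (1 - ζ 6) ^ 2 + ζ 6 ^ 2 = -1
        linear_combination 2 * h2
    · rw [hs2]
      fin_cases j <;> rfl
  · refine (h1 _).trans ?_
    rcases x with j | j <;> fin_cases j <;> rfl
  · refine (h1 _).trans ?_
    rcases x with j | j
    · fin_cases j <;> rfl
    · rw [dihChar_sr, AddChar.one_apply, mul_one]
      fin_cases j <;> rfl
  · refine (h1 _).trans ?_
    rcases x with j | j
    · rw [dihChar_r, AddChar.pow_apply, chi6_cube]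
      fin_cases j <;> rfl
    · rw [dihChar_sr, AddChar.pow_apply, chi6_cube, one_mul]
      fin_cases j <;> rfl
  · refine (h1 _).trans ?_
    rcases x with j | j
    · rw [dihChar_r, AddChar.pow_apply, chi6_cube]
      fin_cases j <;> rfl
    · rw [dihChar_sr, AddChar.pow_apply, chi6_cube]
      fin_cases j
      · exact neg_one_mul 1
      · exact neg_one_mul (-1) |>.trans (neg_neg 1)
      · exact neg_one_mul 1
      · exact neg_one_mul (-1) |>.trans (neg_neg 1)
      · exact neg_one_mul 1
      · exact neg_one_mul (-1) |>.trans (neg_neg 1)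

/-- Matrices for the transformations in a dihedral group. -/
def dihGL (n : ℕ) [NeZero n] {c : ℂ} (hc : c ≠ 0) : DihedralGroup n → GL (Fin 2) ℂ
  | .r i => gl (chi n i) 0 0 1 (by simpa using chi_ne_zero (chi n) i)
  | .sr i => gl 0 (c * chi n (-i)) 1 0 (by simpa using ⟨hc, chi_ne_zero (chi n) (-i)⟩)

theorem lf_dihGL (n : ℕ) [NeZero n] {c : ℂ} (hc : c ≠ 0) (x : DihedralGroup n) :
    lf (dihGL n hc x) = dihLF n hc x := by
  rcases x with i | i
  · exact (rot_eq_lf (chi_ne_zero _ _)).symm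
  · exact (inv_eq_lf (mul_ne_zero hc (chi_ne_zero _ _))).symm

theorem A_roots6 : A (onSphere roots6) = (dihLF 6 one_ne_zero).range := by
  ext f
  rw [mem_A_roots6, mem_range_dihLF]
  simp only [one_mul]

/-- An enumeration of the sixth roots of unity. -/
def enumRoots6 : Fin 6 → Sphere := fun i => ((ζ 6 ^ (i : ℕ) : ℂ) : Sphere)

theorem range_enumRoots6 : Set.range enumRoots6 = onSphere roots6 := by
  rw [onSphere_roots6]
  congr 1
  ext i
  fin_cases i <;> simp [enumRoots6]

theorem kap_roots6_r (i : ZMod 6) :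
    kap enumRoots6 (dihGL 6 one_ne_zero (.r i)) = (chi 6 i ^ 4)⁻¹ :=
  kap_rot (by simpa using chi_ne_zero _ _) _

theorem kap_roots6_sr (i : ZMod 6) :
    kap enumRoots6 (dihGL 6 one_ne_zero (.sr i)) = -chi 6 i ^ 4 := by
  have := kap_inv (k := 1 * chi 6 (-i)) (by simpa using chi_ne_zero _ _)
    (z := fun j => ζ 6 ^ (j : ℕ)) (fun j => pow_ne_zero _ (ζ_ne_zero 6))
  refine this.trans ?_
  rw [Fin.prod_univ_six, chi_neg, one_mul, inv_pow, inv_inv]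
  change (ζ 6 ^ 0 * ζ 6 ^ 1 * ζ 6 ^ 2 * ζ 6 ^ 3 * ζ 6 ^ 4 * ζ 6 ^ 5) * _ = -_
  -- The product of the sixth roots of unity is `ζ 6 ^ 15 = -1`, the origin of the sign; the
  -- polynomial factor is `(X ^ 15 + 1) / (X ^ 3 + 1)` at `ζ 6`.
  linear_combination chi 6 i ^ 4 * (ζ 6 ^ 12 - ζ 6 ^ 9 + ζ 6 ^ 6 - ζ 6 ^ 3 + 1) * ζ6_cube

/-- Rotations scale the three monomials and inversions exchange the outer two. So the outer
coordinates span a two-dimensional summand and the middle one a line. The constant `y` adjusts the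
second basis vector to the matrices of `dihRep`. -/
theorem rot_mul_cols {κ k p q y : ℂ} (h1 : q = κ * k ^ 2) (h2 : p = κ) :
    (!![0, y; 0, 0; 1, 0] : Matrix (Fin 3) (Fin 2) ℂ) * !![p, 0; 0, q] =
      κ • !![k ^ 2, 0, 0; 0, k, 0; 0, 0, 1] * (!![0, y; 0, 0; 1, 0] : Matrix (Fin 3) (Fin 2) ℂ) := by
  rw [h1, h2]
  ext a b
  fin_cases a <;> fin_cases b <;> simp
  ring

theorem inv_mul_cols {κ k p q y : ℂ} (h1 : y * p = κ * k ^ 2) (h2 : q = κ * y) :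
    (!![0, y; 0, 0; 1, 0] : Matrix (Fin 3) (Fin 2) ℂ) * !![0, q; p, 0] =
      κ • !![0, 0, k ^ 2; 0, k, 0; 1, 0, 0] * (!![0, y; 0, 0; 1, 0] : Matrix (Fin 3) (Fin 2) ℂ) := by
  rw [h2]
  ext a b
  fin_cases a <;> fin_cases b <;> simp [h1]

theorem rot_mul_col {κ k p : ℂ} (h : p = κ * k) :
    (!![0; 1; 0] : Matrix (Fin 3) (Fin 1) ℂ) * !![p] =
      κ • !![k ^ 2, 0, 0; 0, k, 0; 0, 0, 1] * (!![0; 1; 0] : Matrix (Fin 3) (Fin 1) ℂ) := by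
  rw [h]
  ext a b
  fin_cases a <;> fin_cases b <;> simp

theorem inv_mul_col {κ k p : ℂ} (h : p = κ * k) :
    (!![0; 1; 0] : Matrix (Fin 3) (Fin 1) ℂ) * !![p] =
      κ • !![0, 0, k ^ 2; 0, k, 0; 1, 0, 0] * (!![0; 1; 0] : Matrix (Fin 3) (Fin 1) ℂ) := by
  rw [h]
  ext a b
  fin_cases a <;> fin_cases b <;> simp

theorem mem_iSup_range {n k : ℕ} {d p : Fin k → ℕ} (P : ∀ i, Fin (p i) → Matrix (Fin n) (Fin (d i)) ℂ)
    (i : Fin k) (s : Fin (p i)) (v : Fin (d i) → ℂ) {w : Fin n → ℂ} (h : P i s *ᵥ v = w) :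
    w ∈ ⨆ s : (Σ i, Fin (p i)), LinearMap.range (P s.1 s.2).mulVecLin :=
  Submodule.mem_iSup_of_mem ⟨i, s⟩ ⟨v, h⟩

/-- The decomposition of the tangent representation at the sixth roots of unity. -/
def colsD6 : ∀ i : Fin 6, Fin ((![0, 1, 0, 0, 0, 1] : Fin 6 → ℕ) i) →
    Matrix (Fin 3) (Fin (dimD6 i)) ℂ
  | 0 => Fin.elim0
  | 1 => fun _ => !![0, -1; 0, 0; 1, 0]
  | 2 => Fin.elim0
  | 3 => Fin.elim0
  | 4 => Fin.elim0
  | 5 => fun _ => !![0; 1; 0]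

/-- For a rotation `kap = k⁻⁴ = k²`, so the two-dimensional summand belongs to the square of the
basic character. On the middle coordinate a rotation acts by `k⁻³ = k³`, and the sign in `kap` makes
inversions act by `-χ³`. -/
theorem colsD6_mul (i : Fin 6) (s : Fin ((![0, 1, 0, 0, 0, 1] : Fin 6 → ℕ) i))
    (x : DihedralGroup 6) : colsD6 i s * repD6 i x =
      kap enumRoots6 (dihGL 6 one_ne_zero x) • sym2 (dihGL 6 one_ne_zero x) * colsD6 i s := by
  -- Writing the inverse as a fifth power turns all conditions into polynomial identities modulo `χ
  -- ^ 6 = 1`.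
  have hi : ∀ i, (chi 6 i)⁻¹ = chi 6 i ^ 5 := fun i =>
    inv_eq_of_mul_eq_one_right (by rw [← pow_succ', chi_pow])
  fin_cases i
  · exact s.elim0
  · change !![0, -1; 0, 0; 1, 0] * dihRep (chi 6 ^ 2) x = _ * (!![0, -1; 0, 0; 1, 0] : Matrix _ _ ℂ)
    rcases x with i | i <;> have h6 := chi_pow (chi 6) i
    · rw [kap_roots6_r, dihGL, sym2_rot, dihRep_r, AddChar.pow_apply, AddChar.pow_apply, chi_neg,
        ← inv_pow, hi]
      refine rot_mul_cols ?_ ?_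
      · linear_combination (-chi 6 i ^ 10 * (chi 6 i ^ 6 + 1)) * h6
      · linear_combination (-chi 6 i ^ 2 * (chi 6 i ^ 12 + chi 6 i ^ 6 + 1)) * h6
    · rw [kap_roots6_sr, dihGL, sym2_inv, dihRep_sr, AddChar.pow_apply, AddChar.pow_apply, one_mul,
        chi_neg, hi]
      refine inv_mul_cols ?_ ?_
      · linear_combination (chi 6 i ^ 2 * (chi 6 i ^ 6 + 1)) * h6
      · linear_combination chi 6 i ^ 4 * h6
  · exact s.elim0
  · exact s.elim0
  · exact s.elim0
  · change !![0; 1; 0] * rep1 _ x = _ * (!![0; 1; 0] : Matrix _ _ ℂ)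
    rcases x with i | i <;> have h6 := chi_pow (chi 6) i
    · rw [kap_roots6_r, dihGL, sym2_rot, rep1_apply, dihChar_r, AddChar.pow_apply, ← inv_pow, hi]
      refine rot_mul_col ?_
      linear_combination (-chi 6 i ^ 3 * (chi 6 i ^ 12 + chi 6 i ^ 6 + 1)) * h6
    · rw [kap_roots6_sr, dihGL, sym2_inv, rep1_apply, dihChar_sr, AddChar.pow_apply, one_mul,
        chi_neg, hi]
      refine inv_mul_col ?_
      linear_combination chi 6 i ^ 3 * h6

theorem colsD6_span (j : Fin 3) : (Pi.single j 1 : Fin 3 → ℂ) ∈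
    ⨆ s : (Σ i, Fin ((![0, 1, 0, 0, 0, 1] : Fin 6 → ℕ) i)),
      LinearMap.range (colsD6 s.1 s.2).mulVecLin := by
  fin_cases j
  · refine mem_iSup_range colsD6 1 ⟨0, by decide⟩ ![0, -1] ?_
    change (!![0, -1; 0, 0; 1, 0] : Matrix (Fin 3) (Fin 2) ℂ) *ᵥ ![0, -1] = Pi.single 0 1
    ext k
    fin_cases k <;> simp
  · refine mem_iSup_range colsD6 5 ⟨0, by decide⟩ ![1] ?_
    change (!![0; 1; 0] : Matrix (Fin 3) (Fin 1) ℂ) *ᵥ ![1] = Pi.single 1 1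
    ext k
    fin_cases k <;> simp
  · refine mem_iSup_range colsD6 1 ⟨0, by decide⟩ ![1, 0] ?_
    change (!![0, -1; 0, 0; 1, 0] : Matrix (Fin 3) (Fin 2) ℂ) *ᵥ ![1, 0] = Pi.single 2 1
    ext k
    fin_cases k <;> simp

theorem case_roots6 {α : Set Sphere} {ψ : Equiv.Perm Sphere} (hψ : ψ ∈ LFT)
    (h : ψ '' α = onSphere roots6) : A α = conjGen ψ {rot (ζ 6), inv 1} ∧
      Nonempty (A α ≃* DihedralGroup 6) ∧
      HasMultiplicityVector α (classesD6 α ψ) tableD6 ![0, 1, 0, 0, 0, 1] := by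
  have hA : A (ψ '' α) = (dihLF 6 one_ne_zero).range := by rw [h, A_roots6]
  obtain ⟨E, hE⟩ := exists_equiv_of_range (dihLF_injective 6 one_ne_zero) hψ hA
  refine ⟨A_eq_conjGen hψ (by rw [hA, range_dihLF]), ⟨E.symm⟩, ?_⟩
  exact hasMultiplicityVector_of E hψ (range_enumRoots6.trans h.symm) (dihGL 6 one_ne_zero)
    (fun x => by rw [lf_dihGL, hE]) (fun x => ⟨classD6 x, (mem_classesD6 h hE x _).2 rfl,
      fun j hj => ((mem_classesD6 h hE x j).1 hj).symm⟩) dimD6 repD6 repD6_irreducible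
    (fun i j x hx => by rw [repD6_trace, (mem_classesD6 h hE x j).1 hx]) colsD6 colsD6_mul
    colsD6_span (by decide)

end SixPoints

end

noncomputable section
namespace SixPoints
open scoped OnePoint Pointwise Matrix

/-! ### Cyclic groups -/

theorem existsUnique_classesZ (n : ℕ) [NeZero n] {α : Set Sphere} {ψ : Equiv.Perm Sphere}
    {E : Multiplicative (ZMod n) ≃* A α} (hE : ∀ x, ψ * E x * ψ⁻¹ = cycLF n x)
    (x : Multiplicative (ZMod n)) : ∃! j, (E x : Equiv.Perm Sphere) ∈ classesZ n ψ j := by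
  have hmem : ∀ j, (E x : Equiv.Perm Sphere) ∈ classesZ n ψ j ↔
      chi n x.toAdd = ζ n ^ (j.val + 1) := by
    intro j
    change ψ * E x * ψ⁻¹ = _ ↔ _
    rw [hE]
    exact ⟨rot_injective (chi_ne_zero _ _) (pow_ne_zero _ (ζ_ne_zero n)), fun e => by
      change rot _ = _
      rw [e]⟩
  simp only [hmem]
  have hn := NeZero.pos n
  apply existsUnique_of_exists_of_unique
  · rw [chi_val]
    have hv := ZMod.val_lt x.toAdd
    rcases Nat.eq_zero_or_pos x.toAdd.val with h0 | hpos
    -- The class with index `j` belongs to the power `j + 1`, so the identity lies in the last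
    -- class.
    · refine ⟨⟨n - 1, by omega⟩, ?_⟩
      rw [h0, pow_zero]
      change _ = ζ n ^ (n - 1 + 1)
      rw [Nat.sub_add_cancel hn, ζ_pow]
    · refine ⟨⟨x.toAdd.val - 1, by omega⟩, ?_⟩
      change _ = ζ n ^ (x.toAdd.val - 1 + 1)
      rw [Nat.sub_add_cancel hpos]
  · intro i j hi hj
    rw [hi, pow_succ, pow_succ] at hj
    exact Fin.ext ((isPrimitiveRoot_ζ n).pow_inj i.2 j.2 (mul_right_cancel₀ (ζ_ne_zero n) hj))

/-- The unit vectors as columns. -/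
def unitCol (v : Fin 3) : Matrix (Fin 3) (Fin 1) ℂ := Matrix.of fun a _ => if a = v then 1 else 0

theorem unitCol_mulVec (v : Fin 3) : unitCol v *ᵥ ![1] = Pi.single v 1 := by
  ext a
  simp [unitCol, Matrix.mulVec, dotProduct, Pi.single_apply]

/-- The coordinate `v` has weight `2 - v` under `sym2`, hence weight `-(2 + v)` after multiplication
by `k⁻⁴`. -/
theorem unitCol_mul {k : ℂ} (hk : k ≠ 0) (v : Fin 3) :
    unitCol v * !![(k ^ (2 + v.val))⁻¹] =
      (k ^ 4)⁻¹ • !![k ^ 2, 0, 0; 0, k, 0; 0, 0, 1] * unitCol v := by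
  ext a b
  fin_cases v <;> fin_cases a <;> fin_cases b <;>
    simp [unitCol, Matrix.mul_apply] <;> field_simp

/-- The multiplicity vector of six points whose group is generated by a rotation fixing none or
one of them. -/
theorem hasMultiplicityVector_cyclic (n : ℕ) [NeZero n] {α : Set Sphere} {ψ : Equiv.Perm Sphere}
    (hψ : ψ ∈ LFT) {z : Fin 6 → ℂ} (hz : Set.range (fun i => (z i : Sphere)) = ψ '' α)
    (hA : A (ψ '' α) = (cycLF n).range) {p : Fin n → ℕ} (w : ∀ i, Fin (p i) → Fin 3)
    (hw : ∀ i s, n ∣ i.val + 3 + (w i s).val) (hs : ∀ j, ∃ i s, w i s = j)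
    (hdim : ∑ i, p i * 1 = 3) :
    HasMultiplicityVector α (classesZ n ψ) (tableZ n) p := by
  obtain ⟨E, hE⟩ := exists_equiv_of_range (cycLF_injective n) hψ hA
  refine hasMultiplicityVector_of E hψ hz
    (fun x => gl (chi n x.toAdd) 0 0 1 (by simpa using chi_ne_zero _ _))
    (fun x => by rw [hE]; exact (rot_eq_lf (chi_ne_zero _ _)).symm)
    (existsUnique_classesZ n hE) (fun _ => 1)
    (fun i => rep1 ((chi n ^ (i.val + 1)).toMonoidHom)) (fun _ => isIrreducible_one _) ?_
    (fun i s => unitCol (w i s)) ?_ ?_ hdim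
  · intro i j x hx
    rw [rep1_apply, Matrix.trace_fin_one_of]
    have hx' : ψ * E x * ψ⁻¹ = _ := hx
    rw [hE] at hx'
    have h := rot_injective (chi_ne_zero _ _) (pow_ne_zero _ (ζ_ne_zero n)) hx'
    change (chi n ^ (i.val + 1)) x.toAdd = ζ n ^ ((i.val + 1) * (j.val + 1))
    rw [AddChar.pow_apply, h, ← pow_mul, mul_comm]
  · intro i s x
    rw [kap_rot, sym2_rot, rep1_apply]
    have h0 := chi_ne_zero (chi n) x.toAdd
    -- The row `i` is the character of exponent `i + 1`. The divisibility in `hw` says that this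
    -- exponent and the weight `-(2 + w)` agree modulo `n`.
    have h1 : ((chi n ^ (i.val + 1)).toMonoidHom x : ℂ) * chi n x.toAdd ^ (2 + (w i s).val) = 1 := by
      change (chi n ^ (i.val + 1)) x.toAdd * _ = _
      rw [AddChar.pow_apply, ← pow_add]
      obtain ⟨m, hm⟩ := hw i s
      rw [show i.val + 1 + (2 + (w i s).val) = n * m by omega, pow_mul, chi_pow, one_pow]
    generalize ((chi n ^ (i.val + 1)).toMonoidHom x : ℂ) = q at h1 ⊢
    have hq : q = (chi n x.toAdd ^ (2 + (w i s).val))⁻¹ := eq_inv_of_mul_eq_one_left h1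
    rw [hq]
    exact unitCol_mul h0 _
  · intro j
    obtain ⟨i, s, rfl⟩ := hs j
    exact mem_iSup_range (d := fun _ => 1) (fun i s => unitCol (w i s)) i s ![1] (unitCol_mulVec _)

/-- An enumeration of zero and the fifth roots of unity. -/
theorem range_zeroRoots5 : Set.range (fun i => ((![0, 1, ζ 5, ζ 5 ^ 2, ζ 5 ^ 3, ζ 5 ^ 4] : Fin 6 → ℂ)
    i : Sphere)) = onSphere zeroRoots5 := by
  rw [onSphere_zeroRoots5]
  congr 1
  ext i
  fin_cases i <;> rfl

theorem range_pm (a b : ℂ) : Set.range (fun i => ((![1, -1, a, -a, b, -b] : Fin 6 → ℂ)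
    i : Sphere)) = onSphere (pm a b) := by
  rw [onSphere_pm]
  congr 1
  ext i
  fin_cases i <;> rfl

theorem range_hex (a : ℂ) : Set.range (fun i => ((![1, ζ 3, ζ 3 ^ 2, a, a * ζ 3, a * ζ 3 ^ 2] :
    Fin 6 → ℂ) i : Sphere)) = onSphere (hex a) := by
  rw [onSphere_hex]
  congr 1
  ext i
  fin_cases i <;> rfl

theorem case_zeroRoots5 {α : Set Sphere} {ψ : Equiv.Perm Sphere} (hψ : ψ ∈ LFT)
    (h : ψ '' α = onSphere zeroRoots5) : A α = conjGen ψ {rot (ζ 5)} ∧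
      Nonempty (A α ≃* Multiplicative (ZMod 5)) ∧
      HasMultiplicityVector α (classesZ 5 ψ) (tableZ 5) ![1, 1, 1, 0, 0] := by
  have hA : A (ψ '' α) = (cycLF 5).range := by
    ext f
    rw [h, mem_A_zeroRoots5, mem_range_cycLF]
  obtain ⟨E, -⟩ := exists_equiv_of_range (cycLF_injective 5) hψ hA
  refine ⟨A_eq_conjGen hψ (by rw [hA, range_cycLF]), ⟨E.symm⟩, ?_⟩
  -- The three coordinates have weights -2, -3, -4, that is 3, 2, 1 modulo 5, so the characters of
  -- exponents 1, 2, 3 occur once each.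
  refine hasMultiplicityVector_cyclic 5 hψ (range_zeroRoots5.trans h.symm) hA
    (fun i => match i with
      | 0 => fun _ => 2
      | 1 => fun _ => 1
      | 2 => fun _ => 0
      | 3 => Fin.elim0
      | 4 => Fin.elim0) (by decide) (by decide) (by decide)

/-- The multiplicity vector of six points whose group is generated by a rotation by `π`. -/
theorem case_pm_cyclic {α : Set Sphere} {ψ : Equiv.Perm Sphere} (hψ : ψ ∈ LFT) {a b : ℂ}
    (h : ψ '' α = onSphere (pm a b))
    (hA : ∀ f, f ∈ A (ψ '' α) ↔ f = 1 ∨ f = rot (-1)) : A α = conjGen ψ {rot (-1)} ∧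
      Nonempty (A α ≃* Multiplicative (ZMod 2)) ∧
      HasMultiplicityVector α (classesZ 2 ψ) (tableZ 2) ![1, 2] := by
  have hA : A (ψ '' α) = (cycLF 2).range := by
    ext f
    rw [hA, mem_range_cycLF]
    simp only [sq_eq_one_iff, or_and_right, exists_or, exists_eq_left, rot_one]
  obtain ⟨E, -⟩ := exists_equiv_of_range (cycLF_injective 2) hψ hA
  refine ⟨A_eq_conjGen hψ (by rw [hA, range_cycLF, ζ2]), ⟨E.symm⟩, ?_⟩
  -- Modulo 2 the weights -2, -3, -4 give the trivial character twice and the sign character once.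
  refine hasMultiplicityVector_cyclic 2 hψ ((range_pm a b).trans h.symm) hA
    (fun i => match i with
      | 0 => fun _ => 1
      | 1 => (![0, 2] : Fin 2 → Fin 3)) (by decide) (by decide) (by decide)

/-! ### The dihedral group of order six -/

/-- The class of an element of the dihedral group of order six. -/
def classD3 : DihedralGroup 3 → Fin 3
  | .r i => if i = 0 then 1 else 0
  | .sr _ => 2

theorem orderOf_r_three {i : ZMod 3} (h : i ≠ 0) : orderOf (DihedralGroup.r i : DihedralGroup 3) = 3 := by
  have : Fact (Nat.Prime 3) := ⟨Nat.prime_three⟩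
  refine orderOf_eq_prime ?_ ?_
  · revert i; decide
  · rw [DihedralGroup.one_def, ne_eq, DihedralGroup.r.injEq]
    exact h

theorem orderOf_of_conj_rot {h κ : Equiv.Perm Sphere} (e : κ * h * κ⁻¹ = rot (ζ 3)) :
    orderOf h = 3 := by
  have h1 : orderOf (κ * h * κ⁻¹) = orderOf h := by
    rw [← MulAut.conj_apply, MulEquiv.orderOf_eq]
  rw [← h1, e]
  have : Fact (Nat.Prime 3) := ⟨Nat.prime_three⟩
  refine orderOf_eq_prime ?_ ?_
  · rw [rot_pow (ζ_ne_zero 3), ζ_pow, rot_one]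
  · rw [← rot_one]
    intro e
    have := rot_injective (ζ_ne_zero 3) one_ne_zero e
    exact (isPrimitiveRoot_ζ 3).ne_one (by norm_num) this

theorem mem_classesD3 {α : Set Sphere} {ψ : Equiv.Perm Sphere} (hψ : ψ ∈ LFT) {a : ℂ} (ha : a ≠ 0)
    {E : DihedralGroup 3 ≃* A α} (hE : ∀ x, ψ * E x * ψ⁻¹ = dihLF 3 ha x) (x : DihedralGroup 3)
    (j : Fin 3) : (E x : Equiv.Perm Sphere) ∈ classesD3 j ↔ classD3 x = j := by
  have h1 : (E x : Equiv.Perm Sphere) = 1 ↔ x = 1 := by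
    rw [OneMemClass.coe_eq_one, EmbeddingLike.map_eq_one_iff]
  have ho : orderOf (E x : Equiv.Perm Sphere) = orderOf x := by
    rw [Subgroup.orderOf_coe, MulEquiv.orderOf_eq]
  rcases x with i | i
  · by_cases hi : i = 0
    · subst hi
      have hx : (E (.r 0) : Equiv.Perm Sphere) = 1 := h1.2 rfl
      have hcl : classD3 (.r 0) = 1 := rfl
      rw [hcl]
      fin_cases j
      · change (∃ κ ∈ LFT, _) ↔ _
        refine ⟨fun ⟨κ, _, e⟩ => ?_, fun h => absurd h (by decide)⟩
        have := orderOf_of_conj_rot e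
        rw [hx, orderOf_one] at this
        exact absurd this (by norm_num)
      · exact ⟨fun _ => rfl, fun _ => hx⟩
      · change orderOf _ = 2 ↔ _
        rw [hx, orderOf_one]
        decide
    · have hcl : classD3 (.r i) = 0 := if_neg hi
      rw [orderOf_r_three hi] at ho
      rw [hcl]
      fin_cases j
      · change (∃ κ ∈ LFT, _) ↔ _
        refine ⟨fun _ => rfl, fun _ => ?_⟩
        have h12 : i = 1 ∨ i = -1 := by
          clear * - hi
          revert i; decide
        rcases h12 with rfl | rfl
        · exact ⟨ψ, hψ, by rw [hE, dihLF_r, chi_one]⟩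
        -- The rotation by the opposite angle is conjugate to the rotation by `2π/3` through `z ↦ 1
        -- / z`.
        · refine ⟨inv 1 * ψ, mul_mem (inv_mem_LFT 1) hψ, ?_⟩
          rw [show inv 1 * ψ * (E (.r (-1)) : Equiv.Perm Sphere) * (inv 1 * ψ)⁻¹ =
            inv 1 * (ψ * E (.r (-1)) * ψ⁻¹) * (inv 1)⁻¹ by group, hE, dihLF_r,
            inv_conj_rot (chi_ne_zero _ _), chi_neg, inv_inv, chi_one]
      · change (E _ : Equiv.Perm Sphere) = 1 ↔ _
        refine ⟨fun h => ?_, fun h => absurd h (by decide)⟩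
        rw [h, orderOf_one] at ho
        exact absurd ho (by norm_num)
      · change orderOf _ = 2 ↔ _
        rw [ho]
        decide
  · have hcl : classD3 (.sr i) = 2 := rfl
    rw [DihedralGroup.orderOf_sr] at ho
    rw [hcl]
    fin_cases j
    · change (∃ κ ∈ LFT, _) ↔ _
      refine ⟨fun ⟨κ, _, e⟩ => ?_, fun h => absurd h (by decide)⟩
      rw [orderOf_of_conj_rot e] at ho
      exact absurd ho (by norm_num)
    · change (E _ : Equiv.Perm Sphere) = 1 ↔ _
      refine ⟨fun h => ?_, fun h => absurd h (by decide)⟩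
      rw [h, orderOf_one] at ho
      exact absurd ho (by norm_num)
    · exact ⟨fun _ => rfl, fun _ => ho⟩

/-- The dimensions of the irreducible representations of the dihedral group of order six. -/
def dimD3 : Fin 3 → ℕ := ![2, 1, 1]

/-- The irreducible representations of the dihedral group of order six. -/
def repD3 : ∀ i : Fin 3, DihedralGroup 3 →* Matrix (Fin (dimD3 i)) (Fin (dimD3 i)) ℂ
  | 0 => dihRep (chi 3 ^ 2)
  | 1 => rep1 1
  | 2 => rep1 (dihChar (n := 3) 1 (by simp) (ε := -1) (by norm_num))

theorem repD3_irreducible (i : Fin 3) : (matRep (repD3 i)).IsIrreducible := by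
  fin_cases i
  · refine isIrreducible_dihRep _ ?_
    rw [AddChar.pow_apply, chi_one, ← pow_mul, show 2 * 2 = 3 + 1 from rfl, pow_succ, ζ_pow, one_mul]
    exact (isPrimitiveRoot_ζ 3).ne_one (by norm_num)
  all_goals exact isIrreducible_one _

theorem repD3_trace (i : Fin 3) (x : DihedralGroup 3) :
    (repD3 i x).trace = tableD3 i (classD3 x) := by
  have h1 : ∀ χ : DihedralGroup 3 →* ℂ, (rep1 χ x).trace = χ x := fun χ => by
    rw [rep1_apply, Matrix.trace_fin_one_of]
  fin_cases i
  · change (dihRep (chi 3 ^ 2) x).trace = _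
    rcases x with j | j
    · rw [dihRep_r, Matrix.trace_fin_two_of]
      have h3 := ζ_pow 3
      have hs := ζ3_sq
      simp only [AddChar.pow_apply, chi_val]
      fin_cases j
      · change (ζ 3 ^ 0) ^ 2 + (ζ 3 ^ 0) ^ 2 = 2
        norm_num
      · change (ζ 3 ^ 1) ^ 2 + (ζ 3 ^ 2) ^ 2 = -1
        linear_combination hs + ζ 3 * h3
      · change (ζ 3 ^ 2) ^ 2 + (ζ 3 ^ 1) ^ 2 = -1
        linear_combination hs + ζ 3 * h3
    · rw [dihRep_sr, Matrix.trace_fin_two_of, add_zero]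
      rfl
  · refine (h1 _).trans ?_
    rcases x with j | j <;> fin_cases j <;> rfl
  · refine (h1 _).trans ?_
    rcases x with j | j
    · fin_cases j <;> rfl
    · rw [dihChar_sr, AddChar.one_apply, mul_one]
      fin_cases j <;> rfl

/-- The decomposition of the tangent representation at `{1, w, w², a, aw, aw²}`. -/
def colsD3 (a : ℂ) : ∀ i : Fin 3, Fin ((![1, 1, 0] : Fin 3 → ℕ) i) →
    Matrix (Fin 3) (Fin (dimD3 i)) ℂ
  | 0 => fun _ => !![0, a; 0, 0; 1, 0]
  | 1 => fun _ => !![0; 1; 0]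
  | 2 => Fin.elim0

theorem colsD3_mul {a : ℂ} (ha : a ≠ 0) (i : Fin 3) (s : Fin ((![1, 1, 0] : Fin 3 → ℕ) i))
    (x : DihedralGroup 3) : colsD3 a i s * repD3 i x =
      kap (fun i => ((![1, ζ 3, ζ 3 ^ 2, a, a * ζ 3, a * ζ 3 ^ 2] : Fin 6 → ℂ) i : Sphere))
        (dihGL 3 ha x) • sym2 (dihGL 3 ha x) * colsD3 a i s := by
  have hi : ∀ i, (chi 3 i)⁻¹ = chi 3 i ^ 2 := fun i =>
    inv_eq_of_mul_eq_one_right (by rw [← pow_succ', chi_pow])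
  have hz := ζ_ne_zero 3
  have hprod : ∏ i, (![1, ζ 3, ζ 3 ^ 2, a, a * ζ 3, a * ζ 3 ^ 2] : Fin 6 → ℂ) i = a ^ 3 := by
    rw [Fin.prod_univ_six]
    change 1 * ζ 3 * ζ 3 ^ 2 * a * (a * ζ 3) * (a * ζ 3 ^ 2) = a ^ 3
    linear_combination a ^ 3 * (ζ 3 ^ 3 + 1) * ζ_pow 3
  have hne : ∀ i, (![1, ζ 3, ζ 3 ^ 2, a, a * ζ 3, a * ζ 3 ^ 2] : Fin 6 → ℂ) i ≠ 0 := by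
    intro i
    fin_cases i <;> simp [ha, hz]
  have h3 := chi_pow (chi 3)
  have hκr : ∀ i, kap (fun i => ((![1, ζ 3, ζ 3 ^ 2, a, a * ζ 3, a * ζ 3 ^ 2] : Fin 6 → ℂ) i : Sphere))
        (dihGL 3 ha (.r i)) = chi 3 i ^ 2 := by
    intro i
    refine (kap_rot (by simpa using chi_ne_zero _ _) _).trans ?_
    rw [← inv_pow, hi]
    linear_combination (chi 3 i ^ 2) * (chi 3 i ^ 3 + 1) * h3 i
  -- The six points have product `a³` and the determinant contributes `a⁻⁴`. The remaining `a⁻¹` is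
  -- absorbed by the entry `a` in the columns.
  have hκs : ∀ i, kap (fun i => ((![1, ζ 3, ζ 3 ^ 2, a, a * ζ 3, a * ζ 3 ^ 2] : Fin 6 → ℂ) i : Sphere))
        (dihGL 3 ha (.sr i)) = a⁻¹ * chi 3 i := by
    intro i
    refine (kap_inv (by simpa using ⟨ha, chi_ne_zero _ _⟩) hne).trans ?_
    have h8 : (a * chi 3 i ^ 2) ^ 4 = a ^ 4 * chi 3 i ^ 2 := by
      linear_combination a ^ 4 * (chi 3 i ^ 5 + chi 3 i ^ 2) * h3 i
    have hχ := chi_ne_zero (chi 3) i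
    rw [hprod, chi_neg, hi, h8]
    field_simp
    exact (h3 i).symm
  fin_cases i
  · change !![0, a; 0, 0; 1, 0] * dihRep (chi 3 ^ 2) x = _ * (!![0, a; 0, 0; 1, 0] : Matrix _ _ ℂ)
    rcases x with i | i <;> have h6 := chi_pow (chi 3) i
    · rw [hκr, dihGL, sym2_rot, dihRep_r, AddChar.pow_apply, AddChar.pow_apply, chi_neg, hi]
      exact rot_mul_cols (by ring) rfl
    · rw [hκs, dihGL, sym2_inv, dihRep_sr, AddChar.pow_apply, AddChar.pow_apply, chi_neg, hi]
      refine inv_mul_cols ?_ ?_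
      · field_simp
        linear_combination (-chi 3 i ^ 2) * h6
      · field_simp
        linear_combination chi 3 i * h6
  · change !![0; 1; 0] * rep1 _ x = _ * (!![0; 1; 0] : Matrix _ _ ℂ)
    rcases x with i | i <;> have h6 := chi_pow (chi 3) i
    · rw [hκr, dihGL, sym2_rot, rep1_apply]
      refine rot_mul_col ?_
      change 1 = _
      linear_combination -h6
    · rw [hκs, dihGL, sym2_inv, rep1_apply, chi_neg, hi]
      refine inv_mul_col ?_
      change 1 = _
      field_simp
      linear_combination -h6
  · exact s.elim0

theorem colsD3_span {a : ℂ} (ha : a ≠ 0) (j : Fin 3) : (Pi.single j 1 : Fin 3 → ℂ) ∈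
    ⨆ s : (Σ i, Fin ((![1, 1, 0] : Fin 3 → ℕ) i)),
      LinearMap.range (colsD3 a s.1 s.2).mulVecLin := by
  fin_cases j
  · refine mem_iSup_range (colsD3 a) 0 ⟨0, by decide⟩ ![0, a⁻¹] ?_
    change (!![0, a; 0, 0; 1, 0] : Matrix (Fin 3) (Fin 2) ℂ) *ᵥ ![0, a⁻¹] = Pi.single 0 1
    ext k
    fin_cases k <;> simp [ha]
  · refine mem_iSup_range (colsD3 a) 1 ⟨0, by decide⟩ ![1] ?_
    change (!![0; 1; 0] : Matrix (Fin 3) (Fin 1) ℂ) *ᵥ ![1] = Pi.single 1 1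
    ext k
    fin_cases k <;> simp
  · refine mem_iSup_range (colsD3 a) 0 ⟨0, by decide⟩ ![1, 0] ?_
    change (!![0, a; 0, 0; 1, 0] : Matrix (Fin 3) (Fin 2) ℂ) *ᵥ ![1, 0] = Pi.single 2 1
    ext k
    fin_cases k <;> simp

theorem case_hex_dihedral {α : Set Sphere} {ψ : Equiv.Perm Sphere} (hψ : ψ ∈ LFT) {a : ℂ}
    (ha : a ≠ 0) (h : ψ '' α = onSphere (hex a)) (hA : A (ψ '' α) = (dihLF 3 ha).range) :
    A α = conjGen ψ {rot (ζ 3), inv a} ∧ Nonempty (A α ≃* DihedralGroup 3) ∧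
      HasMultiplicityVector α classesD3 tableD3 ![1, 1, 0] := by
  obtain ⟨E, hE⟩ := exists_equiv_of_range (dihLF_injective 3 ha) hψ hA
  refine ⟨A_eq_conjGen hψ (by rw [hA, range_dihLF]), ⟨E.symm⟩, ?_⟩
  exact hasMultiplicityVector_of E hψ ((range_hex a).trans h.symm) (dihGL 3 ha)
    (fun x => by rw [lf_dihGL, hE]) (fun x => ⟨classD3 x, (mem_classesD3 hψ ha hE x _).2 rfl,
      fun j hj => ((mem_classesD3 hψ ha hE x j).1 hj).symm⟩) dimD3 repD3 repD3_irreducible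
    (fun i j x hx => by rw [repD3_trace, (mem_classesD3 hψ ha hE x j).1 hx]) (colsD3 a)
    (colsD3_mul ha) (colsD3_span ha) (by decide)

end SixPoints

end

noncomputable section
namespace SixPoints
open scoped OnePoint Pointwise Matrix

/-! ### The Klein four-group -/

theorem chi2 (i : ZMod 2) : chi 2 i = (![1, -1] : Fin 2 → ℂ) i := by
  rw [chi_val, ζ2]
  fin_cases i
  · exact pow_zero _
  · exact pow_one _

theorem chi2_neg (i : ZMod 2) : chi 2 (-i) = chi 2 i := by
  rw [show -i = i by revert i; decide]

theorem chi2_mul_self (i : ZMod 2) : chi 2 i * chi 2 i = 1 := by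
  rw [← sq, chi_pow]

theorem mem_range_dihLF_two {f : Equiv.Perm Sphere} :
    f ∈ (dihLF 2 one_ne_zero).range ↔ f = 1 ∨ f = rot (-1) ∨ f = inv 1 ∨ f = inv (-1) := by
  rw [mem_range_dihLF]
  simp only [sq_eq_one_iff, one_mul, or_and_right, exists_or, exists_eq_left, rot_one]
  tauto

theorem nonempty_dihedral_two :
    Nonempty (DihedralGroup 2 ≃* Multiplicative (ZMod 2) × Multiplicative (ZMod 2)) := by
  obtain ⟨e⟩ := IsKleinFour.nonempty_mulEquiv (G₁ := DihedralGroup 2)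
    (G₂ := Multiplicative (ZMod 2 × ZMod 2))
  exact ⟨e.trans (MulEquiv.prodMultiplicative (ZMod 2) (ZMod 2))⟩

/-- An enumeration of `{0, ∞, ±c, ±1/c}`. -/
def enumTwoC (c : ℂ) : Fin 6 → Sphere :=
  ![((0 : ℂ) : Sphere), ∞, (c : Sphere), ((-c : ℂ) : Sphere), ((c⁻¹ : ℂ) : Sphere),
      ((-c⁻¹ : ℂ) : Sphere)]

theorem range_dihLF_le_A {c : ℂ} (hc : c ≠ 0) (h6 : (Set.range (enumTwoC c)).ncard = 6) :
    (dihLF 2 one_ne_zero).range ≤ A (Set.range (enumTwoC c)) := by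
  rw [range_dihLF, Subgroup.closure_le, ζ2]
  have hc' := inv_ne_zero hc
  have hn := neg_ne_zero.2 hc
  have hn' := neg_ne_zero.2 hc'
  have h1 : (-1 : ℂ) ≠ 0 := by norm_num
  rintro f (rfl | rfl)
  · refine mem_A_of_forall_mem h6 (rot_mem _) ?_
    rintro _ ⟨i, rfl⟩
    fin_cases i
    · exact ⟨0, by simp [enumTwoC, rot_coe h1]⟩
    · exact ⟨1, by simp [enumTwoC, rot_infty h1]⟩
    · exact ⟨3, by simp [enumTwoC, rot_coe h1]⟩
    · exact ⟨2, by simp [enumTwoC, rot_coe h1]⟩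
    · exact ⟨5, by simp [enumTwoC, rot_coe h1]⟩
    · exact ⟨4, by simp [enumTwoC, rot_coe h1]⟩
  · refine mem_A_of_forall_mem h6 (inv_mem_LFT _) ?_
    rintro _ ⟨i, rfl⟩
    have h := @one_ne_zero ℂ _ _
    fin_cases i
    · exact ⟨1, by simp [enumTwoC, inv_zero h]⟩
    · exact ⟨0, by simp [enumTwoC, inv_infty h]⟩
    · exact ⟨4, by simp [enumTwoC, inv_coe h hc]⟩
    · exact ⟨5, by simp [enumTwoC, inv_coe h hn]⟩
    · exact ⟨2, by simp [enumTwoC, inv_coe h hc']⟩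
    · exact ⟨3, by simp [enumTwoC, inv_coe h hn']⟩

/-- The class of an element of the Klein four-group. -/
def classK4 (t : ZMod 2) : DihedralGroup 2 → Fin 4
  | .r i => if i = 0 then 1 else 0
  | .sr i => if i = t then 2 else 3

/-- Writing the sign as `chi 2 t` treats both orders of the last two classes at once. -/
theorem mem_classesK4 {α : Set Sphere} {κ : Equiv.Perm Sphere} {E : DihedralGroup 2 ≃* A α}
    (hE : ∀ x, κ * E x * κ⁻¹ = dihLF 2 one_ne_zero x) (t : ZMod 2) (x : DihedralGroup 2)
    (j : Fin 4) : (E x : Equiv.Perm Sphere) ∈ classesK4 κ (chi 2 t) j ↔ classK4 t x = j := by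
  have h1 : (E x : Equiv.Perm Sphere) = 1 ↔ x = 1 := by
    rw [OneMemClass.coe_eq_one, EmbeddingLike.map_eq_one_iff]
  have h0 := chi_ne_zero (chi 2)
  have hi : ∀ a b, chi 2 a = chi 2 b ↔ a = b := fun _ _ => (chi_injective 2).eq_iff
  have hm : (-1 : ℂ) = chi 2 1 := (chi2 1).symm
  have hm' : -chi 2 t = chi 2 (t + 1) := by rw [AddChar.map_add_eq_mul, ← hm]; ring
  rcases x with i | i
  · have hr : ∀ k : ℂ, k ≠ 0 → rot (chi 2 i) ≠ inv k := fun k hk => rot_ne_inv (h0 _) hk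
    fin_cases j
    · change κ * E _ * κ⁻¹ = rot (-1) ↔ _
      rw [hE, dihLF_r, hm]
      refine Iff.trans ⟨fun e => (hi _ _).1 (rot_injective (h0 _) (h0 _) e), fun e => by rw [e]⟩
        (?_ : i = 1 ↔ _)
      clear * -
      revert i t; decide
    · change (E _ : Equiv.Perm Sphere) = 1 ↔ _
      rw [h1, DihedralGroup.one_def, DihedralGroup.r.injEq]
      clear * -
      revert i t; decide
    · change κ * E _ * κ⁻¹ = inv _ ↔ _
      rw [hE, dihLF_r]
      simp only [hr _ (h0 _), false_iff]
      clear * -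
      revert i t; decide
    · change κ * E _ * κ⁻¹ = inv (-chi 2 t) ↔ _
      rw [hE, dihLF_r, hm']
      simp only [hr _ (h0 _), false_iff]
      clear * -
      revert i t; decide
  · have hr : ∀ k : ℂ, k ≠ 0 → inv (1 * chi 2 (-i)) ≠ rot k := fun k hk =>
      (rot_ne_inv hk (by rw [one_mul]; exact h0 _)).symm
    have hinv : ∀ u : ZMod 2, inv (1 * chi 2 (-i)) = inv (chi 2 u) ↔ i = u := by
      intro u
      rw [chi2_neg, one_mul]
      exact ⟨fun e => (hi _ _).1 (inv_injective_LFT (h0 _) (h0 _) e), fun e => by rw [e]⟩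
    fin_cases j
    · change κ * E _ * κ⁻¹ = rot (-1) ↔ _
      rw [hE, dihLF_sr]
      simp only [hr _ (show (-1 : ℂ) ≠ 0 by norm_num), false_iff]
      clear * -
      revert i t; decide
    · change (E _ : Equiv.Perm Sphere) = 1 ↔ _
      rw [h1, DihedralGroup.one_def]
      refine ⟨nofun, fun h => ?_⟩
      clear * - h
      revert i t; decide
    · change κ * E _ * κ⁻¹ = inv _ ↔ _
      rw [hE, dihLF_sr, hinv]
      clear * -
      revert i t; decide
    · change κ * E _ * κ⁻¹ = inv (-chi 2 t) ↔ _
      rw [hE, dihLF_sr, hm', hinv]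
      clear * -
      revert i t; decide

/-- The irreducible characters of the Klein four-group. -/
def charK4 (t : ZMod 2) : Fin 4 → (DihedralGroup 2 →* ℂ)
  | 0 => 1
  | 1 => dihChar (n := 2) 1 (by simp) (ε := -1) (by norm_num)
  | 2 => dihChar (chi 2) chi2_mul_self (chi2_mul_self t)
  | 3 => dihChar (chi 2) chi2_mul_self (chi2_mul_self (t + 1))

theorem charK4_apply (t : ZMod 2) (i : Fin 4) (x : DihedralGroup 2) :
    charK4 t i x = tableK4 i (classK4 t x) := by
  fin_cases i
  · change 1 = _
    rcases x with j | j <;> fin_cases j <;> fin_cases t <;> rfl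
  · rcases x with j | j
    · fin_cases j <;> fin_cases t <;> rfl
    · change (-1 : ℂ) * 1 = _
      rw [mul_one]
      fin_cases j <;> fin_cases t <;> rfl
  · rcases x with j | j
    · change chi 2 j = _
      rw [chi2]
      fin_cases j <;> fin_cases t <;> rfl
    · change chi 2 t * chi 2 j = _
      rw [← AddChar.map_add_eq_mul, chi2]
      fin_cases j <;> fin_cases t <;> rfl
  · rcases x with j | j
    · change chi 2 j = _
      rw [chi2]
      fin_cases j <;> fin_cases t <;> rfl
    · change chi 2 (t + 1) * chi 2 j = _
      rw [← AddChar.map_add_eq_mul, chi2]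
      fin_cases j <;> fin_cases t <;> rfl

/-- The decomposition of the tangent representation at `{0, ∞, ±c, ±1/c}`. -/
def colsK4 (t : ZMod 2) : ∀ i : Fin 4, Fin ((![1, 0, 1, 1] : Fin 4 → ℕ) i) →
    Matrix (Fin 3) (Fin 1) ℂ
  | 0 => fun _ => !![0; 1; 0]
  | 1 => Fin.elim0
  | 2 => fun _ => !![1; 0; chi 2 t]
  | 3 => fun _ => !![1; 0; -chi 2 t]

/-- The point ∞ contributes the factor `k`; hence `k · k⁻⁴`, which is `k` because `k² = 1`. -/
theorem kap_enumTwoC_r {c : ℂ} (i : ZMod 2) :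
    kap (enumTwoC c) (dihGL 2 one_ne_zero (.r i)) = chi 2 i := by
  have h0 := chi_ne_zero (chi 2) i
  have h2 := chi2_mul_self i
  simp [kap, enumTwoC, Fin.prod_univ_six, dihGL, tf_rot_coe, tf_rot_infty, Matrix.det_fin_two]
  field_simp
  linear_combination (-1 - chi 2 i ^ 2) * h2

/-- The four finite nonzero points have product 1, the point 0 contributes `k` and ∞ contributes 1.
-/
theorem kap_enumTwoC_sr {c : ℂ} (hc : c ≠ 0) (i : ZMod 2) :
    kap (enumTwoC c) (dihGL 2 one_ne_zero (.sr i)) = chi 2 i := by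
  have h0 := chi_ne_zero (chi 2) i
  have h2 := chi2_mul_self i
  simp [kap, enumTwoC, Fin.prod_univ_six, dihGL, tf_inv_coe, tf_inv_infty, tf_inv_zero,
    Matrix.det_fin_two, hc]
  field_simp
  linear_combination (-1 - chi 2 i ^ 2) * h2

/-- The three lines are those of the middle monomial and of the sum and the difference of the outer
two. -/
theorem colsK4_mul {c : ℂ} (hc : c ≠ 0) (t : ZMod 2) (i : Fin 4)
    (s : Fin ((![1, 0, 1, 1] : Fin 4 → ℕ) i)) (x : DihedralGroup 2) :
    colsK4 t i s * rep1 (charK4 t i) x =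
      kap (enumTwoC c) (dihGL 2 one_ne_zero x) • sym2 (dihGL 2 one_ne_zero x) * colsK4 t i s := by
  have hpm : ∀ {k κ p y : ℂ}, p = κ * k ^ 2 → κ = κ * k ^ 2 →
      (!![1; 0; y] : Matrix (Fin 3) (Fin 1) ℂ) * !![p] =
        κ • !![k ^ 2, 0, 0; 0, k, 0; 0, 0, 1] * (!![1; 0; y] : Matrix (Fin 3) (Fin 1) ℂ) := by
    intro k κ p y h1 h2
    rw [h1]
    ext a b
    fin_cases a <;> fin_cases b <;> simp
    rw [← h2]
    ring
  have hpm' : ∀ {k κ p y : ℂ}, p = κ * k ^ 2 * y → y * p = κ →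
      (!![1; 0; y] : Matrix (Fin 3) (Fin 1) ℂ) * !![p] =
        κ • !![0, 0, k ^ 2; 0, k, 0; 1, 0, 0] * (!![1; 0; y] : Matrix (Fin 3) (Fin 1) ℂ) := by
    intro k κ p y h1 h2
    ext a b
    fin_cases a <;> fin_cases b <;> simp
    · linear_combination h1
    · linear_combination h2
  have h3 : ∀ i, chi 2 (i + 1) = -chi 2 i := fun i => by
    rw [AddChar.map_add_eq_mul, chi2 1]
    exact mul_neg_one _
  fin_cases i
  · change !![0; 1; 0] * rep1 1 x = _ * (!![0; 1; 0] : Matrix _ _ ℂ)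
    rcases x with i | i <;> have h2 := chi2_mul_self i
    · rw [kap_enumTwoC_r, dihGL, sym2_rot, rep1_apply]
      exact rot_mul_col h2.symm
    · rw [kap_enumTwoC_sr hc, dihGL, sym2_inv, rep1_apply, one_mul, chi2_neg]
      exact inv_mul_col h2.symm
  · exact s.elim0
  · change !![1; 0; chi 2 t] * rep1 (charK4 t 2) x = _ * (!![1; 0; chi 2 t] : Matrix _ _ ℂ)
    rcases x with i | i <;> have h2 := chi2_mul_self i
    · rw [kap_enumTwoC_r, dihGL, sym2_rot, rep1_apply]
      refine hpm ?_ ?_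
      · change chi 2 i = _
        linear_combination -chi 2 i * h2
      · linear_combination -chi 2 i * h2
    · rw [kap_enumTwoC_sr hc, dihGL, sym2_inv, rep1_apply, one_mul, chi2_neg]
      refine hpm' ?_ ?_
      · change chi 2 t * chi 2 i = _
        linear_combination -chi 2 i * chi 2 t * h2
      · change chi 2 t * (chi 2 t * chi 2 i) = _
        linear_combination chi 2 i * chi2_mul_self t
  · change !![1; 0; -chi 2 t] * rep1 (charK4 t 3) x = _ * (!![1; 0; -chi 2 t] : Matrix _ _ ℂ)
    rcases x with i | i <;> have h2 := chi2_mul_self i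
    · rw [kap_enumTwoC_r, dihGL, sym2_rot, rep1_apply]
      refine hpm ?_ ?_
      · change chi 2 i = _
        linear_combination -chi 2 i * h2
      · linear_combination -chi 2 i * h2
    · rw [kap_enumTwoC_sr hc, dihGL, sym2_inv, rep1_apply, one_mul, chi2_neg]
      refine hpm' ?_ ?_
      · change chi 2 (t + 1) * chi 2 i = _
        rw [h3]
        linear_combination chi 2 i * chi 2 t * h2
      · change -chi 2 t * (chi 2 (t + 1) * chi 2 i) = _
        rw [h3]
        linear_combination chi 2 i * chi2_mul_self t

theorem colsK4_span (t : ZMod 2) (j : Fin 3) : (Pi.single j 1 : Fin 3 → ℂ) ∈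
    ⨆ s : (Σ i, Fin ((![1, 0, 1, 1] : Fin 4 → ℕ) i)),
      LinearMap.range (colsK4 t s.1 s.2).mulVecLin := by
  have ht := chi2_mul_self t
  have h2 : ∀ v, (!![1; 0; chi 2 t] : Matrix (Fin 3) (Fin 1) ℂ) *ᵥ v ∈
      ⨆ s : (Σ i, Fin ((![1, 0, 1, 1] : Fin 4 → ℕ) i)),
      LinearMap.range (colsK4 t s.1 s.2).mulVecLin := fun v =>
    mem_iSup_range (d := fun _ => 1) (colsK4 t) 2 ⟨0, by decide⟩ v rfl
  have h3 : ∀ v, (!![1; 0; -chi 2 t] : Matrix (Fin 3) (Fin 1) ℂ) *ᵥ v ∈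
      ⨆ s : (Σ i, Fin ((![1, 0, 1, 1] : Fin 4 → ℕ) i)),
      LinearMap.range (colsK4 t s.1 s.2).mulVecLin := fun v =>
    mem_iSup_range (d := fun _ => 1) (colsK4 t) 3 ⟨0, by decide⟩ v rfl
  fin_cases j
  · convert add_mem (h2 ![1 / 2]) (h3 ![1 / 2]) using 1
    ext k
    fin_cases k <;> simp
    norm_num
  · refine mem_iSup_range (d := fun _ => 1) (colsK4 t) 0 ⟨0, by decide⟩ ![1] ?_
    change (!![0; 1; 0] : Matrix (Fin 3) (Fin 1) ℂ) *ᵥ ![1] = Pi.single 1 1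
    ext k
    fin_cases k <;> simp
  · convert sub_mem (h2 ![chi 2 t / 2]) (h3 ![chi 2 t / 2]) using 1
    ext k
    fin_cases k <;> simp
    linear_combination -ht

/-- The group of `{0, ∞, ±c, ±1/c}` always contains `⟨z ↦ -z, z ↦ 1/z⟩`. Having order four it equals
this group, which is why every `κ` is allowed. -/
theorem hasMultiplicityVector_K4 {α : Set Sphere} (hα : α.ncard = 6) (hcard : Nat.card (A α) = 4)
    {κ : Equiv.Perm Sphere} {c : ℂ} (h : IsTypeTwoC α κ c) {s : ℂ} (hs : s = 1 ∨ s = -1) :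
    HasMultiplicityVector α (classesK4 κ s) tableK4 ![1, 0, 1, 1] := by
  obtain ⟨hκ, hc, -, hκα⟩ := h
  have hb : Set.range (enumTwoC c) = κ '' α := by rw [hκα, enumTwoC, range_six]
  have h6 : (Set.range (enumTwoC c)).ncard = 6 := by rw [hb, ncard_image_perm _ hα]
  have hA : A (κ '' α) = (dihLF 2 one_ne_zero).range := by
    have hle := range_dihLF_le_A hc h6
    rw [hb] at hle
    have := finite_A hα
    have := Finite.of_equiv _ (conjA hκ (α := α)).toEquiv
    refine (Subgroup.eq_of_le_of_card_ge hle ?_).symm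
    rw [← Nat.card_congr (conjA hκ (α := α)).toEquiv, hcard,
      ← Nat.card_congr (MonoidHom.ofInjective (dihLF_injective 2 one_ne_zero)).toEquiv,
      DihedralGroup.nat_card]
  obtain ⟨t, rfl⟩ : ∃ t : ZMod 2, s = chi 2 t := by
    rcases hs with rfl | rfl
    · exact ⟨0, (chi2 0).symm⟩
    · exact ⟨1, (chi2 1).symm⟩
  obtain ⟨E, hE⟩ := exists_equiv_of_range (dihLF_injective 2 one_ne_zero) hκ hA
  exact hasMultiplicityVector_of E hκ hb (dihGL 2 one_ne_zero)
    (fun x => by rw [lf_dihGL, hE]) (fun x => ⟨classK4 t x, (mem_classesK4 hE t x _).2 rfl,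
      fun j hj => ((mem_classesK4 hE t x j).1 hj).symm⟩) (fun _ => 1) (fun i => rep1 (charK4 t i))
    (fun _ => isIrreducible_one _)
    (fun i j x hx => by
      rw [rep1_apply, Matrix.trace_fin_one_of, charK4_apply, (mem_classesK4 hE t x j).1 hx])
    (colsK4 t) (colsK4_mul hc t) (colsK4_span t) (by decide)

/-- The map `z ↦ (z - 1) / (z + 1)` sends 1, -1 to 0, ∞ and exchanges the roles of `z ↦ -z` and `z ↦
1 / z`. The other four points become `±c, ±1/c` because `b = ±1/a`. -/
theorem exists_isTypeTwoC {α : Set Sphere} {ψ : Equiv.Perm Sphere} (hψ : ψ ∈ LFT)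
    {a b : ℂ} (hab : PmParam a b) (h : ψ '' α = onSphere (pm a b)) (h1 : a * b = 1 ∨ a * b = -1) :
    ∃ κ c, IsTypeTwoC α κ c := by
  have h6 := ncard_pm hab
  obtain ⟨hne, hne', ha0, ha1, ha2, -⟩ := hab
  have e : pm a b = pm a a⁻¹ := by
    ext z
    rw [mem_pm, mem_pm]
    have : b ^ 2 = a⁻¹ ^ 2 := by
      rw [inv_pow]
      refine eq_inv_of_mul_eq_one_right ?_
      rw [← mul_pow]
      rcases h1 with h1 | h1 <;> rw [h1] <;> norm_num
    rw [this]
  rw [e] at h h6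
  have h1' : a - 1 ≠ 0 := sub_ne_zero.2 ha1
  have h2' : a + 1 ≠ 0 := fun h => ha2 (eq_neg_of_add_eq_zero_left h)
  have h1'' : 1 - a ≠ 0 := sub_ne_zero.2 ha1.symm
  have hd : (1 : ℂ) * 1 - (-1) * 1 ≠ 0 := by norm_num
  have e1 : mob 1 (-1) 1 1 ((1 : ℂ) : Sphere) = ((0 : ℂ) : Sphere) := by
    rw [mob_coe hd (by norm_num)]
    norm_num
  have e2 : mob 1 (-1) 1 1 ((-1 : ℂ) : Sphere) = ∞ := mob_pole hd (by norm_num)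
  have e3 : mob 1 (-1) 1 1 (a : Sphere) = (((a - 1) / (a + 1) : ℂ) : Sphere) := by
    rw [mob_coe hd (by rwa [one_mul]), one_mul, sub_eq_add_neg]
  have e4 : mob 1 (-1) 1 1 ((-a : ℂ) : Sphere) = ((((a - 1) / (a + 1))⁻¹ : ℂ) : Sphere) := by
    have hx : 1 * -a + 1 ≠ 0 := by
      rw [show 1 * -a + 1 = 1 - a by ring]
      exact h1''
    rw [mob_coe hd hx, inv_div]
    congr 1
    rw [div_eq_div_iff hx h1']
    ring
  have e5 : mob 1 (-1) 1 1 ((a⁻¹ : ℂ) : Sphere) = ((-((a - 1) / (a + 1)) : ℂ) : Sphere) := by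
    have hx : 1 * a⁻¹ + 1 ≠ 0 := by
      rw [show 1 * a⁻¹ + 1 = a⁻¹ * (a + 1) by field_simp; ring]
      exact mul_ne_zero (inv_ne_zero ha0) h2'
    rw [mob_coe hd hx, neg_div']
    congr 1
    rw [div_eq_div_iff hx h2']
    field_simp
    ring
  have e6 : mob 1 (-1) 1 1 ((-a⁻¹ : ℂ) : Sphere) = ((-((a - 1) / (a + 1))⁻¹ : ℂ) : Sphere) := by
    have hx : 1 * -a⁻¹ + 1 ≠ 0 := by
      rw [show 1 * -a⁻¹ + 1 = a⁻¹ * (a - 1) by field_simp; ring]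
      exact mul_ne_zero (inv_ne_zero ha0) h1'
    rw [mob_coe hd hx, inv_div, neg_div']
    congr 1
    rw [div_eq_div_iff hx h1']
    field_simp
    ring
  have hc : (a - 1) / (a + 1) ≠ 0 := div_ne_zero h1' h2'
  have himg : (mob 1 (-1) 1 1 * ψ : Equiv.Perm Sphere) '' α =
      {((0 : ℂ) : Sphere), ∞, ((((a - 1) / (a + 1) : ℂ)) : Sphere),
        ((-((a - 1) / (a + 1)) : ℂ) : Sphere), ((((a - 1) / (a + 1))⁻¹ : ℂ) : Sphere),
        ((-((a - 1) / (a + 1))⁻¹ : ℂ) : Sphere)} := by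
    rw [image_mul, h, onSphere_pm, range_six]
    simp only [Set.image_insert_eq, Set.image_singleton, e1, e2, e3, e4, e5, e6]
    ext z
    simp only [Set.mem_insert_iff, Set.mem_singleton_iff]
    tauto
  refine ⟨mob 1 (-1) 1 1 * ψ, (a - 1) / (a + 1), mul_mem (mob_mem _ _ _ _) hψ, hc, ?_, himg⟩
  -- If `c² = 1` or `c² = -1`, then `1 / c` coincides with `c` or with `-c`, and fewer than six
  -- points remain.
  intro h4
  have h6' : ((mob 1 (-1) 1 1 * ψ : Equiv.Perm Sphere) '' α).ncard = 6 := by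
    rw [image_mul, h, ncard_image_perm _ h6]
  rw [himg] at h6'
  have hinj := injective_of_range_ncard (range_six _ _ _ _ _ _) h6'
  have h4' : ((a - 1) / (a + 1)) ^ 2 = 1 ∨ ((a - 1) / (a + 1)) ^ 2 = -1 := by
    rw [← sq_eq_one_iff, ← pow_mul]
    exact h4
  rcases h4' with h | h
  · refine absurd (hinj (a₁ := 2) (a₂ := 4) ?_) (by decide)
    change ((_ : ℂ) : Sphere) = ((_ : ℂ) : Sphere)
    rw [← eq_inv_of_mul_eq_one_left (a := (a - 1) / (a + 1)) (by rw [← sq, h])]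
  · refine absurd (hinj (a₁ := 3) (a₂ := 4) ?_) (by decide)
    change ((_ : ℂ) : Sphere) = ((_ : ℂ) : Sphere)
    rw [← eq_inv_of_mul_eq_one_left (a := -((a - 1) / (a + 1))) (by linear_combination -h)]

theorem case_pm_klein {α : Set Sphere} {ψ : Equiv.Perm Sphere} (hψ : ψ ∈ LFT) {a b : ℂ}
    (hab : PmParam a b) (h : ψ '' α = onSphere (pm a b)) (h1 : a * b = 1 ∨ a * b = -1)
    (hA : ∀ f, f ∈ A (ψ '' α) ↔ f = 1 ∨ f = rot (-1) ∨ f = inv 1 ∨ f = inv (-1)) :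
    A α = conjGen ψ {rot (-1), inv 1} ∧
      Nonempty (A α ≃* Multiplicative (ZMod 2) × Multiplicative (ZMod 2)) ∧
      (∃ κ c, IsTypeTwoC α κ c) ∧
      ∀ κ c, IsTypeTwoC α κ c → ∀ s : ℂ, (s = 1 ∨ s = -1) →
        HasMultiplicityVector α (classesK4 κ s) tableK4 ![1, 0, 1, 1] := by
  have hα : α.ncard = 6 := by
    rw [← Set.ncard_image_of_injective _ ψ.injective, h, ncard_pm hab]
  have hA : A (ψ '' α) = (dihLF 2 one_ne_zero).range := by
    ext f
    rw [hA, mem_range_dihLF_two]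
  obtain ⟨E, -⟩ := exists_equiv_of_range (dihLF_injective 2 one_ne_zero) hψ hA
  obtain ⟨e⟩ := nonempty_dihedral_two
  refine ⟨A_eq_conjGen hψ (by rw [hA, range_dihLF, ζ2]), ⟨E.symm.trans e⟩,
    exists_isTypeTwoC hψ hab h h1, fun κ c hκ s hs => hasMultiplicityVector_K4 hα ?_ hκ hs⟩
  rw [← Nat.card_congr E.toEquiv, DihedralGroup.nat_card]

end SixPoints

end

noncomputable section
namespace SixPoints
open scoped OnePoint Pointwise Matrix

/-! ### The group of the octahedron -/

/-- The transformation `z ↦ (1 - z) / (1 + z)`. -/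
def cay : Equiv.Perm Sphere := mob (-1) 1 1 1

theorem cay_det : (-1 : ℂ) * 1 - 1 * 1 ≠ 0 := by norm_num

theorem cay_eq_lf : cay = lf (gl (-1) 1 1 1 cay_det) := mob_eq_lf _

theorem cay_mem : cay ∈ LFT := mob_mem _ _ _ _

theorem cay_coe {z : ℂ} (h : 1 + z ≠ 0) : cay (z : Sphere) = (((1 - z) / (1 + z) : ℂ) : Sphere) := by
  rw [cay, mob_coe cay_det (by rwa [one_mul, add_comm])]
  congr 2 <;> ring

theorem cay_neg_one : cay ((-1 : ℂ) : Sphere) = ∞ := mob_pole cay_det (by norm_num)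

theorem cay_infty : cay ∞ = ((-1 : ℂ) : Sphere) := by
  rw [cay, mob_infty cay_det one_ne_zero, div_one]

theorem cay_zero : cay ((0 : ℂ) : Sphere) = ((1 : ℂ) : Sphere) := by
  rw [cay_coe (by norm_num)]
  norm_num

theorem cay_one : cay ((1 : ℂ) : Sphere) = ((0 : ℂ) : Sphere) := by
  rw [cay_coe (by norm_num)]
  norm_num

theorem cay_I : cay (Complex.I : Sphere) = ((-Complex.I : ℂ) : Sphere) := by
  have h : 1 + Complex.I ≠ 0 := by
    intro h
    have := congrArg Complex.re h
    norm_num at this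
  rw [cay_coe h]
  congr 1
  rw [div_eq_iff h]
  linear_combination Complex.I_sq

theorem cay_neg_I : cay ((-Complex.I : ℂ) : Sphere) = (Complex.I : Sphere) := by
  have h : 1 + -Complex.I ≠ 0 := by
    intro h
    have := congrArg Complex.re h
    norm_num at this
  rw [cay_coe h]
  congr 1
  rw [div_eq_iff h]
  linear_combination Complex.I_sq

theorem cay_mul_cay : cay * cay = 1 := by
  rw [cay_eq_lf, ← map_mul, lf_eq_one]
  simp [Matrix.mul_apply, gl_val]

theorem cay_inv : cay⁻¹ = cay := inv_eq_of_mul_eq_one_left cay_mul_cay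

/-- `cay` exchanges the axis through 0, ∞ with the axis through 1, -1. This expresses inversions by
rotations and `cay`. -/
theorem cay_mul_rot_mul_cay : cay * rot (-1) * cay = inv 1 := by
  rw [cay_eq_lf, rot_eq_lf (by norm_num), inv_eq_lf one_ne_zero, ← map_mul, ← map_mul]
  refine lf_eq_of_scalar (k := 2) fun i j => ?_
  fin_cases i <;> fin_cases j <;> norm_num [Matrix.mul_apply, gl_val, Fin.sum_univ_two]

/-- An enumeration of the octahedron. -/
def enumOcta : Fin 6 → Sphere := ![((0 : ℂ) : Sphere), ∞, ((1 : ℂ) : Sphere),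
  ((Complex.I : ℂ) : Sphere), ((-1 : ℂ) : Sphere), ((-Complex.I : ℂ) : Sphere)]

theorem range_enumOcta : Set.range enumOcta = octahedron := by
  rw [octahedron_eq, enumOcta, range_six, range_six, Set.insert_comm]

theorem enumOcta_injective : Function.Injective enumOcta :=
  injective_of_range_ncard range_enumOcta ncard_octahedron

theorem cay_enumOcta (i : Fin 6) : cay (enumOcta i) = enumOcta ((![2, 4, 0, 5, 1, 3] : Fin 6 → Fin 6) i) := by
  fin_cases i
  · exact cay_zero
  · exact cay_infty
  · exact cay_one
  · exact cay_I
  · exact cay_neg_one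
  · exact cay_neg_I

theorem rot_I_enumOcta (i : Fin 6) :
    rot Complex.I (enumOcta i) = enumOcta ((![0, 1, 3, 4, 5, 2] : Fin 6 → Fin 6) i) := by
  have h := Complex.I_ne_zero
  have h2 := Complex.I_mul_I
  fin_cases i
  · change rot Complex.I ((0 : ℂ) : Sphere) = ((0 : ℂ) : Sphere)
    rw [rot_coe h, mul_zero]
  · exact rot_infty h
  · change rot Complex.I ((1 : ℂ) : Sphere) = ((Complex.I : ℂ) : Sphere)
    rw [rot_coe h, mul_one]
  · change rot Complex.I (Complex.I : Sphere) = ((-1 : ℂ) : Sphere)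
    rw [rot_coe h, h2]
  · change rot Complex.I ((-1 : ℂ) : Sphere) = ((-Complex.I : ℂ) : Sphere)
    rw [rot_coe h, mul_neg_one]
  · change rot Complex.I ((-Complex.I : ℂ) : Sphere) = ((1 : ℂ) : Sphere)
    rw [rot_coe h, mul_neg, h2, neg_neg]

theorem cay_mem_A : cay ∈ A octahedron := by
  refine mem_A_of_forall_mem ncard_octahedron cay_mem ?_
  rw [← range_enumOcta]
  rintro _ ⟨i, rfl⟩
  exact ⟨_, (cay_enumOcta i).symm⟩

theorem rot_I_mem_A : rot Complex.I ∈ A octahedron := by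
  refine mem_A_of_forall_mem ncard_octahedron (rot_mem _) ?_
  rw [← range_enumOcta]
  rintro _ ⟨i, rfl⟩
  exact ⟨_, (rot_I_enumOcta i).symm⟩

theorem exists_I_pow {k : ℂ} (h : k ^ 4 = 1) : ∃ j : ℕ, k = Complex.I ^ j := by
  rcases pow_four_eq_one.1 h with rfl | rfl | rfl | rfl
  · exact ⟨0, (pow_zero _).symm⟩
  · exact ⟨1, (pow_one _).symm⟩
  · exact ⟨2, Complex.I_sq.symm⟩
  · exact ⟨3, Complex.I_pow_three.symm⟩

theorem rot_mem_A_octahedron {k : ℂ} (h : k ^ 4 = 1) : rot k ∈ A octahedron := by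
  obtain ⟨j, rfl⟩ := exists_I_pow h
  rw [← rot_pow Complex.I_ne_zero]
  exact pow_mem rot_I_mem_A j

theorem ne_zero_of_pow_four {k : ℂ} (h : k ^ 4 = 1) : k ≠ 0 := by
  rintro rfl
  norm_num at h

/-- Fixing ∞ makes the transformation affine, and it preserves the zeros of `y ^ 5 - y`. The
constant coefficient modulo `x ^ 4 - 1`, compared with the value at 0, gives `5 p⁴ q = 0`, so the
translation part vanishes. -/
theorem eq_rot_of_mem_A_octahedron {f : Equiv.Perm Sphere} (hf : f ∈ A octahedron)
    (hi : f ∞ = ∞) : ∃ k : ℂ, k ^ 4 = 1 ∧ f = rot k := by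
  obtain ⟨g, rfl⟩ := exists_lf hf.1
  have hr : g 1 0 = 0 := by
    have := den_eq g ∞
    rw [hi] at this
    simpa [den, hc_infty] using this
  set p := g 0 0 with hp
  set q := g 0 1 with hq
  set s := g 1 1 with hs
  have hdet : p * s - q * 0 ≠ 0 := by
    have := det_ne g
    rwa [← det_eq, hr] at this
  have hx : ∀ x : ℂ, x = 0 ∨ x ^ 4 = 1 → (p * x + q) ^ 5 = (p * x + q) * s ^ 4 := by
    intro x hx
    have hm := apply_mem_of_mem_A hf (mem_octahedron.2 hx)
    have hne : lf g (x : Sphere) ≠ ∞ := by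
      rw [← hi]
      exact (lf g).injective.ne (OnePoint.coe_ne_infty x)
    obtain ⟨y, hy⟩ := OnePoint.ne_infty_iff_exists.1 hne
    rw [← hy, mem_octahedron] at hm
    obtain ⟨-, h⟩ := lf_coe_eq hy.symm
    rw [hr, zero_mul, zero_add] at h
    rw [h]
    rcases hm with rfl | hm
    · ring
    · linear_combination y * s ^ 5 * hm
  have h0 := hx 0 (Or.inl rfl)
  have hc := coeff_eq_zero (n := 4) ![q ^ 5 + 5 * p ^ 4 * q - q * s ^ 4, p ^ 5 + 5 * p * q ^ 4 - p * s ^ 4,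
      10 * p ^ 2 * q ^ 3, 10 * p ^ 3 * q ^ 2] (by
        intro x h4
        simp only [Fin.sum_univ_succ]
        simp
        linear_combination hx x (Or.inr h4) - (p ^ 5 * x + 5 * p ^ 4 * q) * h4)
  have h1 := congrFun hc 0
  have h1' : q ^ 5 + 5 * p ^ 4 * q - q * s ^ 4 = 0 := h1
  have hp0 : p ≠ 0 := by rintro h; simp [h] at hdet
  have hq0 : q = 0 := by
    have : 5 * p ^ 4 * q = 0 := by linear_combination h1' - h0
    simpa [hp0] using this
  obtain ⟨k, hk, e⟩ := lf_eq_rot hq0 hr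
  refine ⟨k, ?_, e⟩
  have := apply_mem_of_mem_A hf (mem_octahedron.2 (Or.inr (one_pow 4)))
  rw [e, rot_coe hk, mul_one, mem_octahedron] at this
  exact this.resolve_left hk

theorem inv_one_mem_A : inv 1 ∈ A octahedron := by
  rw [← cay_mul_rot_mul_cay]
  exact mul_mem (mul_mem cay_mem_A (rot_mem_A_octahedron (by norm_num))) cay_mem_A

/-- The vertices are an orbit under rotations and `cay`. The image of ∞ is moved back to ∞, and what
is left fixes ∞ and is a rotation. -/
theorem exists_of_mem_A_octahedron {f : Equiv.Perm Sphere} (hf : f ∈ A octahedron) :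
    (∃ k : ℂ, k ^ 4 = 1 ∧ (f = rot k ∨ f = inv k)) ∨
      ∃ m k : ℂ, m ^ 4 = 1 ∧ k ^ 4 = 1 ∧ f = rot m * cay * rot k := by
  have hv := apply_mem_of_mem_A hf infty_mem_octahedron
  obtain h | h | ⟨v, hv0, h⟩ := sphere_cases (f ∞)
  · obtain ⟨k, hk, e⟩ := eq_rot_of_mem_A_octahedron (mul_mem inv_one_mem_A hf) (by
      rw [Equiv.Perm.mul_apply, h, inv_zero one_ne_zero])
    have hk0 := ne_zero_of_pow_four hk
    refine Or.inl ⟨k⁻¹, by rw [inv_pow, hk, inv_one], Or.inr ?_⟩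
    rw [← one_div, ← inv_mul_rot one_ne_zero hk0, ← e, ← mul_assoc, inv_mul_inv one_ne_zero
      one_ne_zero, div_one, rot_one, one_mul]
  · obtain ⟨k, hk, e⟩ := eq_rot_of_mem_A_octahedron hf h
    exact Or.inl ⟨k, hk, Or.inl e⟩
  · rw [h, mem_octahedron] at hv
    have hv4 := hv.resolve_left hv0
    have hn := neg_ne_zero.2 hv0
    have hn4 : (-v) ^ 4 = 1 := by rw [Even.neg_pow (by decide), hv4]
    obtain ⟨k, hk, e⟩ := eq_rot_of_mem_A_octahedron (f := cay * (rot (-v))⁻¹ * f)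
      (mul_mem (mul_mem cay_mem_A (inv_mem (rot_mem_A_octahedron hn4))) hf) (by
      rw [Equiv.Perm.mul_apply, h, Equiv.Perm.mul_apply, rot_inv hn, rot_coe (inv_ne_zero hn),
        show (-v)⁻¹ * v = -1 by field_simp, cay_neg_one])
    refine Or.inr ⟨-v, k, hn4, hk, ?_⟩
    rw [← e]
    have := cay_mul_cay
    rw [show rot (-v) * cay * (cay * (rot (-v))⁻¹ * f) = rot (-v) * (cay * cay) * (rot (-v))⁻¹ * f by
      group, this]
    group

theorem A_octahedron : A octahedron = Subgroup.closure {rot Complex.I, cay} := by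
  apply le_antisymm
  · intro f hf
    have hr : ∀ k : ℂ, k ^ 4 = 1 → rot k ∈ Subgroup.closure {rot Complex.I, cay} := by
      intro k hk
      obtain ⟨j, rfl⟩ := exists_I_pow hk
      rw [← rot_pow Complex.I_ne_zero]
      exact pow_mem (Subgroup.subset_closure (by simp)) j
    have hc : cay ∈ Subgroup.closure {rot Complex.I, cay} := Subgroup.subset_closure (by simp)
    rcases exists_of_mem_A_octahedron hf with ⟨k, hk, rfl | rfl⟩ | ⟨m, k, hm, hk, rfl⟩
    · exact hr k hk
    · have : inv k = rot k * inv 1 := by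
        rw [rot_mul_inv (ne_zero_of_pow_four hk) one_ne_zero, mul_one]
      rw [this, ← cay_mul_rot_mul_cay]
      exact mul_mem (hr k hk) (mul_mem (mul_mem hc (hr _ (by norm_num))) hc)
    · exact mul_mem (mul_mem (hr m hm) hc) (hr k hk)
  · rw [Subgroup.closure_le]
    rintro f (rfl | rfl)
    · exact rot_I_mem_A
    · exact cay_mem_A

theorem A_octahedron' :
    A octahedron = Subgroup.closure {rot Complex.I, mob Complex.I 1 1 Complex.I} := by
  have hI := Complex.I_ne_zero
  have hd : Complex.I * Complex.I - 1 * 1 ≠ 0 := by norm_num [Complex.I_mul_I]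
  -- The second generator and `cay` lie in the same double coset of the rotations by quarter turns,
  -- so they may replace each other.
  have e : mob Complex.I 1 1 Complex.I = rot Complex.I ^ 3 * cay * rot Complex.I ^ 3 := by
    rw [rot_pow hI, cay_eq_lf, mob_eq_lf hd, rot_eq_lf (pow_ne_zero 3 hI), ← map_mul, ← map_mul]
    refine lf_eq_of_scalar (k := Complex.I) fun i j => ?_
    fin_cases i <;> fin_cases j <;> simp [Matrix.mul_apply, gl_val, Fin.sum_univ_two]
  have e' : cay = rot Complex.I * mob Complex.I 1 1 Complex.I * rot Complex.I := by
    have h4 : rot Complex.I ^ 4 = 1 := by rw [rot_pow hI, Complex.I_pow_four, rot_one]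
    rw [e, show rot Complex.I * (rot Complex.I ^ 3 * cay * rot Complex.I ^ 3) * rot Complex.I =
      rot Complex.I ^ 4 * cay * rot Complex.I ^ 4 by group, h4, one_mul, mul_one]
  rw [A_octahedron]
  apply le_antisymm <;> rw [Subgroup.closure_le] <;> rintro f (rfl | rfl)
  · exact Subgroup.subset_closure (by simp)
  · rw [e']
    have h1 : rot Complex.I ∈ Subgroup.closure {rot Complex.I, mob Complex.I 1 1 Complex.I} :=
      Subgroup.subset_closure (by simp)
    exact mul_mem (mul_mem h1 (Subgroup.subset_closure (by simp))) h1
  · exact Subgroup.subset_closure (by simp)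
  · rw [e]
    have h1 : rot Complex.I ∈ Subgroup.closure {rot Complex.I, cay} :=
      Subgroup.subset_closure (by simp)
    exact mul_mem (mul_mem (pow_mem h1 3) (Subgroup.subset_closure (by simp))) (pow_mem h1 3)

/-! ### The isomorphism with the symmetric group -/

open Equiv in
/-- The six four-cycles, corresponding to the vertices of the octahedron. -/
def fourCycle : Fin 6 → Perm (Fin 4) :=
  ![finRotate 4, (finRotate 4)⁻¹, c[1, 0, 2, 3], c[2, 1, 3, 0], c[3, 2, 0, 1], c[0, 3, 1, 2]]

/-- The number of a four-cycle. -/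
def fourCycleNum (x : Equiv.Perm (Fin 4)) : Fin 6 :=
  if x 0 = 1 then (if x 1 = 2 then 0 else 4) else
  if x 0 = 2 then (if x 2 = 3 then 2 else 3) else (if x 3 = 2 then 1 else 5)

/-- The action of the symmetric group on the vertices of the octahedron. -/
def octaAct (σ : Equiv.Perm (Fin 4)) (i : Fin 6) : Fin 6 := fourCycleNum (σ * fourCycle i * σ⁻¹)

/-- The symmetric group on four letters acts by conjugation on its six four-cycles as the octahedral
group acts on the vertices; a four-cycle and its inverse are opposite vertices. -/
theorem fourCycle_octaAct : ∀ (σ : Equiv.Perm (Fin 4)) (i : Fin 6),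
    fourCycle (octaAct σ i) = σ * fourCycle i * σ⁻¹ := by
  decide +kernel

theorem octaAct_one : ∀ i, octaAct 1 i = i := by decide +kernel

theorem octaAct_mul (σ τ : Equiv.Perm (Fin 4)) (i : Fin 6) :
    octaAct (σ * τ) i = octaAct σ (octaAct τ i) := by
  conv_rhs => rw [octaAct, fourCycle_octaAct]
  rw [octaAct]
  simp only [mul_inv_rev, mul_assoc]

theorem octaAct_faithful : ∀ σ : Equiv.Perm (Fin 4), (∀ i, octaAct σ i = i) → σ = 1 := by
  decide +kernel

theorem octaAct_rotate : ∀ i, octaAct (finRotate 4) i = (![0, 1, 3, 4, 5, 2] : Fin 6 → Fin 6) i := by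
  decide +kernel

theorem octaAct_swap : ∀ i, octaAct (Equiv.swap 0 1) i = (![2, 4, 0, 5, 1, 3] : Fin 6 → Fin 6) i := by
  decide +kernel

theorem closure_rotate_swap :
    Subgroup.closure {finRotate 4, Equiv.swap (0 : Fin 4) 1} = ⊤ :=
  Equiv.Perm.closure_cycle_adjacent_swap isCycle_finRotate support_finRotate 0

/-- The two actions need to be matched only on the generators, a four-cycle and an adjacent
transposition, which correspond to `rot Complex.I` and `cay`. -/
theorem exists_octaAct (σ : Equiv.Perm (Fin 4)) :
    ∃ f ∈ A octahedron, ∀ i, f (enumOcta i) = enumOcta (octaAct σ i) := by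
  have hσ : σ ∈ Subgroup.closure {finRotate 4, Equiv.swap (0 : Fin 4) 1} := by
    rw [closure_rotate_swap]
    trivial
  induction hσ using Subgroup.closure_induction with
  | mem x hx =>
    rcases hx with rfl | rfl
    · exact ⟨_, rot_I_mem_A, fun i => by rw [rot_I_enumOcta, octaAct_rotate]⟩
    · exact ⟨_, cay_mem_A, fun i => by rw [cay_enumOcta, octaAct_swap]⟩
  | one => exact ⟨1, one_mem _, fun i => by rw [octaAct_one]; rfl⟩
  | mul x y _ _ hx hy =>
    obtain ⟨f, hf, hf'⟩ := hx
    obtain ⟨g, hg, hg'⟩ := hy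
    exact ⟨f * g, mul_mem hf hg, fun i => by
      rw [Equiv.Perm.mul_apply, hg', hf', octaAct_mul]⟩
  | inv x _ hx =>
    obtain ⟨f, hf, hf'⟩ := hx
    refine ⟨f⁻¹, inv_mem hf, fun i => ?_⟩
    rw [Equiv.Perm.inv_eq_iff_eq, hf', ← octaAct_mul, mul_inv_cancel, octaAct_one]

theorem eq_of_enumOcta {f g : Equiv.Perm Sphere} (hf : f ∈ LFT) (hg : g ∈ LFT)
    (h : ∀ i, f (enumOcta i) = g (enumOcta i)) : f = g :=
  eq_of_three hf hg (enumOcta_injective.ne (show (0 : Fin 6) ≠ 1 by decide))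
    (enumOcta_injective.ne (show (0 : Fin 6) ≠ 2 by decide))
    (enumOcta_injective.ne (show (1 : Fin 6) ≠ 2 by decide)) (h 0) (h 1) (h 2)

/-- The group of the octahedron as the image of the symmetric group. -/
def octaLF : Equiv.Perm (Fin 4) →* Equiv.Perm Sphere where
  toFun σ := (exists_octaAct σ).choose
  map_one' := by
    have h := (exists_octaAct 1).choose_spec
    exact eq_of_enumOcta h.1.1 (one_mem _) fun i => by rw [h.2, octaAct_one]; rfl
  map_mul' σ τ := by
    have h := (exists_octaAct (σ * τ)).choose_spec
    have h1 := (exists_octaAct σ).choose_spec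
    have h2 := (exists_octaAct τ).choose_spec
    exact eq_of_enumOcta h.1.1 (mul_mem h1.1.1 h2.1.1) fun i => by
      rw [h.2, Equiv.Perm.mul_apply, h2.2, h1.2, octaAct_mul]

theorem octaLF_mem (σ : Equiv.Perm (Fin 4)) : octaLF σ ∈ A octahedron :=
  (exists_octaAct σ).choose_spec.1

theorem octaLF_apply (σ : Equiv.Perm (Fin 4)) (i : Fin 6) :
    octaLF σ (enumOcta i) = enumOcta (octaAct σ i) :=
  (exists_octaAct σ).choose_spec.2 i

theorem octaLF_rotate : octaLF (finRotate 4) = rot Complex.I :=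
  eq_of_enumOcta (octaLF_mem _).1 (rot_mem _) fun i => by
    rw [octaLF_apply, rot_I_enumOcta, octaAct_rotate]

theorem octaLF_swap : octaLF (Equiv.swap 0 1) = cay :=
  eq_of_enumOcta (octaLF_mem _).1 cay_mem fun i => by
    rw [octaLF_apply, cay_enumOcta, octaAct_swap]

theorem octaLF_injective : Function.Injective octaLF := by
  rw [injective_iff_map_eq_one]
  intro σ hσ
  refine octaAct_faithful σ fun i => enumOcta_injective ?_
  rw [← octaLF_apply, hσ]
  rfl

theorem octaLF_range : octaLF.range = A octahedron := by
  rw [A_octahedron, ← octaLF_rotate, ← octaLF_swap, MonoidHom.range_eq_map, ← closure_rotate_swap,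
    MonoidHom.map_closure, Set.image_insert_eq, Set.image_singleton]

end SixPoints

end

noncomputable section
namespace SixPoints
open scoped OnePoint Pointwise Matrix

/-! ### The conjugacy classes of the symmetric group of degree four -/

/-- Representatives of the conjugacy classes. -/
def repS4 : Fin 5 → Equiv.Perm (Fin 4) :=
  ![1, finRotate 4, finRotate 4 * Equiv.swap 0 1, finRotate 4 * finRotate 4, Equiv.swap 0 1]

theorem cycleType_repS4 (j : Fin 5) :
    (repS4 j).cycleType = (![0, {4}, {3}, {2, 2}, {2}] : Fin 5 → Multiset ℕ) j := by
  revert j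
  decide +kernel

theorem exists_isConj_repS4 : ∀ x : Equiv.Perm (Fin 4), ∃ j, IsConj (repS4 j) x := by
  simp only [isConj_iff]
  decide +kernel

/-- Whether the square is 1, whether the cube is 1 and whether the element is itself a square
separate the five classes; all three properties survive automorphisms. -/
theorem repS4_invariants : ∀ j k : Fin 5, (repS4 j ^ 2 = 1 ↔ repS4 k ^ 2 = 1) →
    (repS4 j ^ 3 = 1 ↔ repS4 k ^ 3 = 1) →
    ((∃ y, y * y = repS4 j) ↔ ∃ y, y * y = repS4 k) → j = k := by
  decide +kernel

/-- Automorphisms preserve each conjugacy class, so the labelling of classes in `A α` does not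
depend on the chosen isomorphism with the symmetric group. -/
theorem isConj_of_mulEquiv (e : Equiv.Perm (Fin 4) ≃* Equiv.Perm (Fin 4)) (x : Equiv.Perm (Fin 4)) :
    IsConj (e x) x := by
  obtain ⟨j, hj⟩ := exists_isConj_repS4 x
  obtain ⟨k, hk⟩ := exists_isConj_repS4 (e x)
  obtain ⟨τ, hτ⟩ := isConj_iff.1 hj
  obtain ⟨υ, hυ⟩ := isConj_iff.1 hk
  obtain ⟨E, hE⟩ : ∃ E : Equiv.Perm (Fin 4) ≃* Equiv.Perm (Fin 4), E (repS4 j) = repS4 k := by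
    refine ⟨((MulAut.conj τ).trans e).trans (MulAut.conj υ⁻¹), ?_⟩
    simp only [MulEquiv.trans_apply, MulAut.conj_apply, hτ, ← hυ]
    group
  have hjk : j = k := by
    refine repS4_invariants j k ?_ ?_ ?_ <;> rw [← hE]
    · rw [← map_pow, EmbeddingLike.map_eq_one_iff]
    · rw [← map_pow, EmbeddingLike.map_eq_one_iff]
    · constructor
      · rintro ⟨y, hy⟩
        exact ⟨E y, by rw [← map_mul, hy]⟩
      · rintro ⟨y, hy⟩
        exact ⟨E.symm y, by rw [← map_mul, hy, E.symm_apply_apply]⟩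
  rw [← hjk] at hk
  exact hk.symm.trans hj

/-! ### The irreducible representations -/

/-- The two-dimensional representation of the symmetric group of degree four, with integer
entries: the action on the three pairings of four letters, modulo their sum. -/
def pairRepInt : Equiv.Perm (Fin 4) →* Matrix (Fin 2) (Fin 2) ℤ where
  -- The xor of two of the letters 0, 1, 2, 3 numbers the pairing that contains them as a pair. The
  -- columns are the images of the first two pairings, each minus the image of the third.
  toFun σ := Matrix.of fun i j =>
    (if (σ 0).val ^^^ (σ (j.succ.castSucc)).val = i.val + 1 then 1 else 0) -
      (if (σ 0).val ^^^ (σ 3).val = i.val + 1 then 1 else 0)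
  map_one' := by decide +kernel
  map_mul' := by decide +kernel

/-- The two-dimensional representation of the symmetric group of degree four. -/
def pairRep : Equiv.Perm (Fin 4) →* Matrix (Fin 2) (Fin 2) ℂ :=
  (RingHom.mapMatrix (Int.castRingHom ℂ)).toMonoidHom.comp pairRepInt

theorem pairRep_trace (σ : Equiv.Perm (Fin 4)) :
    (pairRep σ).trace = ((pairRepInt σ).trace : ℂ) := by
  simp [pairRep, Matrix.trace_fin_two]

theorem isIrreducible_pairRep : (matRep pairRep).IsIrreducible := by
  apply isIrreducible_two (x := finRotate 4) (y := Equiv.swap 0 1)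
  have h : (pairRepInt (finRotate 4) * pairRepInt (Equiv.swap 0 1) -
      pairRepInt (Equiv.swap 0 1) * pairRepInt (finRotate 4)).det ≠ 0 := by
    decide +kernel
  have e : pairRep (finRotate 4) * pairRep (Equiv.swap 0 1) -
      pairRep (Equiv.swap 0 1) * pairRep (finRotate 4) =
      RingHom.mapMatrix (Int.castRingHom ℂ) (pairRepInt (finRotate 4) * pairRepInt (Equiv.swap 0 1) -
      pairRepInt (Equiv.swap 0 1) * pairRepInt (finRotate 4)) := by
    rw [RingHom.map_sub, RingHom.map_mul, RingHom.map_mul]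
    rfl
  rw [e, ← RingHom.map_det]
  exact Int.cast_ne_zero.2 h

/-- The sign character with complex values. -/
def signChar : Equiv.Perm (Fin 4) →* ℂ :=
  (Int.castRingHom ℂ).toMonoidHom.comp ((Units.coeHom ℤ).comp Equiv.Perm.sign)

theorem signChar_apply (σ : Equiv.Perm (Fin 4)) : signChar σ = ((Equiv.Perm.sign σ : ℤ) : ℂ) := rfl

/-- The tensor product of a representation with a character. -/
def twistRep {Γ : Type*} [Group Γ] {n : ℕ} (χ : Γ →* ℂ) (X : Representation ℂ Γ (Fin n → ℂ)) :
    Representation ℂ Γ (Fin n → ℂ) where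
  toFun x := χ x • X x
  map_one' := by simp
  map_mul' x y := by
    rw [map_mul, map_mul, smul_mul_smul_comm]

theorem twistRep_apply {Γ : Type*} [Group Γ] {n : ℕ} (χ : Γ →* ℂ)
    (X : Representation ℂ Γ (Fin n → ℂ)) (x : Γ) : twistRep χ X x = χ x • X x := rfl

theorem isIrreducible_twistRep {Γ : Type*} [Group Γ] {n : ℕ} [NeZero n] (χ : Γ →* ℂ)
    {X : Representation ℂ Γ (Fin n → ℂ)} (hX : X.IsIrreducible) :
    (twistRep χ X).IsIrreducible := by
  have hχ : ∀ x, χ x ≠ 0 := fun x => (Group.isUnit x |>.map χ).ne_zero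
  refine isIrreducible_of_forall _ fun S hS => ?_
  let S' : Subrepresentation X := ⟨S.toSubmodule, fun x v hv => by
    have := S.toSubmodule.smul_mem (χ x)⁻¹ (S.apply_mem_toSubmodule x hv)
    rwa [twistRep_apply, LinearMap.smul_apply, smul_smul, inv_mul_cancel₀ (hχ x), one_smul] at this⟩
  have := hX.eq_bot_or_eq_top S'
  rcases this with h | h
  · exact absurd (congrArg Subrepresentation.toSubmodule h) hS
  · exact congrArg Subrepresentation.toSubmodule h

/-! ### The tangent representation at the octahedron -/

theorem kap_enumOcta_rot {k : ℂ} (h : k * 1 - 0 * 0 ≠ 0) :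
    kap enumOcta (gl k 0 0 1 h) = (k ^ 3)⁻¹ := by
  have hk : k ≠ 0 := by simpa using h
  simp [kap, enumOcta, Fin.prod_univ_six, tf_rot_coe, tf_rot_infty, Matrix.det_fin_two]
  field_simp

theorem one_add_I_ne_zero : 1 + Complex.I ≠ 0 := by
  intro h
  have := congrArg Complex.re h
  norm_num at this

theorem one_sub_I_ne_zero : 1 - Complex.I ≠ 0 := by
  intro h
  have := congrArg Complex.re h
  norm_num at this

/-- The point -1 is the pole and contributes its numerator `2 k`; the other factors are 1, 1, 2, `1
+ i` and `1 - i`. -/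
theorem tf_octa {k : ℂ} (h : (-k) * 1 - k * 1 ≠ 0) :
    ∏ i, tf (gl (-k) k 1 1 h) (enumOcta i) = 8 * k := by
  have h1 := one_add_I_ne_zero
  have h2 : -Complex.I + 1 ≠ 0 := by
    rw [neg_add_eq_sub]
    exact one_sub_I_ne_zero
  rw [add_comm] at h1
  have h3 : (1 : ℂ) + 1 ≠ 0 := by norm_num
  simp [enumOcta, Fin.prod_univ_six, tf, den, num, hc_coe, hc_infty, h1, h2, h3]
  linear_combination (-4 * k) * Complex.I_sq

theorem kap_cay : kap enumOcta (gl (-1) 1 1 1 cay_det) = 1 / 2 := by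
  have := tf_octa (k := 1) (by norm_num)
  rw [kap, this]
  norm_num [Matrix.det_fin_two]

theorem rot_cay_det : (-Complex.I) * 1 - Complex.I * 1 ≠ 0 := by
  intro h
  have := congrArg Complex.im h
  norm_num at this

theorem kap_rot_cay :
    kap enumOcta (gl (-Complex.I) Complex.I 1 1 rot_cay_det) = Complex.I / 2 := by
  have := tf_octa (k := Complex.I) rot_cay_det
  rw [kap, this]
  simp [Matrix.det_fin_two]
  rw [show (-Complex.I - Complex.I) ^ 4 = 16 * Complex.I ^ 4 by ring, Complex.I_pow_four]
  ring

/-- A subspace of `ℂ³` invariant under the matrices of two octahedral rotations is trivial. -/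
theorem octa_invariant {V : Submodule ℂ (Fin 3 → ℂ)} (hV : V ≠ ⊥)
    (h1 : ∀ v ∈ V, (![-Complex.I * v 0, -v 1, Complex.I * v 2] : Fin 3 → ℂ) ∈ V)
    (h2 : ∀ v ∈ V, (![v 0 - 2 * v 1 + v 2, -v 0 + v 2, v 0 + 2 * v 1 + v 2] : Fin 3 → ℂ) ∈ V) :
    V = ⊤ := by
  have hI := Complex.I_sq
  -- The first map is diagonal with the distinct eigenvalues `-i, -1, i`, so interpolation
  -- polynomials in it project onto the coordinate lines. The second map then leads from any
  -- coordinate line to the others.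
  have hcoord : ∀ v ∈ V, ∀ j, v j ≠ 0 → (Pi.single j 1 : Fin 3 → ℂ) ∈ V := by
    intro v hv j hj
    have hd := h1 v hv
    have hdd := h1 _ hd
    have key : ∀ c : ℂ, c ≠ 0 → (c * v j) • (Pi.single j 1 : Fin 3 → ℂ) ∈ V →
        (Pi.single j 1 : Fin 3 → ℂ) ∈ V := by
      intro c hc this
      have := V.smul_mem (c * v j)⁻¹ this
      rwa [smul_smul, inv_mul_cancel₀ (mul_ne_zero hc hj), one_smul] at this
    fin_cases j
    · refine key (-2 * (1 + Complex.I)) (mul_ne_zero (by norm_num) one_add_I_ne_zero) ?_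
      convert add_mem (add_mem hdd (V.smul_mem (1 - Complex.I) hd)) (V.smul_mem (-Complex.I) hv)
      ext k
      fin_cases k <;> simp
      · linear_combination (-2 * v 0) * hI
      · ring
      · linear_combination (0 : ℂ) * hI
    · refine key 2 two_ne_zero ?_
      convert add_mem hdd hv
      ext k
      fin_cases k <;> simp
      · linear_combination (-v 0) * hI
      · ring
      · linear_combination (-v 2) * hI
    · refine key (-2 * (1 - Complex.I)) (mul_ne_zero (by norm_num) one_sub_I_ne_zero) ?_
      convert add_mem (add_mem hdd (V.smul_mem (1 + Complex.I) hd)) (V.smul_mem Complex.I hv)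
      ext k
      fin_cases k <;> simp
      · linear_combination (0 : ℂ) * hI
      · ring
      · linear_combination (-2 * v 2) * hI
  obtain ⟨v, hv, hv0⟩ := Submodule.exists_mem_ne_zero_of_ne_bot hV
  obtain ⟨j, hj⟩ := Function.ne_iff.1 hv0
  have hj' := hcoord v hv j hj
  have h0 : (Pi.single 0 1 : Fin 3 → ℂ) ∈ V := by
    fin_cases j
    · exact hj'
    · exact hcoord _ (h2 _ hj') 0 (by simp)
    · exact hcoord _ (h2 _ hj') 0 (by simp)
  have hall : ∀ j, (Pi.single j 1 : Fin 3 → ℂ) ∈ V := by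
    intro j
    refine hcoord _ (h2 _ h0) j ?_
    fin_cases j <;> simp
  rw [eq_top_iff]
  intro v _
  rw [pi_eq_sum_univ' v]
  exact sum_mem fun j _ => V.smul_mem _ (hall j)

theorem isIrreducible_tangentRep {α : Set Sphere} {l : K 3} {φ : Equiv.Perm Sphere} (hφ : φ ∈ LFT)
    (hl : φ '' α = Set.range (pts (l : Fin 3 → ℂ))) {ψ : Equiv.Perm Sphere} (hψ : ψ ∈ LFT)
    (h : ψ '' α = octahedron) :
    Representation.IsIrreducible ((tangentRep l).comp (stabEquiv hφ hl).toMonoidHom) := by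
  obtain ⟨L, hL⟩ := exists_coordinates hφ hl hψ (range_enumOcta.trans h.symm)
  have hmem : ∀ F ∈ A octahedron, ∃ x : A α, ψ * x * ψ⁻¹ = F := fun F hF =>
    ⟨(conjA hψ).symm ⟨F, h ▸ hF⟩, conjA_symm_spec hψ _⟩
  refine isIrreducible_of_forall _ fun S hS => ?_
  have hinv : ∀ F ∈ A octahedron, ∀ M, lf M = F → ∀ v ∈ S.toSubmodule.map L.toLinearMap,
      kap enumOcta M • sym2 M *ᵥ v ∈ S.toSubmodule.map L.toLinearMap := by
    rintro F hF M hM _ ⟨v, hv, rfl⟩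
    obtain ⟨x, hx⟩ := hmem F hF
    exact ⟨_, S.apply_mem_toSubmodule x hv, hL x M (hM.trans hx.symm) v⟩
  have hI := Complex.I_sq
  have htop : S.toSubmodule.map L.toLinearMap = ⊤ := by
    refine octa_invariant ?_ ?_ ?_
    · rw [ne_eq, Submodule.map_eq_bot_iff]
      exact hS
    · intro v hv
      have := hinv _ rot_I_mem_A _ (rot_eq_lf Complex.I_ne_zero).symm v hv
      rw [kap_enumOcta_rot, sym2_rot] at this
      convert this using 1
      ext k
      fin_cases k <;> simp [dotProduct, Fin.sum_univ_three, Complex.I_pow_three]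
      linear_combination -v 1 * hI
    · intro v hv
      have := Submodule.smul_mem _ (2 : ℂ) (hinv _ cay_mem_A _ cay_eq_lf.symm v hv)
      rw [kap_cay] at this
      convert this using 1
      ext k
      fin_cases k <;> simp [sym2, dotProduct, Fin.sum_univ_three]
      ring
  rw [eq_top_iff]
  intro v _
  obtain ⟨w, hw, e⟩ : L v ∈ S.toSubmodule.map L.toLinearMap := htop ▸ trivial
  rwa [L.injective e] at hw

theorem tangentRep_character {α : Set Sphere} {l : K 3} {φ : Equiv.Perm Sphere} (hφ : φ ∈ LFT)
    (hl : φ '' α = Set.range (pts (l : Fin 3 → ℂ))) {ψ : Equiv.Perm Sphere} (hψ : ψ ∈ LFT)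
    {b : Fin 6 → Sphere} (hb : Set.range b = ψ '' α) {h : A α} {M : GL (Fin 2) ℂ}
    (hM : lf M = ψ * h * ψ⁻¹) :
    Representation.character ((tangentRep l).comp (stabEquiv hφ hl).toMonoidHom) h =
      (kap b M • sym2 M).trace := by
  obtain ⟨L, hL⟩ := exists_coordinates hφ hl hψ hb
  change LinearMap.trace ℂ _ (tangentRep l (stabEquiv hφ hl h)) = _
  rw [← LinearMap.trace_conj' _ L]
  have : L.conj (tangentRep l (stabEquiv hφ hl h)) = Matrix.toLin' (kap b M • sym2 M) := by
    refine LinearMap.ext fun v => ?_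
    rw [LinearEquiv.conj_apply_apply, hL h M hM, L.apply_symm_apply, Matrix.toLin'_apply,
      Matrix.smul_mulVec]
  rw [this, Matrix.trace_toLin'_eq]

/-- A character is a class function, so five traces of `kap • sym2` suffice. They are those of the
third row, which identifies the tangent representation with that irreducible. -/
theorem tangentRep_character_repS4 {α : Set Sphere} {l : K 3} {φ : Equiv.Perm Sphere}
    (hφ : φ ∈ LFT) (hl : φ '' α = Set.range (pts (l : Fin 3 → ℂ))) {ψ : Equiv.Perm Sphere}
    (hψ : ψ ∈ LFT) (h : ψ '' α = octahedron) {E : Equiv.Perm (Fin 4) ≃* A α}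
    (hE : ∀ x, ψ * E x * ψ⁻¹ = octaLF x) (j : Fin 5) :
    Representation.character ((tangentRep l).comp (stabEquiv hφ hl).toMonoidHom) (E (repS4 j)) =
      tableS4 2 j := by
  have key : ∀ M : GL (Fin 2) ℂ, lf M = octaLF (repS4 j) →
      Representation.character ((tangentRep l).comp (stabEquiv hφ hl).toMonoidHom) (E (repS4 j)) =
      (kap enumOcta M • sym2 M).trace := fun M hM =>
    tangentRep_character hφ hl hψ (range_enumOcta.trans h.symm) (hM.trans (hE _).symm)
  have hI := Complex.I_ne_zero
  have hI2 := Complex.I_sq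
  have hm1 : (-1 : ℂ) ≠ 0 := by norm_num
  fin_cases j
  · refine (key (gl 1 0 0 1 (by norm_num)) ?_).trans ?_
    · rw [← rot_eq_lf one_ne_zero, rot_one]
      exact (map_one octaLF).symm
    · rw [kap_enumOcta_rot, sym2_rot]
      change _ = (3 : ℂ)
      simp [Matrix.trace_fin_three]
      norm_num
  · refine (key (gl Complex.I 0 0 1 (by simp)) ?_).trans ?_
    · rw [← rot_eq_lf hI]
      exact octaLF_rotate.symm
    · rw [kap_enumOcta_rot, sym2_rot]
      change _ = (-1 : ℂ)
      simp [Matrix.trace_fin_three, Complex.I_pow_three]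
  · refine (key (gl (-Complex.I) Complex.I 1 1 rot_cay_det) ?_).trans ?_
    · have : octaLF (repS4 2) = rot Complex.I * cay := by
        rw [← octaLF_rotate, ← octaLF_swap, ← map_mul]
        rfl
      refine Eq.trans ?_ this.symm
      rw [cay_eq_lf, rot_eq_lf hI, ← map_mul]
      congr 1
      ext i j
      fin_cases i <;> fin_cases j <;> simp [Matrix.mul_apply, gl_val]
    · rw [kap_rot_cay]
      change _ = (0 : ℂ)
      simp [Matrix.trace_fin_three, sym2]
  · refine (key (gl (-1) 0 0 1 (by simp)) ?_).trans ?_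
    · have : octaLF (repS4 3) = rot Complex.I * rot Complex.I := by
        rw [← octaLF_rotate, ← map_mul]
        rfl
      refine Eq.trans ?_ this.symm
      rw [← rot_eq_lf hm1, rot_mul_rot hI hI, Complex.I_mul_I]
    · rw [kap_enumOcta_rot, sym2_rot]
      change _ = (-1 : ℂ)
      rw [Matrix.trace_fin_three]
      change ((-1 : ℂ) ^ 3)⁻¹ * (-1) ^ 2 + ((-1) ^ 3)⁻¹ * (-1) + ((-1) ^ 3)⁻¹ * 1 = -1
      norm_num
  · refine (key (gl (-1) 1 1 1 cay_det) ?_).trans ?_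
    · rw [← cay_eq_lf]
      exact octaLF_swap.symm
    · rw [kap_cay]
      change _ = (1 : ℂ)
      simp [Matrix.trace_fin_three, sym2]
      norm_num

/-- The irreducible representations of a group isomorphic to the symmetric group of degree four. -/
def repsS4 {Γ : Type*} [Group Γ] (e : Γ ≃* Equiv.Perm (Fin 4))
    (X : Representation ℂ Γ (Fin 3 → ℂ)) :
    ∀ i : Fin 5, Representation ℂ Γ (Fin ((![1, 1, 3, 3, 2] : Fin 5 → ℕ) i) → ℂ)
  | 0 => matRep (rep1 1)
  | 1 => matRep (rep1 (signChar.comp e.toMonoidHom))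
  | 2 => X
  | 3 => twistRep (signChar.comp e.toMonoidHom) X
  | 4 => (matRep pairRep).comp e.toMonoidHom

theorem repsS4_irreducible {Γ : Type*} [Group Γ] (e : Γ ≃* Equiv.Perm (Fin 4))
    {X : Representation ℂ Γ (Fin 3 → ℂ)} (hX : X.IsIrreducible) (i : Fin 5) :
    (repsS4 e X i).IsIrreducible := by
  fin_cases i
  · exact isIrreducible_one _
  · exact isIrreducible_one _
  · exact hX
  · exact isIrreducible_twistRep _ hX
  · exact isIrreducible_comp isIrreducible_pairRep e

theorem repsS4_character {Γ : Type*} [Group Γ] (e : Γ ≃* Equiv.Perm (Fin 4))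
    {X : Representation ℂ Γ (Fin 3 → ℂ)}
    (hX : ∀ j, X.character (e.symm (repS4 j)) = tableS4 2 j) (i j : Fin 5) :
    (repsS4 e X i).character (e.symm (repS4 j)) = tableS4 i j := by
  have hsign : signChar.comp e.toMonoidHom (e.symm (repS4 j)) =
      (![1, -1, 1, 1, -1] : Fin 5 → ℂ) j := by
    change signChar (e (e.symm (repS4 j))) = _
    rw [e.apply_symm_apply, signChar_apply]
    have : (Equiv.Perm.sign (repS4 j) : ℤ) = (![1, -1, 1, 1, -1] : Fin 5 → ℤ) j := by
      revert j
      decide +kernel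
    rw [this]
    fin_cases j <;> simp
  fin_cases i
  · change (matRep (rep1 1)).character _ = _
    rw [matRep_character, rep1_apply, Matrix.trace_fin_one_of]
    fin_cases j <;> rfl
  · change (matRep (rep1 _)).character _ = _
    rw [matRep_character, rep1_apply, Matrix.trace_fin_one_of, hsign]
    fin_cases j <;> rfl
  · exact hX j
  · change LinearMap.trace ℂ (Fin 3 → ℂ) ((signChar.comp e.toMonoidHom (e.symm (repS4 j)) : ℂ) •
      X (e.symm (repS4 j))) = _
    rw [map_smul, hsign]
    change _ • X.character _ = _
    rw [hX]
    fin_cases j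
    · exact one_mul (3 : ℂ)
    · exact (neg_mul_neg (1 : ℂ) 1).trans (one_mul 1)
    · exact one_mul (0 : ℂ)
    · exact one_mul (-1 : ℂ)
    · exact (mul_one (-1 : ℂ))
  · change (matRep pairRep).character (e (e.symm (repS4 j))) = _
    rw [e.apply_symm_apply, matRep_character, pairRep_trace]
    have : (pairRepInt (repS4 j)).trace = (![2, 0, -1, 2, 0] : Fin 5 → ℤ) j := by
      clear * -
      revert j
      decide +kernel
    rw [this]
    fin_cases j
    · exact Int.cast_ofNat 2
    · exact Int.cast_zero
    · change ((-1 : ℤ) : ℂ) = -1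
      norm_num
    · exact Int.cast_ofNat 2
    · exact Int.cast_zero

theorem case_octahedron {α : Set Sphere} {ψ : Equiv.Perm Sphere} (hψ : ψ ∈ LFT)
    (h : ψ '' α = octahedron) :
    A α = conjGen ψ {rot Complex.I, mob Complex.I 1 1 Complex.I} ∧
      Nonempty (A α ≃* Equiv.Perm (Fin 4)) ∧
      ∀ Ψ : A α ≃* Equiv.Perm (Fin 4),
        HasMultiplicityVector α (classesS4 α Ψ) tableS4 ![0, 0, 1, 0, 0] := by
  obtain ⟨E, hE⟩ := exists_equiv_of_range octaLF_injective hψ (h ▸ octaLF_range.symm)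
  refine ⟨A_eq_conjGen hψ (by rw [h, A_octahedron']), ⟨E.symm⟩, fun Ψ l φ hφ hl => ?_⟩
  have hconj : ∀ x, (Ψ x).cycleType = (E.symm x).cycleType := by
    intro x
    rw [← Equiv.Perm.isConj_iff_cycleType_eq]
    have := isConj_of_mulEquiv (E.trans Ψ) (E.symm x)
    simpa using this
  have hmem : ∀ (x : A α) j, (x : Equiv.Perm Sphere) ∈ classesS4 α Ψ j ↔
      IsConj (repS4 j) (E.symm x) := by
    intro x j
    rw [Equiv.Perm.isConj_iff_cycleType_eq, cycleType_repS4, ← hconj]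
    exact ⟨fun ⟨_, e⟩ => e.symm, fun e => ⟨x.2, e.symm⟩⟩
  -- The tangent representation itself serves as the third irreducible, so the identity map is the
  -- whole decomposition; its twist by the sign is the fourth.
  set X := (tangentRep l).comp (stabEquiv hφ hl).toMonoidHom with hX
  refine hasMultiplicities_of hφ hl (fun x => ?_) ![1, 1, 3, 3, 2] (repsS4 E.symm X)
    (repsS4_irreducible _ (isIrreducible_tangentRep hφ hl hψ h)) (fun i j x hx => ?_)
    (fun s => match s with
      | ⟨0, s⟩ => Fin.elim0 s
      | ⟨1, s⟩ => Fin.elim0 s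
      | ⟨2, _⟩ => LinearMap.id
      | ⟨3, s⟩ => Fin.elim0 s
      | ⟨4, s⟩ => Fin.elim0 s) ?_ ?_ (by decide)
  · simp only [hmem]
    obtain ⟨j, hj⟩ := exists_isConj_repS4 (E.symm x)
    refine ⟨j, hj, fun k hk => ?_⟩
    have := hk.trans hj.symm
    rw [Equiv.Perm.isConj_iff_cycleType_eq, cycleType_repS4, cycleType_repS4] at this
    clear * - this
    revert k j
    decide
  · obtain ⟨τ, hτ⟩ := isConj_iff.1 ((hmem x j).1 hx)
    have : x = E τ * E (repS4 j) * (E τ)⁻¹ := by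
      rw [← map_inv, ← map_mul, ← map_mul, hτ, E.apply_symm_apply]
    rw [this, Representation.char_conj]
    exact repsS4_character E.symm (tangentRep_character_repS4 hφ hl hψ h hE) i j
  · rintro ⟨i, s⟩ x v
    fin_cases i
    · exact s.elim0
    · exact s.elim0
    · rfl
    · exact s.elim0
    · exact s.elim0
  · rw [eq_top_iff]
    intro v _
    exact Submodule.mem_iSup_of_mem ⟨2, ⟨0, by decide⟩⟩ ⟨v, rfl⟩

end SixPoints

end

noncomputable section
namespace SixPoints
open scoped OnePoint Pointwise

/-! ### Equivalence of sets under linear fractional transformations -/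

/-- Some linear fractional transformation maps `S` onto `T`. -/
def MobiusEquiv (S T : Set Sphere) : Prop := ∃ χ ∈ LFT, χ '' S = T

theorem MobiusEquiv.symm {S T : Set Sphere} (h : MobiusEquiv S T) : MobiusEquiv T S := by
  obtain ⟨χ, hχ, rfl⟩ := h
  exact ⟨χ⁻¹, inv_mem hχ, image_inv_image χ S⟩

theorem MobiusEquiv.trans {S T U : Set Sphere} (h : MobiusEquiv S T) (h' : MobiusEquiv T U) :
    MobiusEquiv S U := by
  obtain ⟨χ, hχ, rfl⟩ := h
  obtain ⟨χ', hχ', rfl⟩ := h'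
  exact ⟨χ' * χ, mul_mem hχ' hχ, image_mul χ' χ S⟩

theorem neg_one_ne_zero_complex : (-1 : ℂ) ≠ 0 := neg_ne_zero.2 one_ne_zero

theorem zero_notMem_pm {a b : ℂ} (ha : a ≠ 0) (hb : b ≠ 0) : (0 : ℂ) ∉ pm a b := by
  rw [mem_pm, zero_pow two_ne_zero]
  rintro (h | h | h)
  · exact zero_ne_one h
  · exact pow_ne_zero 2 ha h.symm
  · exact pow_ne_zero 2 hb h.symm

theorem pm_congr {a b a' b' : ℂ} (ha : a ^ 2 = a' ^ 2) (hb : b ^ 2 = b' ^ 2) :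
    pm a b = pm a' b' := by
  ext z
  rw [mem_pm, mem_pm, ha, hb]

theorem pm_comm (a b : ℂ) : pm a b = pm b a := by
  ext z
  rw [mem_pm, mem_pm, or_comm (a := z ^ 2 = a ^ 2)]

theorem rot_neg_one_mem_A_pm {a b : ℂ} (h : PmParam a b) : rot (-1) ∈ A (onSphere (pm a b)) := by
  refine mem_A_of_forall_mem (ncard_pm h) (rot_mem _) fun z hz => ?_
  obtain ⟨w, hw, rfl⟩ := exists_of_mem_onSphere hz
  rw [rot_coe neg_one_ne_zero_complex, mem_onSphere, mem_pm]
  rw [mem_pm] at hw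
  simpa using hw

theorem rot_mem_A_hex {a k : ℂ} (h : HexParam a) (hk : k ^ 3 = 1) :
    rot k ∈ A (onSphere (hex a)) := by
  have hk0 : k ≠ 0 := by rintro rfl; norm_num at hk
  refine mem_A_of_forall_mem (ncard_hex h) (rot_mem _) fun z hz => ?_
  obtain ⟨w, hw, rfl⟩ := exists_of_mem_onSphere hz
  rw [rot_coe hk0, mem_onSphere, mem_hex, mul_pow, hk, one_mul]
  exact mem_hex.1 hw

theorem conj_mem_A_of_image {S T : Set Sphere} {χ h : Equiv.Perm Sphere} (hχ : χ ∈ LFT)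
    (e : χ '' S = T) (hh : h ∈ A S) : χ * h * χ⁻¹ ∈ A T := by
  rw [← e]
  exact (conj_mem_A hχ).2 hh

/-- A transformation that commutes with `z ↦ -z` maps `pm a b` onto one of six sets. -/
theorem pm_eq_of_commute {a b a' b' : ℂ} (h : PmParam a b) (h' : PmParam a' b')
    {χ : Equiv.Perm Sphere} (hχ : χ ∈ LFT) (e : χ '' onSphere (pm a b) = onSphere (pm a' b'))
    (hc : χ * rot (-1) = rot (-1) * χ) :
    pm a b = pm a' b' ∨ pm a b = pm (1 / a') (b' / a') ∨ pm a b = pm (1 / b') (a' / b') ∨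
      pm a b = pm (1 / a') (1 / b') ∨ pm a b = pm a' (a' / b') ∨ pm a b = pm b' (b' / a') := by
  have ha' : a' ≠ 0 := h'.2.2.1
  have hb' : b' ≠ 0 := h'.2.2.2.2.2.1
  have h1 : (1 : ℂ) ∈ pm a b := by rw [mem_pm]; norm_num
  have hmem : ∀ z, z ∈ onSphere (pm a b) ↔ χ z ∈ onSphere (pm a' b') := fun z => by
    rw [← e, χ.injective.mem_set_image]
  obtain ⟨c, hc0, hc | hc⟩ := eq_rot_or_inv_of_conj hχ neg_one_ne_zero_complex
    neg_one_ne_zero_complex (by norm_num) hc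
  · have hz : ∀ z : ℂ, z ∈ pm a b ↔ c * z ∈ pm a' b' := fun z => by
      rw [← mem_onSphere, hmem, hc, rot_coe hc0, mem_onSphere]
    -- Since 1 lies in the source, the scalar satisfies `c² = 1`, `a'²` or `b'²`. Three values for
    -- each of the two types of transformation give the six sets.
    have hcm := (hz 1).1 h1
    rw [mul_one, mem_pm] at hcm
    have key : ∀ z, z ∈ pm a b ↔ c ^ 2 * z ^ 2 = 1 ∨ c ^ 2 * z ^ 2 = a' ^ 2 ∨
        c ^ 2 * z ^ 2 = b' ^ 2 := fun z => by rw [hz, mem_pm, mul_pow]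
    rcases hcm with hcm | hcm | hcm <;> rw [hcm] at key
    · left
      ext z
      rw [key, mem_pm, one_mul]
    · right; left
      ext z
      rw [key, mem_pm, div_pow, div_pow, one_pow, eq_div_iff (pow_ne_zero 2 ha'),
        eq_div_iff (pow_ne_zero 2 ha'), mul_comm (z ^ 2), mul_eq_left₀ (pow_ne_zero 2 ha')]
      tauto
    · right; right; left
      ext z
      rw [key, mem_pm, div_pow, div_pow, one_pow, eq_div_iff (pow_ne_zero 2 hb'),
        eq_div_iff (pow_ne_zero 2 hb'), mul_comm (z ^ 2), mul_eq_left₀ (pow_ne_zero 2 hb')]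
      tauto
  · have hz : ∀ z : ℂ, z ≠ 0 → (z ∈ pm a b ↔ c / z ∈ pm a' b') := fun z hz => by
      rw [← mem_onSphere, hmem, hc, inv_coe hc0 hz, mem_onSphere]
    have hcm := (hz 1 one_ne_zero).1 h1
    rw [div_one, mem_pm] at hcm
    have key : ∀ z, z ≠ 0 → (z ∈ pm a b ↔ c ^ 2 = z ^ 2 ∨ c ^ 2 = a' ^ 2 * z ^ 2 ∨
        c ^ 2 = b' ^ 2 * z ^ 2) := fun z hz' => by
      rw [hz z hz', mem_pm, div_pow, div_eq_iff (pow_ne_zero 2 hz'), div_eq_iff (pow_ne_zero 2 hz'),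
        div_eq_iff (pow_ne_zero 2 hz'), one_mul]
    have ext' : ∀ u v : ℂ, u ≠ 0 → v ≠ 0 → (∀ z, z ≠ 0 → (z ∈ pm a b ↔ z ∈ pm u v)) →
        pm a b = pm u v := by
      intro u v hu hv H
      ext z
      by_cases hz' : z = 0
      · subst hz'
        exact iff_of_false (zero_notMem_pm h.2.2.1 h.2.2.2.2.2.1) (zero_notMem_pm hu hv)
      · exact H z hz'
    have hs : ∀ x y : ℂ, y ≠ 0 → ∀ z : ℂ, (x ^ 2 = y ^ 2 * z ^ 2 ↔ z ^ 2 = (x / y) ^ 2) := by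
      intro x y hy z
      rw [div_pow, eq_div_iff (pow_ne_zero 2 hy), mul_comm, eq_comm]
    rcases hcm with hcm | hcm | hcm <;> rw [hcm] at key
    · right; right; right; left
      refine ext' _ _ (one_div_ne_zero ha') (one_div_ne_zero hb') fun z hz' => ?_
      have h1' := hs 1
      rw [one_pow] at h1'
      rw [key z hz', mem_pm, h1' a' ha', h1' b' hb', eq_comm (a := 1)]
    · right; right; right; right; left
      refine ext' _ _ ha' (div_ne_zero ha' hb') fun z hz' => ?_
      rw [key z hz', mem_pm, hs a' a' ha', hs a' b' hb', div_self ha', one_pow,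
        eq_comm (a := a' ^ 2)]
      tauto
    · right; right; right; right; right
      refine ext' _ _ hb' (div_ne_zero hb' ha') fun z hz' => ?_
      rw [key z hz', mem_pm, hs b' a' ha', hs b' b' hb', div_self hb', one_pow,
        eq_comm (a := b' ^ 2)]
      tauto

/-- A transformation that conjugates nontrivial rotations maps `hex a` onto `hex a'` only if the
cubes of the parameters are equal or inverse to each other. -/
theorem cube_eq_of_conj {a a' : ℂ} (h : HexParam a) (h' : HexParam a') {χ : Equiv.Perm Sphere}
    (hχ : χ ∈ LFT) (e : χ '' onSphere (hex a) = onSphere (hex a')) {k k' : ℂ} (hk : k ≠ 0)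
    (hk' : k' ≠ 0) (hk1 : k' ≠ 1) (hc : χ * rot k = rot k' * χ) :
    a ^ 3 = a' ^ 3 ∨ a ^ 3 * a' ^ 3 = 1 := by
  have hmem : ∀ z, z ∈ hex a → χ (z : Sphere) ∈ onSphere (hex a') := fun z hz => by
    rw [← e]
    exact ⟨z, mem_onSphere.2 hz, rfl⟩
  have h1 := hmem 1 (by rw [mem_hex]; norm_num)
  have h2 := hmem a (by rw [mem_hex]; norm_num)
  have ha := h.ne_zero
  have ha1 := cube_ne_one h
  obtain ⟨c, hc0, hc | hc⟩ := eq_rot_or_inv_of_conj hχ hk hk' hk1 hc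
  · rw [hc, rot_coe hc0, mem_onSphere, mem_hex] at h1 h2
    rw [mul_one] at h1
    rw [mul_pow] at h2
    rcases h1 with h1 | h1 <;> rw [h1] at h2 <;> rcases h2 with h2 | h2
    · rw [one_mul] at h2; contradiction
    · left; rw [← h2, one_mul]
    · right; rw [← h2, mul_comm]
    · exact absurd ((mul_eq_left₀ (pow_ne_zero 3 h'.ne_zero)).1 h2) ha1
  · rw [hc, inv_coe hc0 one_ne_zero, mem_onSphere, mem_hex, div_one] at h1
    rw [hc, inv_coe hc0 ha, mem_onSphere, mem_hex, div_pow, div_eq_iff (pow_ne_zero 3 ha),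
      div_eq_iff (pow_ne_zero 3 ha)] at h2
    rcases h1 with h1 | h1 <;> rw [h1] at h2 <;> rcases h2 with h2 | h2
    · rw [one_mul] at h2; exact absurd h2.symm ha1
    · right; rw [h2, mul_comm]
    · left; rw [h2, one_mul]
    · exact absurd ((mul_eq_left₀ (pow_ne_zero 3 h'.ne_zero)).1 h2.symm) ha1

theorem hexRoots6_iff {a : ℂ} : HexRoots6 a ↔ a ^ 3 = -1 := by
  have h6 := ζ6_cube
  have h3 := ζ_pow 3
  constructor
  · rintro (rfl | rfl | rfl)
    · exact h6
    · rw [mul_pow, h6, h3, one_mul]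
    · rw [mul_pow, h6, ← pow_mul, mul_comm 2, pow_mul, h3, one_pow, one_mul]
  · intro h
    have h0 := ζ_ne_zero 6
    have : (a / ζ 6) ^ 3 = 1 := by rw [div_pow, h, h6, div_self neg_one_ne_zero_complex]
    obtain ⟨i, hi, e⟩ := (isPrimitiveRoot_ζ 3).eq_pow_of_pow_eq_one this
    rw [eq_div_iff h0] at e
    rw [← e]
    interval_cases i
    · left; rw [pow_zero, one_mul]
    · right; left; rw [pow_one]
    · right; right; rfl

theorem hexOcta_iff {a : ℂ} : HexOcta a ↔ a ^ 3 = (-(2 + (√3 : ℝ)) : ℂ) ^ 3 := by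
  have h3 := ζ_pow 3
  have h0 : (-(2 + (√3 : ℝ)) : ℂ) ≠ 0 := by
    rw [neg_ne_zero]
    exact_mod_cast (by positivity : (2 + √3 : ℝ) ≠ 0)
  constructor
  · rintro (rfl | rfl | rfl)
    · rfl
    · rw [mul_pow, h3, mul_one]
    · rw [mul_pow, ← pow_mul, mul_comm 2, pow_mul, h3, one_pow, mul_one]
  · intro h
    have : (a / (-(2 + (√3 : ℝ)) : ℂ)) ^ 3 = 1 := by rw [div_pow, h, div_self (pow_ne_zero 3 h0)]
    obtain ⟨i, hi, e⟩ := (isPrimitiveRoot_ζ 3).eq_pow_of_pow_eq_one this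
    rw [eq_div_iff h0, mul_comm] at e
    rw [← e]
    interval_cases i
    · left; rw [pow_zero, mul_one]
    · right; left; rw [pow_one]
    · right; right; rfl

theorem hex_eq_roots6 {a : ℂ} (h : a ^ 3 = -1) : hex a = roots6 := by
  ext z
  rw [mem_hex, mem_roots6, h, show z ^ 6 = (z ^ 3) ^ 2 by ring, sq_eq_one_iff]

end SixPoints

end

noncomputable section
namespace SixPoints
open scoped OnePoint Pointwise

/-! ### The sets `pm a b` equivalent to the sixth roots of unity or to the octahedron -/

theorem MobiusEquiv.refl (S : Set Sphere) : MobiusEquiv S S := ⟨1, one_mem _, by simp⟩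

theorem eq_of_subset_of_ncard {S T : Set ℂ} (hS : (onSphere S).ncard = 6)
    (hT : (onSphere T).ncard = 6) (h : S ⊆ T) : S = T := by
  rw [ncard_onSphere] at hS hT
  exact Set.eq_of_subset_of_ncard_le h (by omega) (Set.finite_of_ncard_ne_zero (by omega))

theorem mobiusEquiv_pm_div {a b : ℂ} (h : PmParam a b) :
    MobiusEquiv (onSphere (pm a b)) (onSphere (pm (1 / a) (b / a))) := by
  have ha := h.2.2.1
  have ha2 := pow_ne_zero 2 ha
  refine ⟨rot a⁻¹, rot_mem _, ?_⟩
  rw [image_onSphere_rot (inv_ne_zero ha)]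
  congr 1
  ext z
  constructor
  · rintro ⟨w, hw, rfl⟩
    rw [mem_pm] at hw ⊢
    simp only [mul_pow, div_pow, inv_pow, one_pow]
    field_simp
    tauto
  · intro hz
    refine ⟨a * z, ?_, inv_mul_cancel_left₀ ha z⟩
    rw [mem_pm, div_pow, div_pow, one_pow, eq_div_iff ha2, eq_div_iff ha2] at hz
    rw [mem_pm, mul_pow, mul_comm, mul_eq_right₀ ha2]
    tauto

theorem sq_sqrt_three : ((√3 : ℝ) : ℂ) ^ 2 = 3 := by
  exact_mod_cast Real.sq_sqrt (show (0 : ℝ) ≤ 3 by norm_num)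

theorem sq_sqrt_two : ((√2 : ℝ) : ℂ) ^ 2 = 2 := by
  exact_mod_cast Real.sq_sqrt (show (0 : ℝ) ≤ 2 by norm_num)

theorem pmParam_sqrt_three : PmParam (2 - (√3 : ℝ)) (2 + (√3 : ℝ)) := by
  have h1 : (1 : ℝ) < √3 := Real.lt_sqrt_of_sq_lt (by norm_num)
  have h2 : √3 < 2 := (Real.sqrt_lt' (by norm_num)).2 (by norm_num)
  refine ⟨?_, ?_, ?_, ?_, ?_, ?_, ?_, ?_⟩ <;> intro h <;> have := congrArg Complex.re h <;>
    simp at this <;> linarith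

theorem pmParam_sqrt_two : PmParam (3 - 2 * (√2 : ℝ)) (((√2 : ℝ) - 1) * Complex.I) := by
  have h1 : (1 : ℝ) < √2 := Real.lt_sqrt_of_sq_lt (by norm_num)
  have h2 : √2 < 3 / 2 := (Real.sqrt_lt' (by norm_num)).2 (by norm_num)
  refine ⟨?_, ?_, ?_, ?_, ?_, ?_, ?_, ?_⟩ <;> intro h <;> have h3 := congrArg Complex.re h <;>
    have h4 := congrArg Complex.im h <;> simp at h3 h4 <;> linarith

theorem involution_det : Complex.I * Complex.I - 1 * 1 ≠ 0 := by
  rw [Complex.I_mul_I]; norm_num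

/-- The points ±1 go to points with square 1. For the other four roots the images satisfy `w⁴ - 14
w² + 1 = 0`, whose roots have the squares `7 ± 4√3 = (2 ± √3)²`. -/
theorem image_roots6_pm : mob Complex.I 1 1 Complex.I '' onSphere roots6 =
    onSphere (pm (2 - (√3 : ℝ)) (2 + (√3 : ℝ))) := by
  refine image_eq_of_forall_mem ncard_roots6 (ncard_pm pmParam_sqrt_three) fun z hz => ?_
  obtain ⟨z, hz6, rfl⟩ := exists_of_mem_onSphere hz
  replace hz := mem_roots6.1 hz6
  have hI := Complex.I_sq
  have hd : 1 * z + Complex.I ≠ 0 := by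
    intro h
    have h' : z = -Complex.I := by linear_combination h
    have : z ^ 6 = -1 := by
      rw [h']
      linear_combination (Complex.I ^ 4 - Complex.I ^ 2 + 1) * hI
    rw [hz] at this
    norm_num at this
  rw [mob_coe involution_det hd, mem_onSphere, mem_pm]
  have hd2 := pow_ne_zero 2 hd
  have hz' : (z ^ 2 - 1) * (z ^ 4 + z ^ 2 + 1) = 0 := by linear_combination hz
  have h3 := sq_sqrt_three
  rcases mul_eq_zero.1 hz' with hz | hz
  · left
    rw [div_pow, div_eq_one_iff_eq hd2]
    linear_combination (z ^ 2 - 1) * hI - 2 * hz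
  · right
    have key : (((Complex.I * z + 1) / (1 * z + Complex.I)) ^ 2 - (2 - (√3 : ℝ)) ^ 2) *
        (((Complex.I * z + 1) / (1 * z + Complex.I)) ^ 2 - (2 + (√3 : ℝ)) ^ 2) = 0 := by
      generalize hw : (Complex.I * z + 1) / (1 * z + Complex.I) = w
      have hw' : w ^ 4 - 14 * w ^ 2 + 1 = 0 := by
        have hD : (1 * z + Complex.I) ^ 2 = 2 * Complex.I * z + (z ^ 2 - 1) := by
          linear_combination hI
        have hy : w ^ 2 * (1 * z + Complex.I) ^ 2 = 2 * Complex.I * z - (z ^ 2 - 1) := by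
          rw [← hw, div_pow, div_mul_cancel₀ _ hd2]
          linear_combination z ^ 2 * hI
        rw [hD] at hy hd2
        apply mul_left_cancel₀ (pow_ne_zero 2 hd2)
        linear_combination (w ^ 2 * (2 * Complex.I * z + (z ^ 2 - 1)) + 2 * Complex.I * z -
          (z ^ 2 - 1) - 14 * (2 * Complex.I * z + (z ^ 2 - 1))) * hy + 16 * hz - 48 * z ^ 2 * hI
      linear_combination hw' + ((√3 : ℝ) ^ 2 - 5 - 2 * w ^ 2) * h3
    exact (mul_eq_zero.1 key).imp sub_eq_zero.1 sub_eq_zero.1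

/-- The same transformation turns the involution `z ↦ -1/z` of the sixth roots of unity into `z ↦
-z`. -/
theorem mob_I_mul_inv : mob Complex.I 1 1 Complex.I * inv (-1) =
    rot (-1) * mob Complex.I 1 1 Complex.I := by
  rw [mob_eq_lf involution_det, rot_eq_lf neg_one_ne_zero_complex,
    inv_eq_lf neg_one_ne_zero_complex, ← map_mul, ← map_mul]
  refine lf_eq_of_scalar (k := Complex.I) fun i j => ?_
  fin_cases i <;> fin_cases j <;> simp [Matrix.mul_apply, gl_val, Fin.sum_univ_two]

theorem pmRoots6_of_pm_eq {a b : ℂ}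
    (h : let t : ℂ := 2 - (√3 : ℝ)
      let s : ℂ := 2 + (√3 : ℝ)
      pm a b = pm t s ∨ pm a b = pm (1 / t) (s / t) ∨ pm a b = pm (1 / s) (t / s) ∨
      pm a b = pm (1 / t) (1 / s) ∨ pm a b = pm t (t / s) ∨ pm a b = pm s (s / t)) :
    PmRoots6 a b := by
  have h3 := sq_sqrt_three
  have hts : (2 - (√3 : ℝ) : ℂ) * (2 + (√3 : ℝ)) = 1 := by linear_combination -h3
  have ht0 := left_ne_zero_of_mul (hts ▸ one_ne_zero)
  have hs0 := right_ne_zero_of_mul (hts ▸ one_ne_zero)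
  have e1 : 1 / (2 - (√3 : ℝ) : ℂ) = 2 + (√3 : ℝ) := by
    rw [div_eq_iff ht0]; linear_combination -hts
  have e2 : 1 / (2 + (√3 : ℝ) : ℂ) = 2 - (√3 : ℝ) := by
    rw [div_eq_iff hs0]; linear_combination -hts
  have e3 : (2 + (√3 : ℝ)) / (2 - (√3 : ℝ) : ℂ) = 7 + 4 * (√3 : ℝ) := by
    rw [div_eq_iff ht0]; linear_combination 4 * h3
  have e4 : (2 - (√3 : ℝ)) / (2 + (√3 : ℝ) : ℂ) = 7 - 4 * (√3 : ℝ) := by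
    rw [div_eq_iff hs0]; linear_combination 4 * h3
  simp only [e1, e2, e3, e4] at h
  unfold PmRoots6
  rw [pm_comm (7 - _)]
  rw [pm_comm (2 + (√3 : ℝ)) (2 - (√3 : ℝ))] at h
  tauto

/-- The data attached to a set equivalent to `pm a b`: an involution without fixed points in it. -/
theorem conj_rot_neg_one {a b : ℂ} (h : PmParam a b) {T : Set Sphere} {χ : Equiv.Perm Sphere}
    (hχ : χ ∈ LFT) (e : χ '' onSphere (pm a b) = T) :
    χ * rot (-1) * χ⁻¹ ∈ A T ∧ (χ * rot (-1) * χ⁻¹) * (χ * rot (-1) * χ⁻¹) = 1 ∧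
      ∀ z ∈ T, (χ * rot (-1) * χ⁻¹) z ≠ z := by
  have hn := neg_one_ne_zero_complex
  refine ⟨conj_mem_A_of_image hχ e (rot_neg_one_mem_A_pm h), ?_, ?_⟩
  · have : rot (-1) * rot (-1) = 1 := by rw [rot_mul_rot hn hn, neg_mul_neg, one_mul, rot_one]
    rw [show χ * rot (-1) * χ⁻¹ * (χ * rot (-1) * χ⁻¹) = χ * (rot (-1) * rot (-1)) * χ⁻¹ by group,
      this, mul_one, mul_inv_cancel]
  · rw [← e]
    rintro _ ⟨z, hz, rfl⟩ hf
    obtain ⟨w, hw, rfl⟩ := exists_of_mem_onSphere hz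
    have hf' : χ (rot (-1) (w : Sphere)) = χ w := by simpa using hf
    have := χ.injective hf'
    rw [rot_coe hn, OnePoint.coe_eq_coe] at this
    have hw0 : w = 0 := by linear_combination (-1 / 2) * this
    exact zero_notMem_pm h.2.2.1 h.2.2.2.2.2.1 (hw0 ▸ hw)

/-- The image of `z ↦ -z` is an involution of the hexagon without fixed vertex: either `z ↦ -z`, or
`z ↦ k / z` with `k³ = -1`. In the first case the sets agree up to a scaling or an inversion
preserving the hexagon; the second type is conjugate to `z ↦ -1/z` and is reduced to `z ↦ -z` by the
explicit transformation. -/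
theorem pmRoots6_of_equiv {a b : ℂ} (h : PmParam a b)
    (e : MobiusEquiv (onSphere (pm a b)) (onSphere roots6)) : PmRoots6 a b := by
  obtain ⟨χ, hχ, e⟩ := e
  obtain ⟨hA, hsq, hfix⟩ := conj_rot_neg_one h hχ e
  have hn := neg_one_ne_zero_complex
  obtain ⟨k, hk6, hk | hk⟩ := mem_A_roots6.1 hA <;> rw [hk] at hsq hfix <;>
    rw [mul_inv_eq_iff_eq_mul] at hk
  all_goals have hk0 : k ≠ 0 := by rintro rfl; norm_num at hk6
  · rw [rot_mul_rot hk0 hk0, ← rot_one] at hsq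
    have hkk := rot_injective (mul_ne_zero hk0 hk0) one_ne_zero hsq
    rcases mul_self_eq_one_iff.1 hkk with rfl | rfl
    · have := hfix ((1 : ℂ) : Sphere) (mem_onSphere.2 (mem_roots6.2 (one_pow 6)))
      rw [rot_one] at this
      exact absurd rfl this
    · left
      refine eq_of_subset_of_ncard (ncard_pm h) ncard_roots6 fun z hz => ?_
      have hmem : ∀ z ∈ pm a b, χ (z : Sphere) ∈ onSphere roots6 := fun z hz => by
        rw [← e]
        exact ⟨z, mem_onSphere.2 hz, rfl⟩
      have h1 := hmem 1 (by rw [mem_pm]; norm_num)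
      have h2 := hmem z hz
      have hz0 : z ≠ 0 := fun h0 => zero_notMem_pm h.2.2.1 h.2.2.2.2.2.1 (h0 ▸ hz)
      obtain ⟨c, hc0, hc | hc⟩ := eq_rot_or_inv_of_conj hχ hn hn (by norm_num) hk
      · rw [hc, rot_coe hc0, mem_onSphere, mem_roots6] at h1 h2
        rw [mul_one] at h1
        rw [mul_pow, h1, one_mul] at h2
        exact mem_roots6.2 h2
      · rw [hc, inv_coe hc0 one_ne_zero, mem_onSphere, mem_roots6, div_one] at h1
        rw [hc, inv_coe hc0 hz0, mem_onSphere, mem_roots6, div_pow, h1,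
          div_eq_one_iff_eq (pow_ne_zero 6 hz0)] at h2
        exact mem_roots6.2 h2.symm
  · have hk3 : (k ^ 3 - 1) * (k ^ 3 + 1) = 0 := by linear_combination hk6
    rcases mul_eq_zero.1 hk3 with hk3 | hk3
    -- For `k³ = 1` the vertex `k²` is fixed, since `k / k² = k²`.
    · have := hfix ((k ^ 2 : ℂ) : Sphere)
        (mem_onSphere.2 (mem_roots6.2 (by linear_combination (k ^ 6 + 1) * hk6)))
      rw [inv_coe hk0 (pow_ne_zero 2 hk0)] at this
      refine absurd ?_ this
      congr 1
      rw [div_eq_iff (pow_ne_zero 2 hk0)]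
      linear_combination -k * hk3
    -- Rotation by `k⁻²` conjugates `z ↦ k / z` to `z ↦ -1 / z` because `k³ = -1`.
    · have hm0 : k⁻¹ ^ 2 ≠ 0 := pow_ne_zero 2 (inv_ne_zero hk0)
      have hrot : rot (k⁻¹ ^ 2) ∈ A (onSphere roots6) :=
        mem_A_roots6.2 ⟨_, by rw [← pow_mul, mul_comm, pow_mul, inv_pow, hk6, inv_one, one_pow],
          Or.inl rfl⟩
      refine pmRoots6_of_pm_eq (pm_eq_of_commute h pmParam_sqrt_three
        (χ := mob Complex.I 1 1 Complex.I * (rot (k⁻¹ ^ 2) * χ))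
        (mul_mem (mob_mem _ _ _ _) (mul_mem (rot_mem _) hχ)) ?_ ?_)
      · rw [image_mul, image_mul, e, image_eq_of_mem_A hrot, image_roots6_pm]
      · have : k⁻¹ ^ 2 * k = -1 / k⁻¹ ^ 2 := by
          field_simp
          linear_combination hk3
        rw [← mul_assoc (rot (-1)), ← mob_I_mul_inv, mul_assoc, mul_assoc, hk, ← mul_assoc (rot _),
          rot_mul_inv hm0 hk0, mul_assoc, ← mul_assoc (inv _), inv_mul_rot hn hm0, this]

theorem equiv_of_pmRoots6 {a b : ℂ} (h : PmRoots6 a b) :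
    MobiusEquiv (onSphere (pm a b)) (onSphere roots6) := by
  have h3 := sq_sqrt_three
  have hts : (2 - (√3 : ℝ) : ℂ) * (2 + (√3 : ℝ)) = 1 := by linear_combination -h3
  have ht0 := left_ne_zero_of_mul (hts ▸ one_ne_zero)
  have hs0 := right_ne_zero_of_mul (hts ▸ one_ne_zero)
  have hp := pmParam_sqrt_three
  have hp' : PmParam (2 + (√3 : ℝ)) (2 - (√3 : ℝ)) :=
    pmParam_of_ncard (by rw [pm_comm]; exact ncard_pm hp)
  have key : MobiusEquiv (onSphere (pm (2 - (√3 : ℝ)) (2 + (√3 : ℝ)))) (onSphere roots6) :=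
    MobiusEquiv.symm ⟨_, mob_mem _ _ _ _, image_roots6_pm⟩
  rcases h with h | h | h | h <;> rw [h]
  · exact .refl _
  · have := (mobiusEquiv_pm_div hp').symm
    rw [pm_comm (2 + (√3 : ℝ)), pm_comm (1 / _)] at this
    convert this.trans key using 3
    · rw [eq_div_iff hs0]; linear_combination -4 * h3
    · rw [eq_div_iff hs0]; exact hts
  · exact key
  · convert (mobiusEquiv_pm_div hp).symm.trans key using 3
    · rw [eq_div_iff ht0]; linear_combination hts
    · rw [eq_div_iff ht0]; linear_combination -4 * h3

end SixPoints

end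

/-! ### Involutions of the octahedron and the sets `pm a b` equivalent to it -/

noncomputable section
namespace SixPoints
open scoped OnePoint Pointwise

theorem octaMap_det : (1 : ℂ) * (1 + (√2 : ℝ)) - (1 - (√2 : ℝ)) * 1 ≠ 0 := by
  have h : (1 : ℂ) * (1 + (√2 : ℝ)) - (1 - (√2 : ℝ)) * 1 = ((2 * √2 : ℝ) : ℂ) := by
    push_cast; ring
  rw [h]
  exact_mod_cast (by positivity : (2 * √2 : ℝ) ≠ 0)

/-- A transformation from the octahedron to a set `pm a b`. -/
def octaMap : Equiv.Perm Sphere := mob 1 (1 - (√2 : ℝ)) 1 (1 + (√2 : ℝ))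

theorem octaMap_coe {z w : ℂ} (hz : 1 * z + (1 + (√2 : ℝ)) ≠ 0)
    (h : 1 * z + (1 - (√2 : ℝ)) = w * (1 * z + (1 + (√2 : ℝ)))) :
    octaMap (z : Sphere) = (w : Sphere) := by
  rw [octaMap, mob_coe octaMap_det hz, h, mul_div_cancel_right₀ _ hz]

/-- The zero and the pole of `octaMap` are the fixed points `-1 ± √2` of `cay`, so `cay` becomes `z
↦ -z` (`octaMap_mul_cay`) and the vertices, none of which `cay` fixes, form three opposite pairs. -/
theorem image_octahedron_pm : octaMap '' octahedron =
    onSphere (pm (3 - 2 * (√2 : ℝ)) (((√2 : ℝ) - 1) * Complex.I)) := by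
  have h2 := sq_sqrt_two
  have hI := Complex.I_sq
  have h1 : (1 : ℝ) < √2 := Real.lt_sqrt_of_sq_lt (by norm_num)
  have hr : ∀ x : ℝ, -1 ≤ x → 1 * (x : ℂ) + (1 + (√2 : ℝ)) ≠ 0 := fun x hx => by
    exact_mod_cast (by linarith : 1 * x + (1 + √2) ≠ 0)
  have hi : ∀ x : ℝ, 1 * (x * Complex.I : ℂ) + (1 + (√2 : ℝ)) ≠ 0 := fun x h => by
    have := congrArg Complex.re h
    simp at this
    linarith
  have hpm : ∀ {z w : ℂ}, 1 * z + (1 + (√2 : ℝ)) ≠ 0 →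
      1 * z + (1 - (√2 : ℝ)) = w * (1 * z + (1 + (√2 : ℝ))) →
      w ∈ pm (3 - 2 * (√2 : ℝ)) (((√2 : ℝ) - 1) * Complex.I) →
      octaMap (z : Sphere) ∈ onSphere (pm (3 - 2 * (√2 : ℝ)) (((√2 : ℝ) - 1) * Complex.I)) :=
    fun hz h hw => by
      rw [octaMap_coe hz h]
      exact mem_onSphere.2 hw
  refine image_eq_of_forall_mem ncard_octahedron (ncard_pm pmParam_sqrt_two) fun z hz => ?_
  obtain rfl | ⟨z, rfl⟩ : z = ∞ ∨ ∃ w : ℂ, z = w := by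
    cases z using OnePoint.rec with
    | infty => exact Or.inl rfl
    | coe z => exact Or.inr ⟨z, rfl⟩
  · rw [octaMap, mob_infty octaMap_det one_ne_zero, mem_onSphere]
    simp [pm]
  · rcases mem_octahedron.1 hz with rfl | hz
    · refine hpm (w := -(3 - 2 * (√2 : ℝ))) (by simpa using hr 0 (by norm_num)) ?_ (by simp [pm])
      linear_combination -2 * h2
    rcases pow_four_eq_one.1 hz with rfl | rfl | rfl | rfl
    · refine hpm (w := 3 - 2 * (√2 : ℝ)) (by simpa using hr 1 (by norm_num)) ?_ (by simp [pm])
      linear_combination 2 * h2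
    · refine hpm (w := ((√2 : ℝ) - 1) * Complex.I) (by simpa using hi 1) ?_ (by simp [pm])
      linear_combination -((√2 : ℝ) - 1) * hI - Complex.I * h2
    · refine hpm (w := -1) (by simpa only [Complex.ofReal_neg, Complex.ofReal_one] using hr (-1) le_rfl) ?_ (by simp [pm])
      ring
    · refine hpm (w := -(((√2 : ℝ) - 1) * Complex.I)) (by simpa using hi (-1)) ?_ (by simp [pm])
      linear_combination -((√2 : ℝ) - 1) * hI + Complex.I * h2

theorem octaMap_mul_cay : octaMap * cay = rot (-1) * octaMap := by
  have h2 := sq_sqrt_two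
  rw [octaMap, mob_eq_lf octaMap_det, rot_eq_lf neg_one_ne_zero_complex, cay_eq_lf, ← map_mul,
    ← map_mul]
  refine lf_eq_of_scalar (k := (√2 : ℝ)) fun i j => ?_
  fin_cases i <;> fin_cases j <;> simp [Matrix.mul_apply, gl_val, Fin.sum_univ_two] <;>
    first | ring1 | linear_combination h2 | linear_combination -h2

/-- Conjugation by a rotation combines the two rotations into one, by `k m`. Following 0 through the
square of the result shows that `cay` must send `k m` to 0, that is `k m = 1`. -/
theorem conj_cay_of_form {m k : ℂ} (hm : m ^ 4 = 1) (hk : k ^ 4 = 1)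
    (h : (rot m * cay * rot k) * (rot m * cay * rot k) = 1) :
    rot k * (rot m * cay * rot k) = cay * rot k := by
  have hk0 := ne_zero_of_pow_four hk
  have hm0 := ne_zero_of_pow_four hm
  have hkm : (k * m) ^ 4 = 1 := by rw [mul_pow, hk, hm, one_mul]
  rw [← mul_assoc, ← mul_assoc, rot_mul_rot hk0 hm0]
  suffices k * m = 1 by rw [this, rot_one, one_mul]
  have hkm0 := mul_ne_zero hk0 hm0
  have h' : rot (k * m) * cay * (rot (k * m) * cay) = 1 := by
    rw [← rot_mul_rot hk0 hm0, show rot k * rot m * cay * (rot k * rot m * cay) =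
      rot k * ((rot m * cay * rot k) * (rot m * cay * rot k)) * (rot k)⁻¹ by group, h, mul_one,
      mul_inv_cancel]
  have h0 := congrFun (congrArg DFunLike.coe h') ((0 : ℂ) : Sphere)
  simp only [Equiv.Perm.mul_apply, cay_zero, Equiv.Perm.one_apply] at h0
  rw [rot_coe hkm0, mul_one] at h0
  rcases pow_four_eq_one.1 hkm with e | e | e | e <;> rw [e] at h0 hkm0
  · exact e
  · rw [cay_I, rot_coe hkm0] at h0
    simp at h0
  · rw [cay_neg_one, rot_infty hkm0] at h0
    simp at h0
  · rw [cay_neg_I, rot_coe hkm0] at h0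
    simp at h0

/-- Half turns about vertex axes fix vertices; the remaining involutions are half turns about edge
axes and form a single class, represented by `cay`. -/
theorem exists_conj_cay {f : Equiv.Perm Sphere} (hf : f ∈ A octahedron) (hsq : f * f = 1)
    (hfix : ∀ z ∈ octahedron, f z ≠ z) : ∃ x ∈ A octahedron, x * f = cay * x := by
  obtain ⟨k, hk, rfl | rfl⟩ | ⟨m, k, hm, hk, rfl⟩ := exists_of_mem_A_octahedron hf
  · have hk0 := ne_zero_of_pow_four hk
    exact absurd (by rw [rot_coe hk0, mul_zero]) (hfix ((0 : ℂ) : Sphere) (mem_octahedron.2 (Or.inl rfl)))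
  · have hk0 := ne_zero_of_pow_four hk
    have hI : (k - Complex.I) * (k + Complex.I) = 0 := by
      have h1 := fun (z : ℂ) (hz : z ^ 4 = 1) => hfix (z : Sphere) (mem_octahedron.2 (Or.inr hz))
      have h1a := h1 1 (by norm_num)
      have h1b := h1 Complex.I (by rw [Complex.I_pow_four])
      rw [inv_coe hk0 one_ne_zero, ne_eq, OnePoint.coe_eq_coe, div_one] at h1a
      rw [inv_coe hk0 Complex.I_ne_zero, ne_eq, OnePoint.coe_eq_coe,
        div_eq_iff Complex.I_ne_zero, Complex.I_mul_I] at h1b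
      rcases pow_four_eq_one.1 hk with rfl | rfl | rfl | rfl
      · exact absurd rfl h1a
      · rw [sub_self, zero_mul]
      · exact absurd rfl h1b
      · rw [neg_add_cancel, mul_zero]
    -- Only `k = ±i` is left. Conjugation by `cay` moves the image of ∞ away from 0 and ∞, so the
    -- new involution has the form treated in `conj_cay_of_form`.
    have hg : cay * inv k * cay ∈ A octahedron := mul_mem (mul_mem cay_mem_A hf) cay_mem_A
    have hgsq : (cay * inv k * cay) * (cay * inv k * cay) = 1 := by
      rw [show cay * inv k * cay * (cay * inv k * cay) = cay * inv k * (cay * cay) * inv k * cay by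
        group, cay_mul_cay, mul_one, mul_assoc cay, hsq, mul_one, cay_mul_cay]
    have hinf : (cay * inv k * cay) ∞ = ((k : ℂ) : Sphere) ∨
        (cay * inv k * cay) ∞ = ((-k : ℂ) : Sphere) := by
      rw [Equiv.Perm.mul_apply, Equiv.Perm.mul_apply, cay_infty, inv_coe hk0
        neg_one_ne_zero_complex, div_neg, div_one]
      rcases mul_eq_zero.1 hI with h | h
      · rw [sub_eq_zero.1 h, cay_neg_I]; exact Or.inl rfl
      · rw [eq_neg_of_add_eq_zero_left h, neg_neg, cay_I]; exact Or.inl rfl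
    obtain ⟨j, hj, e | e⟩ | ⟨m, j, hm, hj, e⟩ := exists_of_mem_A_octahedron hg
    · rw [e, rot_infty (ne_zero_of_pow_four hj)] at hinf
      simp at hinf
    · rw [e, inv_infty (ne_zero_of_pow_four hj)] at hinf
      simp [hk0.symm] at hinf
      exact absurd hinf hk0
    · rw [e] at hgsq
      have := conj_cay_of_form hm hj hgsq
      rw [← e] at this
      refine ⟨rot j * cay, mul_mem (rot_mem_A_octahedron hj) cay_mem_A, ?_⟩
      rw [← mul_assoc cay, ← this, mul_assoc (rot j), mul_assoc (rot j), mul_assoc (cay * _), cay_mul_cay, mul_one]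
  · exact ⟨rot k, rot_mem_A_octahedron hk, conj_cay_of_form hm hk hsq⟩

theorem sqrt_two_relations :
    (1 / (3 - 2 * (√2 : ℝ)) : ℂ) = 3 + 2 * (√2 : ℝ) ∧
    (((√2 : ℝ) - 1) * Complex.I / (3 - 2 * (√2 : ℝ)) : ℂ) = ((√2 : ℝ) + 1) * Complex.I ∧
    (1 / (((√2 : ℝ) - 1) * Complex.I) : ℂ) = -(((√2 : ℝ) + 1) * Complex.I) ∧
    ((3 - 2 * (√2 : ℝ)) / (((√2 : ℝ) - 1) * Complex.I) : ℂ) = -(((√2 : ℝ) - 1) * Complex.I) := by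
  have h2 := sq_sqrt_two
  have hI := Complex.I_sq
  have h := pmParam_sqrt_two
  have ha := h.2.2.1
  have hb := h.2.2.2.2.2.1
  refine ⟨?_, ?_, ?_, ?_⟩
  · rw [div_eq_iff ha]; linear_combination 4 * h2
  · rw [div_eq_iff ha]; linear_combination 2 * Complex.I * h2
  · rw [div_eq_iff hb]; linear_combination ((√2 : ℝ) ^ 2 - 1) * hI - h2
  · rw [div_eq_iff hb]; linear_combination ((√2 : ℝ) - 1) ^ 2 * hI - h2

theorem pmOcta_of_pm_eq {a b : ℂ}
    (h : let t : ℂ := 3 - 2 * (√2 : ℝ)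
      let s : ℂ := ((√2 : ℝ) - 1) * Complex.I
      pm a b = pm t s ∨ pm a b = pm (1 / t) (s / t) ∨ pm a b = pm (1 / s) (t / s) ∨
      pm a b = pm (1 / t) (1 / s) ∨ pm a b = pm t (t / s) ∨ pm a b = pm s (s / t)) :
    PmOcta a b := by
  obtain ⟨e1, e2, e3, e4⟩ := sqrt_two_relations
  simp only [e1, e2, e3, e4] at h
  have c1 : ∀ x y : ℂ, pm x (-y) = pm x y := fun x y => pm_congr rfl (neg_sq y)
  have c2 : ∀ x y : ℂ, pm (-x) y = pm y x := fun x y => by rw [pm_comm, c1]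
  simp only [c1, c2] at h
  unfold PmOcta
  tauto

theorem pmOcta_of_equiv {a b : ℂ} (h : PmParam a b)
    (e : MobiusEquiv (onSphere (pm a b)) octahedron) : PmOcta a b := by
  obtain ⟨χ, hχ, e⟩ := e
  obtain ⟨hA, hsq, hfix⟩ := conj_rot_neg_one h hχ e
  obtain ⟨x, hx, hxf⟩ := exists_conj_cay hA hsq hfix
  refine pmOcta_of_pm_eq (pm_eq_of_commute h pmParam_sqrt_two (χ := octaMap * (x * χ))
    (mul_mem (mob_mem _ _ _ _) (mul_mem hx.1 hχ)) ?_ ?_)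
  · rw [image_mul, image_mul, e, image_eq_of_mem_A hx, image_octahedron_pm]
  · have : x * χ * rot (-1) = cay * (x * χ) := by
      rw [← mul_assoc cay, ← hxf]; group
    rw [mul_assoc, this, ← mul_assoc, octaMap_mul_cay, mul_assoc]

theorem equiv_of_pmOcta {a b : ℂ} (h : PmOcta a b) :
    MobiusEquiv (onSphere (pm a b)) octahedron := by
  obtain ⟨e1, e2, e3, e4⟩ := sqrt_two_relations
  have hp := pmParam_sqrt_two
  have hp' := pmParam_of_ncard (pm_comm _ _ ▸ ncard_pm hp)
  have key : MobiusEquiv (onSphere (pm (3 - 2 * (√2 : ℝ)) (((√2 : ℝ) - 1) * Complex.I)))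
      octahedron := MobiusEquiv.symm ⟨_, mob_mem _ _ _ _, image_octahedron_pm⟩
  rcases h with h | h | h <;> rw [h]
  · have := (mobiusEquiv_pm_div hp').symm
    rw [e3, e4, pm_comm (_ * _) (3 - _)] at this
    rw [pm_comm, pm_congr (neg_sq _).symm (neg_sq _).symm]
    exact this.trans key
  · exact key
  · have := (mobiusEquiv_pm_div hp).symm
    rw [e1, e2] at this
    exact this.trans key

end SixPoints

end

noncomputable section
namespace SixPoints
open scoped OnePoint Pointwise

/-! ### The sets `hex a` -/

theorem rot_ζ3_ne_one : rot (ζ 3) ≠ 1 := by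
  rw [← rot_one]
  exact fun h => (isPrimitiveRoot_ζ 3).ne_one (by norm_num)
    (rot_injective (ζ_ne_zero 3) one_ne_zero h)

theorem rot_ζ3_pow : rot (ζ 3) ^ 3 = 1 := by
  rw [rot_pow (ζ_ne_zero 3), ζ_pow, rot_one]

theorem conj_pow_eq_one {G : Type*} [Group G] {x h : G} {n : ℕ} (e : h ^ n = 1) :
    (x * h * x⁻¹) ^ n = 1 := by
  rw [conj_pow, e, mul_one, mul_inv_cancel]

theorem conj_ne_one {G : Type*} [Group G] {x h : G} (e : h ≠ 1) : x * h * x⁻¹ ≠ 1 :=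
  fun h' => e (conj_eq_one_iff.1 h')

/-- A rotation conjugate to a nontrivial element of order three. -/
theorem ne_one_of_conj {χ h : Equiv.Perm Sphere} {k : ℂ} (h1 : h ≠ 1)
    (e : χ * h * χ⁻¹ = rot k) : k ≠ 1 := by
  rintro rfl
  rw [rot_one] at e
  exact conj_ne_one h1 e

theorem cayRot_mem_A : cay * rot Complex.I ∈ A octahedron := mul_mem cay_mem_A rot_I_mem_A

theorem cayRot_zero : (cay * rot Complex.I) ((0 : ℂ) : Sphere) = ((1 : ℂ) : Sphere) := by
  rw [Equiv.Perm.mul_apply, rot_coe Complex.I_ne_zero, mul_zero, cay_zero]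

theorem cayRot_one : (cay * rot Complex.I) ((1 : ℂ) : Sphere) = ((-Complex.I : ℂ) : Sphere) := by
  rw [Equiv.Perm.mul_apply, rot_coe Complex.I_ne_zero, mul_one, cay_I]

theorem cayRot_neg_I : (cay * rot Complex.I) ((-Complex.I : ℂ) : Sphere) = ((0 : ℂ) : Sphere) := by
  rw [Equiv.Perm.mul_apply, rot_coe Complex.I_ne_zero, mul_neg, Complex.I_mul_I, neg_neg, cay_one]

theorem cayRot_infty : (cay * rot Complex.I) ∞ = ((-1 : ℂ) : Sphere) := by
  rw [Equiv.Perm.mul_apply, rot_infty Complex.I_ne_zero, cay_infty]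

theorem cayRot_neg_one : (cay * rot Complex.I) ((-1 : ℂ) : Sphere) = (Complex.I : Sphere) := by
  rw [Equiv.Perm.mul_apply, rot_coe Complex.I_ne_zero, mul_neg_one, cay_neg_I]

/-- The transformation permutes the vertices in the cycles 0, 1, -i and ∞, -1, i; it is a rotation
about the centre of a face. -/
theorem cayRot_pow : (cay * rot Complex.I) ^ 3 = 1 := by
  refine eq_of_three (p := ((0 : ℂ) : Sphere)) (q := ((1 : ℂ) : Sphere))
    (r := ((-Complex.I : ℂ) : Sphere)) (pow_mem cayRot_mem_A.1 3) (one_mem _) (by simp) (by simp)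
    ?_ ?_ ?_ ?_
  · rw [ne_eq, OnePoint.coe_eq_coe]
    intro h
    have := congrArg Complex.re h
    simp at this
  all_goals
    rw [pow_succ, pow_two, Equiv.Perm.mul_apply, Equiv.Perm.mul_apply]
    simp only [cayRot_zero, cayRot_one, cayRot_neg_I, Equiv.Perm.one_apply]

theorem cayRot_ne_one : cay * rot Complex.I ≠ 1 := by
  intro h
  have := cayRot_zero
  rw [h] at this
  simp at this

theorem cayRot_fixed {p : ℂ} (hp : Complex.I * p ^ 2 + (1 + Complex.I) * p - 1 = 0) :
    (cay * rot Complex.I) (p : Sphere) = p := by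
  have h : 1 + Complex.I * p ≠ 0 := by
    intro h
    have h2 : (2 : ℂ) = 0 := by linear_combination (p + 1) * h - hp
    norm_num at h2
  rw [Equiv.Perm.mul_apply, rot_coe Complex.I_ne_zero, cay_coe h]
  congr 1
  rw [div_eq_iff h]
  linear_combination -hp

/-- The first fixed point of an element of order three of the octahedral group. -/
def octaFix : ℂ := (1 - Complex.I) * ((√3 : ℝ) - 1) / 2

/-- The second fixed point of an element of order three of the octahedral group. -/
def octaFix' : ℂ := -((1 - Complex.I) * (1 + (√3 : ℝ)) / 2)

theorem octaFix_ne : octaFix - octaFix' ≠ 0 := by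
  have : octaFix - octaFix' = (1 - Complex.I) * (√3 : ℝ) := by
    unfold octaFix octaFix'; ring
  rw [this]
  refine mul_ne_zero (fun h => ?_) (by simp)
  have := congrArg Complex.re h
  simp at this

theorem hexParam_octa : HexParam (-(2 + (√3 : ℝ))) := by
  have h0 : (0 : ℝ) ≤ √3 := Real.sqrt_nonneg 3
  refine hexParam_of ?_ ?_
  · rw [norm_neg]
    have : ((2 + (√3 : ℝ) : ℂ)) = ((2 + √3 : ℝ) : ℂ) := by push_cast; rfl
    rw [this, Complex.norm_real, Real.norm_of_nonneg (by linarith)]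
    linarith
  · intro h
    have h' : (2 + √3 : ℝ) ^ 3 = -1 := by
      have : ((2 + (√3 : ℝ) : ℂ)) ^ 3 = -1 := by linear_combination -h
      exact_mod_cast this
    have : 0 ≤ (2 + √3 : ℝ) ^ 3 := by positivity
    linarith

theorem hexMap_det : -(2 + (√3 : ℝ)) * -octaFix' - (2 + (√3 : ℝ)) * octaFix * 1 ≠ 0 := by
  have : -(2 + (√3 : ℝ)) * -octaFix' - (2 + (√3 : ℝ)) * octaFix * 1 =
    -(2 + (√3 : ℝ)) * (octaFix - octaFix') := by ring
  rw [this]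
  exact mul_ne_zero hexParam_octa.ne_zero octaFix_ne

/-- A transformation from the octahedron to a set `hex a`. -/
def hexMap : Equiv.Perm Sphere := mob (-(2 + (√3 : ℝ))) ((2 + (√3 : ℝ)) * octaFix) 1 (-octaFix')

theorem hexMap_mem : hexMap ∈ LFT := mob_mem _ _ _ _

theorem octaFix_eq : Complex.I * octaFix ^ 2 + (1 + Complex.I) * octaFix - 1 = 0 := by
  have h3 := sq_sqrt_three
  have hI := Complex.I_sq
  unfold octaFix
  linear_combination ((-2 : ℂ) * ((√3 : ℝ) - 1) ^ 2 / 4 + Complex.I * ((√3 : ℝ) - 1) ^ 2 / 4 - ((√3 : ℝ) - 1) / 2) * hI + h3 / 2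

theorem octaFix'_eq : Complex.I * octaFix' ^ 2 + (1 + Complex.I) * octaFix' - 1 = 0 := by
  have h3 := sq_sqrt_three
  have hI := Complex.I_sq
  unfold octaFix'
  linear_combination ((-2 : ℂ) * ((√3 : ℝ) + 1) ^ 2 / 4 + Complex.I * ((√3 : ℝ) + 1) ^ 2 / 4 + ((√3 : ℝ) + 1) / 2) * hI + h3 / 2

/-- `hexMap` takes the two fixed points of the face rotation to 0 and ∞. The multiplier need not be
known exactly: order three is enough. -/
theorem exists_hexMap_conj : ∃ k : ℂ, k ≠ 0 ∧ k ≠ 1 ∧ k ^ 3 = 1 ∧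
    hexMap * (cay * rot Complex.I) * hexMap⁻¹ = rot k := by
  have hp : hexMap (octaFix : Sphere) = ((0 : ℂ) : Sphere) := by
    rw [hexMap, mob_coe hexMap_det]
    · congr 1
      rw [div_eq_zero_iff]
      left; ring
    · rw [one_mul, ← sub_eq_add_neg]
      exact octaFix_ne
  have hq : hexMap (octaFix' : Sphere) = ∞ := by
    rw [hexMap, mob_pole hexMap_det]
    ring
  have hp' : hexMap⁻¹ ((0 : ℂ) : Sphere) = octaFix := by rw [← hp]; simp
  have hq' : hexMap⁻¹ ∞ = octaFix' := by rw [← hq]; simp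
  obtain ⟨k, hk, e⟩ := eq_rot_of_fix
    (mul_mem (mul_mem hexMap_mem cayRot_mem_A.1) (inv_mem hexMap_mem))
    (by rw [Equiv.Perm.mul_apply, Equiv.Perm.mul_apply, hp', cayRot_fixed octaFix_eq, hp])
    (by rw [Equiv.Perm.mul_apply, Equiv.Perm.mul_apply, hq', cayRot_fixed octaFix'_eq, hq])
  refine ⟨k, hk, ne_one_of_conj cayRot_ne_one e, ?_, e⟩
  have := conj_pow_eq_one (x := hexMap) cayRot_pow
  rw [e, rot_pow hk, ← rot_one] at this
  exact rot_injective (pow_ne_zero 3 hk) one_ne_zero this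

/-- Only two vertices are computed, 0 going to 1 and ∞ to `-(2 + √3)`. The other four follow by the
symmetry of order three, which preserves both sets. -/
theorem image_octahedron_hex : hexMap '' octahedron = onSphere (hex (-(2 + (√3 : ℝ)))) := by
  obtain ⟨k, hk, -, hk3, e⟩ := exists_hexMap_conj
  have h3 := sq_sqrt_three
  have hT := hexParam_octa
  rw [mul_inv_eq_iff_eq_mul] at e
  have step : ∀ {z w : Sphere}, (cay * rot Complex.I) z = w →
      hexMap z ∈ onSphere (hex (-(2 + (√3 : ℝ)))) → hexMap w ∈ onSphere (hex (-(2 + (√3 : ℝ)))) := by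
    rintro z w rfl hz
    have : hexMap ((cay * rot Complex.I) z) = rot k (hexMap z) :=
      congrFun (congrArg DFunLike.coe e) z
    rw [this]
    exact apply_mem_of_mem_A (rot_mem_A_hex hT hk3) hz
  have hinf : hexMap ∞ ∈ onSphere (hex (-(2 + (√3 : ℝ)))) := by
    rw [hexMap, mob_infty hexMap_det one_ne_zero, div_one, mem_onSphere]
    simp [hex]
  have hzero : hexMap ((0 : ℂ) : Sphere) ∈ onSphere (hex (-(2 + (√3 : ℝ)))) := by
    have h0 : octaFix' ≠ 0 := by
      intro h
      have := octaFix'_eq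
      rw [h] at this
      norm_num at this
    rw [hexMap, mob_coe hexMap_det (by simpa using h0), mem_onSphere]
    have : (-(2 + (√3 : ℝ)) * 0 + (2 + (√3 : ℝ)) * octaFix) / (1 * 0 + -octaFix') = 1 := by
      rw [div_eq_one_iff_eq (by simpa using h0)]
      unfold octaFix octaFix'
      linear_combination (1 - Complex.I) / 2 * h3
    rw [this]
    simp [hex]
  have h1 := step cayRot_zero hzero
  have h2 := step cayRot_infty hinf
  refine image_eq_of_forall_mem ncard_octahedron (ncard_hex hT) fun z hz => ?_
  obtain rfl | ⟨z, rfl⟩ : z = ∞ ∨ ∃ w : ℂ, z = w := by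
    cases z using OnePoint.rec with
    | infty => exact Or.inl rfl
    | coe z => exact Or.inr ⟨z, rfl⟩
  · exact hinf
  · rcases mem_octahedron.1 hz with rfl | hz
    · exact hzero
    rcases pow_four_eq_one.1 hz with rfl | rfl | rfl | rfl
    · exact h1
    · exact step cayRot_neg_one h2
    · exact h2
    · exact step cayRot_one h1

theorem hex_congr {a a' : ℂ} (h : a ^ 3 = a' ^ 3) : hex a = hex a' := by
  ext z
  rw [mem_hex, mem_hex, h]

theorem equiv_of_hexOcta {a : ℂ} (h : HexOcta a) : MobiusEquiv (onSphere (hex a)) octahedron := by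
  rw [hex_congr (hexOcta_iff.1 h)]
  exact MobiusEquiv.symm ⟨_, hexMap_mem, image_octahedron_hex⟩

/-- Rotations and inversions in the octahedral group have fourth power 1 and cannot have order
three. An element of the remaining form is conjugate to `cay * rot (k m)`; the orbit of 0 leaves `k
m = ±i`, the minus sign giving the inverse up to conjugation. -/
theorem exists_conj_cayRot {f : Equiv.Perm Sphere} (hf : f ∈ A octahedron) (hf3 : f ^ 3 = 1)
    (h1 : f ≠ 1) : ∃ x ∈ A octahedron,
      x * f * x⁻¹ = cay * rot Complex.I ∨ x * f * x⁻¹ = (cay * rot Complex.I)⁻¹ := by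
  have h4 : f ^ 4 ≠ 1 := by
    rwa [pow_succ, hf3, one_mul]
  obtain ⟨k, hk, rfl | rfl⟩ | ⟨m, k, hm, hk, rfl⟩ := exists_of_mem_A_octahedron hf
  · rw [rot_pow (ne_zero_of_pow_four hk), hk, rot_one] at h4
    exact absurd rfl h4
  · have hk0 := ne_zero_of_pow_four hk
    rw [show 4 = 2 * 2 from rfl, pow_mul, pow_two (inv k), inv_mul_inv hk0 hk0, div_self hk0,
      rot_one, one_pow] at h4
    exact absurd rfl h4
  · have hk0 := ne_zero_of_pow_four hk
    have hm0 := ne_zero_of_pow_four hm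
    have hkm : (k * m) ^ 4 = 1 := by rw [mul_pow, hk, hm, one_mul]
    have hkm0 := mul_ne_zero hk0 hm0
    have hmi : (m⁻¹) ^ 4 = 1 := by rw [inv_pow, hm, inv_one]
    have hconj : (rot m)⁻¹ * (rot m * cay * rot k) * (rot m)⁻¹⁻¹ = cay * rot (k * m) := by
      rw [← rot_mul_rot hk0 hm0]; group
    have h3 : (cay * rot (k * m)) ^ 3 = 1 := by
      rw [← hconj]
      exact conj_pow_eq_one hf3
    have hmA := inv_mem (rot_mem_A_octahedron hm)
    have h0 : (cay * rot (k * m) * (cay * rot (k * m) * (cay * rot (k * m))))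
        ((0 : ℂ) : Sphere) = ((0 : ℂ) : Sphere) := by
      rw [← pow_two, ← pow_succ', h3]; rfl
    simp only [Equiv.Perm.mul_apply] at h0
    rw [rot_coe hkm0, mul_zero, cay_zero, rot_coe hkm0, mul_one] at h0
    rcases pow_four_eq_one.1 hkm with e | e | e | e <;> rw [e] at h0 hkm0
    · rw [rot_one, cay_one, Equiv.Perm.one_apply, cay_zero] at h0
      simp at h0
    · refine ⟨_, hmA, Or.inl ?_⟩
      rw [hconj, e]
    · rw [cay_neg_one, rot_infty hkm0, cay_infty] at h0
      simp at h0
    · refine ⟨rot (-Complex.I) * (rot m)⁻¹, mul_mem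
        (rot_mem_A_octahedron (by rw [neg_pow, Complex.I_pow_four]; norm_num)) hmA, Or.inr ?_⟩
      rw [e] at hconj
      rw [mul_inv_rev, mul_inv_rev cay, cay_inv, rot_inv Complex.I_ne_zero, Complex.inv_I]
      calc _ = rot (-Complex.I) * ((rot m)⁻¹ * (rot m * cay * rot k) * (rot m)⁻¹⁻¹) *
            (rot (-Complex.I))⁻¹ := by group
        _ = rot (-Complex.I) * cay := by rw [hconj]; group

theorem rot_ζ3_mem_A {a : ℂ} (h : HexParam a) : rot (ζ 3) ∈ A (onSphere (hex a)) :=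
  rot_mem_A_hex h (ζ_pow 3)

theorem hexOcta_of_equiv {a : ℂ} (h : HexParam a)
    (e : MobiusEquiv (onSphere (hex a)) octahedron) : HexOcta a := by
  obtain ⟨χ, hχ, e⟩ := e
  obtain ⟨x, hx, hxf⟩ := exists_conj_cayRot (conj_mem_A_of_image hχ e (rot_ζ3_mem_A h))
    (conj_pow_eq_one rot_ζ3_pow) (conj_ne_one rot_ζ3_ne_one)
  obtain ⟨k, hk, hk1, -, hk'⟩ := exists_hexMap_conj
  have key : ∃ k : ℂ, k ≠ 0 ∧ k ≠ 1 ∧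
      hexMap * (x * (χ * rot (ζ 3) * χ⁻¹) * x⁻¹) * hexMap⁻¹ = rot k := by
    rcases hxf with hxf | hxf <;> rw [hxf]
    · exact ⟨k, hk, hk1, hk'⟩
    · refine ⟨k⁻¹, inv_ne_zero hk, inv_ne_one.2 hk1, ?_⟩
      rw [← rot_inv hk, ← hk']
      group
  obtain ⟨k, hk, hk1, hk'⟩ := key
  have hc : hexMap * (x * χ) * rot (ζ 3) = rot k * (hexMap * (x * χ)) := by
    rw [← hk']; group
  rw [hexOcta_iff]
  refine (cube_eq_of_conj h hexParam_octa (mul_mem hexMap_mem (mul_mem hx.1 hχ)) ?_ (ζ_ne_zero 3)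
    hk hk1 hc).resolve_right fun hcube => ?_
  · rw [image_mul, image_mul, e, image_eq_of_mem_A hx, image_octahedron_hex]
  -- Inverse cubes are impossible, since one parameter has modulus at least 1 and the other, `2 +
  -- √3`, more than 1.
  · have h1 : 1 ≤ ‖a‖ ^ 3 := one_le_pow₀ h.1
    have h2 : 1 < ‖(-(2 + (√3 : ℝ)) : ℂ)‖ ^ 3 := by
      have : ‖(-(2 + (√3 : ℝ)) : ℂ)‖ = 2 + √3 := by
        rw [norm_neg]
        have : ((2 + (√3 : ℝ) : ℂ)) = ((2 + √3 : ℝ) : ℂ) := by push_cast; rfl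
        rw [this, Complex.norm_real, Real.norm_of_nonneg (by positivity)]
      rw [this]
      exact one_lt_pow₀ (by linarith [Real.sqrt_nonneg 3]) (by norm_num)
    have h3 := congrArg norm hcube
    rw [norm_mul, norm_pow, norm_pow, norm_one] at h3
    nlinarith

theorem hexParam_neg_one : HexParam (-1) := hexParam_of (by simp) (by norm_num)

theorem hexRoots6_of_equiv {a : ℂ} (h : HexParam a)
    (e : MobiusEquiv (onSphere (hex a)) (onSphere roots6)) : HexRoots6 a := by
  obtain ⟨χ, hχ, e⟩ := e
  have h3 : (χ * rot (ζ 3) * χ⁻¹) ^ 3 = 1 := conj_pow_eq_one rot_ζ3_pow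
  have h1 : χ * rot (ζ 3) * χ⁻¹ ≠ 1 := conj_ne_one rot_ζ3_ne_one
  -- The symmetry of order three must land on a rotation, as inversions have square 1. The sixth
  -- roots of unity are `hex (-1)`, so the cubes can be compared.
  obtain ⟨k, hk6, hk | hk⟩ := mem_A_roots6.1 (conj_mem_A_of_image hχ e (rot_ζ3_mem_A h))
  all_goals have hk0 : k ≠ 0 := by rintro rfl; norm_num at hk6
  · have hk1 := ne_one_of_conj rot_ζ3_ne_one hk
    rw [mul_inv_eq_iff_eq_mul] at hk
    rw [← hex_eq_roots6 (a := -1) (by norm_num)] at e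
    have := cube_eq_of_conj h hexParam_neg_one hχ e (ζ_ne_zero 3) hk0 hk1 hk
    rw [hexRoots6_iff]
    rcases this with h | h
    · rw [h]; norm_num
    · linear_combination -h
  · rw [hk] at h3 h1
    rw [pow_succ, pow_two, inv_mul_inv hk0 hk0, div_self hk0, rot_one, one_mul] at h3
    exact absurd h3 h1

/-- Excludes zero with the fifth roots of unity for any set having a symmetry of order two or three.
-/
theorem pow_five_of_equiv {S : Set Sphere} (e : MobiusEquiv S (onSphere zeroRoots5))
    {h : Equiv.Perm Sphere} (hh : h ∈ A S) : h ^ 5 = 1 := by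
  obtain ⟨χ, hχ, e⟩ := e
  obtain ⟨k, hk, hf⟩ := mem_A_zeroRoots5.1 (conj_mem_A_of_image hχ e hh)
  have hk0 : k ≠ 0 := by rintro rfl; norm_num at hk
  have : (χ * h * χ⁻¹) ^ 5 = 1 := by rw [hf, rot_pow hk0, hk, rot_one]
  rw [conj_pow] at this
  exact conj_eq_one_iff.1 this

theorem not_equiv_zeroRoots5_hex {a : ℂ} (h : HexParam a) :
    ¬ MobiusEquiv (onSphere (hex a)) (onSphere zeroRoots5) := by
  intro e
  have h5 := pow_five_of_equiv e (rot_ζ3_mem_A h)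
  have h3 := rot_ζ3_pow
  refine rot_ζ3_ne_one ?_
  calc rot (ζ 3) = (rot (ζ 3) ^ 3) ^ 2 * (rot (ζ 3) ^ 5)⁻¹ := by group
    _ = 1 := by rw [h3, h5]; simp

theorem not_equiv_zeroRoots5_pm {a b : ℂ} (h : PmParam a b) :
    ¬ MobiusEquiv (onSphere (pm a b)) (onSphere zeroRoots5) := by
  intro e
  have hn := neg_one_ne_zero_complex
  have h5 := pow_five_of_equiv e (rot_neg_one_mem_A_pm h)
  rw [rot_pow hn, ← rot_one] at h5
  have := rot_injective (pow_ne_zero 5 hn) one_ne_zero h5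
  norm_num at this

end SixPoints

end

/-! ### The group of `hex a` for non-exceptional `a` -/

noncomputable section
namespace SixPoints
open scoped OnePoint Pointwise

/-- If `f`, `g` and `f g` have square 1, then `f` and `g` commute. In a coordinate with `f = (z ↦
-z)` the other one is a rotation or an inversion, and the common fixed point, being 0 or ∞, excludes
the inversion. -/
theorem eq_of_involutions {f g : Equiv.Perm Sphere} (hf : f ∈ LFT) (hg : g ∈ LFT) {p : Sphere}
    (hfp : f p = p) (hgp : g p = p) (hf2 : f * f = 1) (hg2 : g * g = 1) (hf1 : f ≠ 1)
    (hg1 : g ≠ 1) (hfg : (f * g) * (f * g) = 1) : f = g := by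
  obtain ⟨ψ, hψ, k, hk, hk1, e⟩ := exists_conj_rot hf hf1 two_pos (by rw [pow_two, hf2])
  have hcomm : f * g = g * f := by
    calc f * g = f * f * (f * g * (f * g))⁻¹ * (g * g) * (f * g) := by rw [hf2, hg2, hfg]; simp
      _ = g * f := by
        rw [hf2, hfg, hg2]
        simp only [inv_one, one_mul, mul_one]
        calc f * g = (f * g * (f * g)) * (g * g)⁻¹ * (g * (f * f)⁻¹ * g⁻¹) * (g * f) := by group
          _ = g * f := by rw [hfg, hg2, hf2]; simp
  have hp : rot k (ψ p) = ψ p := by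
    rw [← e]
    simp [hfp]
  have hc : ψ * g * ψ⁻¹ * rot k = rot k * (ψ * g * ψ⁻¹) := by
    rw [← e, show ψ * g * ψ⁻¹ * (ψ * f * ψ⁻¹) = ψ * (g * f) * ψ⁻¹ by group, ← hcomm]
    group
  have hsq : ∀ c : ℂ, c ≠ 0 → c ≠ 1 → rot c * rot c = 1 → c = -1 := by
    intro c hc0 hc1 h
    rw [rot_mul_rot hc0 hc0, ← rot_one] at h
    exact (mul_self_eq_one_iff.1 (rot_injective (mul_ne_zero hc0 hc0) one_ne_zero h)).resolve_left
      hc1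
  have hconj : ∀ {h : Equiv.Perm Sphere}, h * h = 1 → (ψ * h * ψ⁻¹) * (ψ * h * ψ⁻¹) = 1 := by
    intro h hh
    rw [show ψ * h * ψ⁻¹ * (ψ * h * ψ⁻¹) = ψ * (h * h) * ψ⁻¹ by group, hh, mul_one, mul_inv_cancel]
  have hgψ : (ψ * g * ψ⁻¹) (ψ p) = ψ p := by simp [hgp]
  obtain ⟨c, hc0, hc' | hc'⟩ := eq_rot_or_inv_of_conj
    (mul_mem (mul_mem hψ hg) (inv_mem hψ)) hk hk hk1 hc
  · have h1 := hsq c hc0 (ne_one_of_conj hg1 hc') (hc' ▸ hconj hg2)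
    have h2 := hsq k hk hk1 (e ▸ hconj hf2)
    rw [h1, ← h2, ← e] at hc'
    exact (mul_left_cancel (mul_right_cancel hc')).symm
  · rw [hc'] at hgψ
    rcases rot_fixed hk hk1 hp with h | h <;> rw [h] at hgψ
    · rw [inv_zero hc0] at hgψ
      simp at hgψ
    · rw [inv_infty hc0] at hgψ
      simp at hgψ

/-- By the normal forms an element of order greater than two would put the set into an excluded
case, or would be a rotation of order three of some `hex a'`, whose fixed points 0 and ∞ lie outside
the set. -/
theorem mul_self_eq_one_of_fix {a : ℂ} (h : HexParam a) (h6 : ¬ HexRoots6 a) (h8 : ¬ HexOcta a)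
    {f : Equiv.Perm Sphere} (hf : f ∈ A (onSphere (hex a))) {p : Sphere}
    (hp : p ∈ onSphere (hex a)) (hfp : f p = p) : f * f = 1 := by
  by_cases h1 : f = 1
  · rw [h1, one_mul]
  obtain ⟨ψ, hψ, k, hk, hk1, e, hcase⟩ := exists_normal_form (ncard_hex h) hf h1
  have hinv : k = -1 → f * f = 1 := by
    rintro rfl
    have : (ψ * f * ψ⁻¹) * (ψ * f * ψ⁻¹) = 1 := by
      rw [e, rot_mul_rot hk hk, neg_mul_neg, one_mul, rot_one]
    rw [show ψ * f * ψ⁻¹ * (ψ * f * ψ⁻¹) = ψ * (f * f) * ψ⁻¹ by group] at this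
    exact conj_eq_one_iff.1 this
  rcases hcase with ⟨-, hc⟩ | ⟨-, hc⟩ | ⟨-, hc⟩ | ⟨-, a', ha', hc⟩ | ⟨hc, -⟩ | ⟨hc, -⟩
  · exact absurd (hexRoots6_of_equiv h ⟨ψ, hψ, hc⟩) h6
  · exact absurd ⟨ψ, hψ, hc⟩ (not_equiv_zeroRoots5_hex h)
  · exact absurd (hexOcta_of_equiv h ⟨ψ, hψ, hc⟩) h8
  · exfalso
    have hfix : rot k (ψ p) = ψ p := by rw [← e]; simp [hfp]
    have hmem : ψ p ∈ onSphere (hex a') := by rw [← hc]; exact ⟨p, hp, rfl⟩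
    rcases rot_fixed hk hk1 hfix with h' | h' <;> rw [h'] at hmem
    · rw [mem_onSphere, mem_hex, zero_pow three_ne_zero] at hmem
      rcases hmem with h0 | h0
      · exact zero_ne_one h0
      · exact pow_ne_zero 3 ha'.ne_zero h0.symm
    · exact infty_notMem_onSphere _ hmem
  · exact hinv hc
  · exact hinv hc

theorem one_mem_hex (a : ℂ) : ((1 : ℂ) : Sphere) ∈ onSphere (hex a) := by
  rw [mem_onSphere, mem_hex, one_pow]
  exact Or.inl rfl

theorem inv_mem_A_hex {a k : ℂ} (h : HexParam a) (hk : k ^ 3 = a ^ 3) :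
    inv k ∈ A (onSphere (hex a)) := by
  have ha := pow_ne_zero 3 h.ne_zero
  have hk0 : k ≠ 0 := by
    rintro rfl
    rw [zero_pow three_ne_zero] at hk
    exact ha hk.symm
  refine mem_A_of_forall_mem (ncard_hex h) (inv_mem_LFT _) fun z hz => ?_
  obtain ⟨w, hw, rfl⟩ := exists_of_mem_onSphere hz
  rw [mem_hex] at hw
  have hw0 : w ≠ 0 := by
    rintro rfl
    rw [zero_pow three_ne_zero] at hw
    exact hw.elim zero_ne_one ha.symm
  rw [inv_coe hk0 hw0, mem_onSphere, mem_hex, div_pow, hk]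
  rcases hw with hw | hw <;> rw [hw]
  · right; rw [div_one]
  · left; rw [div_self ha]

/-- The dihedral group is simply transitive on the six points, so any element agrees at 1 with one
of its members. -/
theorem exists_dihedral_apply_one {a : ℂ} (h : HexParam a) {x : Equiv.Perm Sphere}
    (hx : x ∈ A (onSphere (hex a))) : ∃ k : ℂ, k ≠ 0 ∧ ((k ^ 3 = 1 ∧
      x ((1 : ℂ) : Sphere) = rot k ((1 : ℂ) : Sphere)) ∨ (k ^ 3 = a ^ 3 ∧
      x ((1 : ℂ) : Sphere) = inv k ((1 : ℂ) : Sphere))) := by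
  obtain ⟨k, hk, e⟩ := exists_of_mem_onSphere (apply_mem_of_mem_A hx (one_mem_hex a))
  rw [mem_hex] at hk
  have hk0 : k ≠ 0 := by
    rintro rfl
    rw [zero_pow three_ne_zero] at hk
    exact hk.elim zero_ne_one (pow_ne_zero 3 h.ne_zero).symm
  refine ⟨k, hk0, hk.imp (fun hk => ⟨hk, ?_⟩) (fun hk => ⟨hk, ?_⟩)⟩
  · rw [e, rot_coe hk0, mul_one]
  · rw [e, inv_coe hk0 one_ne_zero, div_one]

theorem rot_apply_one {k : ℂ} (hk : k ≠ 0) (h : rot k ((1 : ℂ) : Sphere) = ((1 : ℂ) : Sphere)) :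
    rot k = 1 := by
  rw [rot_coe hk, mul_one, OnePoint.coe_eq_coe] at h
  rw [h, rot_one]

theorem inv_apply_one {k : ℂ} (hk : k ≠ 0) (h : inv k ((1 : ℂ) : Sphere) = ((1 : ℂ) : Sphere)) :
    inv k = inv 1 := by
  rw [inv_coe hk one_ne_zero, div_one, OnePoint.coe_eq_coe] at h
  rw [h]

/-- By `eq_of_involutions` a nontrivial `g` fixing 1 is unique and is an involution. With `r = rot
(ζ 3)` and `d` dihedral agreeing with `g r g` at 1, uniqueness gives `g r g = d` or `g r = d`. In
the second case `g` is dihedral; in the first, `d` has order three and is a rotation, so `g` is a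
rotation or an inversion. Fixing 1 leaves `z ↦ 1 / z`, which is a symmetry only if `a³ = ±1`. -/
theorem eq_one_of_fix_hex {a : ℂ} (h : HexParam a) (h6 : ¬ HexRoots6 a) (h8 : ¬ HexOcta a)
    {g : Equiv.Perm Sphere} (hg : g ∈ A (onSphere (hex a)))
    (hg1 : g ((1 : ℂ) : Sphere) = ((1 : ℂ) : Sphere)) : g = 1 := by
  by_contra hne
  have hsq : ∀ {f : Equiv.Perm Sphere}, f ∈ A (onSphere (hex a)) →
      f ((1 : ℂ) : Sphere) = ((1 : ℂ) : Sphere) → f * f = 1 :=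
    fun hf hf1 => mul_self_eq_one_of_fix h h6 h8 hf (one_mem_hex a) hf1
  have huniq : ∀ {f : Equiv.Perm Sphere}, f ∈ A (onSphere (hex a)) →
      f ((1 : ℂ) : Sphere) = ((1 : ℂ) : Sphere) → f = 1 ∨ f = g := by
    intro f hf hf1
    by_cases hf' : f = 1
    · exact Or.inl hf'
    · exact Or.inr (eq_of_involutions hf.1 hg.1 hf1 hg1 (hsq hf hf1) (hsq hg hg1) hf' hne
        (hsq (mul_mem hf hg) (by rw [Equiv.Perm.mul_apply, hg1, hf1])))
  have hg2 := hsq hg hg1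
  have hgi : g⁻¹ = g := inv_eq_of_mul_eq_one_left hg2
  have hr := rot_ζ3_mem_A h
  have hz := ζ_ne_zero 3
  have hnot : g ≠ inv 1 := by
    rintro rfl
    have hm := apply_mem_of_mem_A hg (z := (a : Sphere))
      (mem_onSphere.2 (mem_hex.2 (Or.inr rfl)))
    have ha3 := pow_ne_zero 3 h.ne_zero
    rw [inv_coe one_ne_zero h.ne_zero, mem_onSphere, mem_hex, div_pow, one_pow,
      div_eq_one_iff_eq ha3, div_eq_iff ha3] at hm
    rcases hm with hm | hm
    · exact cube_ne_one h hm.symm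
    · exact h6 (hexRoots6_iff.2 ((mul_self_eq_one_iff.1 hm.symm).resolve_left (cube_ne_one h)))
  have hx : g * rot (ζ 3) * g ∈ A (onSphere (hex a)) := mul_mem (mul_mem hg hr) hg
  have hfix : ∀ {d : Equiv.Perm Sphere}, d ∈ A (onSphere (hex a)) →
      (g * rot (ζ 3) * g) ((1 : ℂ) : Sphere) = d ((1 : ℂ) : Sphere) →
      g * rot (ζ 3) * g = d ∨ g * rot (ζ 3) = d := by
    intro d hd hd1
    rcases huniq (mul_mem (inv_mem hd) hx)
      (by rw [Equiv.Perm.mul_apply, hd1]; simp) with e | e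
    · exact Or.inl (inv_mul_eq_one.1 e).symm
    · right
      rw [inv_mul_eq_iff_eq_mul] at e
      exact mul_right_cancel e
  obtain ⟨k, hk0, ⟨hk, e⟩ | ⟨hk, e⟩⟩ := exists_dihedral_apply_one h hx
  · rcases hfix (rot_mem_A_hex h hk) e with e | e
    · have hk1 : k ≠ 1 := ne_one_of_conj (χ := g) rot_ζ3_ne_one (by rw [hgi, e])
      obtain ⟨c, hc0, hc | hc⟩ := eq_rot_or_inv_of_conj hg.1 hz hk0 hk1
        (by rw [← e, mul_assoc _ g, hg2, mul_one])
      · rw [hc] at hg1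
        exact hne (hc.trans (rot_apply_one hc0 hg1))
      · rw [hc] at hg1
        exact hnot (hc.trans (inv_apply_one hc0 hg1))
    · have hc : g = rot (k * (ζ 3)⁻¹) := by
        rw [← rot_mul_rot hk0 (inv_ne_zero hz), ← rot_inv hz, ← e]; group
      rw [hc] at hg1
      exact hne (hc.trans (rot_apply_one (mul_ne_zero hk0 (inv_ne_zero hz)) hg1))
  · rcases hfix (inv_mem_A_hex h hk) e with e | e
    · have h2 : (g * rot (ζ 3) * g) * (g * rot (ζ 3) * g) = 1 := by
        rw [e, inv_mul_inv hk0 hk0, div_self hk0, rot_one]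
      have h3 : rot (ζ 3) * rot (ζ 3) = 1 := by
        rw [show g * rot (ζ 3) * g * (g * rot (ζ 3) * g) =
          g * rot (ζ 3) * (g * g) * rot (ζ 3) * g by group, hg2, mul_one] at h2
        calc rot (ζ 3) * rot (ζ 3) = g⁻¹ * (g * rot (ζ 3) * rot (ζ 3) * g) * g⁻¹ := by group
          _ = 1 := by rw [h2, mul_one, hgi, hg2]
      have h4 := rot_ζ3_pow
      rw [pow_succ, pow_two, h3, one_mul] at h4
      exact rot_ζ3_ne_one h4
    · have hc : g = inv (k / (ζ 3)⁻¹) := by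
        rw [← inv_mul_rot hk0 (inv_ne_zero hz), ← rot_inv hz, ← e]; group
      rw [hc] at hg1
      exact hnot (hc.trans (inv_apply_one (div_ne_zero hk0 (inv_ne_zero hz)) hg1))

theorem A_hex {a : ℂ} (h : HexParam a) (h6 : ¬ HexRoots6 a) (h8 : ¬ HexOcta a) :
    A (onSphere (hex a)) = (dihLF 3 h.ne_zero).range := by
  have ha := h.ne_zero
  ext f
  rw [mem_range_dihLF]
  constructor
  · intro hf
    have hd : ∀ {d : Equiv.Perm Sphere}, d ∈ A (onSphere (hex a)) →
        f ((1 : ℂ) : Sphere) = d ((1 : ℂ) : Sphere) → f = d := by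
      intro d hd hd1
      have := eq_one_of_fix_hex h h6 h8 (mul_mem (inv_mem hd) hf)
        (by rw [Equiv.Perm.mul_apply, hd1]; simp)
      exact (inv_mul_eq_one.1 this).symm
    obtain ⟨k, hk0, ⟨hk, e⟩ | ⟨hk, e⟩⟩ := exists_dihedral_apply_one h hf
    · exact ⟨k, hk, Or.inl (hd (rot_mem_A_hex h hk) e)⟩
    · refine ⟨k / a, by rw [div_pow, hk, div_self (pow_ne_zero 3 ha)], Or.inr ?_⟩
      rw [mul_div_cancel₀ _ ha]
      exact hd (inv_mem_A_hex h hk) e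
  · rintro ⟨k, hk, rfl | rfl⟩
    · exact rot_mem_A_hex h hk
    · exact inv_mem_A_hex h (by rw [mul_pow, hk, mul_one])

end SixPoints

end

noncomputable section
namespace SixPoints
open scoped OnePoint Pointwise

/-! ### The sets `pm a b` equivalent to a set `hex c` -/

theorem ncard_hex_of_ne {c : ℂ} (h0 : c ≠ 0) (h1 : c ^ 3 ≠ 1) : (onSphere (hex c)).ncard = 6 := by
  have h2 : hex c = {z : ℂ | z ^ 3 = 1} ∪ {z : ℂ | z ^ 3 = c ^ 3} := by
    ext z; exact mem_hex
  rw [ncard_onSphere, h2, Set.ncard_union_eq (disjoint_rootsOf h1.symm) (finite_rootsOfUnity 3)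
    (finite_rootsOf 3 h0), ncard_rootsOfUnity, ncard_rootsOf 3 h0]

theorem exists_hexParam {c : ℂ} (h0 : c ≠ 0) (h1 : c ^ 3 ≠ 1) :
    ∃ c', HexParam c' ∧ MobiusEquiv (onSphere (hex c)) (onSphere (hex c')) := by
  by_cases hc : 1 ≤ ‖c‖
  · exact ⟨c, hexParam_of hc h1, .refl _⟩
  · refine ⟨c⁻¹, hexParam_of ?_ ?_, inv 1, inv_mem_LFT 1, inv_image_hex h0⟩
    · rw [norm_inv]
      exact (one_le_inv₀ (norm_pos_iff.2 h0)).2 (not_le.1 hc).le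
    · rw [inv_pow]
      exact inv_ne_one.2 h1

/-- The parameters of the transformation that maps `1, a, b` to the cube roots of unity and
conjugates `z ↦ -z` to `z ↦ t² / z`. -/
theorem exists_cube_map {a b w : ℂ} (hw : w ^ 2 + w + 1 = 0) (h : PmParam a b)
    (hc : cubic a b = 0) : ∃ t e : ℂ, t ≠ 0 ∧ t * (e + 1) = e - 1 ∧ t * (e + a) = w * (e - a) ∧
      t * (e + b) = w ^ 2 * (e - b) := by
  obtain ⟨h1, h2, h3, h4, h5, h6, h7, h8⟩ := h
  unfold cubic at hc
  have hw3 : w ^ 3 = 1 := by linear_combination (w - 1) * hw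
  have hw1 : w - 1 ≠ 0 := by
    intro h
    have : (3 : ℂ) = 0 := by linear_combination hw - (w + 2) * h
    norm_num at this
  -- `s`, `P`, `Q` are the sums of `1, a, b` weighted by the characters of the group of order three.
  -- The three equations transform into `t P + Q = 0`, `t Q = 3 e - s` and `t (3 e + s) + P = 0`.
  obtain ⟨P, hP⟩ : ∃ P, P = 1 + w * a + w ^ 2 * b := ⟨_, rfl⟩
  obtain ⟨Q, hQ⟩ : ∃ Q, Q = 1 + w ^ 2 * a + w * b := ⟨_, rfl⟩
  obtain ⟨s, hs⟩ : ∃ s, s = 1 + a + b := ⟨_, rfl⟩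
  -- The first two transformed equations determine `t` and `e`; this is what the third then
  -- requires, and the difference of its sides is three times the cubic.
  have key : 2 * s * P * Q = P ^ 3 + Q ^ 3 := by
    have hprod : P * Q = 1 + a ^ 2 + b ^ 2 - a - b - a * b := by
      rw [hP, hQ]
      linear_combination ((a ^ 2 + b ^ 2) * (w - 1) + (a + b) + a * b * (w ^ 2 - w + 1)) * hw
    have hsum : P + Q = 2 - a - b := by
      rw [hP, hQ]
      linear_combination (a + b) * hw
    rw [show P ^ 3 + Q ^ 3 = (P + Q) ^ 3 - 3 * (P + Q) * (P * Q) by ring, mul_assoc (2 * s), hprod,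
      hsum, hs]
    linear_combination 3 * hc
  have hPQ : P = 0 → Q = 0 → False := by
    intro hP0 hQ0
    have e1 : (w - 1) * (1 - b) = 0 := by
      linear_combination w * hP0 - hQ0 - w * hP + hQ - b * hw3
    have := (mul_eq_zero.1 e1).resolve_left hw1
    exact h7 (by linear_combination -this)
  have hP0 : P ≠ 0 := by
    intro h
    have hQ3 : Q ^ 3 = 0 := by linear_combination -key + (2 * s * Q - P ^ 2) * h
    exact hPQ h (eq_zero_of_pow_eq_zero hQ3)
  have hQ0 : Q ≠ 0 := by
    intro h
    have hP3 : P ^ 3 = 0 := by linear_combination -key + (2 * s * P - Q ^ 2) * h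
    exact hPQ (eq_zero_of_pow_eq_zero hP3) h
  have ht : -Q / P * P = -Q := div_mul_cancel₀ _ hP0
  refine ⟨-Q / P, (s + -Q / P * Q) / 3, div_ne_zero (neg_ne_zero.2 hQ0) hP0, ?_⟩
  generalize -Q / P = t at ht
  have e2 : t * (2 * s + t * Q) = -P := by
    apply mul_left_cancel₀ (mul_ne_zero hP0 hP0)
    linear_combination (2 * s * P + (t * P - Q) * Q) * ht - key
  obtain ⟨e, he⟩ : ∃ e, e = (s + t * Q) / 3 := ⟨_, rfl⟩
  rw [← he]
  have hA : t * P + Q = 0 := by linear_combination ht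
  have hB : t * Q - 3 * e + s = 0 := by linear_combination -3 * he
  have hC : t * (3 * e + s) + P = 0 := by linear_combination e2 + 3 * t * he
  subst hP hQ hs
  clear * - hA hB hC hw
  refine ⟨?_, ?_, ?_⟩
  · grind
  · grind
  · grind

/-- The transformation is `z ↦ t (e + z) / (e - z)`. If `x` goes to `u`, then `-x` goes to `t² / u`,
so the negatives of `1, a, b` fill the second triangle, with parameter `t²`. -/
theorem equiv_hex_of_cubic {a b : ℂ} (h : PmParam a b) (hc : cubic a b = 0) :
    ∃ c, HexParam c ∧ MobiusEquiv (onSphere (pm a b)) (onSphere (hex c)) := by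
  have hw3 := ζ_pow 3
  have hw0 := ζ_ne_zero 3
  have hw1 := (isPrimitiveRoot_ζ 3).ne_one (by norm_num)
  obtain ⟨t, e, ht, e1, ea, eb⟩ := exists_cube_map (w := ζ 3) ζ3_sq h hc
  obtain ⟨-, -, ha0, ha1, ha1', hb0, hb1, hb1'⟩ := id h
  have he : e ≠ 0 := by
    rintro rfl
    have : a * (1 - ζ 3) = 0 := by linear_combination a * e1 - ea
    exact (mul_ne_zero ha0 (sub_ne_zero.2 (Ne.symm hw1))) this
  have hdet : t * e - t * e * -1 ≠ 0 := by
    rw [show t * e - t * e * -1 = 2 * (t * e) by ring]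
    exact mul_ne_zero two_ne_zero (mul_ne_zero ht he)
  have key : ∀ {x u : ℂ}, x ≠ 0 → u ≠ 0 → t * (e + x) = u * (e - x) →
      mob t (t * e) (-1) e (x : Sphere) = (u : Sphere) ∧
      mob t (t * e) (-1) e ((-x : ℂ) : Sphere) = ((t ^ 2 / u : ℂ) : Sphere) := by
    intro x u hx hu hxu
    have hd1 : -1 * x + e ≠ 0 := by
      intro h0
      have : t * (2 * x) = 0 := by linear_combination hxu + (u - t) * h0
      exact mul_ne_zero ht (mul_ne_zero two_ne_zero hx) this
    have hd2 : -1 * -x + e ≠ 0 := by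
      intro h0
      have : u * (2 * x) = 0 := by linear_combination hxu + (u - t) * h0
      exact mul_ne_zero hu (mul_ne_zero two_ne_zero hx) this
    refine ⟨?_, ?_⟩
    · rw [mob_coe hdet hd1]
      congr 1
      rw [div_eq_iff hd1]
      linear_combination hxu
    · rw [mob_coe hdet hd2]
      congr 1
      rw [div_eq_div_iff hd2 hu]
      linear_combination -t * hxu
  obtain ⟨k1, k1'⟩ := key one_ne_zero one_ne_zero (e1.trans (one_mul _).symm)
  obtain ⟨ka, ka'⟩ := key ha0 hw0 ea
  obtain ⟨kb, kb'⟩ := key hb0 (pow_ne_zero 2 hw0) eb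
  -- If the two triangles coincided, -1 would have the same image as 1, `a` or `b`.
  have ht3 : (t ^ 2) ^ 3 ≠ 1 := by
    intro h1
    rw [div_one] at k1'
    obtain ⟨i, hi, hi'⟩ := (isPrimitiveRoot_ζ 3).eq_pow_of_pow_eq_one h1
    rw [← hi'] at k1'
    interval_cases i
    · rw [pow_zero] at k1'
      have := (mob t (t * e) (-1) e).injective (k1'.trans k1.symm)
      rw [OnePoint.coe_eq_coe] at this
      norm_num at this
    · rw [pow_one] at k1'
      have := (mob t (t * e) (-1) e).injective (k1'.trans ka.symm)
      exact ha1' (OnePoint.coe_eq_coe.1 this).symm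
    · have := (mob t (t * e) (-1) e).injective (k1'.trans kb.symm)
      exact hb1' (OnePoint.coe_eq_coe.1 this).symm
  have ht2 := pow_ne_zero 2 ht
  obtain ⟨c, hcp, hce⟩ := exists_hexParam ht2 ht3
  refine ⟨c, hcp, MobiusEquiv.trans ⟨_, mob_mem t (t * e) (-1) e,
    image_eq_of_forall_mem (ncard_pm h) (ncard_hex_of_ne ht2 ht3) fun z hz => ?_⟩ hce⟩
  have hw6 : (ζ 3 ^ 2) ^ 3 = 1 := by rw [← pow_mul, mul_comm, pow_mul, hw3, one_pow]
  have hpos : ∀ u : ℂ, u ^ 3 = 1 → (u : Sphere) ∈ onSphere (hex (t ^ 2)) := fun u hu =>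
    mem_onSphere.2 (mem_hex.2 (Or.inl hu))
  have hneg : ∀ u : ℂ, u ^ 3 = 1 → ((t ^ 2 / u : ℂ) : Sphere) ∈ onSphere (hex (t ^ 2)) :=
    fun u hu => mem_onSphere.2 (mem_hex.2 (Or.inr (by rw [div_pow, hu, div_one])))
  obtain ⟨z, hz', rfl⟩ := exists_of_mem_onSphere hz
  simp only [pm, Set.mem_insert_iff, Set.mem_singleton_iff] at hz'
  rcases hz' with rfl | rfl | rfl | rfl | rfl | rfl
  · rw [k1]; exact hpos _ (one_pow 3)
  · rw [k1']; exact hneg _ (one_pow 3)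
  · rw [ka]; exact hpos _ hw3
  · rw [ka']; exact hneg _ hw3
  · rw [kb]; exact hpos _ hw6
  · rw [kb']; exact hneg _ hw6

theorem equiv_hex_of_pmCubic {a b : ℂ} (h : PmParam a b) (hc : PmCubic a b) :
    ∃ c, HexParam c ∧ MobiusEquiv (onSphere (pm a b)) (onSphere (hex c)) := by
  have key : ∀ a' b' : ℂ, a' ^ 2 = a ^ 2 → b' ^ 2 = b ^ 2 → cubic a' b' = 0 →
      ∃ c, HexParam c ∧ MobiusEquiv (onSphere (pm a b)) (onSphere (hex c)) := by
    intro a' b' ha hb hc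
    rw [← pm_congr ha hb]
    refine equiv_hex_of_cubic (pmParam_of_ncard ?_) hc
    rw [pm_congr ha hb]
    exact ncard_pm h
  rcases hc with hc | hc | hc | hc
  · exact key _ _ rfl rfl hc
  · exact key _ _ (neg_sq a) rfl hc
  · exact key _ _ rfl (neg_sq b) hc
  · exact key _ _ (neg_sq a) (neg_sq b) hc

/-- The symmetric form of the cubic. -/
def cubicForm (x y z : ℂ) : ℂ := (x + y + z) * (x * y + y * z + z * x) - 9 * (x * y * z)

/-- `cubic a b` is `cubicForm 1 a b`, and the form is odd. Hence a sign in front of 1 can be moved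
to `a` and `b`. -/
theorem pmCubic_of_sq {a b x y z : ℂ} (hx : x ^ 2 = 1) (hy : y ^ 2 = a ^ 2) (hz : z ^ 2 = b ^ 2)
    (h : cubicForm x y z = 0) : PmCubic a b := by
  unfold cubicForm at h
  unfold PmCubic cubic
  rcases sq_eq_one_iff.1 hx with rfl | rfl <;>
    rcases sq_eq_sq_iff_eq_or_eq_neg.1 hy with rfl | rfl <;>
    rcases sq_eq_sq_iff_eq_or_eq_neg.1 hz with rfl | rfl
  · left; linear_combination h
  · right; right; left; linear_combination h
  · right; left; linear_combination h
  · right; right; right; linear_combination h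
  · right; right; right; linear_combination -h
  · right; left; linear_combination -h
  · right; right; left; linear_combination -h
  · left; linear_combination -h

theorem cubicForm_rotate (x y z : ℂ) : cubicForm x y z = cubicForm y z x := by
  unfold cubicForm; ring

theorem cubicForm_swap (x y z : ℂ) : cubicForm x y z = cubicForm y x z := by
  unfold cubicForm; ring

theorem pmCubic_of_mem {a b x y z : ℂ} (hx : x ∈ pm a b) (hy : y ∈ pm a b) (hz : z ∈ pm a b)
    (hxy : x ^ 2 ≠ y ^ 2) (hxz : x ^ 2 ≠ z ^ 2) (hyz : y ^ 2 ≠ z ^ 2)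
    (h : cubicForm x y z = 0) : PmCubic a b := by
  rw [mem_pm] at hx hy hz
  rcases hx with hx | hx | hx <;> rcases hy with hy | hy | hy <;>
    first
    | exact absurd (hx.trans hy.symm) hxy
    | rcases hz with hz | hz | hz <;>
      first
      | exact absurd (hx.trans hz.symm) hxz
      | exact absurd (hy.trans hz.symm) hyz
      | exact pmCubic_of_sq hx hy hz h
      | exact pmCubic_of_sq hx hz hy
          (by rw [cubicForm_rotate, cubicForm_swap, ← cubicForm_rotate]; exact h)
      | exact pmCubic_of_sq hy hx hz (cubicForm_swap x y z ▸ h)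
      | exact pmCubic_of_sq hz hx hy (cubicForm_rotate z x y ▸ h)
      | exact pmCubic_of_sq hy hz hx (cubicForm_rotate x y z ▸ h)
      | exact pmCubic_of_sq hz hy hx (by rw [cubicForm_rotate, cubicForm_swap]; exact h)

/-- Solving `X = (u - t) / (u + t)` for `u` turns `u³ = 1` into a cubic equation for `X` with `e₂ =
3` and `e₁ = 3 e₃`, so `e₁ e₂ = 9 e₃`. The factor `1 + t³` is the common denominator of the three
values. -/
theorem cubicForm_eq_zero {w t x y z : ℂ} (hw : w ^ 2 + w + 1 = 0) (h0 : 1 + t ≠ 0)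
    (h1 : w + t ≠ 0) (h2 : w ^ 2 + t ≠ 0) (hx : x * (1 + t) = 1 - t) (hy : y * (w + t) = w - t)
    (hz : z * (w ^ 2 + t) = w ^ 2 - t) : cubicForm x y z = 0 := by
  have hD : (1 + t) * ((w + t) * (w ^ 2 + t)) = 1 + t ^ 3 := by
    linear_combination (w - 1 + w * t + t ^ 2) * hw
  have hD0 : 1 + t ^ 3 ≠ 0 := hD ▸ mul_ne_zero h0 (mul_ne_zero h1 h2)
  have hX : (1 + t ^ 3) * x = 1 - 2 * t + 2 * t ^ 2 - t ^ 3 := by grind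
  have hY : (1 + t ^ 3) * y = 1 - 2 * w ^ 2 * t + 2 * w * t ^ 2 - t ^ 3 := by grind
  have hZ : (1 + t ^ 3) * z = 1 - 2 * w * t + 2 * w ^ 2 * t ^ 2 - t ^ 3 := by grind
  apply mul_left_cancel₀ (pow_ne_zero 3 hD0)
  have : (1 + t ^ 3) ^ 3 * cubicForm x y z =
      cubicForm ((1 + t ^ 3) * x) ((1 + t ^ 3) * y) ((1 + t ^ 3) * z) := by
    unfold cubicForm; ring
  rw [this, hX, hY, hZ, mul_zero]
  clear * - hw
  unfold cubicForm
  grind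

end SixPoints

end

/-! ### Recovering the cubic from an equivalence with `hex c` -/

noncomputable section
namespace SixPoints
open scoped OnePoint Pointwise

theorem cubicForm_smul (k x y z : ℂ) :
    cubicForm (k * x) (k * y) (k * z) = k ^ 3 * cubicForm x y z := by
  unfold cubicForm; ring

/-- For `t² = d` the map `u ↦ (u - t) / (u + t)` turns `z ↦ d / z` into `z ↦ -z`. Its composite with
`χ` commutes with `z ↦ -z` and is therefore `e p` or `e / p`. -/
theorem exists_rot_or_inv_of_involution {d : ℂ} (hd : d ≠ 0) {χ : Equiv.Perm Sphere} (hχ : χ ∈ LFT)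
    (h : χ * rot (-1) = inv d * χ) : ∃ t e : ℂ, t ≠ 0 ∧ e ≠ 0 ∧ ∀ p u : ℂ, p ≠ 0 →
      χ (p : Sphere) = u → u + t ≠ 0 ∧ e * p * (u + t) = u - t := by
  have hn := neg_one_ne_zero_complex
  obtain ⟨t, ht⟩ := IsAlgClosed.exists_pow_nat_eq d two_pos
  have ht0 : t ≠ 0 := by
    rintro rfl
    rw [zero_pow two_ne_zero] at ht
    exact hd ht.symm
  have key : ∀ t : ℂ, t ≠ 0 → t ^ 2 = d → ∃ e : ℂ, e ≠ 0 ∧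
      ((∀ p u : ℂ, p ≠ 0 → χ (p : Sphere) = u → u + t ≠ 0 ∧ e * p * (u + t) = u - t) ∨
       (∀ p u : ℂ, p ≠ 0 → χ (p : Sphere) = u → u + t ≠ 0 ∧ e * (u + t) = p * (u - t))) := by
    intro t ht0 ht
    have hdet : (1 : ℂ) * t - -t * 1 ≠ 0 := by
      rw [show (1 : ℂ) * t - -t * 1 = 2 * t by ring]
      exact mul_ne_zero two_ne_zero ht0
    have hcomm : mob 1 (-t) 1 t * inv d = rot (-1) * mob 1 (-t) 1 t := by
      rw [mob_eq_lf hdet, rot_eq_lf hn, inv_eq_lf hd, ← map_mul, ← map_mul]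
      refine lf_eq_of_scalar (k := t) fun i j => ?_
      fin_cases i <;> fin_cases j <;> simp [Matrix.mul_apply, gl_val, Fin.sum_univ_two, ← ht] <;>
        ring
    have hval : ∀ {u v : ℂ}, mob 1 (-t) 1 t (u : Sphere) = (v : Sphere) →
        u + t ≠ 0 ∧ v * (u + t) = u - t := by
      intro u v hv
      by_cases hu : 1 * u + t = 0
      · rw [mob_pole hdet hu] at hv
        simp at hv
      · rw [mob_coe hdet hu, OnePoint.coe_eq_coe, div_eq_iff hu] at hv
        rw [one_mul] at hu hv
        exact ⟨hu, by linear_combination -hv⟩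
    obtain ⟨e, he, hc | hc⟩ := eq_rot_or_inv_of_conj (χ := mob 1 (-t) 1 t * χ)
      (mul_mem (mob_mem _ _ _ _) hχ) hn hn (by norm_num)
      (by rw [mul_assoc, h, ← mul_assoc, hcomm, mul_assoc])
    · refine ⟨e, he, Or.inl fun p u hp hu => hval ?_⟩
      rw [← hu, ← Equiv.Perm.mul_apply, hc, rot_coe he]
    · refine ⟨e, he, Or.inr fun p u hp hu => ?_⟩
      have := hval (u := u) (v := e / p)
        (by rw [← hu, ← Equiv.Perm.mul_apply, hc, inv_coe he hp])
      refine ⟨this.1, ?_⟩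
      rw [← this.2]
      field_simp
  obtain ⟨e, he, H | H⟩ := key t ht0 ht
  · exact ⟨t, e, ht0, he, H⟩
  -- The square root `-t` replaces the map by its reciprocal, so the case `e / p` takes the same
  -- form as `e p`.
  · refine ⟨-t, e⁻¹, neg_ne_zero.2 ht0, inv_ne_zero he, fun p u hp hu => ?_⟩
    obtain ⟨h1, h2⟩ := H p u hp hu
    refine ⟨fun h0 => ?_, ?_⟩
    · rw [show u - t = u + -t by ring, h0, mul_zero] at h2
      exact mul_ne_zero he h1 h2
    · rw [mul_assoc, ← sub_eq_add_neg, ← h2, inv_mul_cancel_left₀ he, sub_neg_eq_add]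

/-- The image of `z ↦ -z` in the dihedral group is a reflection, for no nontrivial rotation there
has square 1. The preimages of the three cube roots of unity come from three different opposite
pairs and are proportional to `(u - t) / (u + t)`, so `cubicForm_eq_zero` applies up to scaling. -/
theorem pmCubic_of_equiv {a b c : ℂ} (h : PmParam a b) (hc : HexParam c) (h6 : ¬ HexRoots6 c)
    (h8 : ¬ HexOcta c) (e : MobiusEquiv (onSphere (pm a b)) (onSphere (hex c))) : PmCubic a b := by
  obtain ⟨χ, hχ, e⟩ := e
  have hn := neg_one_ne_zero_complex
  obtain ⟨hA, hsq, hfix⟩ := conj_rot_neg_one h hχ e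
  rw [A_hex hc h6 h8, mem_range_dihLF] at hA
  obtain ⟨k, hk, hA | hA⟩ := hA <;> rw [hA] at hsq hfix
  all_goals have hk0 : k ≠ 0 := by rintro rfl; norm_num at hk
  · rw [rot_mul_rot hk0 hk0, ← rot_one] at hsq
    have hkk := rot_injective (mul_ne_zero hk0 hk0) one_ne_zero hsq
    have hk1 : k = 1 := by linear_combination hk - k * hkk
    rw [hk1, rot_one] at hfix
    exact absurd rfl (hfix _ (one_mem_hex c))
  · have hd0 := mul_ne_zero hc.ne_zero hk0
    have hd3 : (c * k) ^ 3 ≠ 1 := by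
      rw [mul_pow, hk, mul_one]
      exact cube_ne_one hc
    rw [mul_inv_eq_iff_eq_mul] at hA
    obtain ⟨t, s, ht, hs, H⟩ := exists_rot_or_inv_of_involution hd0 hχ hA
    have hp : ∀ u : ℂ, u ^ 3 = 1 → ∃ p ∈ pm a b, p ≠ 0 ∧ χ (p : Sphere) = u := by
      intro u hu
      have : (u : Sphere) ∈ χ '' onSphere (pm a b) := by
        rw [e, mem_onSphere, mem_hex]
        exact Or.inl hu
      obtain ⟨z, hz, hzu⟩ := this
      obtain ⟨p, hp, rfl⟩ := exists_of_mem_onSphere hz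
      exact ⟨p, hp, fun h0 => zero_notMem_pm h.2.2.1 h.2.2.2.2.2.1 (h0 ▸ hp), hzu⟩
    have hne : ∀ {p q u v : ℂ}, u ^ 3 = 1 → v ^ 3 = 1 → u ≠ v → χ (p : Sphere) = u →
        χ (q : Sphere) = v → p ^ 2 ≠ q ^ 2 := by
      intro p q u v hu hv huv hpu hqv hpq
      have hv0 : v ≠ 0 := by rintro rfl; norm_num at hv
      rcases sq_eq_sq_iff_eq_or_eq_neg.1 hpq with rfl | rfl
      · exact huv (OnePoint.coe_eq_coe.1 (hpu.symm.trans hqv))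
      · have : χ (rot (-1) (q : Sphere)) = inv (c * k) (χ q) :=
          congrFun (congrArg DFunLike.coe hA) _
        rw [rot_coe hn, neg_one_mul, hpu, hqv, inv_coe hd0 hv0, OnePoint.coe_eq_coe,
          eq_div_iff hv0] at this
        apply hd3
        rw [← this, mul_pow, hu, hv, one_mul]
    have hw := ζ_pow 3
    have hw2 : (ζ 3 ^ 2) ^ 3 = 1 := by rw [← pow_mul, mul_comm, pow_mul, hw, one_pow]
    have hw1 := (isPrimitiveRoot_ζ 3).ne_one (by norm_num)
    have hw21 := (isPrimitiveRoot_ζ 3).pow_ne_one_of_pos_of_lt (l := 2) (by norm_num) (by norm_num)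
    have hww : ζ 3 ≠ ζ 3 ^ 2 := by
      intro h'
      rw [pow_two] at h'
      exact hw1 ((mul_eq_left₀ (ζ_ne_zero 3)).1 h'.symm)
    obtain ⟨p, hpm, hp0, hpu⟩ := hp 1 (one_pow 3)
    obtain ⟨q, hqm, hq0, hqu⟩ := hp (ζ 3) hw
    obtain ⟨r, hrm, hr0, hru⟩ := hp (ζ 3 ^ 2) hw2
    obtain ⟨np, ep⟩ := H p 1 hp0 hpu
    obtain ⟨nq, eq⟩ := H q _ hq0 hqu
    obtain ⟨nr, er⟩ := H r _ hr0 hru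
    have hform := cubicForm_eq_zero ζ3_sq np nq nr ep eq er
    rw [cubicForm_smul] at hform
    exact pmCubic_of_mem hpm hqm hrm (hne (one_pow 3) hw hw1.symm hpu hqu)
      (hne (one_pow 3) hw2 hw21.symm hpu hru) (hne hw hw2 hww hqu hru)
      ((mul_eq_zero.1 hform).resolve_left (pow_ne_zero 3 hs))

/-! ### The general sets `pm a b` -/

theorem mul_self_eq_one_of_general {a b : ℂ} (h : PmParam a b) (hg : PmGeneral a b)
    {f : Equiv.Perm Sphere} (hf : f ∈ A (onSphere (pm a b))) : f * f = 1 := by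
  by_cases h1 : f = 1
  · rw [h1, one_mul]
  obtain ⟨ψ, hψ, hc | hc | hc | ⟨c, hc, e⟩ | ⟨hc, -⟩⟩ := exists_normal_form_pm (ncard_pm h) hf h1
  · exact absurd (pmRoots6_of_equiv h ⟨ψ, hψ, hc⟩) hg.1
  · exact absurd ⟨ψ, hψ, hc⟩ (not_equiv_zeroRoots5_pm h)
  · exact absurd (pmOcta_of_equiv h ⟨ψ, hψ, hc⟩) hg.2.1
  · by_cases h6 : HexRoots6 c
    · rw [hex_eq_roots6 (hexRoots6_iff.1 h6)] at e
      exact absurd (pmRoots6_of_equiv h ⟨ψ, hψ, e⟩) hg.1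
    by_cases h8 : HexOcta c
    · exact absurd (pmOcta_of_equiv h (MobiusEquiv.trans ⟨ψ, hψ, e⟩ (equiv_of_hexOcta h8))) hg.2.1
    · exact absurd (pmCubic_of_equiv h hc h6 h8 ⟨ψ, hψ, e⟩) hg.2.2
  · rw [← pow_two, hc]

/-- Each exceptional case amounts to an equivalence with the hexagon, the octahedron or some `hex
c`, and such equivalences can be composed. -/
theorem pmGeneral_of_equiv {a b a' b' : ℂ} (h : PmParam a b) (h' : PmParam a' b')
    (hg : PmGeneral a b) (e : MobiusEquiv (onSphere (pm a b)) (onSphere (pm a' b'))) :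
    PmGeneral a' b' := by
  refine ⟨fun hc => hg.1 (pmRoots6_of_equiv h (e.trans (equiv_of_pmRoots6 hc))),
    fun hc => hg.2.1 (pmOcta_of_equiv h (e.trans (equiv_of_pmOcta hc))), fun hc => ?_⟩
  obtain ⟨c, hc, he⟩ := equiv_hex_of_pmCubic h' hc
  by_cases h6 : HexRoots6 c
  · rw [hex_eq_roots6 (hexRoots6_iff.1 h6)] at he
    exact hg.1 (pmRoots6_of_equiv h (e.trans he))
  by_cases h8 : HexOcta c
  · exact hg.2.1 (pmOcta_of_equiv h ((e.trans he).trans (equiv_of_hexOcta h8)))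
  · exact hg.2.2 (pmCubic_of_equiv h hc h6 h8 (e.trans he))

/-- The image `k` of 1 has square 1, `a²` or `b²`. In the first case the inversion must match `a²`
with `1 / b²`; in the others 1 is matched with `a²` or `b²`, and the third square is then the square
of that one. -/
theorem param_of_inv_mem {a b k : ℂ} (h : PmParam a b) (hk : k ≠ 0)
    (hf : inv k ∈ A (onSphere (pm a b))) : ((k = 1 ∨ k = -1) ∧ (a * b = 1 ∨ a * b = -1)) ∨
      (b = a ^ 2 ∨ b = -a ^ 2) ∨ (a = b ^ 2 ∨ a = -b ^ 2) := by
  obtain ⟨h1, h2, ha0, ha1, ha1', hb0, hb1, hb1'⟩ := h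
  have hmem : ∀ z : ℂ, z ≠ 0 → z ∈ pm a b → (k ^ 2 = z ^ 2 ∨ k ^ 2 = a ^ 2 * z ^ 2 ∨
      k ^ 2 = b ^ 2 * z ^ 2) := by
    intro z hz hm
    have := apply_mem_of_mem_A hf (mem_onSphere.2 hm)
    have hz2 := pow_ne_zero 2 hz
    rwa [inv_coe hk hz, mem_onSphere, mem_pm, div_pow, div_eq_iff hz2, div_eq_iff hz2,
      div_eq_iff hz2, one_mul] at this
  have hab : a ^ 2 ≠ b ^ 2 := fun h' => (sq_eq_sq_iff_eq_or_eq_neg.1 h').elim h1 h2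
  have ha : a ^ 2 ≠ 1 := fun h' => (sq_eq_one_iff.1 h').elim ha1 ha1'
  have hb : b ^ 2 ≠ 1 := fun h' => (sq_eq_one_iff.1 h').elim hb1 hb1'
  have ha2 := pow_ne_zero 2 ha0
  have hb2 := pow_ne_zero 2 hb0
  have m1 := hmem 1 one_ne_zero (mem_pm.2 (Or.inl (one_pow 2)))
  have ma := hmem a ha0 (mem_pm.2 (Or.inr (Or.inl rfl)))
  have mb := hmem b hb0 (mem_pm.2 (Or.inr (Or.inr rfl)))
  rw [one_pow, mul_one, mul_one] at m1
  have hsq : ∀ x y : ℂ, x ^ 2 = y ^ 2 * y ^ 2 → x = y ^ 2 ∨ x = -y ^ 2 := fun x y hxy =>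
    sq_eq_sq_iff_eq_or_eq_neg.1 (by rw [hxy]; ring)
  rcases m1 with m1 | m1 | m1 <;> rw [m1] at ma mb
  · refine Or.inl ⟨sq_eq_one_iff.1 m1, ?_⟩
    rcases ma with ma | ma | ma
    · exact absurd ma.symm ha
    · have ma' : a ^ 2 = -1 := by
        have : (a ^ 2 - 1) * (a ^ 2 + 1) = 0 := by linear_combination -ma
        exact eq_neg_of_add_eq_zero_left ((mul_eq_zero.1 this).resolve_left (sub_ne_zero.2 ha))
      rcases mb with mb | mb | mb
      · exact absurd mb.symm hb
      · exact sq_eq_one_iff.1 (by rw [mul_pow, ← mb])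
      · have : (b ^ 2 - 1) * (b ^ 2 + 1) = 0 := by linear_combination -mb
        have mb' := eq_neg_of_add_eq_zero_left ((mul_eq_zero.1 this).resolve_left (sub_ne_zero.2 hb))
        exact absurd (ma'.trans mb'.symm) hab
    · exact sq_eq_one_iff.1 (by rw [mul_pow, mul_comm, ← ma])
  · right; right
    rcases mb with mb | mb | mb
    · exact absurd mb hab
    · exact absurd ((mul_eq_left₀ ha2).1 mb.symm) hb
    · exact hsq _ _ mb
  · right; left
    rcases ma with ma | ma | ma
    · exact absurd ma.symm hab
    · exact hsq _ _ ma
    · exact absurd ((mul_eq_left₀ hb2).1 ma.symm) ha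

/-- When every element has square 1 the group is abelian, so each element commutes with `z ↦ -z` and
is a rotation or an inversion. -/
theorem eq_of_mem_A_general {a b : ℂ} (h : PmParam a b) (hg : PmGeneral a b)
    {f : Equiv.Perm Sphere} (hf : f ∈ A (onSphere (pm a b))) :
    f = 1 ∨ f = rot (-1) ∨ ∃ k, k ≠ 0 ∧ f = inv k := by
  have hn := neg_one_ne_zero_complex
  have hr := rot_neg_one_mem_A_pm h
  have hf2 := mul_self_eq_one_of_general h hg hf
  have hr2 := mul_self_eq_one_of_general h hg hr
  have hfr := mul_self_eq_one_of_general h hg (mul_mem hf hr)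
  have hcomm : f * rot (-1) = rot (-1) * f := by
    calc f * rot (-1) = (f * rot (-1))⁻¹ := (inv_eq_of_mul_eq_one_left hfr).symm
      _ = rot (-1) * f := by
        rw [mul_inv_rev, inv_eq_of_mul_eq_one_left hf2, inv_eq_of_mul_eq_one_left hr2]
  obtain ⟨k, hk, e | e⟩ := eq_rot_or_inv_of_conj hf.1 hn hn (by norm_num) hcomm
  · rw [e, rot_mul_rot hk hk, ← rot_one] at hf2
    rcases mul_self_eq_one_iff.1 (rot_injective (mul_ne_zero hk hk) one_ne_zero hf2) with rfl | rfl
    · exact Or.inl (e.trans rot_one)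
    · exact Or.inr (Or.inl e)
  · exact Or.inr (Or.inr ⟨k, hk, e⟩)

theorem pmRoots6_of_pow {a b : ℂ} (h : PmParam a b) (ha : a ^ 6 = 1) (hb : b ^ 6 = 1) :
    PmRoots6 a b := by
  refine Or.inl (eq_of_subset_of_ncard (ncard_pm h) ncard_roots6 fun z hz => ?_)
  rw [mem_roots6, show z ^ 6 = (z ^ 2) ^ 3 by ring]
  rcases mem_pm.1 hz with hz | hz | hz <;> rw [hz]
  · exact one_pow 3
  · rw [← ha]; ring
  · rw [← hb]; ring

/-- An inversion other than `±1 / z` would need `b = ±a²` or `a = ±b²`. Combined with `a b = ±1`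
this gives `a⁶ = b⁶ = 1`, an excluded case. -/
theorem A_pm_klein {a b : ℂ} (h : PmParam a b) (hg : PmGeneral a b) (h1 : a * b = 1 ∨ a * b = -1)
    (f : Equiv.Perm Sphere) : f ∈ A (onSphere (pm a b)) ↔
      f = 1 ∨ f = rot (-1) ∨ f = inv 1 ∨ f = inv (-1) := by
  have hn := neg_one_ne_zero_complex
  have hab : a ^ 2 * b ^ 2 = 1 := by
    rw [← mul_pow]
    exact sq_eq_one_iff.2 h1
  constructor
  · intro hf
    refine (eq_of_mem_A_general h hg hf).imp_right (Or.imp_right ?_)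
    rintro ⟨k, hk, rfl⟩
    rcases param_of_inv_mem h hk hf with ⟨rfl | rfl, -⟩ | hb | ha
    · exact Or.inl rfl
    · exact Or.inr rfl
    · exfalso
      have hb2 : b ^ 2 = a ^ 4 := by rcases hb with rfl | rfl <;> ring
      refine hg.1 (pmRoots6_of_pow h ?_ ?_)
      · linear_combination hab - a ^ 2 * hb2
      · have ha6 : a ^ 6 = 1 := by linear_combination hab - a ^ 2 * hb2
        rw [show b ^ 6 = (b ^ 2) ^ 3 by ring, hb2, ← pow_mul, mul_comm 4, pow_mul,
          show a ^ 3 = a ^ 3 from rfl, ← pow_mul, show 3 * 4 = 6 * 2 from rfl, pow_mul, ha6, one_pow]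
    · exfalso
      have ha2 : a ^ 2 = b ^ 4 := by rcases ha with rfl | rfl <;> ring
      have hb6 : b ^ 6 = 1 := by linear_combination hab - b ^ 2 * ha2
      refine hg.1 (pmRoots6_of_pow h ?_ hb6)
      rw [show a ^ 6 = (a ^ 2) ^ 3 by ring, ha2, ← pow_mul, show 4 * 3 = 6 * 2 from rfl, pow_mul,
        hb6, one_pow]
  · have hr := rot_neg_one_mem_A_pm h
    have hi : inv 1 ∈ A (onSphere (pm a b)) := by
      refine mem_A_of_forall_mem (ncard_pm h) (inv_mem_LFT _) fun z hz => ?_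
      obtain ⟨w, hw, rfl⟩ := exists_of_mem_onSphere hz
      have hw0 : w ≠ 0 := fun h0 => zero_notMem_pm h.2.2.1 h.2.2.2.2.2.1 (h0 ▸ hw)
      have hw2 := pow_ne_zero 2 hw0
      rw [inv_coe one_ne_zero hw0, mem_onSphere, mem_pm, div_pow, one_pow, div_eq_iff hw2,
        div_eq_iff hw2, div_eq_iff hw2, one_mul]
      rcases mem_pm.1 hw with hw | hw | hw <;> rw [hw]
      · exact Or.inl rfl
      · exact Or.inr (Or.inr (by rw [mul_comm, hab]))
      · exact Or.inr (Or.inl hab.symm)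
    rintro (rfl | rfl | rfl | rfl)
    · exact one_mem _
    · exact hr
    · exact hi
    · have := mul_mem hr hi
      rwa [rot_mul_inv hn one_ne_zero, mul_one] at this

theorem A_pm_cyclic {a b : ℂ} (h : PmParam a b) (hg : PmGeneral a b)
    (h1 : ¬ (a * b = 1 ∨ a * b = -1))
    (h2 : ¬ (b = a ^ 2 ∨ b = -a ^ 2 ∨ a = b ^ 2 ∨ a = -b ^ 2))
    (f : Equiv.Perm Sphere) : f ∈ A (onSphere (pm a b)) ↔ f = 1 ∨ f = rot (-1) := by
  constructor
  · intro hf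
    refine (eq_of_mem_A_general h hg hf).imp_right fun h' => h'.resolve_right ?_
    rintro ⟨k, hk, rfl⟩
    rcases param_of_inv_mem h hk hf with ⟨-, h'⟩ | h' | h'
    · exact h1 h'
    · exact h2 (h'.elim Or.inl fun h' => Or.inr (Or.inl h'))
    · exact h2 (Or.inr (Or.inr h'))
  · rintro (rfl | rfl)
    · exact one_mem _
    · exact rot_neg_one_mem_A_pm h

/-- Dividing by `a` gives the parameters `1 / a` and `b / a`, with product `b / a² = ±1`; the case
`a = ±b²` is symmetric. -/
theorem exists_klein_param {a b : ℂ} (h : PmParam a b) (hg : PmGeneral a b)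
    (h2 : b = a ^ 2 ∨ b = -a ^ 2 ∨ a = b ^ 2 ∨ a = -b ^ 2) : ∃ a' b', PmParam a' b' ∧
      MobiusEquiv (onSphere (pm a b)) (onSphere (pm a' b')) ∧ PmGeneral a' b' ∧
      (a' * b' = 1 ∨ a' * b' = -1) := by
  have key : ∀ {a b : ℂ}, PmParam a b → PmGeneral a b → (b = a ^ 2 ∨ b = -a ^ 2) →
      ∃ a' b', PmParam a' b' ∧ MobiusEquiv (onSphere (pm a b)) (onSphere (pm a' b')) ∧
      PmGeneral a' b' ∧ (a' * b' = 1 ∨ a' * b' = -1) := by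
    intro a b h hg h2
    have he := mobiusEquiv_pm_div h
    have hp : PmParam (1 / a) (b / a) := by
      obtain ⟨χ, -, e⟩ := id he
      exact pmParam_of_ncard (by rw [← e]; exact ncard_image_perm χ (ncard_pm h))
    have ha := h.2.2.1
    refine ⟨_, _, hp, he, pmGeneral_of_equiv h hp hg he, ?_⟩
    rw [div_mul_div_comm, one_mul, ← pow_two, div_eq_one_iff_eq (pow_ne_zero 2 ha),
      div_eq_iff (pow_ne_zero 2 ha), neg_one_mul]
    exact h2
  have hp' : PmParam b a := pmParam_of_ncard (by rw [pm_comm]; exact ncard_pm h)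
  rcases or_assoc.2 h2 with h2 | h2
  · exact key h hg h2
  · rw [pm_comm a b]
    refine key hp' (pmGeneral_of_equiv h hp' hg ?_) h2
    rw [pm_comm b a]
    exact .refl _

end SixPoints

end

/-! ### Assembling the cases -/

noncomputable section
namespace SixPoints
open scoped OnePoint Pointwise

theorem exists_image_of_equiv {α S T : Set Sphere} {ψ : Equiv.Perm Sphere} (hψ : ψ ∈ LFT)
    (h : ψ '' α = S) (e : MobiusEquiv S T) : ∃ φ ∈ LFT, φ '' α = T :=
  MobiusEquiv.trans ⟨ψ, hψ, h⟩ e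

theorem case_hex {α : Set Sphere} {ψ : Equiv.Perm Sphere} (hψ : ψ ∈ LFT) {a : ℂ}
    (ha : HexParam a) (h : ψ '' α = onSphere (hex a)) (h6 : ¬ HexRoots6 a) (h8 : ¬ HexOcta a) :
    A α = conjGen ψ {rot (ζ 3), inv a} ∧ Nonempty (A α ≃* DihedralGroup 3) ∧
      HasMultiplicityVector α classesD3 tableD3 ![1, 1, 0] :=
  case_hex_dihedral hψ ha.ne_zero h (by rw [h, A_hex ha h6 h8])

theorem case_pmCubic {α : Set Sphere} {ψ : Equiv.Perm Sphere} (hψ : ψ ∈ LFT) {a b : ℂ}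
    (hab : PmParam a b) (h : ψ '' α = onSphere (pm a b)) (hc : PmCubic a b) :
    ∃ φ ∈ LFT, ∃ c : ℂ, HexParam c ∧ φ '' α = onSphere (hex c) ∧
      (¬ PmRoots6 a b → ¬ PmOcta a b → ¬ HexRoots6 c ∧ ¬ HexOcta c) := by
  obtain ⟨c, hc, e⟩ := equiv_hex_of_pmCubic hab hc
  obtain ⟨φ, hφ, hφα⟩ := exists_image_of_equiv hψ h e
  refine ⟨φ, hφ, c, hc, hφα, fun h6 h8 => ⟨fun hc6 => h6 ?_, fun hc8 => h8 ?_⟩⟩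
  · rw [hex_eq_roots6 (hexRoots6_iff.1 hc6)] at e
    exact pmRoots6_of_equiv hab e
  · exact pmOcta_of_equiv hab (e.trans (equiv_of_hexOcta hc8))

theorem case_trivial {α : Set Sphere} (hα : α.ncard = 6)
    (h6 : ¬ ∃ ψ ∈ LFT, ψ '' α = onSphere roots6)
    (h5 : ¬ ∃ ψ ∈ LFT, ψ '' α = onSphere zeroRoots5)
    (h8 : ¬ ∃ ψ ∈ LFT, ψ '' α = octahedron)
    (h3 : ¬ ∃ ψ ∈ LFT, ∃ a : ℂ, HexParam a ∧ ψ '' α = onSphere (hex a))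
    (h2 : ¬ ∃ ψ ∈ LFT, ∃ a b : ℂ, PmParam a b ∧ ψ '' α = onSphere (pm a b)) : A α = ⊥ := by
  rw [Subgroup.eq_bot_iff_forall]
  intro f hf
  by_contra h1
  obtain ⟨ψ, hψ, h | h | h | ⟨a, ha, h⟩ | ⟨-, a, b, hab, h⟩⟩ := exists_normal_form_pm hα hf h1
  · exact h6 ⟨ψ, hψ, h⟩
  · exact h5 ⟨ψ, hψ, h⟩
  · exact h8 ⟨ψ, hψ, h⟩
  · exact h3 ⟨ψ, hψ, a, ha, h⟩
  · exact h2 ⟨ψ, hψ, a, b, hab, h⟩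

theorem group_list {α : Set Sphere} (hα : α.ncard = 6) :
    Nonempty (A α ≃* DihedralGroup 6) ∨ Nonempty (A α ≃* Multiplicative (ZMod 5)) ∨
      Nonempty (A α ≃* Equiv.Perm (Fin 4)) ∨ Nonempty (A α ≃* DihedralGroup 3) ∨
      Nonempty (A α ≃* Multiplicative (ZMod 2) × Multiplicative (ZMod 2)) ∨
      Nonempty (A α ≃* Multiplicative (ZMod 2)) ∨ A α = ⊥ := by
  by_cases h6 : ∃ ψ ∈ LFT, ψ '' α = onSphere roots6
  · obtain ⟨ψ, hψ, h⟩ := h6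
    exact Or.inl (case_roots6 hψ h).2.1
  by_cases h5 : ∃ ψ ∈ LFT, ψ '' α = onSphere zeroRoots5
  · obtain ⟨ψ, hψ, h⟩ := h5
    exact Or.inr (Or.inl (case_zeroRoots5 hψ h).2.1)
  by_cases h8 : ∃ ψ ∈ LFT, ψ '' α = octahedron
  · obtain ⟨ψ, hψ, h⟩ := h8
    exact Or.inr (Or.inr (Or.inl (case_octahedron hψ h).2.1))
  by_cases h3 : ∃ ψ ∈ LFT, ∃ a : ℂ, HexParam a ∧ ψ '' α = onSphere (hex a)
  · obtain ⟨ψ, hψ, a, ha, h⟩ := h3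
    refine Or.inr (Or.inr (Or.inr (Or.inl (case_hex hψ ha h (fun hc => h6 ⟨ψ, hψ, ?_⟩)
      (fun hc => h8 (exists_image_of_equiv hψ h (equiv_of_hexOcta hc)))).2.1)))
    rw [h, hex_eq_roots6 (hexRoots6_iff.1 hc)]
  by_cases h2 : ∃ ψ ∈ LFT, ∃ a b : ℂ, PmParam a b ∧ ψ '' α = onSphere (pm a b)
  · obtain ⟨ψ, hψ, a, b, hab, h⟩ := h2
    -- Each exceptional condition would provide a normal form that has already been excluded.
    have hg : PmGeneral a b := by
      refine ⟨fun hc => h6 (exists_image_of_equiv hψ h (equiv_of_pmRoots6 hc)),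
        fun hc => h8 (exists_image_of_equiv hψ h (equiv_of_pmOcta hc)), fun hc => ?_⟩
      obtain ⟨φ, hφ, c, hc, hφα, -⟩ := case_pmCubic hψ hab h hc
      exact h3 ⟨φ, hφ, c, hc, hφα⟩
    by_cases h1 : a * b = 1 ∨ a * b = -1
    · exact Or.inr (Or.inr (Or.inr (Or.inr (Or.inl (case_pm_klein hψ hab h h1
        (h ▸ A_pm_klein hab hg h1)).2.1))))
    by_cases hsq : b = a ^ 2 ∨ b = -a ^ 2 ∨ a = b ^ 2 ∨ a = -b ^ 2
    · obtain ⟨a', b', hab', e, hg', h1'⟩ := exists_klein_param hab hg hsq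
      obtain ⟨φ, hφ, hφα⟩ := exists_image_of_equiv hψ h e
      exact Or.inr (Or.inr (Or.inr (Or.inr (Or.inl (case_pm_klein hφ hab' hφα h1'
        (hφα ▸ A_pm_klein hab' hg' h1')).2.1))))
    · exact Or.inr (Or.inr (Or.inr (Or.inr (Or.inr (Or.inl (case_pm_cyclic hψ h
        (h ▸ A_pm_cyclic hab hg h1 hsq)).2.1)))))
  · exact Or.inr (Or.inr (Or.inr (Or.inr (Or.inr (Or.inr (case_trivial hα h6 h5 h8 h3 h2))))))

end SixPoints

end

theorem mainTheorem12 (α : Set Sphere) (hα : α.ncard = 6) :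
    -- the sixth roots of unity
    (∀ ψ ∈ LFT, ψ '' α = onSphere roots6 →
      A α = conjGen ψ {rot (ζ 6), inv 1} ∧
      Nonempty (A α ≃* DihedralGroup 6) ∧
      HasMultiplicityVector α (classesD6 α ψ) tableD6 ![0, 1, 0, 0, 0, 1]) ∧
    -- zero and the fifth roots of unity
    (∀ ψ ∈ LFT, ψ '' α = onSphere zeroRoots5 →
      A α = conjGen ψ {rot (ζ 5)} ∧
      Nonempty (A α ≃* Multiplicative (ZMod 5)) ∧
      HasMultiplicityVector α (classesZ 5 ψ) (tableZ 5) ![1, 1, 1, 0, 0]) ∧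
    -- the octahedron
    (∀ ψ ∈ LFT, ψ '' α = octahedron →
      A α = conjGen ψ {rot Complex.I, mob Complex.I 1 1 Complex.I} ∧
      Nonempty (A α ≃* Equiv.Perm (Fin 4)) ∧
      ∀ Ψ : A α ≃* Equiv.Perm (Fin 4),
        HasMultiplicityVector α (classesS4 α Ψ) tableS4 ![0, 0, 1, 0, 0]) ∧
    -- `{1, w, w², a, aw, aw²}`
    (∀ ψ ∈ LFT, ∀ a : ℂ, HexParam a → ψ '' α = onSphere (hex a) →
      (HexRoots6 a → ψ '' α = onSphere roots6) ∧
      (HexOcta a → ∃ φ ∈ LFT, φ '' α = octahedron) ∧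
      (¬ HexRoots6 a → ¬ HexOcta a →
        A α = conjGen ψ {rot (ζ 3), inv a} ∧
        Nonempty (A α ≃* DihedralGroup 3) ∧
        HasMultiplicityVector α classesD3 tableD3 ![1, 1, 0])) ∧
    -- `{±1, ±a, ±b}`
    (∀ ψ ∈ LFT, ∀ a b : ℂ, PmParam a b → ψ '' α = onSphere (pm a b) →
      (PmRoots6 a b → ∃ φ ∈ LFT, φ '' α = onSphere roots6) ∧
      (PmOcta a b → ∃ φ ∈ LFT, φ '' α = octahedron) ∧
      (PmCubic a b → ∃ φ ∈ LFT, ∃ c : ℂ, HexParam c ∧ φ '' α = onSphere (hex c) ∧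
        (¬ PmRoots6 a b → ¬ PmOcta a b → ¬ HexRoots6 c ∧ ¬ HexOcta c)) ∧
      (PmGeneral a b →
        ((a * b = 1 ∨ a * b = -1) →
          A α = conjGen ψ {rot (-1), inv 1} ∧
          Nonempty (A α ≃* Multiplicative (ZMod 2) × Multiplicative (ZMod 2)) ∧
          (∃ κ c, IsTypeTwoC α κ c) ∧
          ∀ κ c, IsTypeTwoC α κ c → ∀ s : ℂ, (s = 1 ∨ s = -1) →
            HasMultiplicityVector α (classesK4 κ s) tableK4 ![1, 0, 1, 1]) ∧
        ((b = a ^ 2 ∨ b = -a ^ 2 ∨ a = b ^ 2 ∨ a = -b ^ 2) →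
          ∃ φ ∈ LFT, ∃ a' b' : ℂ, PmParam a' b' ∧ φ '' α = onSphere (pm a' b') ∧
            PmGeneral a' b' ∧ (a' * b' = 1 ∨ a' * b' = -1)) ∧
        (¬ (a * b = 1 ∨ a * b = -1) →
          ¬ (b = a ^ 2 ∨ b = -a ^ 2 ∨ a = b ^ 2 ∨ a = -b ^ 2) →
          A α = conjGen ψ {rot (-1)} ∧
          Nonempty (A α ≃* Multiplicative (ZMod 2)) ∧
          HasMultiplicityVector α (classesZ 2 ψ) (tableZ 2) ![1, 2]))) ∧
    -- all other sets
    ((¬ ∃ ψ ∈ LFT, ψ '' α = onSphere roots6) →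
      (¬ ∃ ψ ∈ LFT, ψ '' α = onSphere zeroRoots5) →
      (¬ ∃ ψ ∈ LFT, ψ '' α = octahedron) →
      (¬ ∃ ψ ∈ LFT, ∃ a : ℂ, HexParam a ∧ ψ '' α = onSphere (hex a)) →
      (¬ ∃ ψ ∈ LFT, ∃ a b : ℂ, PmParam a b ∧ ψ '' α = onSphere (pm a b)) →
      A α = ⊥) ∧
    -- the list of groups
    (Nonempty (A α ≃* DihedralGroup 6) ∨ Nonempty (A α ≃* Multiplicative (ZMod 5)) ∨
      Nonempty (A α ≃* Equiv.Perm (Fin 4)) ∨ Nonempty (A α ≃* DihedralGroup 3) ∨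
      Nonempty (A α ≃* Multiplicative (ZMod 2) × Multiplicative (ZMod 2)) ∨
      Nonempty (A α ≃* Multiplicative (ZMod 2)) ∨ A α = ⊥) := by
  refine ⟨fun ψ hψ h => case_roots6 hψ h, fun ψ hψ h => case_zeroRoots5 hψ h,
    fun ψ hψ h => case_octahedron hψ h, fun ψ hψ a ha h => ⟨fun hc => ?_, fun hc => ?_,
    fun h6 h8 => case_hex hψ ha h h6 h8⟩, fun ψ hψ a b hab h => ⟨fun hc => ?_, fun hc => ?_,
    fun hc => case_pmCubic hψ hab h hc, fun hg => ⟨fun h1 => ?_, fun h2 => ?_, fun h1 h2 => ?_⟩⟩,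
    case_trivial hα, group_list hα⟩
  · rw [h, hex_eq_roots6 (hexRoots6_iff.1 hc)]
  · exact exists_image_of_equiv hψ h (equiv_of_hexOcta hc)
  · exact exists_image_of_equiv hψ h (equiv_of_pmRoots6 hc)
  · exact exists_image_of_equiv hψ h (equiv_of_pmOcta hc)
  · exact case_pm_klein hψ hab h h1 (h ▸ A_pm_klein hab hg h1)
  · obtain ⟨a', b', hab', e, hg', h1⟩ := exists_klein_param hab hg h2
    obtain ⟨φ, hφ, hφα⟩ := exists_image_of_equiv hψ h e
    exact ⟨φ, hφ, a', b', hab', hφα, hg', h1⟩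
  · exact case_pm_cyclic hψ h (h ▸ A_pm_cyclic hab hg h1 h2)
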